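/- **Setting.** All machines are interactive Turing machines (ITMs): probabilistic Turing machines with identifier, input, output, work, incoming, outgoing, randomness and control tapes. An instance (ITI) $M$ *controls* the ITIs listed on its control tape: it may read their output tapes and write on their input tapes. An ITM is *PPT* if for some constant $c$, in every run and at each point of it, it has made at most $n^c+c$ steps, where $n$ is the total length of what has been written on its input tape. A *data collector* is a tuple $(\mathcal X,\pi,\pi_D)$ of an ITM $\mathcal X$ and two-party protocols $\pi$ (main) and $\pi_D$ (deletion), each given by a PPT client ITM and a server ITM, where $\pi$ specifies for every completed session a *deletion token*, a function of the session identifier and the transcript only. Whoever initiates a session controls its client, and $\mathcal X$ controls its server. Session identifiers are assigned by an arbitrary fixed rule (a law depending on the security parameter and the identifiers already assigned) and are written only on the identifier tapes of the client and the server. **Execution.** For an environment $\mathcal Z$, a deletion-requester $\mathcal Y$ and a security parameter $\lambda$ (written in unary on all input tapes), one machine is active at a time. Writing a message on a tape of another machine activates that machine; writing on one's output tape activates the controlling machine; if nobody is written to, $\mathcal Z$ is activated. $\mathcal Z$ may send messages to $\mathcal Y$ (not conversely), activate $\mathcal X$, initiate sessions of $\pi$ and $\pi_D$ with arbitrary PPT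 client ITMs and arbitrary inputs (including the deletion tokens of its own sessions), write to its clients, write on its own output tape, and end the *alive phase* (which also ends when $\mathcal Z$ halts). $\mathcal Y$ may initiate sessions of $\pi$ with the honest client on inputs of its choice, write to its clients, and, for any completed session of $\pi$ it initiated, initiate one session of $\pi_D$ with the honest client and the deletion token of that session as input. $\mathcal X$ may write to its servers; clients and servers may send messages to each other or write on their output tapes. In the *terminate phase* the machines may act as before, but whenever nobody is written to, the following procedure goes on: the clients of $\mathcal Y$'s sessions of $\pi$ are activated one after the other until they have halted; then $\pi_D$ is initiated with the deletion token for every completed session of $\pi$ of $\mathcal Y$ for which this has not yet been done; then the clients of these sessions of $\pi_D$ are activated until they have halted; then the execution ends. The *ideal* execution is the one in which $\mathcal Y$ is replaced by $\mathcal Y_0$, which halts whenever it is activated. Let $\mathsf{state}_{\mathcal X}$ be the content of $\mathcal X$'s work tape, and $\mathsf{view}_{\mathcal Z}$ the contents of $\mathcal Z$'s input, output, incoming, outgoing, randomness and control tapes at the end (the control tape listing, for each ITI controlled by $\mathcal Z$, its protocol), with superscripts $R,\lambda$ and $I,\lambda$ for the execution with $\mathcal Y$ and the ideal one. (If an execution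 does not end, a distinguisher counts as not outputting $1$.) **Error.** For a class $\mathcal C$ of PPT deletion-requesters, the deletion-compliance error of $(\mathcal X,\pi,\pi_D)$ with respect to $\mathcal C$ is the function $$\varepsilon_{\mathcal C}(\lambda)=\sup_{\mathcal Z,\ \mathcal Y\in\mathcal C,\ D}\Bigl|\Pr[D(\mathsf{state}_{\mathcal X}^{R,\lambda},\mathsf{view}_{\mathcal Z}^{R,\lambda})=1]-\Pr[D(\mathsf{state}_{\mathcal X}^{I,\lambda},\mathsf{view}_{\mathcal Z}^{I,\lambda})=1]\Bigr|,$$ over all PPT environments $\mathcal Z$ (with PPT client ITMs), all $\mathcal Y\in\mathcal C$ and all unbounded distinguishers $D$. $\mathcal Y$ is *$k$-representative* if, when interacting with $(\mathcal X,\pi,\pi_D)$, it initiates at most $k$ sessions of $\pi$. $\mathcal Y$ is *oblivious* if it never uses the output tapes of the clients it controls, except that the deletion token of a session is computed and given to $\pi_D$ when that session is to be deleted; in particular, neither what is written on these tapes, nor whether or when something is written there, influences its actions (being activated by such a write, it at once returns activation). **Theorem 2.1.** Let $(\mathcal X,\pi,\pi_D)$ be any data collector and $k\in\mathbb N$. Its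 $k$-representative oblivious deletion-compliance error $\varepsilon_{k}^{\mathrm{obl}}$ (with respect to the $k$-representative oblivious PPT deletion-requesters) and its $1$-representative deletion-compliance error $\varepsilon_1$ (with respect to all $1$-representative PPT deletion-requesters) satisfy $$\varepsilon_{k}^{\mathrm{obl}}(\lambda)\le k\cdot\varepsilon_1(\lambda)\qquad\text{for all }\lambda\in\mathbb N .$$ -/

import Mathlib

noncomputable section

namespace DeletionCompliance

/-! ## Interactive Turing machines -/

abbrev Str := List Bool

/-- Symbols on message-carrying tapes: a bit, or the separator `none` closing a message. -/
abbrev Sym := Option Bool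

/-- What writing the message `m` appends to a tape. Writing the empty message appends nothing (it
only passes on activation). -/
def written (m : Str) : List Sym :=
  if m = [] then [] else m.map some ++ [none]

/-- The two protocols of a data collector: `main` is `π`, `deletion` is `π_D`. -/
inductive Protocol
  | main
  | deletion
  deriving DecidableEq

inductive Dir
  | left
  | stay
  | right

def Dir.moveNat : Dir → ℕ → ℕ
  | .left, n => n - 1
  | .stay, n => n
  | .right, n => n + 1

def Dir.moveInt : Dir → ℤ → ℤ
  | .left, n => n - 1
  | .stay, n => n
  | .right, n => n + 1

/-- What a machine sees in one step. A tape whose contents are a list shows `none` past its end.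
* `control`: the protocol of the controlled ITI listed under the control head;
* `caller`: whether that ITI caused the present activation, by writing on its output tape;
* `peer`: the scanned symbol of the output tape of that ITI;
* `coin`: the next cell of the randomness tape, whose head advances in every step. -/
structure Obs where
  ident : Option Bool
  input : Option Sym
  work : Option Bool
  incoming : Option Sym
  control : Option Protocol
  caller : Bool
  peer : Option Sym
  coin : Bool

/-- What a machine does in one step. `emit` appends a bit to the message under composition.
`signal` is `none` to go on computing, `some none` to end the activation without writing to
anyone, and `some (some a)` to end it with the external action `a`, which uses the composed
message. `readIncoming` advances the head of the (single-read) incoming tape. -/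
structure Op (A : Type) where
  work : Option Bool
  moveWork : Dir
  moveIdent : Dir
  moveInput : Dir
  moveControl : Dir
  movePeer : Dir
  readIncoming : Bool
  emit : Option Bool
  signal : Option (Option A)

/-- An interactive Turing machine with set of external actions `A`: a finite control with a set of
halting states and a transition function. -/
structure ITM (A : Type) where
  Q : Type
  finite : Finite Q
  start : Q
  halt : Q → Bool
  δ : Q → Obs → Q × Op A

/-- An instance (ITI) of an interactive Turing machine, with the contents of its tapes and the
positions of its heads. `randomness` is the part of the randomness tape scanned so far (one coin
for each step made so far). The output tape of each controlled ITI is read with its own head. -/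
structure ITI {A : Type} (M : ITM A) where
  state : M.Q
  ident : Str
  input : List Sym
  output : List Sym
  work : ℤ → Option Bool
  incoming : List Sym
  outgoing : List Sym
  randomness : List Bool
  control : List Protocol
  identHead : ℕ
  inputHead : ℕ
  workHead : ℤ
  incomingHead : ℕ
  controlHead : ℕ
  peerHead : ℕ → ℕ
  buffer : Str
  caller : Option ℕ

namespace ITI

variable {A : Type} {M : ITM A}

/-- A fresh instance with the given identifier tape and input tape. -/
def create (M : ITM A) (ident : Str) (input : List Sym) : ITI M where
  state := M.start
  ident := ident
  input := input
  output := []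
  work := fun _ => none
  incoming := []
  outgoing := []
  randomness := []
  control := []
  identHead := 0
  inputHead := 0
  workHead := 0
  incomingHead := 0
  controlHead := 0
  peerHead := fun _ => 0
  buffer := []
  caller := none

def halted (s : ITI M) : Bool := M.halt s.state

def observe (s : ITI M) (peer : Option Sym) (coin : Bool) : Obs where
  ident := s.ident[s.identHead]?
  input := s.input[s.inputHead]?
  work := s.work s.workHead
  incoming := s.incoming[s.incomingHead]?
  control := s.control[s.controlHead]?
  caller := decide (s.caller = some s.controlHead)
  peer := peer
  coin := coin

/-- One step of computation: the new configuration, and the signal given, where an external action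
comes with the composed message. The composed message is discarded when an activation ends. -/
def step (s : ITI M) (peer : Option Sym) (coin : Bool) :
    ITI M × Option (Option (A × Str)) :=
  let r := M.δ s.state (s.observe peer coin)
  let op := r.2
  let msg := s.buffer ++ op.emit.toList
  ({ s with
      state := r.1
      work := fun i => if i = s.workHead then op.work else s.work i
      randomness := s.randomness ++ [coin]
      identHead := op.moveIdent.moveNat s.identHead
      inputHead := op.moveInput.moveNat s.inputHead
      workHead := op.moveWork.moveInt s.workHead
      incomingHead := if op.readIncoming then s.incomingHead + 1 else s.incomingHead
      controlHead := op.moveControl.moveNat s.controlHead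
      peerHead := fun i =>
        if i = s.controlHead then op.movePeer.moveNat (s.peerHead i) else s.peerHead i
      buffer := if op.signal.isSome then [] else msg },
    op.signal.map fun a => a.map fun b => (b, msg))

end ITI

/-- The configurations that an instance of `M` can reach in any surroundings: between its steps,
its input, incoming and control tapes may be extended arbitrarily by others (and messages it has
composed are recorded on its output and outgoing tapes), and the tapes of other machines that it
reads may have any contents. -/
inductive Reachable {A : Type} (M : ITM A) : ITI M → Prop
  | create (ident : Str) (input : List Sym) : Reachable M (ITI.create M ident input)
  | step (s : ITI M) (peer : Option Sym) (coin : Bool) :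
      Reachable M s → s.halted = false → Reachable M (s.step peer coin).1
  | extend (s : ITI M) (inp inc out sent : List Sym) (ctl : List Protocol) (caller : Option ℕ) :
      Reachable M s →
      Reachable M { s with
        input := s.input ++ inp
        incoming := s.incoming ++ inc
        output := s.output ++ out
        outgoing := s.outgoing ++ sent
        control := s.control ++ ctl
        caller := caller }

/-- Probabilistic polynomial time: at any point of any run, the overall number of steps made is at
most polynomial in the overall length of what has been written on the input tape. -/
def ITM.PPT {A : Type} (M : ITM A) : Prop :=
  ∃ c : ℕ, ∀ s : ITI M, Reachable M s → s.randomness.length ≤ s.input.length ^ c + c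

/-! ## Data collectors, environments, deletion-requesters -/

/-- External actions of the client-side and server-side ITIs of a protocol session: write the
composed message on the incoming tape of the other party, or on the own output tape. -/
inductive PartyAct
  | send
  | output

/-- External action of the data collector: write on the input tape of the (server-side) ITI under
its control head. -/
inductive CollectorAct
  | input

/-- External actions of an environment that has `m` client programs at its disposal.
* `toRequester`: write the composed message on the incoming tape of the deletion-requester;
* `toCollector`: pass on activation to the data collector;
* `input`: write the composed message on the input tape of the client under the control head;
* `initiate p i`: initiate a session of `p` with client program `i`, and write the composed message
  on the client's input tape;
* `delete i`: for the session of `π` under the control head, initiate `π_D` with client program `i`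
  and the deletion token of that session as input;
* `output`: write the composed message on the own output tape;
* `endAlive`: declare the end of the alive phase. -/
inductive EnvAct (m : ℕ)
  | toRequester
  | toCollector
  | input
  | initiate (p : Protocol) (i : Fin m)
  | delete (i : Fin m)
  | output
  | endAlive

/-- External actions of a deletion-requester.
* `input`: write the composed message on the input tape of the client under the control head;
* `initiate`: initiate a session of `π` and write the composed message on its client's input tape;
* `delete`: for the session of `π` under the control head, initiate `π_D` with the deletion token
  of that session as input. -/
inductive RequesterAct
  | input
  | initiate
  | delete

/-- The messages of a session, each with its sender (`true` for the client). -/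
abbrev Transcript := List (Bool × Str)

/-- A data collector `(X, π, π_D)`: the program of `X`, the prescribed client-side and server-side
programs of both protocols, and the deletion token of a session of `π` as a function of its session
identifier and transcript (`none` if the transcript is not that of a completed execution). -/
structure DataCollector where
  X : ITM CollectorAct
  client : Protocol → ITM PartyAct
  server : Protocol → ITM PartyAct
  token : Str → Transcript → Option Str
  client_ppt : ∀ p, (client p).PPT

/-- How session identifiers are assigned: their law may depend on the security parameter and on the
identifiers given out so far. -/
abbrev SidRule := ℕ → List Str → PMF Str

/-- An environment, together with the arbitrary client programs it may use in its sessions. -/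
structure Environment where
  m : ℕ
  Z : ITM (EnvAct m)
  adv : Fin m → ITM PartyAct

def Environment.PPT (E : Environment) : Prop :=
  E.Z.PPT ∧ ∀ i, (E.adv i).PPT

/-- A deletion-requester. If `reactive` is false, it disregards activations caused by its clients'
writing on their output tapes: such an activation ends at once without any effect. -/
structure Requester where
  Y : ITM RequesterAct
  reactive : Bool

/-- The requester does not react to its clients' output tapes, neither to their contents nor to
the fact that something has been written there. -/
def Requester.Oblivious (R : Requester) : Prop :=
  R.reactive = false ∧
    ∀ (q : R.Y.Q) (o : Obs) (p : Option Sym), R.Y.δ q { o with peer := p } = R.Y.δ q o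

/-- The completely silent deletion-requester `Y₀`: it is halted from the start. -/
def silent : Requester where
  Y :=
    { Q := Unit
      finite := inferInstance
      start := ()
      halt := fun _ => true
      δ := fun _ _ => ((), ⟨none, .stay, .stay, .stay, .stay, .stay, false, none, some none⟩) }
  reactive := true

/-! ## Executions -/

inductive Owner
  | environment
  | requester
  deriving DecidableEq

/-- A session of a protocol. The transcript records the messages up to the halting of the client.
`deletion` is the (index of the) session of `π_D` run with the token of this session, if any. -/
structure Session where
  protocol : Protocol
  owner : Owner
  sid : Str
  client : (M : ITM PartyAct) × ITI M
  server : (M : ITM PartyAct) × ITI M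
  transcript : Transcript
  deletion : Option ℕ

def Session.clientHalted (t : Session) : Bool := t.client.2.halted

/-- Which client an entry of a control tape refers to: that of a given session, or that of the
deletion session of a given session (no ITI, as long as the latter does not exist). -/
inductive Ref
  | session (i : ℕ)
  | deletionOf (i : ℕ)

/-- Who is activated; `scheduler` stands for the procedure of the terminate phase, and `done` for
the end of the execution. -/
inductive Active
  | environment
  | requester
  | collector
  | client (i : ℕ)
  | server (i : ℕ)
  | scheduler
  | done
  deriving DecidableEq

/-- A configuration of the whole system. The `i`-th entry of the control tape of the collector is
the server of session `i`; those of the environment and the requester are resolved by `zRefs`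
and `yRefs`. -/
structure Sys (D : DataCollector) (E : Environment) (R : Requester) where
  x : ITI D.X
  z : ITI E.Z
  y : ITI R.Y
  zRefs : List Ref
  yRefs : List Ref
  sessions : List Session
  alive : Bool
  active : Active

/-- The security parameter in unary. -/
def unary (sec : ℕ) : List Sym := written (List.replicate sec true)

/-- Apply `f` to the client-side ITI of a session. -/
def Session.mapClient (t : Session)
    (f : {M : ITM PartyAct} → ITI M → ITI M) : Session :=
  { t with client := ⟨t.client.1, f t.client.2⟩ }

def Session.mapServer (t : Session)
    (f : {M : ITM PartyAct} → ITI M → ITI M) : Session :=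
  { t with server := ⟨t.server.1, f t.server.2⟩ }

/-- Record a message in the transcript, unless the client has halted before. -/
def Session.record (t : Session) (fromClient : Bool) (msg : Str) (halted : Bool) : Session :=
  { t with transcript := if halted then t.transcript else t.transcript ++ [(fromClient, msg)] }

/-- A session of `π` whose client has halted, with a transcript that has a deletion token: this
token. -/
def DataCollector.tokenOf (D : DataCollector) (t : Session) : Option Str :=
  if t.protocol = .main ∧ t.clientHalted = true then D.token t.sid t.transcript else none

namespace Sys

variable {D : DataCollector} {E : Environment} {R : Requester}

def initial (D : DataCollector) (E : Environment) (R : Requester) (sec : ℕ) : Sys D E R where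
  x := ITI.create D.X [] (unary sec)
  z := ITI.create E.Z [] (unary sec)
  y := ITI.create R.Y [] (unary sec)
  zRefs := []
  yRefs := []
  sessions := []
  alive := true
  active := .environment

/-- Where activation goes if nobody has been written to: to the environment in the alive phase, and
on in the prescribed procedure in the terminate phase. -/
def idle (S : Sys D E R) : Sys D E R :=
  if S.alive then { S with z := { S.z with caller := none }, active := .environment }
  else { S with active := .scheduler }

def resolve (S : Sys D E R) : Ref → Option ℕ
  | .session i => some i
  | .deletionOf i => (S.sessions[i]?).bind Session.deletion

/-- The session under the control head of the environment. -/
def zTarget (S : Sys D E R) : Option ℕ := (S.zRefs[S.z.controlHead]?).bind S.resolve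

/-- The session under the control head of the requester. -/
def yTarget (S : Sys D E R) : Option ℕ := (S.yRefs[S.y.controlHead]?).bind S.resolve

/-- The symbol at position `pos` of the output tape of the client of session `i`. -/
def clientOutput (S : Sys D E R) (i : Option ℕ) (pos : ℕ) : Option Sym :=
  (i.bind fun j => S.sessions[j]?).bind fun t => t.client.2.output[pos]?

def serverOutput (S : Sys D E R) (i pos : ℕ) : Option Sym :=
  (S.sessions[i]?).bind fun t => t.server.2.output[pos]?

/-- Write on the input tape of the client of session `i` (if there is one) and activate it. -/
def writeClient (S : Sys D E R) (i : Option ℕ) (msg : Str) : Sys D E R :=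
  match i with
  | none => S.idle
  | some j =>
    { S with
      sessions := S.sessions.modify j fun t =>
        t.mapClient fun c => { c with input := c.input ++ written msg }
      active := .client j }

/-- Initiate a session of `p` with the client program `C`, write `msg` on the client's input tape
(after the security parameter) and activate the client. The identifier of an ITI is its party
identifier (`false` for the client) followed by the session identifier. -/
def initiate (rule : SidRule) (sec : ℕ) (S : Sys D E R) (p : Protocol) (w : Owner)
    (C : ITM PartyAct) (msg : Str) : PMF (Sys D E R) :=
  (rule sec (S.sessions.map Session.sid)).bind fun sid =>
    PMF.pure { S with
      x := { S.x with control := S.x.control ++ [p] }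
      sessions := S.sessions ++
        [{ protocol := p
           owner := w
           sid := sid
           client := ⟨C, ITI.create C (false :: sid) (unary sec ++ written msg)⟩
           server := ⟨D.server p, ITI.create (D.server p) (true :: sid) (unary sec)⟩
           transcript := []
           deletion := none }]
      active := .client S.sessions.length }

/-- Initiate `π_D` with client program `C` and the deletion token of session `i` as input, on behalf
of the owner of that session, if the token exists and this has not been done before. -/
def requestDeletion (rule : SidRule) (sec : ℕ) (S : Sys D E R) (i : ℕ) (C : ITM PartyAct) :
    PMF (Sys D E R) :=
  match S.sessions[i]? with
  | none => PMF.pure S.idle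
  | some t =>
    match D.tokenOf t, t.deletion with
    | some tok, none =>
      initiate rule sec
        { S with sessions := S.sessions.modify i fun t =>
            { t with deletion := some S.sessions.length } }
        .deletion t.owner C tok
    | _, _ => PMF.pure S.idle

/-- The session of `π` (not of `π_D`) that an entry of a control tape refers to. -/
def mainSession (S : Sys D E R) : Option Ref → Option ℕ
  | some (.session i) =>
    if (S.sessions[i]?).map Session.protocol = some .main then some i else none
  | _ => none

/-! ### External actions -/

def zAct (rule : SidRule) (sec : ℕ) (S : Sys D E R) (msg : Str) :
    EnvAct E.m → PMF (Sys D E R)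
  | .toRequester => PMF.pure { S with
      z := { S.z with outgoing := S.z.outgoing ++ written msg }
      y := { S.y with incoming := S.y.incoming ++ written msg, caller := none }
      active := .requester }
  | .toCollector => PMF.pure { S with
      x := { S.x with caller := none }
      active := .collector }
  | .input => PMF.pure (S.writeClient S.zTarget msg)
  | .initiate p i =>
      initiate rule sec
        { S with
          z := { S.z with control := S.z.control ++ [p] }
          zRefs := S.zRefs ++ [.session S.sessions.length] }
        p .environment (E.adv i) msg
  | .delete i =>
      match S.mainSession (S.zRefs[S.z.controlHead]?) with
      | none => PMF.pure S.idle
      | some j =>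
        requestDeletion rule sec
          { S with
            z := { S.z with control := S.z.control ++ [.deletion] }
            zRefs := S.zRefs ++ [.deletionOf j] }
          j (E.adv i)
  | .output => PMF.pure
      { S with z := { S.z with output := S.z.output ++ written msg } }.idle
  | .endAlive => PMF.pure { S with alive := false, active := .scheduler }

def yAct (rule : SidRule) (sec : ℕ) (S : Sys D E R) (msg : Str) :
    RequesterAct → PMF (Sys D E R)
  | .input => PMF.pure (S.writeClient S.yTarget msg)
  | .initiate =>
      initiate rule sec
        { S with
          y := { S.y with control := S.y.control ++ [.main] }
          yRefs := S.yRefs ++ [.session S.sessions.length] }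
        .main .requester (D.client .main) msg
  | .delete =>
      match S.mainSession (S.yRefs[S.y.controlHead]?) with
      | none => PMF.pure S.idle
      | some j =>
        requestDeletion rule sec
          { S with
            y := { S.y with control := S.y.control ++ [.deletion] }
            yRefs := S.yRefs ++ [.deletionOf j] }
          j (D.client .deletion)

def xAct (S : Sys D E R) (msg : Str) : CollectorAct → Sys D E R
  | .input =>
    if S.x.controlHead < S.sessions.length then
      { S with
        sessions := S.sessions.modify S.x.controlHead fun t =>
          t.mapServer fun c => { c with input := c.input ++ written msg }
        active := .server S.x.controlHead }
    else S.idle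

/-- The client of session `i`, owned by `w`, has written on its output tape: its owner is
activated. -/
def notifyOwner (S : Sys D E R) (i : ℕ) (w : Owner) : Sys D E R :=
  match w with
  | .environment => { S with
      z := { S.z with caller := S.zRefs.findIdx? fun r => decide (S.resolve r = some i) }
      active := .environment }
  | .requester =>
    if R.reactive then { S with
      y := { S.y with caller := S.yRefs.findIdx? fun r => decide (S.resolve r = some i) }
      active := .requester }
    else S.idle

/-- External actions of the client of session `i`, owned by `w`. -/
def clientAct (S : Sys D E R) (i : ℕ) (w : Owner) (msg : Str) : PartyAct → Sys D E R
  | .send => { S with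
      sessions := S.sessions.modify i fun t =>
        ((t.mapClient fun c => { c with outgoing := c.outgoing ++ written msg }).mapServer
          fun c => { c with incoming := c.incoming ++ written msg }).record true msg false
      active := .server i }
  | .output =>
      { S with sessions := S.sessions.modify i fun t =>
          t.mapClient fun c => { c with output := c.output ++ written msg } }.notifyOwner i w

def serverAct (S : Sys D E R) (i : ℕ) (msg : Str) : PartyAct → Sys D E R
  | .send => { S with
      sessions := S.sessions.modify i fun t =>
        ((t.mapServer fun c => { c with outgoing := c.outgoing ++ written msg }).mapClient
          fun c => { c with incoming := c.incoming ++ written msg }).record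
            false msg t.clientHalted
      active := .client i }
  | .output => { S with
      sessions := S.sessions.modify i fun t =>
        t.mapServer fun c => { c with output := c.output ++ written msg }
      x := { S.x with caller := some i }
      active := .collector }

/-- The procedure of the terminate phase. First every client of `π` initiated by the requester is
activated until it halts; then `π_D` is initiated for every completed session of `π` of the
requester for which this has not yet been done; then every client of these sessions of `π_D` is
activated until it halts. -/
def schedule (rule : SidRule) (sec : ℕ) (S : Sys D E R) : PMF (Sys D E R) :=
  let mine : ℕ → (Session → Bool) → Bool := fun i P =>
    match S.sessions[i]? with
    | some t => decide (t.protocol = .main) && decide (t.owner = .requester) && P t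
    | none => false
  let first : (Session → Bool) → Option ℕ := fun P =>
    (List.range S.sessions.length).find? fun i => mine i P
  match first fun t => !t.clientHalted with
  | some i => PMF.pure { S with active := .client i }
  | none =>
    match first fun t => (D.tokenOf t).isSome && t.deletion.isNone with
    | some i => requestDeletion rule sec S i (D.client .deletion)
    | none =>
      let pending : Session → Option ℕ := fun t =>
        t.deletion.filter fun j => ((S.sessions[j]?).map fun u => !u.clientHalted).getD false
      match first fun t => (pending t).isSome with
      | some i =>
        match (S.sessions[i]?).bind pending with
        | some j => PMF.pure { S with active := .client j }
        | none => PMF.pure { S with active := .done }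
      | none => PMF.pure { S with active := .done }

def coin : PMF Bool := PMF.uniformOfFintype Bool

/-- One step of the execution: a single step of the activated machine, or of the procedure of the
terminate phase. A machine that has halted passes activation on; the alive phase ends if the
environment has halted. -/
def step (rule : SidRule) (sec : ℕ) (S : Sys D E R) : PMF (Sys D E R) :=
  match S.active with
  | .done => PMF.pure S
  | .scheduler => S.schedule rule sec
  | .environment =>
    if S.z.halted then PMF.pure { S with alive := false, active := .scheduler }
    else coin.bind fun b =>
      let r := S.z.step (S.clientOutput S.zTarget (S.z.peerHead S.z.controlHead)) b
      match r.2 with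
      | none => PMF.pure { S with z := r.1 }
      | some none => PMF.pure { S with z := r.1 }.idle
      | some (some (a, msg)) => zAct rule sec { S with z := r.1 } msg a
  | .requester =>
    if S.y.halted then PMF.pure S.idle
    else coin.bind fun b =>
      let r := S.y.step (S.clientOutput S.yTarget (S.y.peerHead S.y.controlHead)) b
      match r.2 with
      | none => PMF.pure { S with y := r.1 }
      | some none => PMF.pure { S with y := r.1 }.idle
      | some (some (a, msg)) => yAct rule sec { S with y := r.1 } msg a
  | .collector =>
    if S.x.halted then PMF.pure S.idle
    else coin.bind fun b =>
      let r := S.x.step (S.serverOutput S.x.controlHead (S.x.peerHead S.x.controlHead)) b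
      match r.2 with
      | none => PMF.pure { S with x := r.1 }
      | some none => PMF.pure { S with x := r.1 }.idle
      | some (some (a, msg)) => PMF.pure (xAct { S with x := r.1 } msg a)
  | .client i =>
    match S.sessions[i]? with
    | none => PMF.pure S.idle
    | some t =>
      if t.clientHalted then PMF.pure S.idle
      else coin.bind fun b =>
        let r := t.client.2.step none b
        let S' : Sys D E R :=
          { S with sessions := S.sessions.set i { t with client := ⟨t.client.1, r.1⟩ } }
        match r.2 with
        | none => PMF.pure S'
        | some none => PMF.pure S'.idle
        | some (some (a, msg)) => PMF.pure (S'.clientAct i t.owner msg a)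
  | .server i =>
    match S.sessions[i]? with
    | none => PMF.pure S.idle
    | some t =>
      if t.server.2.halted then PMF.pure S.idle
      else coin.bind fun b =>
        let r := t.server.2.step none b
        let S' : Sys D E R :=
          { S with sessions := S.sessions.set i { t with server := ⟨t.server.1, r.1⟩ } }
        match r.2 with
        | none => PMF.pure S'
        | some none => PMF.pure S'.idle
        | some (some (a, msg)) => PMF.pure (S'.serverAct i msg a)

end Sys

/-- The first `n` steps of the execution of the collector `D` with environment `E` and
deletion-requester `R`. -/
def run (rule : SidRule) (D : DataCollector) (E : Environment) (R : Requester) (sec : ℕ) :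
    ℕ → PMF (Sys D E R)
  | 0 => PMF.pure (Sys.initial D E R sec)
  | n + 1 => (run rule D E R sec n).bind (Sys.step rule sec)

/-! ## Deletion-compliance error -/

/-- The view of the environment: the contents of its input, output, incoming, outgoing, randomness
and control tapes. -/
structure View where
  input : List Sym
  output : List Sym
  incoming : List Sym
  outgoing : List Sym
  randomness : List Bool
  control : List Protocol

/-- The state of the collector, which is the contents of its work tape, and the view of the
environment. -/
abbrev Outcome := (ℤ → Option Bool) × View

def Sys.outcome {D : DataCollector} {E : Environment} {R : Requester} (S : Sys D E R) : Outcome :=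
  (S.x.work, ⟨S.z.input, S.z.output, S.z.incoming, S.z.outgoing, S.z.randomness, S.z.control⟩)

/-- A computationally unbounded, possibly randomized distinguisher. -/
abbrev Distinguisher := Outcome → PMF Bool

/-- The probability that the execution ends and the distinguisher then outputs 1. (The supremum is
the limit of an increasing sequence.) -/
def prob (rule : SidRule) (D : DataCollector) (E : Environment) (R : Requester) (sec : ℕ)
    (A : Distinguisher) : ENNReal :=
  ⨆ n : ℕ, ((run rule D E R sec n).bind fun S =>
    if S.active = .done then A S.outcome else PMF.pure false) true

/-- The advantage of a distinguisher between the real and the ideal execution. -/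
def advantage (rule : SidRule) (D : DataCollector) (E : Environment) (R : Requester) (sec : ℕ)
    (A : Distinguisher) : ℝ :=
  |(prob rule D E R sec A).toReal - (prob rule D E silent sec A).toReal|

/-- The deletion-compliance error with respect to a class `C` of deletion-requesters. -/
def complianceError (rule : SidRule) (D : DataCollector) (C : Requester → Prop) (sec : ℕ) :
    ENNReal :=
  ⨆ (E : Environment) (_ : E.PPT) (R : Requester) (_ : R.Y.PPT) (_ : C R) (A : Distinguisher),
    ENNReal.ofReal (advantage rule D E R sec A)

/-- When interacting with the collector `D`, the requester initiates at most `k` instances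
of `π`. -/
def Representative (rule : SidRule) (D : DataCollector) (k : ℕ) (R : Requester) : Prop :=
  ∀ (E : Environment), E.PPT → ∀ (sec n : ℕ), ∀ S ∈ (run rule D E R sec n).support,
    S.sessions.countP (fun t => decide (t.protocol = .main) && decide (t.owner = .requester)) ≤ k

/-- The `k`-representative deletion-compliance error. -/
def representativeError (rule : SidRule) (D : DataCollector) (k sec : ℕ) : ENNReal :=
  complianceError rule D (Representative rule D k) sec

/-- The `k`-representative oblivious deletion-compliance error. -/
def obliviousRepresentativeError (rule : SidRule) (D : DataCollector) (k sec : ℕ) : ENNReal :=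
  complianceError rule D (fun R => Representative rule D k R ∧ R.Oblivious) sec

end DeletionCompliance

end

open scoped ENNReal

noncomputable section

namespace DeletionCompliance

variable {D : DataCollector} {E : Environment} {R : Requester}

/-! The proof is a hybrid argument over the sessions of the requester. In the hybrid with limit
`lim` (`Ghost.step lim`), only the first `lim` sessions of `π` that the requester asks for come into
being; whatever it wants to do with later ones just passes activation on. The requester is shown a
blank instead of its clients' output, which makes no difference to an oblivious one. Since a
`k`-representative requester never asks for more than `k` sessions, the hybrid with limit `k` is the
real execution (`Ghost.prob_eq`). The hybrid with limit `0` is the ideal one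
(`Ghost.prob_silent_eq`). It remains to show that the hybrids with limits `d` and `d + 1` differ by
at most the 1-representative error (`Ghost.value_le_add`); telescoping then gives the factor `k`.

For this, one environment runs both `E` and `R` in its head (`Mind.plan`). The sessions of `R` with
ordinals below `d` it initiates itself, as sessions of its own with the honest client programs;
whatever concerns the session with ordinal `d` it hands on to an actual requester (`relayer`), which
has only that session. If the requests are met, this is the hybrid with limit `d + 1`; if the
requester does nothing, it is that with limit `d`. The collector cannot tell who owns a session, so
its state is the same in the hybrid and in the emulation. The view of `E` is made available to the
distinguisher in unary on the output tape of the new environment. Outputs of clients run on behalf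
of `R` activate the new environment, but as `R` would not react to them, they can be treated as
activations without a cause. This is the point where obliviousness is indispensable to the
emulation.

Three difficulties have to be overcome.

The terminate phase: the new environment must emulate its procedure within its own alive phase,
without seeing which clients have halted. It therefore activates every client `T` times; superfluous
activations have no effect. Such a `T` exists if the inputs of the clients have bounded length.
Deletion tokens may be arbitrarily long, but inputs of the requester's clients grow only on
boundedly many occasions (steps of `R`, deletions), so long inputs are improbable uniformly in time
(`exists_val_indic_le`, `Ghost.exists_long_le`).

Machines: the emulation is first described as a `Strategy` with arbitrary memory, then realized by a
machine that memorizes its observations and is cut off after a constant number of steps. This is PPT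
because the error is considered for one security parameter at a time. A distinguisher that rejects
late executions (`timely`) makes the cut-off harmless in the limit (`Macro.value_le_add`).

Different speeds: the executions compared do not proceed in lockstep. `Simulates` compares their
limiting payoffs when each step of one process is matched by one or more steps of the other, up to a
persistent bad event whose probability is the loss. -/

/-- A payoff that depends on the state of the collector and the output of the environment. -/
abbrev Payoff := (ℤ → Option Bool) → List Sym → ℝ≥0∞

theorem mem_pure {α : Type*} {a b : α} : b ∈ (PMF.pure a).support ↔ b = a := by simp

theorem some_unique {α : Type*} {o : Option α} {a b : α} (h : o = some a) (h' : o = some b) :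
    a = b := Option.some.inj (h.symm.trans h')


/-! ## Expectations under discrete distributions -/

section Expectation

universe u v w

variable {α : Type u} {β : Type v} {γ : Type w}

/-- Expectation of a nonnegative function. -/
def ev (p : PMF α) (f : α → ℝ≥0∞) : ℝ≥0∞ := ∑' a, p a * f a

theorem ev_pure (a : α) (f : α → ℝ≥0∞) : ev (PMF.pure a) f = f a := by
  classical
  unfold ev
  simp_all

theorem ev_bind (p : PMF α) (q : α → PMF β) (f : β → ℝ≥0∞) :
    ev (p.bind q) f = ev p fun a => ev (q a) f := by
  unfold ev
  simp_rw [PMF.bind_apply, ← ENNReal.tsum_mul_right, ← ENNReal.tsum_mul_left]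
  rw [ENNReal.tsum_comm]
  grind

theorem ev_map (p : PMF α) (g : α → β) (f : β → ℝ≥0∞) :
    ev (p.map g) f = ev p fun a => f (g a) := by
  unfold PMF.map
  rw [ev_bind]
  simp [ev_pure]

theorem ev_mono {p : PMF α} {f g : α → ℝ≥0∞} (h : ∀ a ∈ p.support, f a ≤ g a) :
    ev p f ≤ ev p g := by
  refine ENNReal.tsum_le_tsum fun a => ?_
  by_cases ha : a ∈ p.support
  · exact mul_le_mul_right (h a ha) _
  simp_all

theorem ev_congr {p : PMF α} {f g : α → ℝ≥0∞} (h : ∀ a ∈ p.support, f a = g a) :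
    ev p f = ev p g :=
  le_antisymm (ev_mono fun a ha => (h a ha).le) (ev_mono fun a ha => (h a ha).ge)

theorem ev_add (p : PMF α) (f g : α → ℝ≥0∞) :
    ev p (fun a => f a + g a) = ev p f + ev p g := by
  unfold ev
  simp_rw [mul_add]
  exact ENNReal.tsum_add

theorem ev_const (p : PMF α) (c : ℝ≥0∞) : ev p (fun _ => c) = c := by
  unfold ev
  rw [ENNReal.tsum_mul_right, p.tsum_coe, one_mul]

theorem ev_le_const {p : PMF α} {f : α → ℝ≥0∞} {c : ℝ≥0∞} (h : ∀ a ∈ p.support, f a ≤ c) :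
    ev p f ≤ c := (ev_mono h).trans (ev_const p c).le

/-- Monotone convergence: an expectation is an integral with respect to counting measure, on a space
where all sets are declared measurable. -/
theorem ev_iSup (p : PMF α) (f : ℕ → α → ℝ≥0∞) (hf : Monotone f) :
    ev p (fun a => ⨆ n, f n a) = ⨆ n, ev p (f n) := by
  let _ : MeasurableSpace α := ⊤
  have key : ∀ g : α → ℝ≥0∞, ev p g = ∫⁻ a, p a * g a ∂MeasureTheory.Measure.count :=
    fun g => (MeasureTheory.lintegral_count' measurable_from_top).symm
  simp_rw [key, ENNReal.mul_iSup]
  exact MeasureTheory.lintegral_iSup (fun _ => measurable_from_top)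
    fun m n h a => mul_le_mul_right (hf h a) _

end Expectation

/-! ## Liftings of relations to distributions -/

section Lift

universe u v w

variable {α : Type u} {β : Type v} {γ : Type w}

/-- The lifting of a relation to distributions, in its dual form. -/
def Lift (r : α → β → Prop) (p : PMF α) (q : PMF β) : Prop :=
  (∀ (f : α → ℝ≥0∞) (g : β → ℝ≥0∞), (∀ a b, r a b → f a ≤ g b) → ev p f ≤ ev q g) ∧
    ∀ (f : α → ℝ≥0∞) (g : β → ℝ≥0∞), (∀ a b, r a b → g b ≤ f a) → ev q g ≤ ev p f

variable {r : α → β → Prop}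

theorem Lift.pure {a : α} {b : β} (h : r a b) : Lift r (PMF.pure a) (PMF.pure b) :=
  ⟨fun f g hfg => by simpa [ev_pure] using hfg a b h,
    fun f g hfg => by simpa [ev_pure] using hfg a b h⟩

/-- Testing with pairs of functions instead of constructing a joint distribution pays off here:
common randomness is handled by monotonicity of expectations alone. -/
theorem Lift.bind (p : PMF γ) {κ : γ → PMF α} {κ' : γ → PMF β}
    (h : ∀ c ∈ p.support, Lift r (κ c) (κ' c)) : Lift r (p.bind κ) (p.bind κ') := by
  refine ⟨fun f g hfg => ?_, fun f g hfg => ?_⟩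
  · rw [ev_bind, ev_bind]
    exact ev_mono fun c hc => (h c hc).1 f g hfg
  · rw [ev_bind, ev_bind]
    exact ev_mono fun c hc => (h c hc).2 f g hfg

theorem Lift.map (p : PMF γ) {κ : γ → α} {κ' : γ → β}
    (h : ∀ c ∈ p.support, r (κ c) (κ' c)) : Lift r (p.map κ) (p.map κ') :=
  Lift.bind p fun c hc => Lift.pure (h c hc)

theorem Lift.mono {s : α → β → Prop} {p : PMF α} {q : PMF β} (h : Lift r p q)
    (hrs : ∀ a b, r a b → s a b) : Lift s p q :=
  ⟨fun f g hfg => h.1 f g fun a b hab => hfg a b (hrs a b hab),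
    fun f g hfg => h.2 f g fun a b hab => hfg a b (hrs a b hab)⟩

/-- Off the support a test function does not contribute to the expectation. So it may be replaced
there by `0` where it has to be the smaller one of the pair, and by `⊤` where it has to be the
larger one. -/
theorem Lift.support_left {p : PMF α} {q : PMF β} (h : Lift r p q) :
    Lift (fun a b => r a b ∧ a ∈ p.support) p q := by
  classical
  refine ⟨fun f g hfg => ?_, fun f g hfg => ?_⟩
  · refine le_trans (le_of_eq ?_) (h.1 (fun a => if a ∈ p.support then f a else 0) g ?_)
    · exact ev_congr fun a ha => by grind
    · intro a b hab
      split_ifs with ha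
      · grind
      · exact zero_le
  · refine le_trans (h.2 (fun a => if a ∈ p.support then f a else ⊤) g ?_) (le_of_eq ?_)
    · intro a b hab
      split_ifs with ha
      · grind
      · exact le_top
    · exact ev_congr fun a ha => by grind

end Lift

/-! ## Values of absorbing processes -/

section Value

universe u

variable {α : Type u} (step : α → PMF α) (pay : α → ℝ≥0∞)

/-- The expected payoff after `n` steps. -/
def val : ℕ → α → ℝ≥0∞
  | 0, a => pay a
  | n + 1, a => ev (step a) (val n)

/-- The expected payoff in the long run. -/
def value (a : α) : ℝ≥0∞ := ⨆ n, val step pay n a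

variable {step pay}

/-- For payoffs of executions the hypothesis holds because a configuration with positive payoff is
absorbing, for indicators because the event persists. It makes the supremum in `value` a limit. -/
theorem val_le_succ (h : ∀ a, pay a ≤ ev (step a) pay) (n : ℕ) (a : α) :
    val step pay n a ≤ val step pay (n + 1) a := by
  induction n generalizing a with
  | zero => exact h a
  | succ n ih => exact ev_mono fun b _ => ih b

theorem val_mono (h : ∀ a, pay a ≤ ev (step a) pay) : Monotone (val step pay) :=
  monotone_nat_of_le_succ fun n a => val_le_succ h n a

theorem val_le_value (n : ℕ) (a : α) : val step pay n a ≤ value step pay a :=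
  le_iSup (fun n => val step pay n a) n

/-- First-step analysis; supremum and expectation may be exchanged by monotone convergence. -/
theorem value_eq (h : ∀ a, pay a ≤ ev (step a) pay) (a : α) :
    value step pay a = ev (step a) (value step pay) := by
  unfold value
  rw [ev_iSup _ _ (val_mono h)]
  exact le_antisymm (iSup_le fun n => (val_le_succ h n a).trans
    (le_iSup (fun n => ev (step a) (val step pay n)) n))
    (iSup_le fun n => le_iSup (fun n => val step pay n a) (n + 1))

theorem val_le_one (h : ∀ a, pay a ≤ 1) (n : ℕ) (a : α) : val step pay n a ≤ 1 := by
  induction n generalizing a with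
  | zero => exact h a
  | succ n ih => exact ev_le_const fun b _ => ih b

theorem value_le_one (h : ∀ a, pay a ≤ 1) (a : α) : value step pay a ≤ 1 :=
  iSup_le fun n => val_le_one h n a

theorem val_of_absorbing {a : α} (h : step a = PMF.pure a) (n : ℕ) :
    val step pay n a = pay a := by
  induction n with
  | zero => rfl
  | succ n ih => rw [val, h, ev_pure, ih]

/-- The distribution after `n` steps. -/
def iter (step : α → PMF α) (a : α) : ℕ → PMF α
  | 0 => PMF.pure a
  | n + 1 => (iter step a n).bind step

/-- An execution is cut at time `n`: the distribution reached so far, computed forwards, is paired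
with the expected payoff of what follows, computed backwards. -/
theorem ev_iter (a : α) (n m : ℕ) :
    ev (iter step a n) (val step pay m) = val step pay (n + m) a := by
  induction n generalizing m with
  | zero => simp [iter, ev_pure]
  | succ n ih =>
    rw [iter, ev_bind, show n + 1 + m = n + (m + 1) by omega, ← ih (m + 1)]
    rfl

theorem ev_iter_pay (a : α) (n : ℕ) : ev (iter step a n) pay = val step pay n a :=
  ev_iter (pay := pay) a n 0

/-- Invariants hold along an execution. -/
theorem iter_invariant {P : α → Prop} {a : α} (h0 : P a)
    (h : ∀ b, P b → ∀ c ∈ (step b).support, P c) (n : ℕ) :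
    ∀ b ∈ (iter step a n).support, P b := by
  induction n with
  | zero =>
    intro b hb
    simp [iter] at hb
    grind
  | succ n ih =>
    intro b hb
    simp only [iter, PMF.mem_support_bind_iff] at hb
    grind

end Value

/-! ## Simulations -/

section Simulation

universe u v

variable {α : Type u} {β : Type v}

/-- The distribution `p` of states of one process is matched by the further steps of another process
in state `b`, up to the relation `rel`. -/
inductive Matches (stepS : β → PMF β) (payS : β → ℝ≥0∞) (rel : α → β → Prop) : PMF α → β → Prop
  | here {a : α} {b : β} : rel a b → Matches stepS payS rel (PMF.pure a) b
  | sync {p : PMF α} {b : β} : payS b = 0 → Lift rel p (stepS b) → Matches stepS payS rel p b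
  | flip {κ : Bool → PMF α} {σ : Bool → β} {b : β} : payS b = 0 → stepS b = Sys.coin.map σ →
      (∀ c, Matches stepS payS rel (κ c) (σ c)) → Matches stepS payS rel (Sys.coin.bind κ) b
  | wait {p : PMF α} {b : β} : payS b = 0 →
      (∀ b' ∈ (stepS b).support, Matches stepS payS rel p b') → Matches stepS payS rel p b

/-- As `Matches`, with at least one step of the other process. -/
inductive MatchesPos (stepS : β → PMF β) (payS : β → ℝ≥0∞) (rel : α → β → Prop) :
    PMF α → β → Prop
  | sync {p : PMF α} {b : β} : payS b = 0 → Lift rel p (stepS b) → MatchesPos stepS payS rel p b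
  | flip {κ : Bool → PMF α} {σ : Bool → β} {b : β} : payS b = 0 → stepS b = Sys.coin.map σ →
      (∀ c, Matches stepS payS rel (κ c) (σ c)) → MatchesPos stepS payS rel (Sys.coin.bind κ) b
  | wait {p : PMF α} {b : β} : payS b = 0 →
      (∀ b' ∈ (stepS b).support, Matches stepS payS rel p b') → MatchesPos stepS payS rel p b

variable {stepS : β → PMF β} {payS : β → ℝ≥0∞} {rel : α → β → Prop}

theorem MatchesPos.matches {p : PMF α} {b : β} (h : MatchesPos stepS payS rel p b) :
    Matches stepS payS rel p b := by
  cases h with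
  | sync h1 h2 => exact .sync h1 h2
  | flip h1 h2 h3 => exact .flip h1 h2 h3
  | wait h1 h2 => exact .wait h1 h2

theorem MatchesPos.pay_eq_zero {p : PMF α} {b : β} (h : MatchesPos stepS payS rel p b) :
    payS b = 0 := by
  cases h <;> assumption

/-- A coin of the other process may be wasted, since `p` is the mixture, over this coin, of copies
of itself. -/
theorem MatchesPos.stutter {p : PMF α} {b : β} {σ : Bool → β} (h0 : payS b = 0)
    (h : stepS b = Sys.coin.map σ) (hσ : ∀ c, Matches stepS payS rel p (σ c)) :
    MatchesPos stepS payS rel p b := by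
  have := MatchesPos.flip (κ := fun _ => p) h0 h hσ
  aesop

theorem MatchesPos.det {p : PMF α} {b b' : β} (h0 : payS b = 0)
    (h : stepS b = PMF.pure b') (hb : Matches stepS payS rel p b') :
    MatchesPos stepS payS rel p b :=
  MatchesPos.stutter (σ := fun _ => b') h0 (by rw [h]; exact (PMF.map_const _ _).symm) fun _ => hb

theorem Matches.det {p : PMF α} {b b' : β} (h0 : payS b = 0)
    (h : stepS b = PMF.pure b') (hb : Matches stepS payS rel p b') :
    Matches stepS payS rel p b := (MatchesPos.det h0 h hb).matches

theorem Matches.mono {rel' : α → β → Prop} {p : PMF α} {b : β}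
    (h : Matches stepS payS rel p b) (hr : ∀ a b, a ∈ p.support → rel a b → rel' a b) :
    Matches stepS payS rel' p b := by
  induction h with
  | here h => exact .here (hr _ _ (by simp) h)
  | sync h1 h2 => exact .sync h1 (h2.support_left.mono fun a b hab => hr a b hab.2 hab.1)
  | flip h1 h2 h3 ih =>
    refine .flip h1 h2 fun c => ih c fun a b ha => hr a b ?_
    rw [PMF.mem_support_bind_iff]
    exact ⟨c, by simp [Sys.coin], ha⟩
  | wait h1 _ ih => exact .wait h1 fun b' hb' => ih b' hb' hr

theorem MatchesPos.mono {rel' : α → β → Prop} {p : PMF α} {b : β}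
    (h : MatchesPos stepS payS rel p b) (hr : ∀ a b, a ∈ p.support → rel a b → rel' a b) :
    MatchesPos stepS payS rel' p b := by
  cases h with
  | sync h1 h2 => exact .sync h1 (h2.support_left.mono fun a b hab => hr a b hab.2 hab.1)
  | flip h1 h2 h3 =>
    refine .flip h1 h2 fun c => (h3 c).mono fun a b ha => hr a b ?_
    rw [PMF.mem_support_bind_iff]
    exact ⟨c, by simp [Sys.coin], ha⟩
  | wait h1 h2 => exact .wait h1 fun b' hb' => (h2 b' hb').mono hr

/-- On its way to a related state the other process only spends steps and earns nothing, so what it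
can earn in `n` steps is at most what it could earn by spending all `n` steps after arrival. The
induction is on the derivation of the match, so no uniform bound on its length is needed. -/
theorem Matches.val_le {H : α → ℝ≥0∞} (hpay : ∀ b, payS b ≤ ev (stepS b) payS) {n : ℕ}
    (hn : ∀ a b, rel a b → val stepS payS n b ≤ H a) {p : PMF α} {b : β}
    (h : Matches stepS payS rel p b) : val stepS payS n b ≤ ev p H := by
  induction h with
  | here h => rw [ev_pure]; exact hn _ _ h
  | sync h1 h2 =>
    cases n with
    | zero => rw [val, h1]; exact zero_le
    | succ n => exact h2.2 _ _ fun a b hab => (val_le_succ hpay n b).trans (hn a b hab)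
  | flip h1 h2 h3 ih =>
    cases n with
    | zero => rw [val, h1]; exact zero_le
    | succ n =>
      rw [val, h2, ev_map, ev_bind]
      exact ev_mono fun c _ => (val_le_succ hpay n _).trans (ih c)
  | wait h1 h2 ih =>
    cases n with
    | zero => rw [val, h1]; exact zero_le
    | succ n =>
      exact (ev_mono fun c hc => (val_le_succ hpay n _).trans (ih c hc)).trans (ev_const _ _).le

/-- The one step that is certain to be made reduces the horizon from `n + 1` to `n`. This is what
drives the induction on the horizon in `Simulates.value_le`. -/
theorem MatchesPos.val_le {H : α → ℝ≥0∞} (hpay : ∀ b, payS b ≤ ev (stepS b) payS) {n : ℕ}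
    (hn : ∀ a b, rel a b → val stepS payS n b ≤ H a) {p : PMF α} {b : β}
    (h : MatchesPos stepS payS rel p b) : val stepS payS (n + 1) b ≤ ev p H := by
  cases h with
  | sync h1 h2 => exact h2.2 _ _ fun a b hab => hn a b hab
  | flip h1 h2 h3 =>
    rw [val, h2, ev_map, ev_bind]
    exact ev_mono fun c _ => (h3 c).val_le hpay hn
  | wait h1 h2 => exact (ev_mono fun c hc => (h2 c hc).val_le hpay hn).trans (ev_const _ _).le

/-- In this direction the other process has unlimited time, so the fixed point equation `value_eq`
absorbs its additional steps. -/
theorem Matches.le_value {F : α → ℝ≥0∞} (hpay : ∀ b, payS b ≤ ev (stepS b) payS)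
    (hF : ∀ a b, rel a b → F a ≤ value stepS payS b) {p : PMF α} {b : β}
    (h : Matches stepS payS rel p b) : ev p F ≤ value stepS payS b := by
  induction h with
  | here h => rw [ev_pure]; exact hF _ _ h
  | sync h1 h2 => rw [value_eq hpay]; exact h2.1 _ _ hF
  | flip h1 h2 h3 ih =>
    rw [value_eq hpay, h2, ev_map, ev_bind]
    exact ev_mono fun c _ => ih c
  | wait h1 h2 ih =>
    rw [value_eq hpay]
    exact (ev_const _ _).ge.trans (ev_mono fun c hc => ih c hc)

variable {stepW : α → PMF α} {payW : α → ℝ≥0∞}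

/-- A process simulates another one up to the occurrence of the event `bad`. -/
structure Simulates (stepW : α → PMF α) (payW : α → ℝ≥0∞) (stepS : β → PMF β) (payS : β → ℝ≥0∞)
    (bad : α → Prop) (rel : α → β → Prop) : Prop where
  payW_le : ∀ a, payW a ≤ ev (stepW a) payW
  payS_le : ∀ b, payS b ≤ ev (stepS b) payS
  payW_le_one : ∀ a, payW a ≤ 1
  payS_le_one : ∀ b, payS b ≤ 1
  bad_step : ∀ a, bad a → ∀ a' ∈ (stepW a).support, bad a'
  step : ∀ a b, rel a b → bad a ∨ (payW a = 0 ∧ MatchesPos stepS payS rel (stepW a) b) ∨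
    ((∀ n, val stepS payS n b = payW a) ∧ ∀ n, val stepW payW n a = payW a)

/-- The indicator of a property. -/
def indic (bad : α → Prop) (a : α) : ℝ≥0∞ := by
  classical exact if bad a then 1 else 0

theorem indic_le_one (bad : α → Prop) (a : α) : indic bad a ≤ 1 := by
  unfold indic; split_ifs <;> simp

theorem indic_le_ev {bad : α → Prop} (h : ∀ a, bad a → ∀ a' ∈ (stepW a).support, bad a') (a : α) :
    indic bad a ≤ ev (stepW a) (indic bad) := by
  by_cases ha : bad a
  · rw [ev_congr (g := fun _ => 1) fun a' ha' => by simp [indic, h a ha a' ha'], ev_const]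
    exact indic_le_one _ _
  · simp [indic, ha]

theorem one_le_value_indic {bad : α → Prop} {a : α} (ha : bad a) :
    1 ≤ value stepW (indic bad) a :=
  le_trans (by simp [val, indic, ha]) (val_le_value (step := stepW) 0 a)

variable {bad : α → Prop}

/-- Induction on the horizon of the simulating process. Payoffs are at most `1`, so from a bad state
on everything is paid for by the value of the indicator, which is `1` there. -/
theorem Simulates.value_le (h : Simulates stepW payW stepS payS bad rel) {a : α} {b : β}
    (hab : rel a b) :
    value stepS payS b ≤ value stepW payW a + value stepW (indic bad) a := by
  refine iSup_le fun n => ?_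
  induction n generalizing a b with
  | zero =>
    rcases h.step a b hab with h1 | h1 | h1
    · exact (val_le_one h.payS_le_one _ _).trans ((one_le_value_indic h1).trans le_add_self)
    · have : payS b = 0 := h1.2.pay_eq_zero
      simp [val, this]
    · rw [h1.1]; exact (val_le_value (step := stepW) (pay := payW) 0 a).trans le_self_add
  | succ n ih =>
    rcases h.step a b hab with h1 | h1 | h1
    · exact (val_le_one h.payS_le_one _ _).trans ((one_le_value_indic h1).trans le_add_self)
    · rw [value_eq h.payW_le, value_eq (indic_le_ev h.bad_step), ← ev_add]
      exact h1.2.val_le h.payS_le fun a b hab => ih hab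
    grind

theorem Simulates.le_value (h : Simulates stepW payW stepS payS bad rel) {a : α} {b : β}
    (hab : rel a b) :
    value stepW payW a ≤ value stepS payS b + value stepW (indic bad) a := by
  refine iSup_le fun n => ?_
  induction n generalizing a b with
  | zero =>
    rcases h.step a b hab with h1 | h1 | h1
    · exact (val_le_one h.payW_le_one _ _).trans ((one_le_value_indic h1).trans le_add_self)
    · rw [val, h1.1]; exact zero_le
    · rw [h1.2, ← h1.1 0]; exact (val_le_value (step := stepS) 0 b).trans le_self_add
  | succ n ih =>
    rcases h.step a b hab with h1 | h1 | h1
    · exact (val_le_one h.payW_le_one _ _).trans ((one_le_value_indic h1).trans le_add_self)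
    · rw [value_eq (indic_le_ev h.bad_step)]
      -- Truncated subtraction turns the induction hypothesis into a bound on a single function of
      -- the state of the first process, as `Matches.le_value` demands; `le_tsub_add` undoes it
      -- afterwards.
      have h2 := h1.2.matches.le_value h.payS_le
        (F := fun a => val stepW payW n a - value stepW (indic bad) a)
        fun a b hab => tsub_le_iff_right.2 (ih hab)
      refine le_trans ?_ (add_le_add_left h2 _)
      rw [val, ← ev_add]
      exact ev_mono fun a _ => le_tsub_add
    grind

end Simulation

/-! ## Steps of the collector, the clients and the servers -/

/-- A session without the information on who has initiated it. -/
def Session.erase (t : Session) : Session := { t with owner := .environment }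

/-- The client takes a step. -/
def Session.stepClient (b : Bool) (t : Session) : Session :=
  { t with client := ⟨t.client.1, (t.client.2.step none b).1⟩ }

/-- The server takes a step. -/
def Session.stepServer (b : Bool) (t : Session) : Session :=
  { t with server := ⟨t.server.1, (t.server.2.step none b).1⟩ }

def Session.clientSend (msg : Str) (t : Session) : Session :=
  ((t.mapClient fun c => { c with outgoing := c.outgoing ++ written msg }).mapServer
    fun c => { c with incoming := c.incoming ++ written msg }).record true msg false

def Session.serverSend (msg : Str) (t : Session) : Session :=
  ((t.mapServer fun c => { c with outgoing := c.outgoing ++ written msg }).mapClient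
    fun c => { c with incoming := c.incoming ++ written msg }).record false msg t.clientHalted

def Session.clientOut (msg : Str) (t : Session) : Session :=
  t.mapClient fun c => { c with output := c.output ++ written msg }

def Session.serverOut (msg : Str) (t : Session) : Session :=
  t.mapServer fun c => { c with output := c.output ++ written msg }

def Session.clientInput (msg : Str) (t : Session) : Session :=
  t.mapClient fun c => { c with input := c.input ++ written msg }

def Session.serverInput (msg : Str) (t : Session) : Session :=
  t.mapServer fun c => { c with input := c.input ++ written msg }

/-- Where a step of a machine other than the environment and the requester leads. -/
inductive Event
  | cont
  | idle
  | output (i : ℕ)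

/-- The effect of a step of the collector or of a party of a session. -/
structure Update (D : DataCollector) where
  x : ITI D.X
  idx : ℕ
  f : Session → Session
  active : Active
  event : Event

namespace Update

/-- Activation is passed on. -/
def pass (x : ITI D.X) : Update D := ⟨x, 0, id, .collector, .idle⟩

/-- The effect of a step of the collector with a given signal, when there are `n` sessions. -/
def ofCollector (x : ITI D.X) (n : ℕ) : Option (Option (CollectorAct × Str)) → Update D
  | none => ⟨x, 0, id, .collector, .cont⟩
  | some none => ⟨x, 0, id, .collector, .idle⟩
  | some (some (_, msg)) =>
    if x.controlHead < n then
      ⟨x, x.controlHead, Session.serverInput msg, .server x.controlHead, .cont⟩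
    else ⟨x, 0, id, .collector, .idle⟩

/-- The effect of a step of a client with a given signal. -/
def ofClient (x : ITI D.X) (i : ℕ) (b : Bool) : Option (Option (PartyAct × Str)) → Update D
  | none => ⟨x, i, Session.stepClient b, .client i, .cont⟩
  | some none => ⟨x, i, Session.stepClient b, .client i, .idle⟩
  | some (some (.send, msg)) => ⟨x, i, fun t => (t.stepClient b).clientSend msg, .server i, .cont⟩
  | some (some (.output, msg)) =>
    ⟨x, i, fun t => (t.stepClient b).clientOut msg, .client i, .output i⟩

/-- The effect of a step of a server with a given signal. -/
def ofServer (x : ITI D.X) (i : ℕ) (b : Bool) : Option (Option (PartyAct × Str)) → Update D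
  | none => ⟨x, i, Session.stepServer b, .server i, .cont⟩
  | some none => ⟨x, i, Session.stepServer b, .server i, .idle⟩
  | some (some (.send, msg)) => ⟨x, i, fun t => (t.stepServer b).serverSend msg, .client i, .cont⟩
  | some (some (.output, msg)) =>
    ⟨{ x with caller := some i }, i, fun t => (t.stepServer b).serverOut msg, .collector, .cont⟩

end Update

/-- The collector or a party of a session is active. -/
def Active.IsCore : Active → Prop
  | .collector | .client _ | .server _ => True
  | _ => False

/-- The number of steps that the client has made. -/
def Session.steps (t : Session) : ℕ := t.client.2.randomness.length

/-- The contents of the client's input tape. -/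
def Session.input (t : Session) : List Sym := t.client.2.input

/-- The relation of the states of a session at two points of an execution. -/
structure Session.Evolves (t t' : Session) : Prop where
  protocol : t'.protocol = t.protocol
  owner : t'.owner = t.owner
  sid : t'.sid = t.sid
  program : t'.client.1 = t.client.1
  deletion : ∀ j, t.deletion = some j → t'.deletion = some j
  halted : t.clientHalted = true → t'.clientHalted = true
  steps : t.steps ≤ t'.steps
  transcript : t.clientHalted = true → t'.transcript = t.transcript
  reachable : Reachable t.client.1 t.client.2 → Reachable t'.client.1 t'.client.2

/-- The state of a session evolves, but for the input of its client and its deletion. -/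
structure Session.Quiet (t t' : Session) : Prop where
  evolves : t.Evolves t'
  deletion : t'.deletion = t.deletion
  input : t'.input = t.input

theorem Session.Evolves.refl (t : Session) : t.Evolves t :=
  ⟨rfl, rfl, rfl, rfl, fun _ h => h, fun h => h, le_rfl, fun _ => rfl, fun h => h⟩

theorem Session.Evolves.trans {t u v : Session} (h : t.Evolves u) (h' : u.Evolves v) :
    t.Evolves v where
  protocol := h'.protocol.trans h.protocol
  owner := h'.owner.trans h.owner
  sid := h'.sid.trans h.sid
  program := h'.program.trans h.program
  deletion j hj := h'.deletion j (h.deletion j hj)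
  halted hh := h'.halted (h.halted hh)
  steps := h.steps.trans h'.steps
  transcript hh := (h'.transcript (h.halted hh)).trans (h.transcript hh)
  reachable hr := h'.reachable (h.reachable hr)

theorem Session.Evolves.tokenOf {t t' : Session} (h : t.Evolves t')
    (ht : t.clientHalted = true) : D.tokenOf t' = D.tokenOf t := by
  simp [DataCollector.tokenOf, h.protocol, h.halted ht, ht, h.sid, h.transcript ht]

theorem Reachable.appendTapes {A : Type} {M : ITM A} {s : ITI M} (h : Reachable M s)
    (inp inc out sent : List Sym) :
    Reachable M { s with
      input := s.input ++ inp
      incoming := s.incoming ++ inc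
      output := s.output ++ out
      outgoing := s.outgoing ++ sent } := by
  simpa using Reachable.extend s inp inc out sent [] s.caller h

theorem Session.evolves_stepClient (b : Bool) {t : Session} (h : t.clientHalted = false) :
    t.Evolves (t.stepClient b) where
  protocol := rfl
  owner := rfl
  sid := rfl
  program := rfl
  deletion _ hj := hj
  halted hh := by grind
  steps := by simp [Session.steps, Session.stepClient, ITI.step]
  transcript _ := rfl
  reachable hr := Reachable.step _ _ _ hr h

theorem Session.evolves_stepServer (b : Bool) (t : Session) : t.Evolves (t.stepServer b) :=
  ⟨rfl, rfl, rfl, rfl, fun _ h => h, fun h => h, le_rfl, fun _ => rfl, fun h => h⟩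

theorem Session.evolves_serverOut (msg : Str) (t : Session) : t.Evolves (t.serverOut msg) :=
  ⟨rfl, rfl, rfl, rfl, fun _ h => h, fun h => h, le_rfl, fun _ => rfl, fun h => h⟩

theorem Session.evolves_serverInput (msg : Str) (t : Session) : t.Evolves (t.serverInput msg) :=
  ⟨rfl, rfl, rfl, rfl, fun _ h => h, fun h => h, le_rfl, fun _ => rfl, fun h => h⟩

theorem Session.evolves_clientOut (msg : Str) (t : Session) : t.Evolves (t.clientOut msg) :=
  ⟨rfl, rfl, rfl, rfl, fun _ h => h, fun h => h, le_rfl, fun _ => rfl,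
    fun h => by
      have := h.appendTapes [] [] (written msg) []
      simp at this
      exact this⟩

theorem Session.evolves_clientInput (msg : Str) (t : Session) : t.Evolves (t.clientInput msg) :=
  ⟨rfl, rfl, rfl, rfl, fun _ h => h, fun h => h, le_rfl, fun _ => rfl,
    fun h => by
      have := h.appendTapes (written msg) [] [] []
      simp at this
      exact this⟩

theorem Session.evolves_serverSend (msg : Str) (t : Session) : t.Evolves (t.serverSend msg) :=
  ⟨rfl, rfl, rfl, rfl, fun _ h => h, fun h => h, le_rfl,
    fun h => by simp [Session.serverSend, Session.record, Session.mapServer, Session.mapClient, h],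
    fun h => by
      have := h.appendTapes [] (written msg) [] []
      simp at this
      exact this⟩

theorem Session.evolves_stepClient_clientSend (b : Bool) (msg : Str) {t : Session}
    (h : t.clientHalted = false) : t.Evolves ((t.stepClient b).clientSend msg) where
  protocol := rfl
  owner := rfl
  sid := rfl
  program := rfl
  deletion _ hj := hj
  halted hh := by grind
  steps := by
    simp [Session.steps, Session.stepClient, ITI.step, Session.clientSend, Session.record,
      Session.mapServer, Session.mapClient]
  transcript hh := by grind
  reachable hr := by
    have := (Reachable.step _ none b hr h).appendTapes [] [] [] (written msg)
    simp at this
    exact this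

namespace Sys

/-- Replace the collector, the sessions and the active machine. -/
def core (S : Sys D E R) (x : ITI D.X) (ss : List Session) (a : Active) : Sys D E R :=
  { S with x := x, sessions := ss, active := a }

/-- The effect of a step with a given coin. -/
def upd (S : Sys D E R) (b : Bool) : Update D :=
  match S.active with
  | .collector =>
    if S.x.halted then .pass S.x
    else
      let r := S.x.step (S.serverOutput S.x.controlHead (S.x.peerHead S.x.controlHead)) b
      .ofCollector r.1 S.sessions.length r.2
  | .client i =>
    match S.sessions[i]? with
    | none => .pass S.x
    | some t =>
      if t.clientHalted then .pass S.x else .ofClient S.x i b (t.client.2.step none b).2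
  | .server i =>
    match S.sessions[i]? with
    | none => .pass S.x
    | some t =>
      if t.server.2.halted then .pass S.x else .ofServer S.x i b (t.server.2.step none b).2
  | _ => .pass S.x

/-- Pass on activation after an event. -/
def finish (S : Sys D E R) : Event → Sys D E R
  | .cont => S
  | .idle => S.idle
  | .output i =>
    match S.sessions[i]? with
    | none => S
    | some t => S.notifyOwner i t.owner

def applyUpd (S : Sys D E R) (u : Update D) : Sys D E R :=
  (S.core u.x (S.sessions.modify u.idx u.f) u.active).finish u.event

theorem coin_bind_pure {α : Type*} (f : Bool → α) :
    (coin.bind fun b => PMF.pure (f b)) = coin.map f := rfl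

theorem coin_map_const {α : Type*} (a : α) : coin.map (fun _ => a) = PMF.pure a :=
  PMF.map_const _ _

@[simp] theorem idle_core_self (S : Sys D E R) (a : Active) :
    (S.core S.x S.sessions a).idle = S.idle := by
  aesop

theorem set_eq_modify {l : List Session} {i : ℕ} {t : Session} (h : l[i]? = some t)
    (f : Session → Session) : l.set i (f t) = l.modify i f := by
  apply List.ext_getElem?
  grind

/-- The collector, the clients and the servers all follow one pattern: toss a coin, derive an
`Update` from it, apply this, pass activation on. A machine that has halted fits in as well, because
a constant function of a coin is deterministic. All later comparisons of executions only need facts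
about `upd`. -/
theorem step_core (rule : SidRule) (sec : ℕ) (S : Sys D E R) (h : S.active.IsCore) :
    S.step rule sec = coin.map fun b => S.applyUpd (S.upd b) := by
  have hpass : ∀ S : Sys D E R, S.applyUpd (.pass S.x) = S.idle := fun S => by
    simp [applyUpd, Update.pass, List.modify_id, finish]
  obtain ⟨x, z, y, zr, yr, ss, al, ac⟩ := S
  cases ac with
  | collector =>
    unfold step
    dsimp only
    split_ifs with hh
    · simp only [upd, hh, if_true]
      exact ((congrArg coin.map (funext fun _ => hpass _)).trans (coin_map_const _)).symm
    · rw [← coin_bind_pure]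
      congr 1; funext b
      simp only [upd, hh]
      split <;> rename_i h1 <;> simp only [h1, Bool.false_eq_true, if_false]
      · simp [applyUpd, finish, core, List.modify_id, Update.ofCollector]
      · simp [applyUpd, finish, core, List.modify_id, idle, Update.ofCollector]
      · next a msg =>
        cases a
        simp only [xAct, Update.ofCollector]
        split_ifs with h1
        · simp [applyUpd, finish, core]
          rfl
        · simp [applyUpd, finish, core, List.modify_id, idle]
  | client i =>
    unfold step
    dsimp only
    split
    · next h =>
      simp only [upd, h]
      exact ((congrArg coin.map (funext fun _ => hpass _)).trans (coin_map_const _)).symm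
    · next t ht =>
      split_ifs with hh
      · simp [upd, ht, hh]
        exact ((congrArg coin.map (funext fun _ => hpass _)).trans (coin_map_const _)).symm
      · rw [← coin_bind_pure]
        congr 1; funext b
        have hset : ss.set i { t with client := ⟨t.client.1, (t.client.2.step none b).1⟩ } =
          ss.modify i (Session.stepClient b) := set_eq_modify ht (Session.stepClient b)
        simp only [upd, ht, hh]
        rw [hset]
        split <;> rename_i h1 <;> simp only [h1, Bool.false_eq_true, if_false]
        · simp only [applyUpd, finish, core, Update.ofClient]
        · simp only [applyUpd, finish, core, Update.ofClient]
        · next a msg =>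
          cases a
          · simp only [applyUpd, finish, core, clientAct, List.modify_modify_eq, Update.ofClient]
            rfl
          · simp only [applyUpd, finish, core, clientAct, List.modify_modify_eq, Update.ofClient,
              List.getElem?_modify_eq, ht]
            rfl
  | server i =>
    unfold step
    dsimp only
    split
    · next h =>
      simp only [upd, h]
      exact ((congrArg coin.map (funext fun _ => hpass _)).trans (coin_map_const _)).symm
    · next t ht =>
      split_ifs with hh
      · simp [upd, ht, hh]
        exact ((congrArg coin.map (funext fun _ => hpass _)).trans (coin_map_const _)).symm
      · rw [← coin_bind_pure]
        congr 1; funext b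
        have hset : ss.set i { t with server := ⟨t.server.1, (t.server.2.step none b).1⟩ } =
          ss.modify i (Session.stepServer b) := set_eq_modify ht (Session.stepServer b)
        simp only [upd, ht, hh]
        rw [hset]
        split <;> rename_i h1 <;> simp [h1]
        · simp only [applyUpd, finish, core, Update.ofServer]
        · simp only [applyUpd, finish, core, Update.ofServer]
        · next a msg =>
          cases a
          · simp only [applyUpd, finish, core, serverAct, List.modify_modify_eq, Update.ofServer]
            rfl
          · simp only [applyUpd, finish, core, serverAct, List.modify_modify_eq, Update.ofServer]
            rfl
  | _ => exact h.elim

/-- What the updates do to the session concerned. -/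
theorem upd_quiet (S : Sys D E R) (b : Bool) {t : Session}
    (ht : S.sessions[(S.upd b).idx]? = some t) :
    t.Quiet ((S.upd b).f t) := by
  have hpass : t.Quiet ((Update.pass S.x).f t) := ⟨.refl t, rfl, rfl⟩
  revert ht
  unfold upd
  split
  · split_ifs
    · grind
    · dsimp only
      rcases (S.x.step (S.serverOutput S.x.controlHead (S.x.peerHead S.x.controlHead)) b).2 with
        _ | _ | ⟨a, msg⟩
      · exact fun _ => hpass
      · exact fun _ => hpass
      · unfold Update.ofCollector
        split_ifs
        · exact fun _ => ⟨Session.evolves_serverInput _ t, rfl, rfl⟩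
        · exact fun _ => hpass
  · split
    · grind
    · next i u h1 =>
      split_ifs with hh
      · grind
      · rw [Bool.not_eq_true] at hh
        rcases (u.client.2.step none b).2 with _ | _ | ⟨_ | _, msg⟩ <;> intro ht <;>
          (replace ht : _ = some t := h1.symm.trans ht; rw [Option.some.injEq] at ht; subst ht)
        · exact ⟨Session.evolves_stepClient b hh, rfl, rfl⟩
        · exact ⟨Session.evolves_stepClient b hh, rfl, rfl⟩
        · exact ⟨Session.evolves_stepClient_clientSend b _ hh, rfl, rfl⟩
        · exact ⟨(Session.evolves_stepClient b hh).trans (Session.evolves_clientOut _ _), rfl, rfl⟩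
  · split
    · grind
    · next i u h1 =>
      split_ifs with hh
      · grind
      · rcases (u.server.2.step none b).2 with _ | _ | ⟨_ | _, msg⟩ <;> intro ht
        · exact ⟨Session.evolves_stepServer b t, rfl, rfl⟩
        · exact ⟨Session.evolves_stepServer b t, rfl, rfl⟩
        · exact ⟨(Session.evolves_stepServer b t).trans (Session.evolves_serverSend _ _), rfl, rfl⟩
        · exact ⟨(Session.evolves_stepServer b t).trans (Session.evolves_serverOut _ _), rfl, rfl⟩
  grind

/-- The change made to a session neither looks at its owner nor depends on it. Therefore sessions
may belong to different parties in two executions that are compared. -/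
theorem upd_erase (S : Sys D E R) (b : Bool) (t : Session) :
    ((S.upd b).f t).erase = (S.upd b).f t.erase := by
  unfold upd
  split
  · split_ifs
    · rfl
    · dsimp only
      rcases (S.x.step (S.serverOutput S.x.controlHead (S.x.peerHead S.x.controlHead)) b).2 with
        _ | _ | ⟨a, msg⟩
      · rfl
      · rfl
      · unfold Update.ofCollector
        split_ifs <;> rfl
  · split
    · rfl
    · next i u h1 =>
      split_ifs
      · rfl
      · rcases (u.client.2.step none b).2 with _ | _ | ⟨_ | _, msg⟩ <;> rfl
  · split
    · rfl
    · next i u h1 =>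
      split_ifs
      · rfl
      · rcases (u.server.2.step none b).2 with _ | _ | ⟨_ | _, msg⟩ <;> rfl
  · rfl

/-- An active client that has not halted makes a step. -/
theorem upd_client (S : Sys D E R) (b : Bool) {i : ℕ} {t : Session} (ha : S.active = .client i)
    (ht : S.sessions[i]? = some t) (hh : t.clientHalted = false) :
    (S.upd b).idx = i ∧ ((S.upd b).f t).steps = t.steps + 1 := by
  have hu : S.upd b = .ofClient S.x i b (t.client.2.step none b).2 := by
    simp [upd, ha, ht, hh]
  rw [hu]
  rcases (t.client.2.step none b).2 with _ | _ | ⟨_ | _, msg⟩ <;> refine ⟨rfl, ?_⟩ <;>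
    simp [Session.stepClient, ITI.step, Session.clientSend, Session.record, Session.mapServer,
      Session.mapClient, Session.clientOut, Update.ofClient, Session.steps]

theorem upd_active (S : Sys D E R) (b : Bool) : (S.upd b).active.IsCore := by
  unfold upd
  split
  · split_ifs
    · trivial
    · dsimp only
      rcases (S.x.step (S.serverOutput S.x.controlHead (S.x.peerHead S.x.controlHead)) b).2 with
        _ | _ | ⟨a, msg⟩
      · trivial
      · trivial
      · unfold Update.ofCollector
        split_ifs <;> trivial
  · split
    · trivial
    · next i u h1 =>
      split_ifs
      · trivial
      · rcases (u.client.2.step none b).2 with _ | _ | ⟨_ | _, msg⟩ <;> trivial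
  · split
    · trivial
    · next i u h1 =>
      split_ifs
      · trivial
      · rcases (u.server.2.step none b).2 with _ | _ | ⟨_ | _, msg⟩ <;> trivial
  · trivial

/-! ### Executions with the same core -/

variable {E' : Environment} {R' : Requester}

/-- Two configurations agree on the collector and, but for the owners, on the sessions. -/
structure Agree (S : Sys D E R) (S' : Sys D E' R') : Prop where
  x : S'.x = S.x
  sessions : S'.sessions.map Session.erase = S.sessions.map Session.erase

namespace Agree

variable {S : Sys D E R} {S' : Sys D E' R'}

theorem length (h : Agree S S') : S'.sessions.length = S.sessions.length := by
  simpa using congrArg List.length h.sessions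

theorem get (h : Agree S S') (i : ℕ) :
    (S'.sessions[i]?).map Session.erase = (S.sessions[i]?).map Session.erase := by
  simpa using congrArg (·[i]?) h.sessions

theorem get_none (h : Agree S S') {i : ℕ} (hi : S.sessions[i]? = none) :
    S'.sessions[i]? = none := by
  simpa [hi] using h.get i

theorem get_some (h : Agree S S') {i : ℕ} {t : Session} (hi : S.sessions[i]? = some t) :
    ∃ w, S'.sessions[i]? = some { t with owner := w } := by
  have h1 := h.get i
  rw [hi, Option.map_some, Option.map_eq_some_iff] at h1
  obtain ⟨u, h2, h3⟩ := h1
  refine ⟨u.owner, h2.trans (congrArg some ?_)⟩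
  cases t; cases u
  simpa [Session.erase] using h3

theorem symm (h : Agree S S') : Agree S' S := ⟨h.x.symm, h.sessions.symm⟩

theorem sids (h : Agree S S') : S'.sessions.map Session.sid = S.sessions.map Session.sid := by
  have := congrArg (List.map Session.sid) h.sessions
  simpa [List.map_map, Function.comp_def, Session.erase] using this

theorem clientOutput (h : Agree S S') (i : Option ℕ) (pos : ℕ) :
    S'.clientOutput i pos = S.clientOutput i pos := by
  cases i with
  | none => rfl
  | some i =>
    unfold Sys.clientOutput
    simp
    cases h1 : S.sessions[i]? with
    | none => rw [h.get_none h1]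
    | some t =>
      obtain ⟨w, h2⟩ := h.get_some h1
      grind

/-- The active machine sees the collector's tapes and those of the session concerned; the owner of a
session is written on none of them. -/
theorem upd (h : Agree S S') (ha : S'.active = S.active) (b : Bool) : S'.upd b = S.upd b := by
  unfold Sys.upd
  rw [ha]
  split
  · have : S'.serverOutput = S.serverOutput := by
      funext i pos
      unfold Sys.serverOutput
      cases h1 : S.sessions[i]? with
      | none => rw [h.get_none h1]
      | some t =>
        obtain ⟨w, h2⟩ := h.get_some h1
        grind
    simp only [h.x, this, h.length]
  · next i hi =>
    cases h1 : S.sessions[i]? with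
    | none => rw [h.get_none h1, h.x]
    | some t =>
      obtain ⟨w, h2⟩ := h.get_some h1
      rw [h2, h.x]
      rfl
  · next i hi =>
    cases h1 : S.sessions[i]? with
    | none => rw [h.get_none h1, h.x]
    | some t =>
      obtain ⟨w, h2⟩ := h.get_some h1
      rw [h2, h.x]
  · rw [h.x]

theorem modify (h : Agree S S') {x : ITI D.X} {i : ℕ} {f : Session → Session}
    (hf : ∀ t, (f t).erase = f t.erase) {a a' : Active} :
    Agree (S.core x (S.sessions.modify i f) a) (S'.core x (S'.sessions.modify i f) a') := by
  refine ⟨rfl, ?_⟩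
  have key : ∀ l : List Session, (l.modify i f).map Session.erase =
      (l.map Session.erase).modify i f := by
    intro l
    apply List.ext_getElem?
    grind
  simp only [core, key, h.sessions]

end Agree

end Sys

/-! ## The development of the list of sessions -/

/-- The sessions at two points of an execution. -/
def Grows (ss ss' : List Session) : Prop :=
  ∀ (i : ℕ) (t : Session), ss[i]? = some t →
    ∃ t', ss'[i]? = some t' ∧ t.Evolves t' ∧ t.input.length ≤ t'.input.length

/-- No new sessions of the requester and no new input to its clients. -/
def Calm (ss ss' : List Session) : Prop :=
  ∀ (i : ℕ) (t' : Session), ss'[i]? = some t' → t'.owner = .requester →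
    ∃ t, ss[i]? = some t ∧ t.input = t'.input

/-- A session of `π` of the requester. -/
def Session.isMain (t : Session) : Bool :=
  decide (t.protocol = .main) && decide (t.owner = .requester)

/-- The indices of the sessions of `π` of the requester. -/
def mainIndices (ss : List Session) : List ℕ :=
  (List.range ss.length).filter fun i => (ss[i]?).any Session.isMain

def resolveIn (ss : List Session) : Ref → Option ℕ
  | .session i => some i
  | .deletionOf i => (ss[i]?).bind Session.deletion

theorem Session.Evolves.isMain {t t' : Session} (h : t.Evolves t') : t'.isMain = t.isMain := by
  simp [Session.isMain, h.protocol, h.owner]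

theorem Grows.refl (ss : List Session) : Grows ss ss :=
  fun _ t h => ⟨t, h, .refl t, le_rfl⟩

theorem Grows.trans {ss ss' ss'' : List Session} (h : Grows ss ss') (h' : Grows ss' ss'') :
    Grows ss ss'' := fun i t ht => by
  obtain ⟨t', h1, h2, h3⟩ := h i t ht
  obtain ⟨t'', h4, h5, h6⟩ := h' i t' h1
  exact ⟨t'', h4, h2.trans h5, h3.trans h6⟩

theorem Calm.refl (ss : List Session) : Calm ss ss := fun _ t h _ => ⟨t, h, rfl⟩

theorem Grows.append (ss ss' : List Session) : Grows ss (ss ++ ss') := fun i t h =>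
  ⟨t, by grind, .refl t, le_rfl⟩

theorem Grows.modify {ss : List Session} {i : ℕ} {f : Session → Session}
    (h : ∀ t, ss[i]? = some t → t.Evolves (f t) ∧ t.input.length ≤ (f t).input.length) :
    Grows ss (ss.modify i f) := by
  intro j t ht
  rw [List.getElem?_modify, ht]
  by_cases hij : i = j
  · grind
  · exact ⟨t, by simp [hij], .refl t, le_rfl⟩

theorem Calm.modify {ss : List Session} {i : ℕ} {f : Session → Session}
    (h : ∀ t, ss[i]? = some t → (f t).owner = .requester → (f t).input = t.input) :
    Calm ss (ss.modify i f) := by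
  intro j t' ht ho
  grind

theorem Calm.append {ss : List Session} {u : Session} (h : u.owner ≠ .requester) :
    Calm ss (ss ++ [u]) := by
  intro j t' ht ho
  grind

/-- That owners are preserved in the second stage (`hg`) is needed in order to recognize a session
of the requester as such already in between. -/
theorem Calm.trans {ss ss' ss'' : List Session} (h : Calm ss ss') (h' : Calm ss' ss'')
    (hg : Grows ss' ss'') : Calm ss ss'' := fun i t'' ht ho => by
  obtain ⟨t', h1, h2⟩ := h' i t'' ht ho
  obtain ⟨u, h3, h4, -⟩ := hg i t' h1
  have : t'' = u := some_unique ht h3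
  subst this
  obtain ⟨t, h5, h6⟩ := h i t' h1 (h4.owner ▸ ho)
  grind

theorem Grows.resolve {ss ss' : List Session} (h : Grows ss ss') {r : Ref} {i : ℕ}
    (hr : resolveIn ss r = some i) : resolveIn ss' r = some i := by
  cases r with
  | session j => exact hr
  | deletionOf j =>
    simp only [resolveIn, Option.bind_eq_some_iff] at hr ⊢
    obtain ⟨t, h1, h2⟩ := hr
    obtain ⟨t', h3, h4, -⟩ := h j t h1
    exact ⟨t', h3, h4.deletion _ h2⟩

theorem countP_le_of_getElem? {α : Type*} {P : α → Bool} {l l' : List α}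
    (h : ∀ (i : ℕ) (t : α), l[i]? = some t → ∃ t', l'[i]? = some t' ∧ (P t = true → P t' = true)) :
    l.countP P ≤ l'.countP P := by
  induction l generalizing l' with
  | nil => simp
  | cons a l ih =>
    obtain ⟨b, hb, hab⟩ := h 0 a rfl
    cases l' with
    | nil => simp at hb
    | cons b' l' =>
      obtain rfl : b' = b := by grind
      have := ih (l' := l') fun i t ht => by simpa using h (i + 1) t (by grind)
      grind

theorem countP_lt_of_getElem? {α : Type*} {P : α → Bool} {l l' : List α}
    (h : ∀ (i : ℕ) (t : α), l[i]? = some t → ∃ t', l'[i]? = some t' ∧ (P t = true → P t' = true))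
    {j : ℕ} {u : α} (hu : l'[j]? = some u) (hPu : P u = true)
    (hl : ∀ t, l[j]? = some t → P t = false) :
    l.countP P < l'.countP P := by
  induction l' generalizing l j with
  | nil => simp at hu
  | cons b l' ih =>
    cases l with
    | nil =>
      grind
    | cons a l =>
      obtain ⟨b', hb, hab⟩ := h 0 a rfl
      obtain rfl : b = b' := by grind
      have h' : ∀ (i : ℕ) (t : α), l[i]? = some t → ∃ t', l'[i]? = some t' ∧ (P t = true → P t' = true) :=
        fun i t ht => by simpa using h (i + 1) t (by grind)
      simp only [List.countP_cons]
      cases j with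
      | zero =>
        obtain rfl : b = u := by grind
        have h1 := hl a rfl
        have h2 := countP_le_of_getElem? h'
        grind
      | succ j =>
        have h1 := ih h' (j := j) (by grind) (fun t ht => hl t (by grind))
        grind

theorem mainIndices_congr {ss ss' : List Session} (hl : ss'.length = ss.length)
    (h : Grows ss ss') : mainIndices ss' = mainIndices ss := by
  unfold mainIndices
  rw [hl]
  refine List.filter_congr fun i hi => ?_
  obtain ⟨t', h1, h2, -⟩ := h i _ (List.getElem?_eq_getElem (List.mem_range.1 hi))
  rw [h1, List.getElem?_eq_getElem (List.mem_range.1 hi)]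
  simp [h2.isMain]

theorem mainIndices_append (ss : List Session) (t : Session) :
    mainIndices (ss ++ [t]) = mainIndices ss ++ if t.isMain then [ss.length] else [] := by
  unfold mainIndices
  rw [List.length_append, List.length_singleton, List.range_succ, List.filter_append]
  congr 1
  · refine List.filter_congr fun i hi => ?_
    grind
  grind

theorem mem_mainIndices {ss : List Session} {i : ℕ} :
    i ∈ mainIndices ss ↔ ∃ t, ss[i]? = some t ∧ t.isMain = true := by
  unfold mainIndices
  grind

theorem length_mainIndices (ss : List Session) :
    (mainIndices ss).length = ss.countP Session.isMain := by
  induction ss using List.reverseRecOn with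
  | nil => rfl
  | append_singleton ss t ih =>
    rw [mainIndices_append, List.length_append, ih, List.countP_append]
    grind

/-- Consistency of the sessions with each other and with the control tape of the environment. -/
structure Consistent (D : DataCollector) (ss : List Session) (zr : List Ref)
    (zc : List Protocol) : Prop where
  program : ∀ (i : ℕ) (t : Session), ss[i]? = some t → t.owner = .requester →
    t.client.1 = D.client t.protocol ∧ Reachable t.client.1 t.client.2
  length : zr.length = zc.length
  session : ∀ h i : ℕ, zr[h]? = some (.session i) →
    ∃ t, ss[i]? = some t ∧ t.owner = .environment ∧ zc[h]? = some t.protocol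
  deletionOf : ∀ h i : ℕ, zr[h]? = some (.deletionOf i) →
    ∃ t, ss[i]? = some t ∧ t.owner = .environment ∧ zc[h]? = some .deletion
  deletion : ∀ (i : ℕ) (t : Session) (j : ℕ), ss[i]? = some t → t.deletion = some j →
    ∃ u, ss[j]? = some u ∧ u.owner = t.owner ∧ u.protocol = .deletion
  referred : ∀ (i : ℕ) (t : Session), ss[i]? = some t → t.owner = .environment →
    ∃ r ∈ zr, resolveIn ss r = some i

/-- A new entry of the control tape of the environment. -/
def RefOK (ss : List Session) (p : Protocol) : Ref → Prop
  | .session i => ∃ t, ss[i]? = some t ∧ t.owner = .environment ∧ p = t.protocol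
  | .deletionOf i => ∃ t, ss[i]? = some t ∧ t.owner = .environment ∧ p = .deletion

/-- Everything consistency says about existing sessions and entries is inherited under growth. Only
new sessions, new links to deletions and at most one new entry of the control tape have to be
examined; the other preservation lemmas are instances. -/
theorem Consistent.extend {ss ss' : List Session} {zr zr' : List Ref}
    {zc zc' : List Protocol} (h : Consistent D ss zr zc) (hg : Grows ss ss')
    (hnew : ∀ (i : ℕ) (t : Session), ss'[i]? = some t → ss[i]? = none →
      (t.owner = .requester → t.client.1 = D.client t.protocol ∧
        Reachable t.client.1 t.client.2) ∧ t.deletion = none ∧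
      (t.owner = .environment → ∃ r ∈ zr', resolveIn ss' r = some i))
    (hdel : ∀ (i : ℕ) (t t' : Session) (j : ℕ), ss[i]? = some t → ss'[i]? = some t' →
      t'.deletion = some j → t.deletion = some j ∨
        ∃ u, ss'[j]? = some u ∧ u.owner = t.owner ∧ u.protocol = .deletion)
    (hz : (zr' = zr ∧ zc' = zc) ∨ ∃ r p, zr' = zr ++ [r] ∧ zc' = zc ++ [p] ∧ RefOK ss' p r) :
    Consistent D ss' zr' zc' := by
  have hmem : ∀ r ∈ zr, r ∈ zr' := by
    grind
  have hlen : zr'.length = zc'.length := by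
    rcases hz with ⟨h1, h2⟩ | ⟨r, p, h1, h2, -⟩ <;> simp [h1, h2, h.length]
  have hcases : ∀ (k : ℕ) (r : Ref), zr'[k]? = some r →
      (zr[k]? = some r ∧ zc'[k]? = zc[k]?) ∨ ∃ p, zc'[k]? = some p ∧ RefOK ss' p r := by
    grind
  refine ⟨fun i t ht ho => ?_, hlen, fun k i hk => ?_, fun k i hk => ?_, fun i t j ht hj => ?_,
    fun i t ht ho => ?_⟩
  · cases h1 : ss[i]? with
    | none => grind
    | some u =>
      obtain ⟨t', h2, h3, -⟩ := hg i u h1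
      obtain rfl : t = t' := some_unique ht h2
      have := h.program i u h1 (h3.owner ▸ ho)
      exact ⟨h3.program.trans (this.1.trans (by rw [h3.protocol])), h3.reachable this.2⟩
  · rcases hcases k _ hk with ⟨h1, h2⟩ | ⟨p, h1, t, h2, h3, h4⟩
    · obtain ⟨t, h3, h4, h5⟩ := h.session k i h1
      obtain ⟨t', h6, h7, -⟩ := hg i t h3
      exact ⟨t', h6, h7.owner.trans h4, by rw [h2, h5, h7.protocol]⟩
    grind
  · rcases hcases k _ hk with ⟨h1, h2⟩ | ⟨p, h1, t, h2, h3, h4⟩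
    · obtain ⟨t, h3, h4, h5⟩ := h.deletionOf k i h1
      obtain ⟨t', h6, h7, -⟩ := hg i t h3
      exact ⟨t', h6, h7.owner.trans h4, by rw [h2, h5]⟩
    grind
  · cases h1 : ss[i]? with
    | none => grind
    | some u =>
      obtain ⟨t', h2, h3, -⟩ := hg i u h1
      obtain rfl : t = t' := some_unique ht h2
      rcases hdel i u t j h1 ht hj with h4 | ⟨v, h4, h5, h6⟩
      · obtain ⟨v, h5, h6, h7⟩ := h.deletion i u j h1 h4
        obtain ⟨v', h8, h9, -⟩ := hg j v h5
        exact ⟨v', h8, by rw [h9.owner, h6, h3.owner], h9.protocol.trans h7⟩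
      · exact ⟨v, h4, by rw [h5, h3.owner], h6⟩
  · cases h1 : ss[i]? with
    | none => grind
    | some u =>
      obtain ⟨t', h2, h3, -⟩ := hg i u h1
      obtain rfl : t = t' := some_unique ht h2
      obtain ⟨r, h4, h5⟩ := h.referred i u h1 (h3.owner ▸ ho)
      exact ⟨r, hmem r h4, hg.resolve h5⟩

/-- Modifications of a session that leave the deletion unaffected preserve consistency. -/
theorem Consistent.modify {ss : List Session} {zr : List Ref}
    {zc : List Protocol} (h : Consistent D ss zr zc) {i : ℕ} {f : Session → Session}
    (hf : ∀ t, ss[i]? = some t → t.Evolves (f t) ∧ t.input.length ≤ (f t).input.length ∧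
      (f t).deletion = t.deletion) :
    Consistent D (ss.modify i f) zr zc := by
  refine h.extend (Grows.modify fun t ht => ⟨(hf t ht).1, (hf t ht).2.1⟩) (fun j t h1 h2 => ?_)
    (fun j t t' k h1 h2 h3 => .inl ?_) (.inl ⟨rfl, rfl⟩)
  · grind
  grind

/-- A new session of the environment. -/
theorem Consistent.append_environment {ss : List Session} {zr : List Ref}
    {zc : List Protocol} (h : Consistent D ss zr zc) {u : Session} (ho : u.owner = .environment)
    (hd : u.deletion = none) :
    Consistent D (ss ++ [u]) (zr ++ [.session ss.length]) (zc ++ [u.protocol]) := by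
  refine h.extend (Grows.append _ _) (fun j t h1 h2 => ?_) (fun j t t' k h1 h2 h3 => .inl ?_)
    (.inr ⟨_, _, rfl, rfl, u, by simp, ho, rfl⟩)
  · rw [List.getElem?_append_right (by grind), List.getElem?_singleton] at h1
    split_ifs at h1 with hj
    cases h1
    refine ⟨fun h' => by grind, hd, fun _ => ⟨.session ss.length, by simp, ?_⟩⟩
    have := List.getElem?_eq_none_iff.1 h2
    simp [resolveIn]; omega
  grind

/-- A new session of the requester. -/
theorem Consistent.append_requester {ss : List Session} {zr : List Ref}
    {zc : List Protocol} (h : Consistent D ss zr zc) {u : Session} (ho : u.owner = .requester)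
    (hp : u.client.1 = D.client u.protocol ∧ Reachable u.client.1 u.client.2)
    (hd : u.deletion = none) :
    Consistent D (ss ++ [u]) zr zc := by
  refine h.extend (Grows.append _ _) (fun j t h1 h2 => ?_) (fun j t t' k h1 h2 h3 => .inl ?_)
    (.inl ⟨rfl, rfl⟩)
  · grind
  grind

/-- The sessions after the initiation of the deletion `u` of session `i`. -/
def withDeletion (ss : List Session) (i : ℕ) (u : Session) : List Session :=
  ss.modify i (fun t => { t with deletion := some ss.length }) ++ [u]

theorem evolves_withDeletion {t : Session} (h : t.deletion = none) (n : ℕ) :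
    t.Evolves { t with deletion := some n } :=
  ⟨rfl, rfl, rfl, rfl, fun j hj => by grind, fun h => h, le_rfl, fun _ => rfl, fun h => h⟩

theorem Grows.withDeletion {ss : List Session} {i : ℕ} {t : Session} (ht : ss[i]? = some t)
    (hd : t.deletion = none) (u : Session) : Grows ss (withDeletion ss i u) := by
  refine (Grows.modify fun t' ht' => ?_).trans (Grows.append _ _)
  obtain rfl : t = t' := some_unique ht ht'
  exact ⟨evolves_withDeletion hd _, le_rfl⟩

theorem getElem?_withDeletion {ss : List Session} {i j : ℕ} {u v : Session}
    (h : (withDeletion ss i u)[j]? = some v) : (j = ss.length ∧ v = u) ∨ ∃ t, ss[j]? = some t ∧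
      v = if i = j then { t with deletion := some ss.length } else t := by
  unfold withDeletion at h
  grind

theorem getElem?_withDeletion_length (ss : List Session) (i : ℕ) (u : Session) :
    (withDeletion ss i u)[ss.length]? = some u := by
  unfold withDeletion
  grind

theorem getElem?_withDeletion_self {ss : List Session} {i : ℕ} {t : Session}
    (h : ss[i]? = some t) (u : Session) :
    (withDeletion ss i u)[i]? = some { t with deletion := some ss.length } := by
  unfold withDeletion
  grind

theorem mainIndices_withDeletion {ss : List Session} {i : ℕ} {t : Session} (ht : ss[i]? = some t)
    (hd : t.deletion = none) {u : Session} (hu : u.protocol = .deletion) :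
    mainIndices (withDeletion ss i u) = mainIndices ss := by
  unfold withDeletion
  rw [mainIndices_append, mainIndices_congr (by simp) (Grows.modify fun t' ht' => ?_)]
  · simp [Session.isMain, hu]
  · obtain rfl : t = t' := some_unique ht ht'
    exact ⟨evolves_withDeletion hd _, le_rfl⟩

theorem Consistent.withDeletion {ss : List Session} {zr zr' : List Ref}
    {zc zc' : List Protocol} (h : Consistent D ss zr zc) {i : ℕ} {t u : Session}
    (ht : ss[i]? = some t) (hd : t.deletion = none) (ho : u.owner = t.owner)
    (hp : u.protocol = .deletion) (hu : u.deletion = none)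
    (hc : u.owner = .requester → u.client.1 = D.client u.protocol ∧
      Reachable u.client.1 u.client.2) (hz : (t.owner = .requester ∧ zr' = zr ∧ zc' = zc) ∨
      (t.owner = .environment ∧ zr' = zr ++ [.deletionOf i] ∧ zc' = zc ++ [.deletion])) :
    Consistent D (withDeletion ss i u) zr' zc' := by
  refine h.extend (Grows.withDeletion ht hd u) (fun j v h1 h2 => ?_) (fun j v v' k h1 h2 h3 => ?_)
    ?_
  · rcases getElem?_withDeletion h1 with ⟨rfl, rfl⟩ | ⟨w, h3, -⟩
    · refine ⟨hc, hu, fun h' => ?_⟩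
      rcases hz with ⟨h4, -⟩ | ⟨-, h4, -⟩
      · grind
      · refine ⟨.deletionOf i, by simp [h4], ?_⟩
        simp [resolveIn, getElem?_withDeletion_self ht]
    grind
  · rcases getElem?_withDeletion h2 with ⟨rfl, rfl⟩ | ⟨w, h4, h5⟩
    · simp at h1
    · obtain rfl : v = w := some_unique h1 h4
      split_ifs at h5 with hij
      · subst hij
        obtain rfl : v = t := some_unique h1 ht
        obtain rfl : ss.length = k := by grind
        exact .inr ⟨u, getElem?_withDeletion_length _ _ _, ho, hp⟩
      grind
  · rcases hz with ⟨-, h1, h2⟩ | ⟨h1, h2, h3⟩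
    · grind
    · exact .inr ⟨_, _, h2, h3, _, getElem?_withDeletion_self ht u, h1, rfl⟩

theorem Consistent.append_ref {ss : List Session} {zr : List Ref}
    {zc : List Protocol} (h : Consistent D ss zr zc) {i : ℕ} {t : Session}
    (ht : ss[i]? = some t) (ho : t.owner = .environment) :
    Consistent D ss (zr ++ [.deletionOf i]) (zc ++ [.deletion]) := by
  refine h.extend (Grows.refl _) (fun j v h1 h2 => ?_) (fun j v v' k h1 h2 h3 => .inl ?_)
    (.inr ⟨_, _, rfl, rfl, t, ht, ho, rfl⟩)
  · grind
  grind

/-- A session that has just been initiated. -/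
def Session.fresh (D : DataCollector) (sec : ℕ) (p : Protocol) (w : Owner) (C : ITM PartyAct)
    (msg sid : Str) : Session where
  protocol := p
  owner := w
  sid := sid
  client := ⟨C, ITI.create C (false :: sid) (unary sec ++ written msg)⟩
  server := ⟨D.server p, ITI.create (D.server p) (true :: sid) (unary sec)⟩
  transcript := []
  deletion := none

/-- The number of sessions of `π` of the requester the deletion of which has been initiated. -/
def deletedCount (ss : List Session) : ℕ :=
  ss.countP fun t => t.isMain && t.deletion.isSome

theorem deletedCount_mono {ss ss' : List Session} (h : Grows ss ss') :
    deletedCount ss ≤ deletedCount ss' := by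
  refine countP_le_of_getElem? fun i t ht => ?_
  obtain ⟨t', h1, h2, -⟩ := h i t ht
  refine ⟨t', h1, fun h3 => ?_⟩
  rw [Bool.and_eq_true, Option.isSome_iff_exists] at h3
  obtain ⟨h3, j, h4⟩ := h3
  simp [h2.isMain, h3, h2.deletion j h4]

theorem deletedCount_le (ss : List Session) : deletedCount ss ≤ (mainIndices ss).length := by
  rw [length_mainIndices]
  exact List.countP_mono_left fun t _ h => (Bool.and_eq_true_iff.1 h).1

theorem deletedCount_withDeletion {ss : List Session} {i : ℕ} {t : Session}
    (ht : ss[i]? = some t) (hm : t.isMain = true) (hd : t.deletion = none) (u : Session) :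
    deletedCount ss < deletedCount (withDeletion ss i u) := by
  refine countP_lt_of_getElem? (fun j v hv => ?_) (getElem?_withDeletion_self ht u)
    (by simpa [Session.isMain] using hm) fun v hv => ?_
  · obtain ⟨v', h1, h2, -⟩ := Grows.withDeletion ht hd u j v hv
    refine ⟨v', h1, fun h3 => ?_⟩
    rw [Bool.and_eq_true, Option.isSome_iff_exists] at h3
    obtain ⟨h3, k, h4⟩ := h3
    simp [h2.isMain, h3, h2.deletion k h4]
  grind

theorem DataCollector.tokenOf_eq_some {t : Session} {tok : Str}
    (h : D.tokenOf t = some tok) : t.protocol = .main ∧ t.clientHalted = true := by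
  unfold DataCollector.tokenOf at h
  grind

namespace Sys

/-- Add a new session of `p` and activate its client. -/
def addSession (S : Sys D E R) (p : Protocol) (u : Session) : Sys D E R :=
  { S with
    x := { S.x with control := S.x.control ++ [p] }
    sessions := S.sessions ++ [u]
    active := .client S.sessions.length }

/-- Add a new session, which deletes session `i`, and activate its client. -/
def addDeletion (S : Sys D E R) (i : ℕ) (u : Session) : Sys D E R :=
  { S with
    x := { S.x with control := S.x.control ++ [.deletion] }
    sessions := withDeletion S.sessions i u
    active := .client S.sessions.length }

theorem initiate_eq (rule : SidRule) (sec : ℕ) (S : Sys D E R) (p : Protocol) (w : Owner)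
    (C : ITM PartyAct) (msg : Str) :
    S.initiate rule sec p w C msg = (rule sec (S.sessions.map Session.sid)).map fun sid =>
      S.addSession p (.fresh D sec p w C msg sid) := rfl

/-- Recording the link to the deletion leaves the list of identifiers unchanged, so that a deletion
is the drawing of an identifier followed by a deterministic update. -/
theorem requestDeletion_eq (rule : SidRule) (sec : ℕ) {S : Sys D E R} {i : ℕ} {t : Session}
    {tok : Str} (C : ITM PartyAct) (h1 : S.sessions[i]? = some t) (h2 : D.tokenOf t = some tok)
    (h3 : t.deletion = none) :
    S.requestDeletion rule sec i C = (rule sec (S.sessions.map Session.sid)).map fun sid =>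
      S.addDeletion i (.fresh D sec .deletion t.owner C tok sid) := by
  unfold requestDeletion
  simp only [h1, h2, h3]
  rw [initiate_eq]
  have : (S.sessions.modify i fun t => { t with deletion := some S.sessions.length }).map
      Session.sid = S.sessions.map Session.sid := by
    apply List.ext_getElem?
    grind
  simp only [this, addSession, addDeletion, withDeletion, List.length_modify]

theorem requestDeletion_eq_idle (rule : SidRule) (sec : ℕ) {S : Sys D E R} {i : ℕ}
    (C : ITM PartyAct) (h : ∀ t, S.sessions[i]? = some t → D.tokenOf t = none ∨ t.deletion ≠ none) :
    S.requestDeletion rule sec i C = PMF.pure S.idle := by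
  unfold requestDeletion
  grind

theorem requestDeletion_cases (S : Sys D E R) (i : ℕ) :
    (∃ t tok, S.sessions[i]? = some t ∧ D.tokenOf t = some tok ∧ t.deletion = none) ∨
      ∀ t, S.sessions[i]? = some t → D.tokenOf t = none ∨ t.deletion ≠ none := by
  by_contra h
  push Not at h
  obtain ⟨h1, t, h2, h3, h4⟩ := h
  obtain ⟨tok, h3⟩ := Option.ne_none_iff_exists'.1 h3
  grind

/-- The first session of `π` of the requester with the given property. -/
def firstMain (ss : List Session) (P : Session → Bool) : Option ℕ :=
  (mainIndices ss).find? fun i => (ss[i]?).any P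

/-- The deletion of a session if its client has not halted. -/
def pendingDeletion (ss : List Session) (t : Session) : Option ℕ :=
  t.deletion.filter fun j => ((ss[j]?).map fun u => !u.clientHalted).getD false

/-- Searching all sessions with a built-in test for ownership is searching `mainIndices`. The
position in that list, the ordinal of the session, is the name under which an environment that
emulates the requester knows it. -/
theorem schedule_eq (rule : SidRule) (sec : ℕ) (S : Sys D E R) :
    S.schedule rule sec =
      match firstMain S.sessions fun t => !t.clientHalted with
      | some i => PMF.pure { S with active := .client i }
      | none =>
        match firstMain S.sessions fun t => (D.tokenOf t).isSome && t.deletion.isNone with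
        | some i => requestDeletion rule sec S i (D.client .deletion)
        | none =>
          match firstMain S.sessions fun t => (pendingDeletion S.sessions t).isSome with
          | some i =>
            match (S.sessions[i]?).bind (pendingDeletion S.sessions) with
            | some j => PMF.pure { S with active := .client j }
            | none => PMF.pure { S with active := .done }
          | none => PMF.pure { S with active := .done } := by
  have key : ∀ P : Session → Bool, ((List.range S.sessions.length).find? fun i =>
      match S.sessions[i]? with
      | some t => decide (t.protocol = .main) && decide (t.owner = .requester) && P t
      | none => false) = firstMain S.sessions P := by
    intro P
    unfold firstMain mainIndices
    rw [List.find?_filter]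
    congr 1
    funext i
    cases h : S.sessions[i]? <;> simp [Session.isMain]
  simp only [← key]
  rfl

theorem firstMain_eq_some {ss : List Session} {P : Session → Bool} {i : ℕ}
    (h : firstMain ss P = some i) :
    ∃ t, ss[i]? = some t ∧ t.isMain = true ∧ P t = true := by
  have h1 := List.find?_some h
  obtain ⟨t, h2, h3⟩ := mem_mainIndices.1 (List.mem_of_find?_eq_some h)
  grind

theorem firstMain_eq_none {ss : List Session} {P : Session → Bool} :
    firstMain ss P = none ↔ ∀ (i : ℕ) (t : Session), ss[i]? = some t → t.isMain = true →
      P t = false := by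
  unfold firstMain
  rw [List.find?_eq_none]
  constructor
  · intro h i t h1 h2
    simpa [h1] using h i (mem_mainIndices.2 ⟨t, h1, h2⟩)
  · intro h i hi
    obtain ⟨t, h1, h2⟩ := mem_mainIndices.1 hi
    grind

theorem resolve_eq (S : Sys D E R) (r : Ref) : S.resolve r = resolveIn S.sessions r := by
  cases r <;> rfl

@[simp] theorem idle_sessions (S : Sys D E R) : S.idle.sessions = S.sessions := by
  unfold idle; split <;> rfl
@[simp] theorem idle_zRefs (S : Sys D E R) : S.idle.zRefs = S.zRefs := by
  unfold idle; split <;> rfl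
@[simp] theorem idle_yRefs (S : Sys D E R) : S.idle.yRefs = S.yRefs := by
  unfold idle; split <;> rfl
@[simp] theorem idle_x (S : Sys D E R) : S.idle.x = S.x := by
  unfold idle; split <;> rfl
@[simp] theorem idle_y (S : Sys D E R) : S.idle.y = S.y := by
  unfold idle; split <;> rfl
@[simp] theorem idle_alive (S : Sys D E R) : S.idle.alive = S.alive := by
  unfold idle; split <;> rfl
@[simp] theorem idle_z_control (S : Sys D E R) : S.idle.z.control = S.z.control := by
  unfold idle; split <;> rfl

/-- What a step of the execution without activity of the requester does to the sessions and the
requester. -/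
structure Moves (S S' : Sys D E R) : Prop where
  grows : Grows S.sessions S'.sessions
  consistent : Consistent D S'.sessions S'.zRefs S'.z.control
  mains : mainIndices S'.sessions = mainIndices S.sessions
  y : ∃ inc c, S'.y = { S.y with incoming := S.y.incoming ++ inc, caller := c }
  calm : Calm S.sessions S'.sessions ∨ deletedCount S.sessions < deletedCount S'.sessions
  yRefs : S'.yRefs = S.yRefs

theorem Moves.congr {S S' S'' : Sys D E R} (h : Moves S S') (h1 : S''.sessions = S'.sessions)
    (h2 : S''.zRefs = S'.zRefs) (h3 : S''.z.control = S'.z.control)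
    (h4 : ∃ inc c, S''.y = { S'.y with incoming := S'.y.incoming ++ inc, caller := c })
    (h5 : S''.yRefs = S'.yRefs) : Moves S S'' := by
  obtain ⟨a, b, c, ⟨inc, ca, d⟩, e, f⟩ := h
  obtain ⟨inc', ca', h4⟩ := h4
  exact ⟨h1 ▸ a, by grind, h1 ▸ c, ⟨inc ++ inc', ca', by simp [h4, d]⟩, h1 ▸ e, h5.trans f⟩

theorem Moves.refl {S : Sys D E R} (h : Consistent D S.sessions S.zRefs S.z.control) :
    Moves S S :=
  ⟨.refl _, h, rfl, ⟨[], S.y.caller, by simp⟩, .inl (.refl _), rfl⟩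

theorem Moves.idle {S S' : Sys D E R} (h : Moves S S') : Moves S S'.idle :=
  h.congr (by simp) (by simp) (by simp) ⟨[], S'.y.caller, by simp⟩ (by simp)

theorem Moves.notifyOwner {S S' : Sys D E R} (h : Moves S S') (i : ℕ) (w : Owner) :
    Moves S (S'.notifyOwner i w) := by
  unfold Sys.notifyOwner
  cases w with
  | environment => exact h.congr rfl rfl rfl ⟨[], S'.y.caller, by simp⟩ rfl
  | requester =>
    split_ifs
    · exact h.congr rfl rfl rfl ⟨[], _, by simp; rfl⟩ rfl
    · exact h.idle

theorem Moves.finish {S S' : Sys D E R} (h : Moves S S') (e : Event) :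
    Moves S (S'.finish e) := by
  cases e with
  | cont => exact h
  | idle => exact h.idle
  | output i =>
    unfold Sys.finish
    dsimp only
    split
    · exact h
    · exact h.notifyOwner _ _

theorem Moves.modify {S S' : Sys D E R} (hc : Consistent D S.sessions S.zRefs S.z.control)
    {i : ℕ} {f : Session → Session}
    (hf : ∀ t, S.sessions[i]? = some t → t.Evolves (f t) ∧ t.input.length ≤ (f t).input.length ∧
      (f t).deletion = t.deletion ∧ (t.owner = .requester → (f t).input = t.input))
    (h1 : S'.sessions = S.sessions.modify i f) (h2 : S'.zRefs = S.zRefs)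
    (h3 : S'.z.control = S.z.control)
    (h4 : ∃ inc c, S'.y = { S.y with incoming := S.y.incoming ++ inc, caller := c })
    (h5 : S'.yRefs = S.yRefs) : Moves S S' := by
  have hg : Grows S.sessions (S.sessions.modify i f) :=
    Grows.modify fun t ht => ⟨(hf t ht).1, (hf t ht).2.1⟩
  refine ⟨h1 ▸ hg, ?_, ?_, h4, .inl ?_, h5⟩
  · rw [h1, h2, h3]
    exact hc.modify fun t ht => ⟨(hf t ht).1, (hf t ht).2.1, (hf t ht).2.2.1⟩
  · rw [h1]; exact mainIndices_congr (by simp) hg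
  · rw [h1]
    exact Calm.modify fun t ht ho => (hf t ht).2.2.2 ((hf t ht).1.owner ▸ ho)

theorem Moves.core {S : Sys D E R} (hc : Consistent D S.sessions S.zRefs S.z.control) (b : Bool) :
    Moves S (S.applyUpd (S.upd b)) := by
  refine Moves.finish (S' := S.core _ (S.sessions.modify _ _) _)
    (Moves.modify hc (fun t ht => ?_) rfl rfl rfl ⟨[], S.y.caller, ?_⟩ rfl) _
  · have := S.upd_quiet b ht
    exact ⟨this.evolves, by rw [this.input], this.deletion, fun _ => this.input⟩
  · simp [Sys.core]

/-- The deletion of a session is initiated by the scheduler. -/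
theorem Moves.addDeletion {S S₀ : Sys D E R} (hs : S.sessions = S₀.sessions)
    (hy : S.y = S₀.y) (hr : S.yRefs = S₀.yRefs) {sec i : ℕ} {t : Session} {tok sid : Str} {C : ITM PartyAct}
    (hc : Consistent D S₀.sessions S₀.zRefs S₀.z.control)
    (h1 : S₀.sessions[i]? = some t) (h2 : D.tokenOf t = some tok) (h3 : t.deletion = none)
    (hz : (t.owner = .requester ∧ C = D.client .deletion ∧ S.zRefs = S₀.zRefs ∧
        S.z.control = S₀.z.control) ∨
      (t.owner = .environment ∧ S.zRefs = S₀.zRefs ++ [.deletionOf i] ∧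
        S.z.control = S₀.z.control ++ [.deletion])) :
    Moves S₀ (S.addDeletion i (.fresh D sec .deletion t.owner C tok sid)) := by
  refine ⟨?_, ?_, ?_, ⟨[], S.y.caller, by simp [Sys.addDeletion, hy]⟩, ?_, hr⟩
  · unfold Sys.addDeletion
    rw [hs]
    exact Grows.withDeletion h1 h3 _
  · unfold Sys.addDeletion
    rw [hs]
    refine hc.withDeletion h1 h3 rfl rfl rfl (fun ho => ?_) ?_
    · rcases hz with ⟨-, h4, -⟩ | ⟨h4, -⟩
      · subst h4
        exact ⟨rfl, Reachable.create _ _⟩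
      · simp [Session.fresh, h4] at ho
    grind
  · unfold Sys.addDeletion
    rw [hs]
    exact mainIndices_withDeletion h1 h3 rfl
  · unfold Sys.addDeletion
    rw [hs]
    rcases hz with ⟨h4, -⟩ | ⟨h4, -⟩
    · exact .inr (deletedCount_withDeletion h1
        (by simp [Session.isMain, h4, (D.tokenOf_eq_some h2).1]) h3 _)
    · have hn : (Session.fresh D sec .deletion t.owner C tok sid).owner ≠ .requester := by
        simp [Session.fresh, h4]
      exact .inl (Calm.trans (Calm.modify (f := fun t => { t with deletion := some _ })
        fun t' ht' ho => rfl) (Calm.append hn) (.append _ _))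

end Sys

theorem Consistent.target {ss : List Session} {zr : List Ref}
    {zc : List Protocol} (h : Consistent D ss zr zc) {k : ℕ} {r : Ref} {j : ℕ}
    (hr : zr[k]? = some r) (hj : resolveIn ss r = some j) :
    ∃ t, ss[j]? = some t ∧ t.owner = .environment := by
  cases r with
  | session i =>
    obtain ⟨t, h1, h2, -⟩ := h.session k i hr
    obtain rfl : i = j := by simpa [resolveIn] using hj
    grind
  | deletionOf i =>
    obtain ⟨t, h1, h2, -⟩ := h.deletionOf k i hr
    simp [resolveIn, h1] at hj
    obtain ⟨u, h3, h4, -⟩ := h.deletion i t j h1 hj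
    grind

namespace Sys

theorem writeClient_some (S : Sys D E R) (j : ℕ) (msg : Str) :
    S.writeClient (some j) msg =
      { S with sessions := S.sessions.modify j (Session.clientInput msg), active := .client j } :=
  rfl

theorem zTarget_eq_some {S : Sys D E R} {j : ℕ} (h : S.zTarget = some j) :
    ∃ r, S.zRefs[S.z.controlHead]? = some r ∧ resolveIn S.sessions r = some j := by
  unfold zTarget at h
  rw [Option.bind_eq_some_iff] at h
  aesop

theorem mainSession_eq_some {S : Sys D E R} {r : Option Ref} {j : ℕ}
    (h : S.mainSession r = some j) :
    r = some (.session j) ∧ ∃ t, S.sessions[j]? = some t ∧ t.protocol = .main := by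
  unfold mainSession at h
  grind

theorem Moves.zAct {rule : SidRule} {sec : ℕ} {S : Sys D E R}
    (hc : Consistent D S.sessions S.zRefs S.z.control) (msg : Str) (a : EnvAct E.m)
    {S' : Sys D E R} (h : S' ∈ (S.zAct rule sec msg a).support) : Moves S S' := by
  cases a with
  | toRequester =>
    obtain rfl := mem_pure.1 h
    exact (Moves.refl hc).congr rfl rfl rfl ⟨written msg, none, rfl⟩ rfl
  | toCollector =>
    obtain rfl := mem_pure.1 h
    exact (Moves.refl hc).congr rfl rfl rfl ⟨[], S.y.caller, by simp⟩ rfl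
  | input =>
    obtain rfl := mem_pure.1 h
    cases ht : S.zTarget with
    | none => exact (Moves.refl hc).idle
    | some j =>
      obtain ⟨r, h1, h2⟩ := zTarget_eq_some ht
      -- The control tape of the environment leads only to sessions of its own, so its writing never
      -- lengthens the input of a client of the requester.
      obtain ⟨t, h3, h4⟩ := hc.target h1 h2
      rw [writeClient_some]
      refine Moves.modify hc (fun t' ht' => ?_) rfl rfl rfl ⟨[], S.y.caller, by simp⟩ rfl
      obtain rfl : t = t' := some_unique h3 ht'
      exact ⟨Session.evolves_clientInput _ _,
        by simp [Session.input, Session.clientInput, Session.mapClient], rfl,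
        fun ho => by grind⟩
  | initiate p i =>
    simp only [Sys.zAct, initiate_eq, PMF.mem_support_map_iff] at h
    obtain ⟨sid, -, rfl⟩ := h
    refine ⟨.append _ _, hc.append_environment rfl rfl, ?_, ⟨[], S.y.caller, by simp [addSession]⟩,
      .inl (Calm.append (by simp [Session.fresh])), rfl⟩
    simp [addSession, mainIndices_append, Session.isMain, Session.fresh]
  | delete i =>
    simp only [Sys.zAct] at h
    split at h
    · obtain rfl := mem_pure.1 h
      exact (Moves.refl hc).idle
    · next j hj =>
      obtain ⟨h1, -⟩ := mainSession_eq_some hj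
      obtain ⟨t, h2, h3, -⟩ := hc.session _ _ h1
      set S₁ : Sys D E R := { S with
        z := { S.z with control := S.z.control ++ [.deletion] }
        zRefs := S.zRefs ++ [.deletionOf j] } with hS₁
      rcases S₁.requestDeletion_cases j with ⟨t', tok, h4, h5, h6⟩ | h4
      · obtain rfl : t = t' := some_unique h2 h4
        rw [requestDeletion_eq rule sec _ h4 h5 h6, PMF.mem_support_map_iff] at h
        obtain ⟨sid, -, rfl⟩ := h
        exact Moves.addDeletion (S := S₁) (S₀ := S) rfl rfl rfl hc h2 h5 h6 (.inr ⟨h3, rfl, rfl⟩)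
      · rw [requestDeletion_eq_idle rule sec _ h4, mem_pure] at h
        subst h
        refine Moves.idle ⟨.refl _, ?_, rfl, ⟨[], S.y.caller, by simp [hS₁]⟩, .inl (.refl _), rfl⟩
        exact hc.append_ref h2 h3
  | output =>
    obtain rfl := mem_pure.1 h
    exact Moves.idle ((Moves.refl hc).congr rfl rfl rfl ⟨[], S.y.caller, by simp⟩ rfl)
  | endAlive =>
    obtain rfl := mem_pure.1 h
    exact (Moves.refl hc).congr rfl rfl rfl ⟨[], S.y.caller, by simp⟩ rfl

theorem step_environment_halted (rule : SidRule) (sec : ℕ) {S : Sys D E R}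
    (ha : S.active = .environment) (h : S.z.halted = true) :
    S.step rule sec = PMF.pure { S with alive := false, active := .scheduler } := by
  unfold step
  grind

/-- The effect of a step of the environment with a given signal. -/
def zNext (rule : SidRule) (sec : ℕ) (S : Sys D E R) :
    Option (Option (EnvAct E.m × Str)) → PMF (Sys D E R)
  | none => PMF.pure S
  | some none => PMF.pure S.idle
  | some (some (a, msg)) => S.zAct rule sec msg a

/-- The symbol that the environment sees on the output tape of a client. -/
def zPeer (S : Sys D E R) : Option Sym :=
  S.clientOutput S.zTarget (S.z.peerHead S.z.controlHead)

theorem step_environment (rule : SidRule) (sec : ℕ) {S : Sys D E R}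
    (ha : S.active = .environment) (h : S.z.halted = false) :
    S.step rule sec = coin.bind fun b =>
      { S with z := (S.z.step S.zPeer b).1 }.zNext rule sec (S.z.step S.zPeer b).2 := by
  unfold step
  simp [ha, h]
  rfl

theorem step_scheduler (rule : SidRule) (sec : ℕ) {S : Sys D E R}
    (ha : S.active = .scheduler) : S.step rule sec = S.schedule rule sec := by
  unfold step
  grind

theorem step_done (rule : SidRule) (sec : ℕ) {S : Sys D E R}
    (ha : S.active = .done) : S.step rule sec = PMF.pure S := by
  unfold step
  grind

theorem step_requester_halted (rule : SidRule) (sec : ℕ) {S : Sys D E R}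
    (ha : S.active = .requester) (h : S.y.halted = true) :
    S.step rule sec = PMF.pure S.idle := by
  unfold step
  grind

/-- The effect of a step of the requester with a given signal. -/
def yNext (rule : SidRule) (sec : ℕ) (S : Sys D E R) :
    Option (Option (RequesterAct × Str)) → PMF (Sys D E R)
  | none => PMF.pure S
  | some none => PMF.pure S.idle
  | some (some (a, msg)) => S.yAct rule sec msg a

/-- The symbol that the requester sees on the output tape of a client. -/
def yPeer (S : Sys D E R) : Option Sym :=
  S.clientOutput S.yTarget (S.y.peerHead S.y.controlHead)

theorem step_requester (rule : SidRule) (sec : ℕ) {S : Sys D E R}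
    (ha : S.active = .requester) (h : S.y.halted = false) :
    S.step rule sec = coin.bind fun b =>
      { S with y := (S.y.step S.yPeer b).1 }.yNext rule sec (S.y.step S.yPeer b).2 := by
  unfold step
  simp [ha, h]
  rfl

theorem Moves.schedule {rule : SidRule} {sec : ℕ} {S : Sys D E R}
    (hc : Consistent D S.sessions S.zRefs S.z.control)
    {S' : Sys D E R} (h : S' ∈ (S.schedule rule sec).support) : Moves S S' := by
  have hact : ∀ a, S' = { S with active := a } → Moves S S' := by
    rintro a rfl
    exact (Moves.refl hc).congr rfl rfl rfl ⟨[], S.y.caller, by simp⟩ rfl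
  rw [schedule_eq] at h
  split at h
  · simp_all
  · split at h
    · next i hi =>
      obtain ⟨t, h1, h2, h3⟩ := firstMain_eq_some hi
      rw [Bool.and_eq_true, Option.isSome_iff_exists, Option.isNone_iff_eq_none] at h3
      obtain ⟨⟨tok, h3⟩, h4⟩ := h3
      rw [requestDeletion_eq rule sec _ h1 h3 h4, PMF.mem_support_map_iff] at h
      obtain ⟨sid, -, rfl⟩ := h
      simp [Session.isMain] at h2
      exact Moves.addDeletion rfl rfl rfl hc h1 h3 h4 (.inl ⟨h2.2, rfl, rfl, rfl⟩)
    · split at h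
      · split at h <;> simp at h <;>
          grind
      simp_all

/-- Besides the requester itself, only the procedure of the terminate phase can create a session of
the requester, namely a deletion, and each time one more session counts as deleted. The alternative
in `calm` records this; the tightness estimate rests on it. -/
theorem Moves.step {rule : SidRule} {sec : ℕ} {S : Sys D E R}
    (hc : Consistent D S.sessions S.zRefs S.z.control) (ha : S.active ≠ .requester)
    {S' : Sys D E R} (h : S' ∈ (S.step rule sec).support) : Moves S S' := by
  have hcore : S.active.IsCore → Moves S S' := by
    intro hco
    rw [step_core rule sec S hco, PMF.mem_support_map_iff] at h
    obtain ⟨b, -, rfl⟩ := h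
    exact Moves.core hc b
  cases hact : S.active with
  | requester => grind
  | collector => exact hcore (by rw [hact]; trivial)
  | client i => exact hcore (by rw [hact]; trivial)
  | server i => exact hcore (by rw [hact]; trivial)
  | scheduler => exact Moves.schedule hc (step_scheduler rule sec hact ▸ h)
  | done =>
    rw [step_done rule sec hact, mem_pure] at h
    subst h
    exact Moves.refl hc
  | environment =>
    cases hh : S.z.halted with
    | true =>
      rw [step_environment_halted rule sec hact hh, mem_pure] at h
      subst h
      exact (Moves.refl hc).congr rfl rfl rfl ⟨[], S.y.caller, by simp⟩ rfl
    | false =>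
      rw [step_environment rule sec hact hh, PMF.mem_support_bind_iff] at h
      obtain ⟨b, -, h⟩ := h
      have h1 : Moves S { S with z := (S.z.step S.zPeer b).1 } :=
        (Moves.refl hc).congr rfl rfl rfl ⟨[], S.y.caller, by simp⟩ rfl
      revert h
      rcases (S.z.step S.zPeer b).2 with _ | _ | ⟨a, msg⟩ <;> intro h
      · simp [zNext] at h
        grind
      · simp [zNext] at h
        exact h ▸ h1.idle
      · have h2 := Moves.zAct (S := { S with z := (S.z.step S.zPeer b).1 }) h1.consistent msg a h
        exact ⟨h2.grows, h2.consistent, h2.mains, h2.y, h2.calm, h2.yRefs⟩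

end Sys

/-! ## The execution with the first sessions of the requester only -/

/-- A configuration of the execution in which only the first sessions of `π` that the requester
initiates come into being. `entries` tells for each entry of the control tape of the requester
which of its sessions it refers to (and whether to the deletion of that session), `indices` are the
indices of the sessions that have come into being, and `count` is the number of all of them. -/
structure Ghost (D : DataCollector) (E : Environment) (R : Requester) where
  sys : Sys D E R
  entries : List (Bool × ℕ)
  indices : List ℕ
  count : ℕ

namespace Ghost

/-- The session that an entry refers to. -/
def target (g : Ghost D E R) (e : Bool × ℕ) : Option ℕ :=
  (g.indices[e.2]?).bind fun j =>
    if e.1 then (g.sys.sessions[j]?).bind Session.deletion else some j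

/-- External actions of the requester, when `lim` of its sessions come into being. -/
def act (lim : ℕ) (rule : SidRule) (sec : ℕ) (g : Ghost D E R) (msg : Str) :
    RequesterAct → PMF (Ghost D E R)
  | .input => PMF.pure { g with
      sys := g.sys.writeClient ((g.entries[g.sys.y.controlHead]?).bind g.target) msg }
  | .initiate =>
    let S : Sys D E R := { g.sys with
      y := { g.sys.y with control := g.sys.y.control ++ [.main] }
      yRefs := g.sys.yRefs ++ [.session g.sys.sessions.length] }
    if g.count < lim then
      (S.initiate rule sec .main .requester (D.client .main) msg).map fun S' =>
        { sys := S'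
          entries := g.entries ++ [(false, g.count)]
          indices := g.indices ++ [g.sys.sessions.length]
          count := g.count + 1 }
    else PMF.pure
      { sys := S.idle
        entries := g.entries ++ [(false, g.count)]
        indices := g.indices
        count := g.count + 1 }
  | .delete =>
    match g.entries[g.sys.y.controlHead]? with
    | some (false, q) =>
      match g.indices[q]? with
      | some j =>
        ({ g.sys with
          y := { g.sys.y with control := g.sys.y.control ++ [Protocol.deletion] }
          yRefs := g.sys.yRefs ++ [Ref.deletionOf j] }.requestDeletion rule sec j
            (D.client .deletion)).map fun S' =>
          { g with sys := S', entries := g.entries ++ [(true, q)] }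
      | none => PMF.pure { g with
          sys := { g.sys with
            y := { g.sys.y with control := g.sys.y.control ++ [Protocol.deletion] } }.idle
          entries := g.entries ++ [(true, q)] }
    | _ => PMF.pure { g with sys := g.sys.idle }

/-- Replace the requester. -/
def withY (g : Ghost D E R) (y : ITI R.Y) : Ghost D E R := { g with sys := { g.sys with y := y } }

/-- The effect of a step of the requester with a given signal. -/
def next (lim : ℕ) (rule : SidRule) (sec : ℕ) (g : Ghost D E R) :
    Option (Option (RequesterAct × Str)) → PMF (Ghost D E R)
  | none => PMF.pure g
  | some none => PMF.pure { g with sys := g.sys.idle }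
  | some (some (a, msg)) => g.act lim rule sec msg a

/-- One step of the execution. -/
def step (lim : ℕ) (rule : SidRule) (sec : ℕ) (g : Ghost D E R) : PMF (Ghost D E R) :=
  if g.sys.active = .requester then
    if g.sys.y.halted then PMF.pure { g with sys := g.sys.idle }
    else Sys.coin.bind fun b =>
      (g.withY (g.sys.y.step none b).1).next lim rule sec (g.sys.y.step none b).2
  else (g.sys.step rule sec).map fun S => { g with sys := S }

def initial (D : DataCollector) (E : Environment) (R : Requester) (sec : ℕ) : Ghost D E R where
  sys := Sys.initial D E R sec
  entries := []
  indices := []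
  count := 0

/-- The invariants of the execution. -/
structure Inv (lim sec : ℕ) (g : Ghost D E R) : Prop where
  consistent : Consistent D g.sys.sessions g.sys.zRefs g.sys.z.control
  indices : g.indices = mainIndices g.sys.sessions
  length : g.indices.length = min g.count lim
  entries : ∀ e ∈ g.entries, e.2 < g.count
  reachable : Reachable R.Y g.sys.y
  input : g.sys.y.input = unary sec

/-- A measure for the activity of the requester. -/
def activity (g : Ghost D E R) : ℕ :=
  g.sys.y.randomness.length + (mainIndices g.sys.sessions).length + deletedCount g.sys.sessions

/-- What a step does to the sessions. -/
structure Progress (g g' : Ghost D E R) : Prop where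
  grows : Grows g.sys.sessions g'.sys.sessions
  activity_le : g.activity ≤ g'.activity
  calm : Calm g.sys.sessions g'.sys.sessions ∨ g.activity < g'.activity

theorem inv_initial (lim sec : ℕ) : Inv lim sec (initial D E R sec) := by
  refine ⟨⟨?_, rfl, ?_, ?_, ?_, ?_⟩, rfl, rfl, ?_, Reachable.create _ _, rfl⟩ <;>
    simp [initial, Sys.initial]

/-- A step of the requester lengthens its randomness tape, so the activity increases strictly and
nothing has to be known about inputs. -/
theorem Progress.of_step {g g' : Ghost D E R} (hg : Grows g.sys.sessions g'.sys.sessions)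
    (hy : g.sys.y.randomness.length < g'.sys.y.randomness.length) : Progress g g' := by
  have hm : (mainIndices g.sys.sessions).length ≤ (mainIndices g'.sys.sessions).length := by
    rw [length_mainIndices, length_mainIndices]
    refine countP_le_of_getElem? fun i t ht => ?_
    obtain ⟨t', h1, h2, -⟩ := hg i t ht
    exact ⟨t', h1, fun h3 => by rw [h2.isMain, h3]⟩
  have hd := deletedCount_mono hg
  have : g.activity < g'.activity := by unfold activity; omega
  exact ⟨hg, this.le, .inr this⟩

end Ghost

namespace Ghost

/-- The invariants are preserved when the requester acts. -/
theorem act_inv {lim sec : ℕ} {rule : SidRule} {g : Ghost D E R} (h : g.Inv lim sec) (msg : Str)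
    (a : RequesterAct) {g' : Ghost D E R} (hg : g' ∈ (g.act lim rule sec msg a).support) :
    g'.Inv lim sec ∧ Grows g.sys.sessions g'.sys.sessions ∧
      g'.sys.y.randomness = g.sys.y.randomness := by
  have hy : ∀ p, Reachable R.Y { g.sys.y with control := g.sys.y.control ++ [p] } := fun p => by
    simpa using Reachable.extend g.sys.y [] [] [] [] [p] g.sys.y.caller h.reachable
  cases a with
  | input =>
    obtain rfl := mem_pure.1 hg
    cases ht : (g.entries[g.sys.y.controlHead]?).bind g.target with
    | none =>
      simp only [Sys.writeClient]
      exact ⟨⟨by simpa using h.consistent, by simpa using h.indices, h.length, h.entries,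
        by simpa using h.reachable, by simpa using h.input⟩, by simpa using Grows.refl _, by simp⟩
    | some j =>
      rw [Sys.writeClient_some]
      have hg : Grows g.sys.sessions (g.sys.sessions.modify j (Session.clientInput msg)) :=
        Grows.modify fun t ht => ⟨Session.evolves_clientInput _ _,
          by simp [Session.input, Session.clientInput, Session.mapClient]⟩
      refine ⟨⟨?_, ?_, h.length, h.entries, h.reachable, h.input⟩, hg, rfl⟩
      · exact h.consistent.modify fun t ht => ⟨Session.evolves_clientInput _ _,
          by simp [Session.input, Session.clientInput, Session.mapClient], rfl⟩
      · dsimp only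
        rw [mainIndices_congr (by simp) hg]
        exact h.indices
  | initiate =>
    have hlen := h.length
    have hent : ∀ e ∈ g.entries ++ [(false, g.count)], e.2 < g.count + 1 := by
      intro e he
      rcases List.mem_append.1 he with he | he
      · exact (h.entries e he).trans (Nat.lt_succ_self _)
      grind
    simp only [act] at hg
    split_ifs at hg with hc
    · rw [Sys.initiate_eq] at hg
      simp only [PMF.mem_support_map_iff] at hg
      obtain ⟨S', ⟨sid, -, rfl⟩, rfl⟩ := hg
      refine ⟨⟨?_, ?_, ?_, hent, hy _, h.input⟩, Grows.append _ _, rfl⟩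
      · exact h.consistent.append_requester rfl ⟨rfl, Reachable.create _ _⟩ rfl
      · simp [Sys.addSession, mainIndices_append, h.indices, Session.isMain, Session.fresh]
      grind
    · obtain rfl := mem_pure.1 hg
      refine ⟨⟨by simpa using h.consistent, by simpa using h.indices, ?_, hent,
        by simpa using hy _, by simpa using h.input⟩, by simpa using Grows.refl _, by simp⟩
      grind
  | delete =>
    simp only [act] at hg
    split at hg
    · next q hq =>
      have hent : ∀ e ∈ g.entries ++ [(true, q)], e.2 < g.count := by
        intro e he
        rcases List.mem_append.1 he with he | he
        · exact h.entries e he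
        · obtain rfl := List.mem_singleton.1 he
          exact (h.entries (false, q) (List.mem_of_getElem? hq) : q < g.count)
      split at hg
      · next j hj =>
        simp only [PMF.mem_support_map_iff] at hg
        obtain ⟨S', hS, rfl⟩ := hg
        set S₁ : Sys D E R := { g.sys with
          y := { g.sys.y with control := g.sys.y.control ++ [.deletion] }
          yRefs := g.sys.yRefs ++ [.deletionOf j] } with hS₁
        obtain ⟨t, h1, h2⟩ := mem_mainIndices.1 (h.indices ▸ List.mem_of_getElem? hj)
        rcases S₁.requestDeletion_cases j with ⟨t', tok, h4, h5, h6⟩ | h4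
        · obtain rfl : t = t' := some_unique h1 h4
          simp [Session.isMain] at h2
          rw [Sys.requestDeletion_eq rule sec _ h4 h5 h6, PMF.mem_support_map_iff] at hS
          obtain ⟨sid, -, rfl⟩ := hS
          refine ⟨⟨?_, ?_, h.length, hent, hy _, h.input⟩, Grows.withDeletion h1 h6 _, rfl⟩
          · exact h.consistent.withDeletion h1 h6 rfl rfl rfl
              (fun _ => ⟨rfl, Reachable.create _ _⟩) (.inl ⟨h2.2, rfl, rfl⟩)
          · exact h.indices.trans (mainIndices_withDeletion h1 h6 rfl).symm
        · rw [Sys.requestDeletion_eq_idle rule sec _ h4, mem_pure] at hS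
          subst hS
          exact ⟨⟨by simpa [hS₁] using h.consistent, by simpa [hS₁] using h.indices, h.length, hent,
            by simp_all, by simpa [hS₁] using h.input⟩,
            by simpa [hS₁] using Grows.refl _, by simp [hS₁]⟩
      · obtain rfl := mem_pure.1 hg
        exact ⟨⟨by simpa using h.consistent, by simpa using h.indices, h.length, hent,
          by simpa using hy _, by simpa using h.input⟩, by simpa using Grows.refl _, by simp⟩
    · obtain rfl := mem_pure.1 hg
      exact ⟨⟨by simpa using h.consistent, by simpa using h.indices, h.length, h.entries,
        by simpa using h.reachable, by simpa using h.input⟩, by simpa using Grows.refl _, by simp⟩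

theorem inv_idle {lim sec : ℕ} {g : Ghost D E R} (h : g.Inv lim sec) :
    ({ g with sys := g.sys.idle } : Ghost D E R).Inv lim sec :=
  ⟨by simpa using h.consistent, by simpa using h.indices, h.length, h.entries,
    by simpa using h.reachable, by simpa using h.input⟩

theorem inv_withY {lim sec : ℕ} {g : Ghost D E R} (h : g.Inv lim sec)
    (hh : g.sys.y.halted = false) (b : Bool) : (g.withY (g.sys.y.step none b).1).Inv lim sec :=
  ⟨h.consistent, h.indices, h.length, h.entries, h.reachable.step _ _ _ hh, h.input⟩

/-- Steps preserve the invariants. -/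
theorem step_inv {lim sec : ℕ} {rule : SidRule} {g : Ghost D E R} (h : g.Inv lim sec)
    {g' : Ghost D E R} (hg : g' ∈ (g.step lim rule sec).support) :
    g'.Inv lim sec ∧ Progress g g' := by
  have hidle : Progress g { g with sys := g.sys.idle } :=
    ⟨by simpa using Grows.refl _, by simp [activity], .inl (by simpa using Calm.refl _)⟩
  unfold step at hg
  split_ifs at hg with ha hh
  · obtain rfl := mem_pure.1 hg
    exact ⟨inv_idle h, hidle⟩
  · rw [Bool.not_eq_true] at hh
    rw [PMF.mem_support_bind_iff] at hg
    obtain ⟨b, -, hg⟩ := hg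
    have h1 := inv_withY h hh b
    have key : g'.Inv lim sec ∧ Grows g.sys.sessions g'.sys.sessions ∧
        g'.sys.y.randomness = (g.sys.y.step none b).1.randomness := by
      revert hg
      rcases (g.sys.y.step none b).2 with _ | _ | ⟨a, msg⟩ <;> intro hg
      · obtain rfl := mem_pure.1 hg
        exact ⟨h1, Grows.refl _, rfl⟩
      · obtain rfl := mem_pure.1 hg
        refine ⟨inv_idle h1, ?_, ?_⟩
        · simpa [withY] using Grows.refl _
        · simp [withY]
      · exact act_inv h1 msg a hg
    refine ⟨key.1, .of_step key.2.1 ?_⟩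
    rw [key.2.2]
    simp [ITI.step]
  · rw [PMF.mem_support_map_iff] at hg
    obtain ⟨S, hS, rfl⟩ := hg
    have hm := Sys.Moves.step h.consistent ha hS
    obtain ⟨inc, c, hy⟩ := hm.y
    have hyr : S.y.randomness = g.sys.y.randomness := by rw [hy]
    refine ⟨⟨hm.consistent, h.indices.trans hm.mains.symm, h.length, h.entries, ?_, ?_⟩,
      ⟨hm.grows, ?_, ?_⟩⟩
    · dsimp only
      rw [hy]
      simpa using Reachable.extend g.sys.y [] inc [] [] [] c h.reachable
    · dsimp only
      rw [hy]
      exact h.input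
    · have := deletedCount_mono hm.grows
      unfold activity
      dsimp only
      rw [hm.mains, hyr]
      omega
    · refine hm.calm.imp id fun hd => ?_
      unfold activity
      dsimp only
      rw [hm.mains, hyr]
      omega

/-- Some client of the requester has got a long input. -/
def Long (L : ℕ) (g : Ghost D E R) : Prop :=
  ∃ (i : ℕ) (t : Session), g.sys.sessions[i]? = some t ∧ t.owner = .requester ∧ L < t.input.length

theorem Progress.long {L : ℕ} {g g' : Ghost D E R} (h : Progress g g') (hg : g.Long L) :
    g'.Long L := by
  obtain ⟨i, t, h1, h2, h3⟩ := hg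
  obtain ⟨t', h4, h5, h6⟩ := h.grows i t h1
  exact ⟨i, t', h4, h5.owner.trans h2, h3.trans_le h6⟩

/-- In a calm step the inputs of the requester's clients stay what they were, so a long one was long
before; every other step is counted by the activity. -/
theorem Progress.not_long {L : ℕ} {g g' : Ghost D E R} (h : Progress g g') (hg : g'.Long L) :
    g.Long L ∨ g.activity < g'.activity := by
  rcases h.calm with hc | hc
  · obtain ⟨i, t', h1, h2, h3⟩ := hg
    obtain ⟨t, h4, h5⟩ := hc i t' h1 h2
    obtain ⟨u, h6, h7, -⟩ := h.grows i t h4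
    obtain rfl : t' = u := some_unique h1 h6
    exact .inl ⟨i, t, h4, h7.owner ▸ h2, h5 ▸ h3⟩
  grind

theorem exists_not_long (g : Ghost D E R) : ∃ L, ¬ g.Long L := by
  refine ⟨(g.sys.sessions.map fun t => t.input.length).sum, ?_⟩
  rintro ⟨i, t, h1, -, h3⟩
  have : t.input.length ≤ (g.sys.sessions.map fun t => t.input.length).sum :=
    List.single_le_sum (fun _ _ => Nat.zero_le _) _
      (List.mem_map_of_mem (List.mem_of_getElem? h1))
  omega

theorem Long.mono {L L' : ℕ} (hL : L ≤ L') {g : Ghost D E R} (h : g.Long L') : g.Long L := by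
  obtain ⟨i, t, h1, h2, h3⟩ := h
  exact ⟨i, t, h1, h2, hL.trans_lt h3⟩

/-- Nothing but the security parameter is ever written on the input tape of the requester, so PPT
bounds its steps by a constant. The two remaining summands count sessions and deleted sessions, at
most `lim` each. -/
theorem activity_le {lim sec c : ℕ} {g : Ghost D E R} (h : g.Inv lim sec)
    (hc : ∀ s : ITI R.Y, Reachable R.Y s → s.randomness.length ≤ s.input.length ^ c + c) :
    g.activity ≤ (unary sec).length ^ c + c + 2 * lim := by
  have h1 := hc _ h.reachable
  rw [h.input] at h1
  have h2 := deletedCount_le g.sys.sessions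
  have h3 := h.length
  rw [h.indices] at h3
  unfold activity
  omega

end Ghost

/-! ## Tightness -/

/-- If events `bad L` that decrease to nothing may occur only when a bounded measure increases, then
their probabilities tend to zero uniformly in time. -/
theorem exists_val_indic_le {α : Type*} {step : α → PMF α} {a₀ : α} {P : α → Prop} (h₀ : P a₀)
    (hP : ∀ a, P a → ∀ b ∈ (step a).support, P b) {φ : α → ℕ} {bad : ℕ → α → Prop}
    (hφ : ∀ a, P a → ∀ b ∈ (step a).support, φ a ≤ φ b)
    (hbad : ∀ a, P a → ∀ b ∈ (step a).support, ∀ L, bad L b → bad L a ∨ φ a < φ b)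
    (hpers : ∀ L a, bad L a → ∀ b ∈ (step a).support, bad L b)
    (hmono : ∀ L L', L ≤ L' → ∀ a, bad L' a → bad L a) (hex : ∀ a, ∃ L, ¬ bad L a)
    {B : ℕ} (hB : ∀ a, P a → φ a ≤ B) {δ : ℝ≥0∞} (hδ : δ ≠ 0) :
    ∃ L, value step (indic (bad L)) a₀ ≤ δ := by
  have hinv := iter_invariant h₀ hP
  set e : ℕ → ℝ≥0∞ := fun n => ev (iter step a₀ n) fun a => (φ a : ℝ≥0∞) with he
  have heB : ∀ n, e n ≤ B := fun n => ev_le_const fun a ha => by exact_mod_cast hB a (hinv n a ha)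
  have hfin : ∀ n, e n ≠ ⊤ := fun n => ((heB n).trans_lt (ENNReal.natCast_lt_top B)).ne
  have hsup : (⨆ n, e n) ≠ ⊤ := ((iSup_le heB).trans_lt (ENNReal.natCast_lt_top B)).ne
  have hδ2 : δ / 2 ≠ 0 := by simp_all
  -- The expected measure is bounded, so at some time `N` it is within `δ / 2` of its supremum.
  obtain ⟨N, hN⟩ : ∃ N, ⨆ n, e n ≤ e N + δ / 2 := by
    by_contra hcon
    push Not at hcon
    have h1 : (⨆ n, e n) + δ / 2 ≤ ⨆ n, e n := by
      rw [ENNReal.iSup_add]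
      exact iSup_le fun n => (hcon n).le
    exact hδ2 (by simpa using (ENNReal.add_le_add_iff_left hsup).1 (h1.trans (add_zero _).ge))
  -- Whatever becomes bad in a step gains at least `1` in `φ`. Hence, after time `N`, the
  -- probability of being bad grows by no more than the expected measure, for all `L` alike. The
  -- inequality is written with sums because subtraction in `ℝ≥0∞` is truncated.
  have hstep : ∀ L m, ev (iter step a₀ (N + m)) (indic (bad L)) + e N ≤
      ev (iter step a₀ N) (indic (bad L)) + e (N + m) := by
    intro L m
    induction m with
    | zero => exact le_rfl
    | succ m ih =>
      have h1 : ev (iter step a₀ (N + (m + 1))) (indic (bad L)) + e (N + m) ≤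
          ev (iter step a₀ (N + m)) (indic (bad L)) + e (N + (m + 1)) := by
        simp only [he]
        rw [show N + (m + 1) = N + m + 1 from rfl, iter, ev_bind, ev_bind, ← ev_add, ← ev_add]
        refine ev_mono fun a ha => ?_
        have hPa := hinv (N + m) a ha
        rw [← ev_const (step a) (φ a : ℝ≥0∞), ← ev_const (step a) (indic (bad L) a), ← ev_add,
          ← ev_add]
        refine ev_mono fun b hb => ?_
        have h2 := hφ a hPa b hb
        by_cases hbb : bad L b
        · rcases hbad a hPa b hb L hbb with h3 | h3
          · simp [indic, hbb, h3]
            gcongr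
          · have : (1 : ℝ≥0∞) + φ a ≤ φ b := by exact_mod_cast (by grind)
            simp [indic, hbb]
            exact this.trans le_add_self
        · simp [indic, hbb]
          exact (Nat.cast_le.2 h2).trans le_add_self
      have h3 := add_le_add h1 ih
      have h4 : e (N + m) + ev (iter step a₀ (N + m)) (indic (bad L)) ≠ ⊤ := by
        refine ENNReal.add_ne_top.2 ⟨hfin _, ((ev_le_const (c := 1) fun a _ =>
          indic_le_one _ a).trans_lt ENNReal.one_lt_top).ne⟩
      refine (ENNReal.add_le_add_iff_left h4).1 ?_
      calc _ = ev (iter step a₀ (N + (m + 1))) (indic (bad L)) + e (N + m) +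
            (ev (iter step a₀ (N + m)) (indic (bad L)) + e N) := by ring
        _ ≤ _ := h3
        _ = _ := by ring
  -- At the single time `N` the events decrease to nothing, so one of them has small probability:
  -- monotone convergence for the complements.
  obtain ⟨L, hL⟩ : ∃ L, ev (iter step a₀ N) (indic (bad L)) ≤ δ / 2 := by
    have h1 : (⨆ L, ev (iter step a₀ N) (indic fun a => ¬ bad L a)) = 1 := by
      rw [← ev_iSup]
      · rw [← ev_const (iter step a₀ N) 1]
        refine ev_congr fun a _ => le_antisymm (iSup_le fun L => indic_le_one _ a) ?_
        obtain ⟨L, hL⟩ := hex a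
        exact le_trans (by simp [indic, hL]) (le_iSup _ L)
      · intro L L' hLL a
        by_cases h : bad L a
        · simp [indic, h]
        · have : ¬ bad L' a := fun h' => h (hmono L L' hLL a h')
          simp [indic, h, this]
    have h2 : ∀ L, ev (iter step a₀ N) (indic fun a => ¬ bad L a) +
        ev (iter step a₀ N) (indic (bad L)) = 1 := by
      intro L
      rw [← ev_add, ← ev_const (iter step a₀ N) 1]
      refine ev_congr fun a _ => ?_
      by_cases h : bad L a <;> simp [indic, h]
    by_contra hcon
    push Not at hcon
    have h3 : (1 : ℝ≥0∞) + δ / 2 ≤ 1 := by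
      conv_lhs => rw [← h1]
      rw [ENNReal.iSup_add]
      refine iSup_le fun L => ?_
      rw [← h2 L]
      exact add_le_add_right (hcon L).le _
    exact hδ2 (by simpa using
      (ENNReal.add_le_add_iff_left ENNReal.one_ne_top).1 (h3.trans (add_zero _).ge))
  refine ⟨L, iSup_le fun n => ?_⟩
  -- Bad events persist, so the probability at time `n` is at most that at time `N + n`, to which
  -- the estimate applies.
  have h1 := val_mono (indic_le_ev (stepW := step) (hpers L)) (Nat.le_add_left n N) a₀
  refine h1.trans ?_
  rw [← ev_iter_pay]
  have h2 : e (N + n) ≤ e N + δ / 2 := (le_iSup e (N + n)).trans hN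
  have h3 := (hstep L n).trans (add_le_add hL h2)
  refine (ENNReal.add_le_add_iff_right (hfin N)).1 (h3.trans (le_of_eq ?_))
  rw [add_comm (e N), ← add_assoc, ENNReal.add_halves]

/-- The clients of the requester hardly ever get very long inputs. -/
theorem Ghost.exists_long_le (rule : SidRule) (D : DataCollector) (E : Environment)
    (hR : R.Y.PPT) (lim sec : ℕ) {δ : ℝ≥0∞} (hδ : δ ≠ 0) :
    ∃ L, value (Ghost.step lim rule sec) (indic fun g : Ghost D E R => g.Inv lim sec ∧ g.Long L)
      (Ghost.initial D E R sec) ≤ δ := by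
  obtain ⟨c, hc⟩ := hR
  -- The invariant is made part of the bad event, because the event has to persist from every
  -- configuration, including those that are never reached.
  refine exists_val_indic_le (P := Ghost.Inv lim sec) (φ := Ghost.activity)
    (Ghost.inv_initial lim sec) (fun g hg g' hg' => (Ghost.step_inv hg hg').1)
    (fun g hg g' hg' => (Ghost.step_inv hg hg').2.activity_le)
    (fun g hg g' hg' L hL => ?_) (fun L g hg g' hg' => ?_)
    (fun L L' hL g hg => ⟨hg.1, hg.2.mono hL⟩) (fun g => ?_)
    (fun g hg => Ghost.activity_le hg hc) hδ
  · exact ((Ghost.step_inv hg hg').2.not_long hL.2).imp (fun h => ⟨hg, h⟩) id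
  · have := Ghost.step_inv hg.1 hg'
    exact ⟨this.1, this.2.long hg.2⟩
  · obtain ⟨L, hL⟩ := g.exists_not_long
    grind

/-! ### Success probabilities of distinguishers as limiting payoffs -/

namespace Sys

variable {E E' : Environment} {R R' : Requester}

/-- The probability that the distinguisher outputs 1 if the execution has ended. -/
def pay (A : Distinguisher) (S : Sys D E R) : ℝ≥0∞ :=
  if S.active = .done then A S.outcome true else 0

theorem pay_le_one (A : Distinguisher) (S : Sys D E R) : S.pay A ≤ 1 := by
  unfold pay
  split_ifs
  · exact PMF.coe_le_one _ _
  · exact zero_le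

theorem pay_of_active {A : Distinguisher} {S : Sys D E R} (h : S.active ≠ .done) :
    S.pay A = 0 := if_neg h

theorem pay_le_step (rule : SidRule) (sec : ℕ) (A : Distinguisher) (S : Sys D E R) :
    S.pay A ≤ ev (S.step rule sec) (pay A) := by
  by_cases h : S.active = .done
  · rw [step_done rule sec h, ev_pure]
  · rw [pay_of_active h]
    exact zero_le

theorem val_of_done (rule : SidRule) (sec : ℕ) (A : Distinguisher) {S : Sys D E R}
    (h : S.active = .done) (n : ℕ) : val (step rule sec) (pay A) n S = S.pay A :=
  val_of_absorbing (step_done rule sec h) n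

end Sys

theorem run_eq_iter (rule : SidRule) (D : DataCollector) (E : Environment) (R : Requester)
    (sec n : ℕ) : run rule D E R sec n = iter (Sys.step rule sec) (Sys.initial D E R sec) n := by
  induction n with
  | zero => rfl
  | succ n ih => rw [run, iter, ih]

theorem prob_eq_value (rule : SidRule) (D : DataCollector) (E : Environment) (R : Requester)
    (sec : ℕ) (A : Distinguisher) :
    prob rule D E R sec A =
      value (Sys.step rule sec) (Sys.pay A) (Sys.initial D E R sec) := by
  unfold prob value
  refine iSup_congr fun n => ?_
  rw [← ev_iter_pay, ← run_eq_iter]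
  unfold ev
  rw [PMF.bind_apply]
  refine tsum_congr fun S => ?_
  unfold Sys.pay
  split_ifs <;> simp [PMF.pure_apply]

/-! ## Exchanging the environment and the requester -/

namespace Sys

variable {E E' : Environment} {R R' : Requester}

/-- The same configuration with another environment and another requester. -/
def transport (S : Sys D E R) (z : ITI E'.Z) (y : ITI R'.Y) (yr : List Ref) : Sys D E' R' where
  x := S.x
  z := z
  y := y
  zRefs := S.zRefs
  yRefs := yr
  sessions := S.sessions
  alive := S.alive
  active := S.active

/-- The same with the caller of another instance. -/
def _root_.DeletionCompliance.ITI.calledAs {A B : Type} {M : ITM A} {N : ITM B} (s : ITI M)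
    (t : ITI N) : ITI M := { s with caller := t.caller }

variable {S : Sys D E R} {z : ITI E'.Z} {y : ITI R'.Y} {yr : List Ref}

theorem calledAs_self (h : z.caller = S.z.caller) : z.calledAs S.z = z := by
  unfold ITI.calledAs
  rw [← h]

theorem idle_of_alive (h : S.alive = true) :
    S.idle = { S with z := { S.z with caller := none }, active := .environment } := if_pos h

theorem idle_of_not_alive (h : S.alive ≠ true) : S.idle = { S with active := .scheduler } :=
  if_neg h

theorem transport_idle (h : z.caller = S.z.caller) :
    (S.transport z y yr).idle = S.idle.transport (z.calledAs S.idle.z) y yr := by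
  by_cases ha : S.alive = true
  · rw [idle_of_alive ha, idle_of_alive (S := S.transport z y yr) ha]
    rfl
  · rw [idle_of_not_alive ha, idle_of_not_alive (S := S.transport z y yr) ha]
    simp only [transport]
    rw [show z.calledAs S.z = z from calledAs_self h]

theorem transport_writeClient (h : z.caller = S.z.caller) (i : Option ℕ) (msg : Str) :
    (S.transport z y yr).writeClient i msg =
      (S.writeClient i msg).transport (z.calledAs (S.writeClient i msg).z) y yr := by
  cases i with
  | none => exact transport_idle h
  | some i =>
    unfold writeClient transport ITI.calledAs
    simp only [← h]

theorem initiate_z {rule : SidRule} {sec : ℕ} {p : Protocol} {w : Owner}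
    {C : ITM PartyAct} {msg : Str} {T : Sys D E R} (hT : T ∈ (S.initiate rule sec p w C msg).support) :
    T.z = S.z := by
  rw [initiate_eq, PMF.mem_support_map_iff] at hT
  obtain ⟨sid, -, rfl⟩ := hT
  rfl

theorem transport_requestDeletion (h : z.caller = S.z.caller) (rule : SidRule) (sec i : ℕ)
    (C : ITM PartyAct) : (S.transport z y yr).requestDeletion rule sec i C =
      (S.requestDeletion rule sec i C).map fun T => T.transport (z.calledAs T.z) y yr := by
  rcases S.requestDeletion_cases i with ⟨t, tok, h1, h2, h3⟩ | h1
  · rw [requestDeletion_eq rule sec C h1 h2 h3,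
      requestDeletion_eq (S := S.transport z y yr) rule sec C h1 h2 h3, PMF.map_comp]
    simp only [Function.comp_def, addDeletion, transport]
    rw [show z.calledAs S.z = z from calledAs_self h]
  · rw [requestDeletion_eq_idle rule sec C h1,
      requestDeletion_eq_idle (S := S.transport z y yr) rule sec C h1, PMF.pure_map,
      transport_idle h]

/-- What follows an output of a client is the only consequence of a core step that depends on the
owner, and on whether a requester reacts. It is the same in both executions if the environment owns
the session, or if neither requester reacts. -/
theorem transport_notifyOwner (h : z.caller = S.z.caller) {w : Owner} (i : ℕ)
    (hw : w = .environment ∨ (R.reactive = false ∧ R'.reactive = false)) :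
    (S.transport z y yr).notifyOwner i w =
      (S.notifyOwner i w).transport (z.calledAs (S.notifyOwner i w).z) y yr := by
  cases w with
  | environment =>
    unfold notifyOwner transport ITI.calledAs
    simp only [resolve_eq]
  | requester =>
    obtain ⟨h1, h2⟩ := hw.resolve_left (by simp)
    simp [notifyOwner, h1, h2]
    exact transport_idle h

theorem upd_owner (b : Bool) (t : Session) (i : ℕ) (ht : S.sessions[i]? = some t) :
    ∃ t', (S.sessions.modify (S.upd b).idx (S.upd b).f)[i]? = some t' ∧ t'.owner = t.owner := by
  rw [List.getElem?_modify, ht]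
  by_cases hi : (S.upd b).idx = i
  · subst hi
    exact ⟨(S.upd b).f t, by simp, (S.upd_quiet b ht).evolves.owner⟩
  grind

theorem transport_applyUpd (h : z.caller = S.z.caller) (b : Bool)
    (hw : (R.reactive = false ∧ R'.reactive = false) ∨ ∀ t ∈ S.sessions, t.owner = .environment) :
    (S.transport z y yr).applyUpd (S.upd b) =
      (S.applyUpd (S.upd b)).transport (z.calledAs (S.applyUpd (S.upd b)).z) y yr := by
  have hcore : (S.transport z y yr).core (S.upd b).x (S.sessions.modify (S.upd b).idx (S.upd b).f)
      (S.upd b).active = (S.core (S.upd b).x (S.sessions.modify (S.upd b).idx (S.upd b).f)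
      (S.upd b).active).transport z y yr := rfl
  unfold applyUpd
  rw [show (S.transport z y yr).sessions = S.sessions from rfl, hcore]
  cases (S.upd b).event with
  | cont =>
    simp only [finish, core]
    rw [show z.calledAs S.z = z from calledAs_self h]
  | idle => exact transport_idle h
  | output i =>
    simp only [finish]
    have hs : ∀ (x : ITI D.X) (ss : List Session) (a : Active),
      ((S.core x ss a).transport z y yr).sessions[i]? = (S.core x ss a).sessions[i]? :=
      fun _ _ _ => rfl
    rw [hs]
    split
    · next heq =>
      simp only [core]
      rw [show z.calledAs S.z = z from calledAs_self h]
    · next t ht =>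
      refine transport_notifyOwner (by exact h) i ?_
      refine hw.symm.imp (fun hw => ?_) id
      have hlen := (List.getElem?_eq_some_iff.1 ht).1
      simp only [core, List.length_modify] at hlen
      obtain ⟨t', h1, h2⟩ := upd_owner (S := S) b _ i (List.getElem?_eq_getElem hlen)
      obtain rfl : t = t' := some_unique ht h1
      grind

theorem transport_schedule (h : z.caller = S.z.caller) (rule : SidRule) (sec : ℕ) :
    (S.transport z y yr).schedule rule sec =
      (S.schedule rule sec).map fun T => T.transport (z.calledAs T.z) y yr := by
  have hp : ∀ a, PMF.pure { S.transport z y yr with active := a } =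
      (PMF.pure { S with active := a } : PMF (Sys D E R)).map
        fun T => T.transport (z.calledAs T.z) y yr := by
    intro a
    rw [PMF.pure_map]
    simp only [transport]
    rw [show z.calledAs S.z = z from calledAs_self h]
  rw [schedule_eq, schedule_eq, show (S.transport z y yr).sessions = S.sessions from rfl]
  split
  · exact hp _
  · split
    · exact transport_requestDeletion h _ _ _ _
    · split
      · split <;> exact hp _
      · exact hp _

/-- Steps that are not steps of the environment or of the requester hardly depend on them. -/
theorem transport_step (h : z.caller = S.z.caller) (rule : SidRule) (sec : ℕ)
    (hw : (R.reactive = false ∧ R'.reactive = false) ∨ ∀ t ∈ S.sessions, t.owner = .environment)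
    (h1 : S.active ≠ .environment) (h2 : S.active ≠ .requester) :
    (S.transport z y yr).step rule sec =
      (S.step rule sec).map fun T => T.transport (z.calledAs T.z) y yr := by
  have hcore : S.active.IsCore → (S.transport z y yr).step rule sec =
      (S.step rule sec).map fun T => T.transport (z.calledAs T.z) y yr := by
    intro hc
    rw [step_core rule sec S hc, step_core rule sec (S.transport z y yr) hc, PMF.map_comp]
    congr 1
    funext b
    exact transport_applyUpd h b hw
  cases ha : S.active with
  | environment => grind
  | requester => grind
  | collector => exact hcore (by rw [ha]; trivial)
  | client i => exact hcore (by rw [ha]; trivial)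
  | server i => exact hcore (by rw [ha]; trivial)
  | scheduler =>
    rw [step_scheduler rule sec ha, step_scheduler (S := S.transport z y yr) rule sec ha]
    exact transport_schedule h rule sec
  | done =>
    rw [step_done rule sec ha, step_done (S := S.transport z y yr) rule sec ha, PMF.pure_map,
      calledAs_self h]

end Sys

/-- The environment with another central program. -/
def Environment.withZ (E : Environment) (Z : ITM (EnvAct E.m)) : Environment where
  m := E.m
  Z := Z
  adv := E.adv

/-- The same with caller, control tape and output tape of another instance. -/
def ITI.sync {A B : Type} {M : ITM A} {N : ITM B} (s : ITI M) (t : ITI N) : ITI M :=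
  { s with caller := t.caller, control := t.control, output := t.output }

namespace Sys

variable {R R' : Requester} {Z : ITM (EnvAct E.m)}
  {S : Sys D E R} {z : ITI Z} {y : ITI R'.Y} {yr : List Ref}

/-- `S` with another environment and another requester. -/
abbrev swap (S : Sys D E R) (z : ITI Z) (y : ITI R'.Y) (yr : List Ref) : Sys D (E.withZ Z) R' :=
  S.transport (E' := E.withZ Z) z y yr

@[simp] theorem idle_z_output (S : Sys D E R) : S.idle.z.output = S.z.output := by
  unfold idle; split <;> rfl

theorem requestDeletion_z {rule : SidRule} {sec i : ℕ} {C : ITM PartyAct} {T : Sys D E R}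
    (hT : T ∈ (S.requestDeletion rule sec i C).support) :
    T.z = S.z ∨ T.z = S.idle.z := by
  rcases S.requestDeletion_cases i with ⟨t, tok, h1, h2, h3⟩ | h1
  · rw [requestDeletion_eq rule sec C h1 h2 h3, PMF.mem_support_map_iff] at hT
    obtain ⟨sid, -, rfl⟩ := hT
    exact .inl rfl
  · rw [requestDeletion_eq_idle rule sec C h1, mem_pure] at hT
    grind

theorem idle_z_eq (S : Sys D E R) : S.idle.z = { S.z with caller := S.idle.z.caller } := by
  unfold idle; split <;> rfl

theorem map_congr_support {α β : Type*} {p : PMF α} {f g : α → β}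
    (h : ∀ a ∈ p.support, f a = g a) : p.map f = p.map g := by
  ext b
  rw [PMF.map_apply, PMF.map_apply]
  refine tsum_congr fun a => ?_
  by_cases ha : a ∈ p.support
  · rw [h a ha]
  simp_all

/-- Actions of the environment other than messages to the requester hardly depend on the internal
state of the environment and on the requester. -/
theorem swap_zAct (h1 : z.caller = S.z.caller) (h2 : z.control = S.z.control)
    (h3 : z.output = S.z.output) (h4 : z.controlHead = S.z.controlHead) (rule : SidRule) (sec : ℕ)
    (msg : Str) (a : EnvAct E.m) (ha : a ≠ .toRequester) :
    (S.swap z y yr).zAct rule sec msg a =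
      (S.zAct rule sec msg a).map fun T => T.swap (z.sync T.z) y yr := by
  have hs : z.sync S.z = z := by unfold ITI.sync; rw [← h1, ← h2, ← h3]
  cases a with
  | toRequester => grind
  | toCollector =>
    simp only [zAct, PMF.pure_map]
    rw [hs]
    rfl
  | input =>
    simp only [zAct, PMF.pure_map]
    congr 1
    have ht : (S.swap z y yr).zTarget = S.zTarget := by
      unfold zTarget
      simp only [swap, transport, h4]
      rfl
    rw [ht, transport_writeClient (E' := E.withZ Z) h1]
    congr 1
    cases S.zTarget with
    | none =>
      simp only [writeClient, ITI.sync, ITI.calledAs, idle_z_output, idle_z_control, ← h2, ← h3]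
      rfl
    | some j =>
      simp only [writeClient, ITI.sync, ITI.calledAs, ← h2, ← h3]
      rfl
  | initiate p i =>
    simp only [zAct, initiate_eq, PMF.map_comp]
    congr 1
    funext sid
    simp only [Function.comp, addSession, swap, transport, ITI.sync, ← h1, ← h2, ← h3]
    rfl
  | delete i =>
    have hm : (S.swap z y yr).mainSession ((S.swap z y yr).zRefs[(S.swap z y yr).z.controlHead]?) =
        S.mainSession (S.zRefs[S.z.controlHead]?) := by
      unfold mainSession
      simp only [swap, transport, h4]
      rfl
    simp only [zAct]
    rw [hm]
    split
    · rw [PMF.pure_map, transport_idle (E' := E.withZ Z) h1]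
      simp only [ITI.sync, ITI.calledAs, idle_z_output, idle_z_control, ← h2, ← h3]
      rfl
    · next j hj =>
      set S₁ : Sys D E R := { S with
        z := { S.z with control := S.z.control ++ [.deletion] }
        zRefs := S.zRefs ++ [.deletionOf j] } with hS₁
      set z₁ : ITI Z := { z with control := S.z.control ++ [.deletion] } with hz₁
      have := transport_requestDeletion (E' := E.withZ Z) (S := S₁) (z := z₁) (y := y) (yr := yr)
        (by exact h1) rule sec j (E.adv i)
      have hl : { S.swap z y yr with
          z := { (S.swap z y yr).z with control := (S.swap z y yr).z.control ++ [Protocol.deletion] }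
          zRefs := (S.swap z y yr).zRefs ++ [Ref.deletionOf j] } = S₁.swap z₁ y yr := by
        simp only [swap, transport, hz₁, ← h2]
        rfl
      rw [hl]
      refine this.trans (map_congr_support fun T hT => ?_)
      have : T.z.control = S.z.control ++ [.deletion] ∧ T.z.output = S.z.output := by
        rcases requestDeletion_z hT with h | h <;> rw [h] <;> simp [hS₁]
      simp only [swap, ITI.sync, ITI.calledAs, this, hz₁, ← h3]
      rfl
  | output =>
    simp only [zAct, PMF.pure_map]
    congr 1
    have hl : { S.swap z y yr with
        z := { (S.swap z y yr).z with output := (S.swap z y yr).z.output ++ written msg } } =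
          { S with z := { S.z with output := S.z.output ++ written msg } }.swap
            { z with output := S.z.output ++ written msg } y yr := by
      simp only [swap, transport, ← h3]
      rfl
    rw [hl]
    refine (transport_idle (E' := E.withZ Z) (by exact h1)).trans ?_
    simp only [swap, ITI.sync, ITI.calledAs, idle_z_output, idle_z_control, ← h2]
    rfl
  | endAlive =>
    simp only [zAct, PMF.pure_map]
    rw [hs]
    rfl

/-- Actions change but caller, control tape and output tape of the environment. -/
theorem zAct_sync {rule : SidRule} {sec : ℕ} {msg : Str} {a : EnvAct E.m}
    (ha : a ≠ .toRequester) {T : Sys D E R}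
    (hT : T ∈ (S.zAct rule sec msg a).support) : S.z.sync T.z = T.z := by
  have hidle : ∀ S' : Sys D E R, S'.z.sync S'.idle.z = S'.idle.z := fun S' => by
    rw [idle_z_eq]; rfl
  cases a with
  | toRequester => grind
  | toCollector | endAlive =>
    obtain rfl := mem_pure.1 hT
    rfl
  | input =>
    obtain rfl := mem_pure.1 hT
    cases S.zTarget with
    | none => exact hidle S
    | some j => rfl
  | initiate p i =>
    rw [initiate_z hT]
    rfl
  | delete i =>
    simp only [zAct] at hT
    split at hT
    · simp_all
    · rcases requestDeletion_z hT with h | h <;> rw [h]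
      · rfl
      · rw [idle_z_eq]; rfl
  | output =>
    obtain rfl := mem_pure.1 hT
    rw [idle_z_eq]; rfl

end Sys

/-! ## Executions without and with all sessions of the requester -/

theorem value_indic_false {α : Type*} (step : α → PMF α) (a : α) :
    value step (indic fun _ => False) a = 0 := by
  unfold value
  simp only [ENNReal.iSup_eq_zero]
  intro n
  induction n generalizing a with
  | zero => simp [val, indic]
  | succ n ih =>
    rw [val, ev_congr (g := fun _ => 0) fun b _ => ih b, ev_const]

theorem Simulates.value_eq {α β : Type*} {stepW : α → PMF α} {payW : α → ℝ≥0∞}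
    {stepS : β → PMF β} {payS : β → ℝ≥0∞} {rel : α → β → Prop}
    (h : Simulates stepW payW stepS payS (fun _ => False) rel) {a : α} {b : β} (hab : rel a b) :
    value stepS payS b = value stepW payW a := by
  have h1 := h.value_le hab
  have h2 := h.le_value hab
  rw [value_indic_false, add_zero] at h1 h2
  grind

namespace Ghost

def pay (A : Distinguisher) (g : Ghost D E R) : ℝ≥0∞ := g.sys.pay A

theorem step_of_ne {lim sec : ℕ} {rule : SidRule} {g : Ghost D E R}
    (h : g.sys.active ≠ .requester) :
    g.step lim rule sec = (g.sys.step rule sec).map fun S => { g with sys := S } := if_neg h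

theorem step_done {lim sec : ℕ} {rule : SidRule} {g : Ghost D E R} (h : g.sys.active = .done) :
    g.step lim rule sec = PMF.pure g := by
  rw [step_of_ne (by simp [h]), Sys.step_done rule sec h, PMF.pure_map]

theorem pay_le_step (lim : ℕ) (rule : SidRule) (sec : ℕ) (A : Distinguisher) (g : Ghost D E R) :
    g.pay A ≤ ev (g.step lim rule sec) (pay A) := by
  by_cases h : g.sys.active = .done
  · rw [step_done h, ev_pure]
  · rw [pay, Sys.pay_of_active h]
    exact zero_le

theorem val_of_done {lim sec : ℕ} {rule : SidRule} {A : Distinguisher} {g : Ghost D E R}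
    (h : g.sys.active = .done) (n : ℕ) : val (Ghost.step lim rule sec) (pay A) n g = g.pay A :=
  val_of_absorbing (step_done h) n

theorem step_requester_halted {lim sec : ℕ} {rule : SidRule} {g : Ghost D E R}
    (h : g.sys.active = .requester) (hh : g.sys.y.halted = true) :
    g.step lim rule sec = PMF.pure { g with sys := g.sys.idle } := by
  unfold step
  grind

theorem step_requester {lim sec : ℕ} {rule : SidRule} {g : Ghost D E R}
    (h : g.sys.active = .requester) (hh : g.sys.y.halted = false) :
    g.step lim rule sec = Sys.coin.bind fun b =>
      (g.withY (g.sys.y.step none b).1).next lim rule sec (g.sys.y.step none b).2 := by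
  unfold step
  grind

/-- The entry of the control tape of the requester in the execution with all sessions. -/
def ref (g : Ghost D E R) (e : Bool × ℕ) : Option Ref :=
  (g.indices[e.2]?).map fun j => if e.1 then .deletionOf j else .session j

/-- The execution with all sessions is this one. -/
structure Full (lim sec : ℕ) (g : Ghost D E R) : Prop where
  inv : g.Inv lim sec
  refs : ∀ i : ℕ, g.sys.yRefs[i]? = (g.entries[i]?).bind g.ref
  count_le : g.count ≤ lim

variable {lim sec : ℕ} {rule : SidRule} {g : Ghost D E R}

theorem Full.length (h : g.Full lim sec) : g.indices.length = g.count := by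
  rw [h.inv.length, min_eq_left h.count_le]

theorem Full.yTarget (h : g.Full lim sec) :
    g.sys.yTarget = (g.entries[g.sys.y.controlHead]?).bind g.target := by
  unfold Sys.yTarget
  rw [h.refs, Option.bind_assoc]
  congr 1
  funext e
  unfold ref target
  cases g.indices[e.2]? with
  | none => rfl
  | some j =>
    rcases e with ⟨_ | _, q⟩ <;> rfl

theorem Full.mainSession (h : g.Full lim sec) (i : ℕ) :
    g.sys.mainSession (g.sys.yRefs[i]?) =
      match g.entries[i]? with
      | some (false, q) => g.indices[q]?
      | _ => none := by
  rw [h.refs]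
  split
  · next q hq =>
    have := h.inv.entries _ (List.mem_of_getElem? hq)
    dsimp only at this
    rw [← h.length] at this
    have hj := List.getElem?_eq_getElem this
    have hmem : g.indices[q] ∈ mainIndices g.sys.sessions :=
      (congrArg (g.indices[q] ∈ ·) h.inv.indices).mp (List.mem_of_getElem? hj)
    obtain ⟨t, h1, h2⟩ := mem_mainIndices.1 hmem
    simp [Session.isMain] at h2
    simp [hq, ref, hj, Sys.mainSession, h1, h2.1]
  · next hn =>
    cases he : g.entries[i]? with
    | none => rfl
    | some e =>
      rcases e with ⟨_ | _, q⟩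
      · grind
      · simp [ref]
        cases g.indices[q]? <;> rfl

theorem _root_.DeletionCompliance.isSome_getElem?' {α : Type*} (l : List α) (i : ℕ) :
    (l[i]?).isSome = true ↔ i < l.length := by simp

theorem Full.append (h : g.Full lim sec) {g' : Ghost D E R} (hi : g'.Inv lim sec)
    (hc : g'.count ≤ lim) {ix : List ℕ} (h1 : g'.indices = g.indices ++ ix) {e : Bool × ℕ} {r : Ref}
    (h2 : g'.entries = g.entries ++ [e]) (h3 : g'.sys.yRefs = g.sys.yRefs ++ [r])
    (h4 : g'.ref e = some r) : g'.Full lim sec := by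
  -- Every entry names a session that exists, so the two lists have entries at the same positions,
  -- hence the same length; the new entry goes to the same place in both.
  have hlen : g.sys.yRefs.length = g.entries.length := by
    have h5 : ∀ i : ℕ, i < g.sys.yRefs.length ↔ i < g.entries.length := by
      intro i
      rw [← isSome_getElem?', ← isSome_getElem?', h.refs]
      cases he : g.entries[i]? with
      | none => simp
      | some e =>
        have := h.inv.entries _ (List.mem_of_getElem? he)
        rw [← h.length] at this
        simp [ref, this]
    exact le_antisymm (le_of_not_gt fun hlt => lt_irrefl _ ((h5 _).1 hlt))
      (le_of_not_gt fun hlt => lt_irrefl _ ((h5 _).2 hlt))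
  refine ⟨hi, fun i => ?_, hc⟩
  rw [h2, h3]
  rcases lt_trichotomy i g.entries.length with hlt | heq | hgt
  · rw [List.getElem?_append_left (hlen ▸ hlt), List.getElem?_append_left hlt, h.refs]
    have := List.getElem?_eq_getElem hlt
    rw [this, Option.bind_some, Option.bind_some]
    unfold ref
    rw [h1, List.getElem?_append_left]
    rw [h.length]
    exact h.inv.entries _ (List.mem_of_getElem? this)
  · grind
  simp_all

theorem Full.congr (h : g.Full lim sec) {g' : Ghost D E R} (hi : g'.Inv lim sec)
    (h1 : g'.indices = g.indices) (h2 : g'.entries = g.entries) (h3 : g'.sys.yRefs = g.sys.yRefs)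
    (h4 : g'.count = g.count) : g'.Full lim sec :=
  ⟨hi, fun i => by
    unfold ref
    rw [h1, h2, h3, h.refs]
    rfl, h4 ▸ h.count_le⟩

@[simp] theorem _root_.DeletionCompliance.Sys.writeClient_yRefs (S : Sys D E R) (i : Option ℕ)
    (msg : Str) : (S.writeClient i msg).yRefs = S.yRefs := by
  cases i with
  | none => simp [Sys.writeClient]
  | some i => rfl

/-- As long as no session is suppressed, `entries` together with `indices` is just another notation
for `yRefs`. The bound `hc` on the possible results guarantees that none is suppressed now. -/
theorem Full.yAct (h : g.Full lim sec) (msg : Str) (a : RequesterAct)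
    (hc : ∀ S' ∈ (g.sys.yAct rule sec msg a).support, (mainIndices S'.sessions).length ≤ lim) :
    g.sys.yAct rule sec msg a = (g.act lim rule sec msg a).map Ghost.sys ∧
      ∀ g' ∈ (g.act lim rule sec msg a).support, g'.Full lim sec := by
  have hinv : ∀ g' ∈ (g.act lim rule sec msg a).support, g'.Inv lim sec :=
    fun g' hg' => (act_inv h.inv msg a hg').1
  cases a with
  | input =>
    refine ⟨by simp only [Sys.yAct, act, PMF.pure_map, h.yTarget], fun g' hg' => ?_⟩
    have hi := hinv g' hg'
    simp [act] at hg'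
    subst hg'
    exact h.congr hi rfl rfl (by simp) rfl
  | initiate =>
    -- Some identifier has positive probability, and with it the initiation would lead to a
    -- configuration with `count + 1` sessions of `π`, which `hc` limits.
    have hlt : g.count < lim := by
      have hne := (rule sec (g.sys.sessions.map Session.sid)).support_nonempty
      obtain ⟨sid, hs⟩ := hne
      have := hc _ (by
        simp only [Sys.yAct, Sys.initiate_eq, PMF.mem_support_map_iff]
        exact ⟨sid, hs, rfl⟩)
      simp only [Sys.addSession, mainIndices_append, Session.isMain, Session.fresh,
        ← h.inv.indices] at this
      simp [h.length] at this
      omega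
    have hact : g.act lim rule sec msg .initiate = _ := if_pos hlt
    refine ⟨?_, fun g' hg' => ?_⟩
    · rw [hact, PMF.map_comp]
      exact (PMF.map_id _).symm
    · have hi := hinv g' hg'
      rw [hact, Sys.initiate_eq, PMF.map_comp, PMF.mem_support_map_iff] at hg'
      obtain ⟨sid, -, rfl⟩ := hg'
      refine h.append hi hlt (ix := [g.sys.sessions.length]) rfl rfl
        (r := .session g.sys.sessions.length) rfl ?_
      simp [ref, ← h.length]
  | delete =>
    have hm := h.mainSession g.sys.y.controlHead
    have hidle : (PMF.pure g.sys.idle = (PMF.pure { g with sys := g.sys.idle }).map Ghost.sys) ∧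
        ∀ g' ∈ (PMF.pure { g with sys := g.sys.idle }).support, g'.Full lim sec := by
      refine ⟨by rw [PMF.pure_map], fun g' hg' => ?_⟩
      simp at hg'
      subst hg'
      exact h.congr (inv_idle h.inv) rfl rfl (by simp) rfl
    simp only [Sys.yAct, act] at hinv ⊢
    cases he : g.entries[g.sys.y.controlHead]? with
    | none =>
      grind
    | some e =>
      rcases e with ⟨_ | _, q⟩
      · simp only [he] at hm hinv ⊢
        rw [hm]
        have hlt := h.inv.entries _ (List.mem_of_getElem? he)
        dsimp only at hlt
        rw [← h.length] at hlt
        have hj := List.getElem?_eq_getElem hlt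
        simp only [hj] at hinv ⊢
        refine ⟨by rw [PMF.map_comp]; exact (PMF.map_id _).symm, fun g' hg' => ?_⟩
        have hi := hinv g' hg'
        rw [PMF.mem_support_map_iff] at hg'
        obtain ⟨S', hS', rfl⟩ := hg'
        refine h.append hi h.count_le (ix := []) (by simp) rfl (r := .deletionOf g.indices[q])
          ?_ (by simp [ref, hj])
        set S₁ : Sys D E R := { g.sys with
          y := { g.sys.y with control := g.sys.y.control ++ [.deletion] }
          yRefs := g.sys.yRefs ++ [.deletionOf g.indices[q]] } with hS₁
        rcases S₁.requestDeletion_cases g.indices[q] with ⟨t, tok, h1, h2, h3⟩ | h1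
        · rw [Sys.requestDeletion_eq rule sec _ h1 h2 h3, PMF.mem_support_map_iff] at hS'
          obtain ⟨sid, -, rfl⟩ := hS'
          rfl
        · rw [Sys.requestDeletion_eq_idle rule sec _ h1, mem_pure] at hS'
          simp_all
      grind

/-- Obliviousness: what is written on the output tapes of clients does not matter. -/
theorem _root_.DeletionCompliance.Requester.Oblivious.step (hR : R.Oblivious) (s : ITI R.Y)
    (p : Option Sym) (b : Bool) : s.step p b = s.step none b := by
  have : R.Y.δ s.state (s.observe p b) = R.Y.δ s.state (s.observe none b) :=
    hR.2 s.state (s.observe none b) p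
  unfold ITI.step
  rw [this]

/-- This is where the blank shown to the requester is justified: `hR.step` replaces the symbol it
actually scans on the output tape of a client. -/
theorem Full.step (hR : R.Oblivious) (h : g.Full lim sec)
    (hc : ∀ S' ∈ (g.sys.step rule sec).support, (mainIndices S'.sessions).length ≤ lim) :
    g.sys.step rule sec = (g.step lim rule sec).map Ghost.sys ∧
      ∀ g' ∈ (g.step lim rule sec).support, g'.Full lim sec := by
  by_cases ha : g.sys.active = .requester
  · cases hh : g.sys.y.halted with
    | true =>
      rw [step_requester_halted ha hh, Sys.step_requester_halted rule sec ha hh, PMF.pure_map]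
      refine ⟨rfl, fun g' hg' => ?_⟩
      simp at hg'
      subst hg'
      exact h.congr (inv_idle h.inv) rfl rfl (by simp) rfl
    | false =>
      have hfull : ∀ b, (g.withY (g.sys.y.step none b).1).Full lim sec := fun b =>
        h.congr (inv_withY h.inv hh b) rfl rfl rfl rfl
      rw [Sys.step_requester rule sec ha hh] at hc ⊢
      rw [step_requester ha hh, PMF.map_bind]
      have key : ∀ b, ({ g.sys with y := (g.sys.y.step g.sys.yPeer b).1 }.yNext rule sec
          (g.sys.y.step g.sys.yPeer b).2 = ((g.withY (g.sys.y.step none b).1).next lim rule sec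
          (g.sys.y.step none b).2).map Ghost.sys) ∧
          ∀ g' ∈ ((g.withY (g.sys.y.step none b).1).next lim rule sec
          (g.sys.y.step none b).2).support, g'.Full lim sec := by
        intro b
        have hc' : ∀ S' ∈ ({ g.sys with y := (g.sys.y.step g.sys.yPeer b).1 }.yNext rule sec
          (g.sys.y.step g.sys.yPeer b).2).support, (mainIndices S'.sessions).length ≤ lim :=
          fun S' hS' => hc S' (by
            rw [PMF.mem_support_bind_iff]
            exact ⟨b, by simp [Sys.coin], hS'⟩)
        rw [hR.step] at hc' ⊢
        have hb := hfull b
        revert hc'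
        rcases (g.sys.y.step none b).2 with _ | _ | ⟨a, msg⟩ <;> intro hc'
        · refine ⟨by simp only [Sys.yNext, next, PMF.pure_map, withY], fun g' hg' => ?_⟩
          simp [next] at hg'
          grind
        · refine ⟨by simp only [Sys.yNext, next, PMF.pure_map, withY], fun g' hg' => ?_⟩
          simp [next] at hg'
          subst hg'
          exact hb.congr (inv_idle hb.inv) rfl rfl (by simp) rfl
        · exact hb.yAct msg a hc'
      refine ⟨congrArg _ (funext fun b => (key b).1), fun g' hg' => ?_⟩
      rw [PMF.mem_support_bind_iff] at hg'
      grind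
  · have hinv : ∀ g' ∈ (g.step lim rule sec).support, g'.Inv lim sec :=
      fun g' hg' => (step_inv h.inv hg').1
    rw [step_of_ne ha] at hinv ⊢
    refine ⟨by rw [PMF.map_comp]; exact (PMF.map_id _).symm, fun g' hg' => ?_⟩
    have hi := hinv g' hg'
    rw [PMF.mem_support_map_iff] at hg'
    obtain ⟨S', hS', rfl⟩ := hg'
    exact h.congr hi rfl rfl (Sys.Moves.step h.inv.consistent ha hS').yRefs rfl

/-- An oblivious requester with few sessions leads to the same results if it does not see outputs
and only the first sessions come into being. -/
theorem prob_eq {k : ℕ} (hE : E.PPT) (hk : Representative rule D k R) (hR : R.Oblivious) (sec : ℕ)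
    (A : Distinguisher) :
    prob rule D E R sec A =
      value (Ghost.step k rule sec) (pay A) (Ghost.initial D E R sec) := by
  rw [prob_eq_value]
  refine iSup_congr fun n => ?_
  -- The induction is restricted to configurations that the real execution can reach, since only for
  -- these the number of sessions is known to be bounded.
  have key : ∀ (n : ℕ) (g : Ghost D E R), g.Full k sec →
      (∃ m, g.sys ∈ (run rule D E R sec m).support) →
      val (Sys.step rule sec) (Sys.pay A) n g.sys = val (Ghost.step k rule sec) (pay A) n g := by
    intro n
    induction n with
    | zero => exact fun g _ _ => rfl
    | succ n ih =>
      rintro g hg ⟨m, hm⟩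
      have hrun : ∀ S' ∈ (g.sys.step rule sec).support,
          S' ∈ (run rule D E R sec (m + 1)).support := fun S' hS' => by
        rw [run, PMF.mem_support_bind_iff]
        grind
      obtain ⟨h1, h2⟩ := hg.step hR fun S' hS' => by
        rw [length_mainIndices]
        exact hk E hE sec (m + 1) S' (hrun S' hS')
      rw [val, val, h1, ev_map]
      refine ev_congr fun g' hg' => ih g' (h2 g' hg') ⟨m + 1, hrun _ ?_⟩
      rw [h1, PMF.mem_support_map_iff]
      grind
  refine key n (initial D E R sec) ⟨inv_initial _ _, fun i => ?_, Nat.zero_le _⟩ ⟨0, ?_⟩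
  · simp [initial, Sys.initial]
  · simp [run, initial]

end Ghost

theorem Lift.map_right {α β : Type*} {r : α → β → Prop} (p : PMF α) {f : α → β}
    (h : ∀ a ∈ p.support, r a (f a)) : Lift r p (p.map f) := by
  have := Lift.map (r := r) p (κ := id) (κ' := f) h
  rwa [PMF.map_id] at this

theorem Lift.symm {α β : Type*} {r : α → β → Prop} {p : PMF α} {q : PMF β} (h : Lift r p q) :
    Lift (fun b a => r a b) q p :=
  ⟨fun f g hfg => h.2 g f fun a b hab => hfg b a hab,
    fun f g hfg => h.1 g f fun a b hab => hfg b a hab⟩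

theorem Lift.support_both {α β : Type*} {r : α → β → Prop} {p : PMF α} {q : PMF β}
    (h : Lift r p q) : Lift (fun a b => r a b ∧ a ∈ p.support ∧ b ∈ q.support) p q :=
  h.support_left.symm.support_left.symm.mono fun _ _ hab => ⟨hab.1.1, hab.1.2, hab.2⟩

theorem Lift.map_right' {α β γ : Type*} {r : α → β → Prop} {p : PMF α} {q : PMF β}
    {s : α → γ → Prop} {f : β → γ} (h : Lift r p q) (hs : ∀ a b, r a b → s a (f b)) :
    Lift s p (q.map f) :=
  ⟨fun u v huv => by rw [ev_map]; exact h.1 _ _ fun a b hab => huv _ _ (hs a b hab),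
    fun u v huv => by rw [ev_map]; exact h.2 _ _ fun a b hab => huv _ _ (hs a b hab)⟩

namespace Sys

variable {S : Sys D E R}

/-- A configuration is transported onto itself: `transport_step`, applied to its own environment,
says that a core step changes nothing of the environment but the caller. -/
theorem step_calledAs {rule : SidRule} {sec : ℕ}
    (hw : R.reactive = false ∨ ∀ t ∈ S.sessions, t.owner = .environment)
    (h1 : S.active ≠ .environment) (h2 : S.active ≠ .requester) {T : Sys D E R}
    (hT : T ∈ (S.step rule sec).support) : S.z.calledAs T.z = T.z := by
  have h := transport_step (S := S) (z := S.z) (y := S.y) (yr := S.yRefs) rfl rule sec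
    (hw.imp (fun h => ⟨h, h⟩) id) h1 h2
  change S.step rule sec = _ at h
  have hT' := hT
  rw [h, PMF.mem_support_map_iff] at hT'
  obtain ⟨T', -, rfl⟩ := hT'
  rfl

theorem zAct_toRequester (rule : SidRule) (sec : ℕ) (S : Sys D E R) (msg : Str) :
    S.zAct rule sec msg .toRequester = PMF.pure { S with
      z := { S.z with outgoing := S.z.outgoing ++ written msg }
      y := { S.y with incoming := S.y.incoming ++ written msg, caller := none }
      active := .requester } := rfl

end Sys

/-! ### The ideal execution as the hybrid without sessions of the requester -/

namespace Ghost

variable {sec : ℕ} {rule : SidRule}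

/-- The ideal execution, and the execution in which no session of the requester comes into being. -/
structure Void (sec : ℕ) (S : Sys D E silent) (g : Ghost D E R) : Prop where
  inv : g.Inv 0 sec
  sys : ∃ y yr, g.sys = S.transport S.z y yr
  owner : ∀ t ∈ S.sessions, t.owner = .environment

theorem Inv.indices_eq {g : Ghost D E R} (h : g.Inv 0 sec) : g.indices = [] := by
  have := h.length
  grind

/-- With limit `0` there is no session of `π` of the requester, so none can be deleted either. Hence
the step is calm, and every session still belongs to the environment. -/
theorem Void.of_moves {S S' : Sys D E silent} {g g' : Ghost D E R} (h : Void sec S g)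
    (hm : S.Moves S') (hi : g'.Inv 0 sec) (hs : ∃ y yr, g'.sys = S'.transport S'.z y yr) :
    Void sec S' g' := by
  refine ⟨hi, hs, fun t' ht' => ?_⟩
  obtain ⟨y, yr, hs⟩ := hs
  have h0 : mainIndices S'.sessions = [] := by
    have h1 := hi.indices
    rw [hs, hi.indices_eq] at h1
    exact h1.symm
  have hc : Calm S.sessions S'.sessions := by
    refine hm.calm.resolve_right fun hd => ?_
    have := deletedCount_le S'.sessions
    grind
  cases ho : t'.owner with
  | environment => rfl
  | requester =>
    obtain ⟨i, hi⟩ := List.mem_iff_getElem?.1 ht'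
    obtain ⟨t, h1, -⟩ := hc i t' hi ho
    obtain ⟨t'', h2, h3, -⟩ := hm.grows i t h1
    obtain rfl : t' = t'' := some_unique hi h2
    rw [h3.owner, h.owner t (List.mem_of_getElem? h1)] at ho
    cases ho

/-- All sessions being suppressed, whatever the requester attempts amounts to passing on activation,
apart from changes to its own tapes and references. -/
theorem act_zero {g : Ghost D E R} (h : g.Inv 0 sec) (msg : Str) (a : RequesterAct) :
    ∃ g', g.act 0 rule sec msg a = PMF.pure g' ∧
      ∃ y yr, g'.sys = (g.sys.transport g.sys.z y yr : Sys D E R).idle := by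
  have h0 := h.indices_eq
  cases a with
  | input =>
    refine ⟨_, rfl, g.sys.y, g.sys.yRefs, ?_⟩
    have : (g.entries[g.sys.y.controlHead]?).bind g.target = none := by
      cases g.entries[g.sys.y.controlHead]? with
      | none => rfl
      | some e => simp [target, h0]
    rw [this]
    rfl
  | initiate =>
    aesop
  | delete =>
    simp only [act]
    split
    · rw [h0]
      exact ⟨_, rfl, _, g.sys.yRefs, rfl⟩
    · exact ⟨_, rfl, g.sys.y, g.sys.yRefs, rfl⟩

/-- The silent requester returns activation in one step, while `R` may compute for a while before it
returns it. This ends because `R` is PPT: `n` bounds the number of steps that it may still make. -/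
theorem void_requester {A : Distinguisher} {c : ℕ}
    (hc : ∀ s : ITI R.Y, Reachable R.Y s → s.randomness.length ≤ s.input.length ^ c + c)
    (n : ℕ) {S : Sys D E silent} {g : Ghost D E R} (h : Void sec S g) (ha : S.active = .requester)
    (hn : (unary sec).length ^ c + c ≤ n + g.sys.y.randomness.length) :
    MatchesPos (Ghost.step 0 rule sec) (Ghost.pay A) (Void sec) (PMF.pure S.idle) g := by
  induction n generalizing g with
  | zero | succ n ih =>
    obtain ⟨y, yr, hs⟩ := h.sys
    have hga : g.sys.active = .requester := by rw [hs]; exact ha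
    have hpay : g.pay A = 0 := Sys.pay_of_active (by simp [hga])
    have hidle : ∀ (g' : Ghost D E R) y' yr', g'.Inv 0 sec →
        g'.sys = (S.transport S.z y' yr' : Sys D E R).idle → Void sec S.idle g' := by
      intro g' y' yr' hi hs'
      refine ⟨hi, ⟨y', yr', ?_⟩, by simpa using h.owner⟩
      rw [hs', Sys.transport_idle rfl, Sys.idle_z_eq]
      rfl
    cases hh : g.sys.y.halted with
    | true =>
      refine MatchesPos.det hpay (step_requester_halted hga hh)
        (.here (hidle _ y yr (inv_idle h.inv) ?_))
      rw [hs]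
    | false =>
      have hnext : ∀ b, ∃ g', (g.withY (g.sys.y.step none b).1).next 0 rule sec
          (g.sys.y.step none b).2 = PMF.pure g' ∧
          Matches (Ghost.step 0 rule sec) (Ghost.pay A) (Void sec) (PMF.pure S.idle) g' := by
        intro b
        have hi := inv_withY h.inv hh b
        have hlen : (g.sys.y.step none b).1.randomness.length =
            g.sys.y.randomness.length + 1 := by simp [ITI.step]
        have hsys : (g.withY (g.sys.y.step none b).1).sys =
            S.transport S.z (g.sys.y.step none b).1 yr := by
          unfold withY
          rw [hs]
          rfl
        generalize hsig : (g.sys.y.step none b).2 = sig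
        rcases sig with _ | _ | ⟨a, msg⟩
        · refine ⟨_, rfl, ?_⟩
          -- For `n = 0` there is no induction hypothesis, but a further step of computation would
          -- exceed the polynomial bound.
          first
          | exact (ih ⟨hi, ⟨_, _, hsys⟩, h.owner⟩ (by
              simp only [withY, hlen]; omega)).matches
          | exfalso
            have := hc _ hi.reachable
            rw [hi.input] at this
            simp only [withY, hlen] at this
            omega
        · refine ⟨_, rfl, .here (hidle _ (g.sys.y.step none b).1 yr (inv_idle hi) ?_)⟩
          rw [hsys]
        · obtain ⟨g', h1, y', yr', h2⟩ := act_zero hi msg a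
          refine ⟨g', h1, .here (hidle g' y' yr' ?_ ?_)⟩
          · exact (act_inv (rule := rule) hi msg a (h1 ▸ by simp)).1
          · rw [h2, hsys]
            rfl
      choose σ h1 h2 using hnext
      refine MatchesPos.stutter (σ := σ) hpay ?_ h2
      rw [step_requester hga hh, ← Sys.coin_bind_pure]
      grind

/-- The silent requester reacts to outputs and `R` need not, which is immaterial here: all sessions
belong to the environment (`Void.owner`), so no output is ever addressed to a requester. -/
theorem simulates_void (rule : SidRule) (sec : ℕ) (A : Distinguisher) (hR : R.Y.PPT) :
    Simulates (Sys.step rule sec) (Sys.pay A) (Ghost.step 0 rule sec) (Ghost.pay A)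
      (fun _ => False) (Void sec : Sys D E silent → Ghost D E R → Prop) where
  payW_le := Sys.pay_le_step rule sec A
  payS_le := pay_le_step 0 rule sec A
  payW_le_one := Sys.pay_le_one A
  payS_le_one g := Sys.pay_le_one A g.sys
  bad_step _ h := h.elim
  step S g h := by
    obtain ⟨y, yr, hs⟩ := h.sys
    have hga : g.sys.active = S.active := by rw [hs]; rfl
    by_cases hdone : S.active = .done
    · refine .inr (.inr ⟨fun n => ?_, Sys.val_of_done rule sec A hdone⟩)
      rw [val_of_done (hga.trans hdone)]
      unfold pay
      rw [hs]
      rfl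
    refine .inr (.inl ⟨Sys.pay_of_active hdone, ?_⟩)
    have hpay : g.pay A = 0 := Sys.pay_of_active (by rwa [hga])
    have hcons : Consistent D S.sessions S.zRefs S.z.control := by
      have := h.inv.consistent
      rwa [hs] at this
    by_cases hreq : S.active = .requester
    · rw [Sys.step_requester_halted rule sec hreq rfl]
      obtain ⟨c, hc⟩ := hR
      exact void_requester hc _ h hreq (Nat.le_add_right _ _)
    have hstep : g.step 0 rule sec = (g.sys.step rule sec).map fun T => { g with sys := T } :=
      step_of_ne (by rwa [hga])
    have hinv : ∀ T ∈ (g.sys.step rule sec).support, ({ g with sys := T } : Ghost D E R).Inv 0 sec :=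
      fun T hT => (step_inv (rule := rule) h.inv (by
        simp_all)).1
    refine .sync hpay ?_
    rw [hstep]
    have key : Lift (fun S' T => ∃ y yr, T = S'.transport S'.z y yr) (S.step rule sec)
        (g.sys.step rule sec) := by
      rw [hs]
      by_cases henv : S.active = .environment
      · cases hh : S.z.halted with
        | true =>
          rw [Sys.step_environment_halted rule sec henv hh,
            Sys.step_environment_halted (S := S.transport S.z y yr) rule sec henv hh]
          exact Lift.pure ⟨y, yr, rfl⟩
        | false =>
          rw [Sys.step_environment rule sec henv hh,
            Sys.step_environment (S := S.transport S.z y yr) rule sec henv hh]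
          refine Lift.bind _ fun b _ => ?_
          change Lift _ _ (Sys.zNext rule sec ({ S with
            z := (S.z.step S.zPeer b).1 }.transport (S.z.step S.zPeer b).1 y yr)
              (S.z.step S.zPeer b).2)
          generalize hS : ({ S with z := (S.z.step S.zPeer b).1 } : Sys D E silent) = S₁
          rw [show (S.z.step S.zPeer b).1 = S₁.z by rw [← hS]]
          rcases (S.z.step S.zPeer b).2 with _ | _ | ⟨a, msg⟩
          · exact Lift.pure ⟨y, yr, rfl⟩
          · refine Lift.pure ⟨y, yr, ?_⟩
            rw [Sys.transport_idle rfl, Sys.idle_z_eq]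
            rfl
          · by_cases ha : a = .toRequester
            · subst ha
              exact Lift.pure ⟨_, _, rfl⟩
            · have := Sys.swap_zAct (S := S₁) (Z := E.Z) (z := S₁.z) (y := y) (yr := yr) rfl rfl
                rfl rfl rule sec msg a ha
              change Lift _ (S₁.zAct rule sec msg a)
                ((S₁.transport S₁.z y yr : Sys D E R).zAct rule sec msg a)
              have h2 : (S₁.transport S₁.z y yr : Sys D E R).zAct rule sec msg a =
                  (S₁.zAct rule sec msg a).map fun T => T.transport (S₁.z.sync T.z) y yr := this
              rw [h2]
              refine Lift.map_right _ fun T hT => ⟨y, yr, ?_⟩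
              rw [Sys.zAct_sync ha hT]
      · rw [Sys.transport_step rfl rule sec (.inr h.owner) henv hreq]
        refine Lift.map_right _ fun T hT => ⟨y, yr, ?_⟩
        rw [Sys.step_calledAs (.inr h.owner) henv hreq hT]
    have key2 : Lift (fun S' T => (∃ y yr, T = S'.transport S'.z y yr) ∧
        S' ∈ (S.step rule sec).support ∧ T ∈ (g.sys.step rule sec).support) (S.step rule sec)
        (g.sys.step rule sec) := key.support_both
    exact key2.map_right' fun S' T hT =>
      h.of_moves (Sys.Moves.step hcons hreq hT.2.1) (hinv T hT.2.2) hT.1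

/-- The ideal execution leads to the same results as that in which no session of the requester comes
into being. -/
theorem prob_silent_eq (hR : R.Y.PPT) (rule : SidRule) (sec : ℕ) (A : Distinguisher) :
    prob rule D E silent sec A =
      value (Ghost.step 0 rule sec) (pay A) (Ghost.initial D E R sec) := by
  rw [prob_eq_value]
  refine ((simulates_void rule sec A hR).value_eq ⟨inv_initial _ _, ⟨_, _, rfl⟩, ?_⟩).symm
  simp [Sys.initial]

end Ghost

/-! ## Strategies of environments -/

/-- Actions of an environment other than messages to the requester. -/
inductive OwnAct (m : ℕ)
  | toCollector
  | input
  | initiate (p : Protocol) (i : Fin m)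
  | delete (i : Fin m)
  | output
  | endAlive

def OwnAct.act {m : ℕ} : OwnAct m → EnvAct m
  | .toCollector => .toCollector
  | .input => .input
  | .initiate p i => .initiate p i
  | .delete i => .delete i
  | .output => .output
  | .endAlive => .endAlive

theorem OwnAct.act_ne {m : ℕ} (a : OwnAct m) (h : a.act = .toRequester) : False := by
  cases a <;> cases h

/-- Requests to a requester that has a single session of `π`: initiate it, write on the input tape
of its client, write on the input tape of the client of its deletion, delete it. -/
inductive Relay
  | initiate
  | input
  | inputDeletion
  | delete

def Relay.code : Relay → Bool × Bool
  | .initiate => (false, false)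
  | .input => (false, true)
  | .inputDeletion => (true, false)
  | .delete => (true, true)

/-- What an environment may do: act on its own, with the control head at a given position, or send
a request to the requester. -/
inductive Order (m : ℕ)
  | own (pos : ℕ) (msg : Str) (a : OwnAct m)
  | relay (msg : Str) (r : Relay)

/-- The program of an environment with arbitrary memory: it looks at a position of the output tape
of the client at a position of its control tape, and then decides. -/
structure Strategy (m : ℕ) where
  St : Type
  start : St
  look : St → ℕ × ℕ
  next : St → Bool → Option Sym → Bool → St × Option (Order m)

/-- A requester that does nothing. -/
def idler : Requester := { silent with reactive := false }

/-- A configuration of the execution with an environment that follows a strategy. -/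
structure Macro (D : DataCollector) (E : Environment) (σ : Strategy E.m) where
  sys : Sys D E idler
  st : σ.St
  pend : Option (Order E.m)

namespace Sys

variable {R R' : Requester}

/-- The control head of the environment is moved. -/
def zSeek (S : Sys D E R) (pos : ℕ) : Sys D E R := { S with z := { S.z with controlHead := pos } }

/-- The control head of the requester is moved. -/
def ySeek (S : Sys D E R) (pos : ℕ) : Sys D E R := { S with y := { S.y with controlHead := pos } }

/-- The effect of a request to the requester. -/
def request (rule : SidRule) (sec : ℕ) (S : Sys D E R) (msg : Str) : Relay → PMF (Sys D E R)
  | .initiate => if S.yRefs = [] then (S.ySeek 0).yAct rule sec msg .initiate else PMF.pure S.idle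
  | .input => (S.ySeek 0).yAct rule sec msg .input
  | .inputDeletion => (S.ySeek 1).yAct rule sec msg .input
  | .delete => (S.ySeek 0).yAct rule sec msg .delete

/-- The effect of an order. Requests are disregarded if `live` is false. -/
def perform (live : Bool) (rule : SidRule) (sec : ℕ) (S : Sys D E R) : Order E.m → PMF (Sys D E R)
  | .own pos msg a => (S.zSeek pos).zAct rule sec msg a.act
  | .relay msg r => if live then S.request rule sec msg r else PMF.pure S.idle

/-- The payoff. -/
def payoff (B : Payoff) (S : Sys D E R) : ℝ≥0∞ :=
  if S.active = .done then B S.x.work S.z.output else 0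

theorem payoff_of_active {B : Payoff} {S : Sys D E R}
    (h : S.active ≠ .done) : S.payoff B = 0 := if_neg h

theorem payoff_le_one {B : Payoff} (hB : ∀ w o, B w o ≤ 1) (S : Sys D E R) : S.payoff B ≤ 1 := by
  unfold payoff
  aesop

/-- The symbol at a position of the output tape of the client at a position of the control tape. -/
def zLook (S : Sys D E R) (l : ℕ × ℕ) : Option Sym :=
  S.clientOutput ((S.zRefs[l.1]?).bind S.resolve) l.2

end Sys

namespace Macro

variable {σ : Strategy E.m}

/-- One step of the execution with an environment that follows a strategy. -/
def step (live : Bool) (rule : SidRule) (sec : ℕ) (c : Macro D E σ) : PMF (Macro D E σ) :=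
  if c.sys.active = .environment then
    match c.pend with
    | some o => (c.sys.perform live rule sec o).map fun S => ⟨S, c.st, none⟩
    | none => Sys.coin.map fun b =>
      let r := σ.next c.st (decide (c.sys.z.caller = some (σ.look c.st).1))
        (c.sys.zLook (σ.look c.st)) b
      ⟨c.sys, r.1, r.2⟩
  else (c.sys.step rule sec).map fun S => ⟨S, c.st, c.pend⟩

def initial (D : DataCollector) (E : Environment) (σ : Strategy E.m) (sec : ℕ) : Macro D E σ :=
  ⟨Sys.initial D E idler sec, σ.start, none⟩

variable {live : Bool} {rule : SidRule} {sec : ℕ} {c : Macro D E σ}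

theorem step_pend {o : Order E.m} (h : c.sys.active = .environment) (ho : c.pend = some o) :
    c.step live rule sec = (c.sys.perform live rule sec o).map fun S => ⟨S, c.st, none⟩ := by
  unfold step
  grind

theorem step_next (h : c.sys.active = .environment) (ho : c.pend = none) :
    c.step live rule sec = Sys.coin.map fun b =>
      let r := σ.next c.st (decide (c.sys.z.caller = some (σ.look c.st).1))
        (c.sys.zLook (σ.look c.st)) b
      ⟨c.sys, r.1, r.2⟩ := by
  unfold step
  grind

theorem step_of_ne (h : c.sys.active ≠ .environment) :
    c.step live rule sec = (c.sys.step rule sec).map fun S => ⟨S, c.st, c.pend⟩ := if_neg h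

theorem step_done (h : c.sys.active = .done) : c.step live rule sec = PMF.pure c := by
  rw [step_of_ne (by simp [h]), Sys.step_done rule sec h, PMF.pure_map]

def payoff (B : Payoff) (c : Macro D E σ) : ℝ≥0∞ := c.sys.payoff B

theorem payoff_le_step (B : Payoff) (c : Macro D E σ) :
    c.payoff B ≤ ev (c.step live rule sec) (payoff B) := by
  by_cases h : c.sys.active = .done
  · rw [step_done h, ev_pure]
  · rw [payoff, Sys.payoff_of_active h]
    exact zero_le

theorem val_of_done {B : Payoff} (h : c.sys.active = .done) (n : ℕ) :
    val (Macro.step live rule sec) (payoff B) n c = c.payoff B :=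
  val_of_absorbing (step_done h) n

end Macro

/-! ## Strategies as machines -/

/-- Phases in the realization of a strategy. -/
inductive Task (m : ℕ)
  | look
  | send (pos : ℕ) (l : Str) (a : EnvAct m)

def Task.ofPend {m : ℕ} : Option (Order m) → Task m
  | none => .look
  | some (.own pos msg a) => .send pos msg a.act
  | some (.relay msg r) => .send 0 (r.code.1 :: r.code.2 :: msg) .toRequester

/-- The memory of a machine that realizes a strategy; it keeps track of the positions of its control
head and of its heads on the output tapes of clients. -/
structure Micro {m : ℕ} (σ : Strategy m) where
  st : σ.St
  task : Task m
  control : ℕ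
  peer : ℕ → ℕ

/-- An operation that does nothing. -/
def Op.nop {A : Type} (s : Obs) : Op A :=
  ⟨s.work, .stay, .stay, .stay, .stay, .stay, false, none, none⟩

namespace Micro

variable {m : ℕ} {σ : Strategy m}

def moveControl (q : Micro σ) (d : Dir) : Micro σ := { q with control := d.moveNat q.control }

def movePeer (q : Micro σ) (d : Dir) : Micro σ :=
  { q with peer := fun i => if i = q.control then d.moveNat (q.peer i) else q.peer i }

/-- The transition function of a machine that realizes a strategy. -/
def step (q : Micro σ) (o : Obs) : Micro σ × Op (EnvAct m) :=
  match q.task with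
  | .look =>
    if q.control < (σ.look q.st).1 then
      (q.moveControl .right, { (Op.nop o : Op (EnvAct m)) with moveControl := .right })
    else if (σ.look q.st).1 < q.control then
      (q.moveControl .left, { (Op.nop o : Op (EnvAct m)) with moveControl := .left })
    else if q.peer q.control < (σ.look q.st).2 then
      (q.movePeer .right, { (Op.nop o : Op (EnvAct m)) with movePeer := .right })
    else if (σ.look q.st).2 < q.peer q.control then
      (q.movePeer .left, { (Op.nop o : Op (EnvAct m)) with movePeer := .left })
    else
      let r := σ.next q.st o.caller o.peer o.coin
      ({ q with st := r.1, task := .ofPend r.2 }, Op.nop o)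
  | .send pos l a =>
    if q.control < pos then
      (q.moveControl .right, { (Op.nop o : Op (EnvAct m)) with moveControl := .right })
    else if pos < q.control then
      (q.moveControl .left, { (Op.nop o : Op (EnvAct m)) with moveControl := .left })
    else
      match l with
      | b :: l => ({ q with task := .send pos l a }, { (Op.nop o : Op (EnvAct m)) with emit := some b })
      | [] => ({ q with task := .look }, { (Op.nop o : Op (EnvAct m)) with signal := some (some a) })

def start (σ : Strategy m) : Micro σ := ⟨σ.start, .look, 0, fun _ => 0⟩

end Micro

/-- The effect of an operation on the tapes and heads, and the signal given. -/
def ITI.perform {A : Type} {M : ITM A} (s : ITI M) (op : Op A) (coin : Bool) :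
    ITI M × Option (Option (A × Str)) :=
  let msg := s.buffer ++ op.emit.toList
  ({ s with
      work := fun i => if i = s.workHead then op.work else s.work i
      randomness := s.randomness ++ [coin]
      identHead := op.moveIdent.moveNat s.identHead
      inputHead := op.moveInput.moveNat s.inputHead
      workHead := op.moveWork.moveInt s.workHead
      incomingHead := if op.readIncoming then s.incomingHead + 1 else s.incomingHead
      controlHead := op.moveControl.moveNat s.controlHead
      peerHead := fun i =>
        if i = s.controlHead then op.movePeer.moveNat (s.peerHead i) else s.peerHead i
      buffer := if op.signal.isSome then [] else msg },
    op.signal.map fun a => a.map fun b => (b, msg))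

/-- One step of the execution with a machine of unbounded memory that realizes a strategy. -/
def microStep (σ : Strategy E.m)
    (rule : SidRule) (sec : ℕ) (s : Sys D E R × Micro σ) : PMF (Sys D E R × Micro σ) :=
  if s.1.active = .environment then
    Sys.coin.bind fun b =>
      let r := s.2.step (s.1.z.observe s.1.zPeer b)
      ({ s.1 with z := (s.1.z.perform r.2 b).1 }.zNext rule sec (s.1.z.perform r.2 b).2).map
        fun S => (S, r.1)
  else (s.1.step rule sec).map fun S => (S, s.2)

theorem microStep_environment
    {σ : Strategy E.m} {rule : SidRule} {sec : ℕ} {s : Sys D E R × Micro σ}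
    (h : s.1.active = .environment) :
    microStep σ rule sec s = Sys.coin.bind fun b =>
      ({ s.1 with z := (s.1.z.perform (s.2.step (s.1.z.observe s.1.zPeer b)).2 b).1 }.zNext rule sec
        (s.1.z.perform (s.2.step (s.1.z.observe s.1.zPeer b)).2 b).2).map
        fun S => (S, (s.2.step (s.1.z.observe s.1.zPeer b)).1) := if_pos h

theorem microStep_of_ne {σ : Strategy E.m} {rule : SidRule} {sec : ℕ} {s : Sys D E R × Micro σ}
    (h : s.1.active ≠ .environment) :
    microStep σ rule sec s = (s.1.step rule sec).map fun S => (S, s.2) := if_neg h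

theorem microStep_done {σ : Strategy E.m} {rule : SidRule} {sec : ℕ} {s : Sys D E R × Micro σ}
    (h : s.1.active = .done) : microStep σ rule sec s = PMF.pure s := by
  rw [microStep_of_ne (by simp [h]), Sys.step_done rule sec h, PMF.pure_map]

theorem payoff_le_microStep {σ : Strategy E.m} {rule : SidRule} {sec : ℕ} (B : Payoff)
    (s : Sys D E R × Micro σ) :
    s.1.payoff B ≤ ev (microStep σ rule sec s) fun s => s.1.payoff B := by
  by_cases h : s.1.active = .done
  · rw [microStep_done h, ev_pure]
  · rw [Sys.payoff_of_active h]
    exact zero_le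

/-! ## Transport of actions of the requester -/

namespace Sys

variable {R R' : Requester} {S : Sys D E R} {z : ITI E.Z} {y : ITI R'.Y}

@[simp] theorem writeClient_z_control (S : Sys D E R) (i : Option ℕ) (msg : Str) :
    (S.writeClient i msg).z.control = S.z.control := by
  cases i <;> simp [writeClient]

@[simp] theorem writeClient_z_output (S : Sys D E R) (i : Option ℕ) (msg : Str) :
    (S.writeClient i msg).z.output = S.z.output := by
  cases i <;> simp [writeClient]


theorem yAct_z {rule : SidRule} {sec : ℕ} {msg : Str} {a : RequesterAct} {T : Sys D E R}
    (hT : T ∈ (S.yAct rule sec msg a).support) :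
    T.z.control = S.z.control ∧ T.z.output = S.z.output := by
  cases a with
  | input =>
    simp [yAct] at hT
    simp_all
  | initiate =>
    rw [initiate_z hT]
    grind
  | delete =>
    simp only [yAct] at hT
    split at hT
    · simp_all
    · rcases requestDeletion_z hT with h | h <;> rw [h] <;> simp

theorem request_z {rule : SidRule} {sec : ℕ} {msg : Str} {r : Relay} {T : Sys D E R}
    (hT : T ∈ (S.request rule sec msg r).support) :
    T.z.control = S.z.control ∧ T.z.output = S.z.output := by
  cases r with
  | initiate =>
    simp only [request] at hT
    split_ifs at hT
    · exact yAct_z (S := S.ySeek 0) hT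
    simp_all
  | input => exact yAct_z (rule := rule) (sec := sec) (msg := msg) (S := S.ySeek 0) (a := .input) hT
  | inputDeletion => exact yAct_z (rule := rule) (sec := sec) (msg := msg) (S := S.ySeek 1) (a := .input) hT
  | delete => exact yAct_z (msg := msg) (S := S.ySeek 0) (a := .delete) hT

/-- A new entry of the control tape of the requester. -/
def yEntry (S : Sys D E R) (p : Protocol) (r : Ref) : Sys D E R :=
  { S with y := { S.y with control := S.y.control ++ [p] }, yRefs := S.yRefs ++ [r] }

theorem yAct_delete (rule : SidRule) (sec : ℕ) (S : Sys D E R) (msg : Str) :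
    S.yAct rule sec msg .delete =
      match S.mainSession (S.yRefs[S.y.controlHead]?) with
      | none => PMF.pure S.idle
      | some j => (S.yEntry .deletion (.deletionOf j)).requestDeletion rule sec j
          (D.client .deletion) := rfl

theorem requestDeletion_yRefs {rule : SidRule} {sec i : ℕ} {C : ITM PartyAct} {T : Sys D E R}
    (hT : T ∈ (S.requestDeletion rule sec i C).support) : T.yRefs = S.yRefs := by
  rcases S.requestDeletion_cases i with ⟨t, tok, h3, h4, h5⟩ | h3
  · rw [requestDeletion_eq rule sec _ h3 h4 h5, PMF.mem_support_map_iff] at hT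
    obtain ⟨sid, -, rfl⟩ := hT
    rfl
  · rw [requestDeletion_eq_idle rule sec _ h3, mem_pure] at hT
    simp_all

/-- Actions of the requester hardly depend on its internal state and on the environment. -/
theorem transport_yAct (h1 : z.caller = S.z.caller) (h2 : y.controlHead = S.y.controlHead)
    (rule : SidRule) (sec : ℕ) (msg : Str) (a : RequesterAct) :
    Lift (fun T T' => ∃ ctl, T' = T.transport (z.calledAs T.z) { y with control := ctl } T.yRefs)
      (S.yAct rule sec msg a) ((S.transport z y S.yRefs : Sys D E R').yAct rule sec msg a) := by
  cases a with
  | input =>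
    refine Lift.pure ⟨y.control, ?_⟩
    have ht : (S.transport z y S.yRefs : Sys D E R').yTarget = S.yTarget := by
      unfold yTarget
      simp only [transport, h2]
      rfl
    rw [ht, transport_writeClient h1, writeClient_yRefs]
  | initiate =>
    simp only [yAct, initiate_eq]
    refine Lift.map _ fun sid _ => ⟨y.control ++ [.main], ?_⟩
    simp only [addSession, transport]
    rw [show z.calledAs S.z = z from calledAs_self h1]
  | delete =>
    have hm : (S.transport z y S.yRefs : Sys D E R').mainSession
        ((S.transport z y S.yRefs : Sys D E R').yRefs[(S.transport z y S.yRefs :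
          Sys D E R').y.controlHead]?) = S.mainSession (S.yRefs[S.y.controlHead]?) := by
      unfold mainSession
      simp only [transport, h2]
      rfl
    rw [yAct_delete, yAct_delete, hm]
    split
    · refine Lift.pure ⟨y.control, ?_⟩
      rw [transport_idle h1, idle_yRefs]
    · next j hj =>
      have := transport_requestDeletion (S := S.yEntry .deletion (.deletionOf j)) (z := z)
        (y := { y with control := y.control ++ [.deletion] }) (yr := S.yRefs ++ [.deletionOf j])
        (E' := E) (R' := R') h1 rule sec j (D.client .deletion)
      rw [show (S.transport z y S.yRefs : Sys D E R').yEntry .deletion (.deletionOf j) =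
        (S.yEntry .deletion (.deletionOf j)).transport z
          { y with control := y.control ++ [.deletion] } (S.yRefs ++ [.deletionOf j]) from rfl, this]
      refine Lift.map_right _ fun T hT => ⟨y.control ++ [.deletion], ?_⟩
      rw [requestDeletion_yRefs hT]
      rfl

end Sys

/-! ## A requester that does nothing -/

theorem ppt_of_halted (h : ∀ q, R.Y.halt q = true) : R.Y.PPT := by
  refine ⟨0, fun s hs => ?_⟩
  suffices h' : s.randomness.length = 0 by omega
  induction hs with
  | create => rfl
  | step s p c _ hh _ => simp [ITI.halted, h] at hh
  | extend s _ _ _ _ _ _ _ ih => exact ih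

theorem representative_of_halted (h : ∀ q, R.Y.halt q = true) (rule : SidRule)
    (D : DataCollector) : Representative rule D 0 R := by
  intro E _ sec n
  have key : ∀ S ∈ (run rule D E R sec n).support,
      Consistent D S.sessions S.zRefs S.z.control ∧ mainIndices S.sessions = [] := by
    rw [run_eq_iter]
    refine iter_invariant ⟨(Ghost.inv_initial (R := R) 0 sec).consistent, rfl⟩ ?_ n
    rintro S ⟨h1, h2⟩ T hT
    by_cases ha : S.active = .requester
    · rw [Sys.step_requester_halted rule sec ha (h _), mem_pure] at hT
      simp_all
    · have := Sys.Moves.step h1 ha hT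
      exact ⟨this.consistent, this.mains.trans h2⟩
  intro S hS
  have := length_mainIndices S.sessions
  rw [(key S hS).2] at this
  exact this.ge

/-- A halted requester is 0-representative, so that its real execution is the hybrid with limit `0`,
and so is the ideal one. This allows the ideal execution to be represented by requesters that do not
react. -/
theorem prob_of_halted (h : ∀ q, R.Y.halt q = true) (hR : R.Oblivious)
    (hE : E.PPT) (rule : SidRule) (D : DataCollector) (sec : ℕ) (A : Distinguisher) :
    prob rule D E R sec A = prob rule D E silent sec A := by
  rw [Ghost.prob_silent_eq (ppt_of_halted h), Ghost.prob_eq hE (representative_of_halted h rule D) hR]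

/-! ## A requester that passes on requests -/

/-- The memory of the requester while it reads a request: the code as far as it is known. -/
abbrev RelayMode := Option (Bool × Option Bool)

/-- Equal bits encode initiation and deletion, different bits the two ways of writing on an input
tape; which of these is meant has already been expressed by the position of the control head. A
second initiation is suppressed, whatever the environment asks for. -/
def relayAct (b b' initiated : Bool) : Option RequesterAct :=
  match b, b' with
  | false, false => if initiated then none else some .initiate
  | true, true => some .delete
  | _, _ => some .input

/-- Between requests the control head is at position `0` or `1`. Reading the first bit moves it to
the left, hence to `0`, where the session of `π` is listed; the code of `inputDeletion` moves it on
to `1`, the place of the first entry for its deletion. Every step reads a symbol or ends the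
activation, which later bounds the running time. -/
def relayMove (q : RelayMode × Bool) (o : Obs) (sym : Option Sym) :
    (RelayMode × Bool) × Op RequesterAct :=
  match sym with
  | none => (q, { (Op.nop o : Op RequesterAct) with signal := some none })
  | some s =>
    match q.1, s with
    | none, some b => ((some (b, none), q.2),
        { (Op.nop o : Op RequesterAct) with readIncoming := true, moveControl := .left })
    | none, none => (q, { (Op.nop o : Op RequesterAct) with readIncoming := true })
    | some (b, none), some b' => ((some (b, some b'), q.2),
        { (Op.nop o : Op RequesterAct) with
          readIncoming := true, moveControl := if b && !b' then .right else .stay })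
    | some (_, none), none =>
        ((none, q.2), { (Op.nop o : Op RequesterAct) with readIncoming := true })
    | some (_, some _), some e =>
        (q, { (Op.nop o : Op RequesterAct) with readIncoming := true, emit := some e })
    | some (b, some b'), none => ((none, q.2 || (!b && !b')),
        { (Op.nop o : Op RequesterAct) with
          readIncoming := true, signal := some (relayAct b b' q.2) })

def relayStep (q : RelayMode × Bool) (o : Obs) : (RelayMode × Bool) × Op RequesterAct :=
  relayMove q o o.incoming

/-- The requester that reads requests and executes them, initiating at most one session of `π`. -/
def relayer : Requester where
  Y :=
    { Q := RelayMode × Bool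
      finite := inferInstance
      start := (none, false)
      halt := fun _ => false
      δ := relayStep }
  reactive := false

theorem relayer_oblivious : relayer.Oblivious := by
  refine ⟨rfl, fun q o p => ?_⟩
  aesop

/-- What the requester does with requests. -/
structure Delegate (σ : Strategy E.m) (rule : SidRule)
    (sec : ℕ) (B : Payoff) (live : Bool) (R : Requester)
    (Ready : ITI R.Y → Bool → Prop) : Prop where
  reactive : R.reactive = false
  initial : Ready (ITI.create R.Y [] (unary sec)) false
  run : ∀ (S : Sys D E idler) (z : ITI E.Z) (y : ITI R.Y) (q : Micro σ) (msg : Str) (r : Relay),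
    Ready y (!S.yRefs.isEmpty) → z.caller = S.z.caller →
    Matches (microStep (D := D) (R := R) σ rule sec) (fun s => s.1.payoff B)
      (fun T s => ∃ y', Ready y' (!T.yRefs.isEmpty) ∧
        s = (T.transport (z.calledAs T.z) y' T.yRefs, q))
      (if live then S.request rule sec msg r else PMF.pure S.idle)
      (({ S with active := .requester } : Sys D E idler).transport z
        { y with
          incoming := y.incoming ++ written (r.code.1 :: r.code.2 :: msg)
          caller := none } S.yRefs, q)
  rest : ∀ (S : Sys D E idler) (z : ITI E.Z) (y : ITI R.Y) (q : Micro σ),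
    Ready y (!S.yRefs.isEmpty) → z.caller = S.z.caller → S.active = .requester →
    MatchesPos (microStep (D := D) (R := R) σ rule sec) (fun s => s.1.payoff B)
      (fun T s => ∃ y', Ready y' (!T.yRefs.isEmpty) ∧
        s = (T.transport (z.calledAs T.z) y' T.yRefs, q))
      (PMF.pure S.idle) (S.transport z y S.yRefs, q)

/-- With `live = false` a request has to result in passing on activation, which a halted requester
does in its first step, whatever it has been sent. -/
theorem idler_delegate (σ : Strategy E.m) (rule : SidRule) (sec : ℕ) (B : Payoff) :
    Delegate (D := D) σ rule sec B false idler fun _ _ => True := by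
  have key : ∀ (S : Sys D E idler) (z : ITI E.Z) (y : ITI idler.Y) (q : Micro σ),
      z.caller = S.z.caller → S.active = .requester →
      MatchesPos (microStep (D := D) (R := idler) σ rule sec) (fun s => s.1.payoff B)
      (fun T s => ∃ y' : ITI idler.Y, True ∧ s = (T.transport (z.calledAs T.z) y' T.yRefs, q))
      (PMF.pure S.idle) (S.transport z y S.yRefs, q) := by
    intro S z y q h1 h2
    refine MatchesPos.det (b' := ((S.transport z y S.yRefs).idle, q))
      (Sys.payoff_of_active (by simp [Sys.transport, h2])) ?_ (.here ⟨y, trivial, ?_⟩)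
    · rw [microStep_of_ne (by simp [Sys.transport, h2]),
        Sys.step_requester_halted (S := S.transport z y S.yRefs) rule sec h2 rfl, PMF.pure_map]
    · rw [Sys.transport_idle h1, Sys.idle_yRefs]
  exact ⟨rfl, trivial, fun S z y q msg r _ h => (key { S with active := .requester } z _ q h rfl).matches,
    fun S z y q _ h ha => key S z y q h ha⟩

namespace Sys

theorem yAct_active (rule : SidRule) (sec : ℕ) (S : Sys D E R) (a : Active) (msg : Str)
    (b : RequesterAct) :
    ({ S with active := a } : Sys D E R).yAct rule sec msg b = S.yAct rule sec msg b := by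
  aesop

end Sys

/-! ### The relaying requester at work -/

section

variable {σ : Strategy E.m} {rule : SidRule} {sec : ℕ} {B : Payoff}

theorem ITI.observe_incoming {A : Type} {M : ITM A} (s : ITI M) (p : Option Sym) (b : Bool) :
    (s.observe p b).incoming = (s.incoming.drop s.incomingHead).head? := by
  simp [ITI.observe, List.head?_drop]

theorem drop_succ_of_drop_eq_cons {α : Type*} {l l' : List α} {n : ℕ} {a : α}
    (h : l.drop n = a :: l') : l.drop (n + 1) = l' := by
  rw [← List.tail_drop, h]
  rfl

/-- The requester in a certain phase, with `rest` still to be read. -/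
structure RelayState (y : ITI relayer.Y) (mode : RelayMode) (flag : Bool) (rest : List Sym)
    (buffer : Str) : Prop where
  state : y.state = (mode, flag)
  rest : y.incoming.drop y.incomingHead = rest
  buffer : y.buffer = buffer
  le : y.incomingHead ≤ y.incoming.length

namespace RelayState

variable {y : ITI relayer.Y} {flag : Bool} {l : List Sym} {b b' e : Bool} {buf : Str}

theorem delta {mode : RelayMode} (h : RelayState y mode flag l buf) (c : Bool) :
    relayer.Y.δ y.state (y.observe none c) = relayMove (mode, flag) (y.observe none c) l.head? := by
  rw [h.state, ← h.rest, ← y.observe_incoming none c]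
  rfl

theorem succ_le {mode : RelayMode} {s : Sym} (h : RelayState y mode flag (s :: l) buf) :
    y.incomingHead + 1 ≤ y.incoming.length := by
  have := congrArg List.length h.rest
  grind

theorem step_none {mode : RelayMode} (h : RelayState y mode flag [] []) (c : Bool) :
    RelayState (y.step none c).1 mode flag [] [] ∧ (y.step none c).2 = some none ∧
      (y.step none c).1.controlHead = y.controlHead := by
  unfold ITI.step
  rw [h.delta]
  exact ⟨⟨rfl, h.rest, rfl, h.le⟩, rfl, rfl⟩

theorem step_fetch (h : RelayState y none flag (some b :: l) []) (hy : y.controlHead ≤ 1)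
    (c : Bool) :
    RelayState (y.step none c).1 (some (b, none)) flag l [] ∧ (y.step none c).2 = none ∧
      (y.step none c).1.controlHead = 0 := by
  unfold ITI.step
  rw [h.delta]
  refine ⟨⟨rfl, drop_succ_of_drop_eq_cons h.rest, ?_, h.succ_le⟩, rfl, ?_⟩
  · simp [relayMove, Op.nop, h.buffer]
  · exact Nat.sub_eq_zero_of_le hy

theorem step_second (h : RelayState y (some (b, none)) flag (some b' :: l) [])
    (hy : y.controlHead = 0) (c : Bool) :
    RelayState (y.step none c).1 (some (b, some b')) flag l [] ∧ (y.step none c).2 = none ∧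
      (y.step none c).1.controlHead = if b && !b' then 1 else 0 := by
  unfold ITI.step
  rw [h.delta]
  refine ⟨⟨rfl, drop_succ_of_drop_eq_cons h.rest, ?_, h.succ_le⟩, rfl, ?_⟩
  · simp [relayMove, Op.nop, h.buffer]
  · dsimp only
    rw [hy]
    cases b <;> cases b' <;> rfl

theorem step_copy (h : RelayState y (some (b, some b')) flag (some e :: l) buf) (c : Bool) :
    RelayState (y.step none c).1 (some (b, some b')) flag l (buf ++ [e]) ∧
      (y.step none c).2 = none ∧ (y.step none c).1.controlHead = y.controlHead := by
  unfold ITI.step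
  rw [h.delta]
  refine ⟨⟨rfl, drop_succ_of_drop_eq_cons h.rest, ?_, h.succ_le⟩, rfl, rfl⟩
  simp [relayMove, Op.nop, h.buffer]

theorem step_end (h : RelayState y (some (b, some b')) flag [none] buf) (c : Bool) :
    RelayState (y.step none c).1 none (flag || (!b && !b')) [] [] ∧
      (y.step none c).2 = some ((relayAct b b' flag).map fun a => (a, buf)) ∧
      (y.step none c).1.controlHead = y.controlHead := by
  unfold ITI.step
  rw [h.delta]
  refine ⟨⟨rfl, drop_succ_of_drop_eq_cons h.rest, rfl, h.succ_le⟩, ?_, rfl⟩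
  simp [relayMove, Op.nop, h.buffer]

end RelayState

/-- The requester waits for a request. -/
def RelayReady (y : ITI relayer.Y) (flag : Bool) : Prop :=
  RelayState y none flag [] [] ∧ y.controlHead ≤ 1

theorem microStep_relayer {S : Sys D E idler} {z : ITI E.Z} {y : ITI relayer.Y} {q : Micro σ}
    (ha : S.active = .requester) :
    microStep σ rule sec (S.transport z y S.yRefs, q) = Sys.coin.bind fun b =>
      (Sys.yNext rule sec (S.transport z (y.step none b).1 S.yRefs : Sys D E relayer)
        (y.step none b).2).map fun T => (T, q) := by
  rw [microStep_of_ne (by simp [Sys.transport, ha]),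
    Sys.step_requester (S := S.transport z y S.yRefs) rule sec ha rfl, PMF.map_bind]
  refine congrArg _ (funext fun b => ?_)
  rw [show (S.transport z y S.yRefs : Sys D E relayer).y = y from rfl,
    relayer_oblivious.step]
  rfl

theorem relay_step {S : Sys D E idler} {z : ITI E.Z} {y : ITI relayer.Y} {q : Micro σ}
    {α : Type*} {rel : α → Sys D E relayer × Micro σ → Prop} {p : PMF α}
    (ha : S.active = .requester) (h : ∀ b, (y.step none b).2 = none)
    (hm : ∀ b, Matches (microStep σ rule sec) (fun s => s.1.payoff B) rel p
      (S.transport z (y.step none b).1 S.yRefs, q)) :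
    MatchesPos (microStep σ rule sec) (fun s => s.1.payoff B) rel p
      (S.transport z y S.yRefs, q) := by
  refine MatchesPos.stutter (Sys.payoff_of_active (by simp [Sys.transport, ha])) ?_ hm
  rw [microStep_relayer ha, ← Sys.coin_bind_pure]
  congr 1
  funext b
  rw [h b]
  simp only [Sys.yNext, PMF.pure_map]

theorem relay_copy {S : Sys D E idler} {z : ITI E.Z} {q : Micro σ}
    {α : Type*} {rel : α → Sys D E relayer × Micro σ → Prop} {p : PMF α}
    (ha : S.active = .requester) {b b' flag : Bool} {pos : ℕ} (l : Str) {msg buf : Str}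
    (hmsg : buf ++ l = msg)
    (hm : ∀ y, RelayState y (some (b, some b')) flag [none] msg → y.controlHead = pos →
      Matches (microStep σ rule sec) (fun s => s.1.payoff B) rel p (S.transport z y S.yRefs, q)) :
    ∀ y, RelayState y (some (b, some b')) flag (l.map some ++ [none]) buf → y.controlHead = pos →
      Matches (microStep σ rule sec) (fun s => s.1.payoff B) rel p
        (S.transport z y S.yRefs, q) := by
  induction l generalizing buf with
  | nil =>
    grind
  | cons e l ih =>
    intro y h hy
    exact (relay_step ha (fun c => (h.step_copy c).2.1) fun c =>
      ih (buf := buf ++ [e]) (by grind) _ (h.step_copy c).1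
        ((h.step_copy c).2.2.trans hy)).matches

/-- The requester's flag and the nonemptiness of `yRefs` both tell whether its session has been
initiated. They stay in agreement because only initiation makes an empty list nonempty: a deletion
presupposes an entry under the control head. -/
theorem relay_request {S : Sys D E idler} {msg : Str} {r : Relay} {T : Sys D E idler}
    (hT : T ∈ (S.request rule sec msg r).support) :
    (!T.yRefs.isEmpty) = (!S.yRefs.isEmpty || (!r.code.1 && !r.code.2)) := by
  cases r with
  | initiate =>
    simp only [Sys.request] at hT
    split_ifs at hT with h
    · rw [Sys.yAct, Sys.initiate_eq, PMF.mem_support_map_iff] at hT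
      obtain ⟨sid, -, rfl⟩ := hT
      simp [Sys.addSession, Relay.code]
    simp_all
  | input =>
    obtain rfl := mem_pure.1 hT
    simp [Relay.code, Sys.ySeek]
  | inputDeletion =>
    obtain rfl := mem_pure.1 hT
    simp [Relay.code, Sys.ySeek]
  | delete =>
    simp only [Sys.request] at hT
    rw [Sys.yAct_delete] at hT
    split at hT
    · obtain rfl := mem_pure.1 hT
      simp [Relay.code, Sys.ySeek]
    · next j hj =>
      rw [Sys.requestDeletion_yRefs hT]
      obtain ⟨h1, -⟩ := Sys.mainSession_eq_some hj
      have : S.yRefs ≠ [] := fun h => by simp [Sys.ySeek, h] at h1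
      simp only [Relay.code, Sys.ySeek, Sys.yEntry]
      cases hr : S.yRefs <;> simp_all

/-- The only step of the relayer with an outside effect. By now the buffer holds the message and the
control head is where `Sys.request` wants it, so `transport_yAct` identifies the two actions. -/
theorem relay_final {S : Sys D E idler} {z : ITI E.Z} {y : ITI relayer.Y} {q : Micro σ}
    (hz : z.caller = S.z.caller) {msg : Str} {r : Relay}
    (h : RelayState y (some (r.code.1, some r.code.2)) (!S.yRefs.isEmpty) [none] msg)
    (hy : y.controlHead = if r.code.1 && !r.code.2 then 1 else 0) :
    Matches (microStep (D := D) (R := relayer) σ rule sec) (fun s => s.1.payoff B)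
      (fun T s => ∃ y', RelayReady y' (!T.yRefs.isEmpty) ∧
        s = (T.transport (z.calledAs T.z) y' T.yRefs, q)) (S.request rule sec msg r)
      (({ S with active := .requester } : Sys D E idler).transport z y S.yRefs, q) := by
  set S₁ : Sys D E idler := { S with active := .requester } with hS₁
  refine .sync (Sys.payoff_of_active (by simp [Sys.transport, hS₁])) ?_
  have := microStep_relayer (D := D) (σ := σ) (rule := rule) (sec := sec) (S := S₁) (z := z)
    (y := y) (q := q) rfl
  change Lift _ _ (microStep σ rule sec (S₁.transport z y S₁.yRefs, q))
  -- The requester's coin has no influence; a dummy coin is put in front of the effect of the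
  -- request so that both sides are mixtures over the same coin.
  rw [this, ← PMF.bind_const Sys.coin (S.request rule sec msg r)]
  refine Lift.bind _ fun c _ => ?_
  obtain ⟨h1, h2, h3⟩ := h.step_end c
  generalize hy1 : (y.step none c).1 = y₁ at h1 h3
  rw [h2]
  have hready : ∀ T ∈ (S.request rule sec msg r).support, ∀ ctl,
      RelayReady { y₁ with control := ctl } (!T.yRefs.isEmpty) := by
    intro T hT ctl
    rw [relay_request hT]
    refine ⟨⟨h1.state, h1.rest, h1.buffer, h1.le⟩, ?_⟩
    grind
  have hact : ∀ (a : RequesterAct) (pos : ℕ), y₁.controlHead = pos →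
      S.request rule sec msg r = (S.ySeek pos).yAct rule sec msg a →
      Lift (fun T s => ∃ y', RelayReady y' (!T.yRefs.isEmpty) ∧
        s = (T.transport (z.calledAs T.z) y' T.yRefs, q)) (S.request rule sec msg r)
        ((Sys.yNext rule sec (S₁.transport z y₁ S₁.yRefs : Sys D E relayer)
          (some (some (a, msg)))).map fun T => (T, q)) := by
    intro a pos hpos hreq
    have h4 := Sys.transport_yAct (S := S₁.ySeek pos) (z := z) (y := y₁) hz hpos rule sec msg a
    rw [show (S₁.ySeek pos).yAct rule sec msg a = S.request rule sec msg r by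
      rw [hreq]; exact Sys.yAct_active rule sec (S.ySeek pos) .requester msg a] at h4
    refine h4.support_left.map_right' ?_
    grind
  rw [hy] at h3
  cases r with
  | initiate =>
    by_cases he : S.yRefs = []
    · have : relayAct false false (!S.yRefs.isEmpty) = some .initiate := by simp [relayAct, he]
      simp [Relay.code, this]
      refine hact .initiate 0 h3 ?_
      simp [Sys.request, he]
    · have : relayAct false false (!S.yRefs.isEmpty) = none := by simp [relayAct, he]
      simp [Relay.code, this]
      have hreq : S.request rule sec msg .initiate = PMF.pure S.idle := if_neg he
      rw [hreq] at hready ⊢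
      simp only [Sys.yNext, PMF.pure_map]
      refine Lift.pure ⟨_, hready S.idle (by simp) y₁.control, ?_⟩
      have : (S₁.transport z y₁ S₁.yRefs : Sys D E relayer).idle = _ := Sys.transport_idle hz
      rw [this, Sys.idle_yRefs]
      rfl
  | input => exact hact .input 0 h3 rfl
  | inputDeletion => exact hact .input 1 h3 rfl
  | delete => exact hact .delete 0 h3 rfl

/-- The requester that passes on requests does so. -/
theorem relayer_delegate (σ : Strategy E.m) (rule : SidRule) (sec : ℕ) (B : Payoff) :
    Delegate (D := D) σ rule sec B true relayer RelayReady where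
  reactive := rfl
  initial := ⟨⟨rfl, rfl, rfl, le_rfl⟩, Nat.zero_le _⟩
  run S z y q msg r h hz := by
    simp
    set y₀ : ITI relayer.Y := { y with
      incoming := y.incoming ++ written (r.code.1 :: r.code.2 :: msg)
      caller := none } with hy₀
    have h0 : RelayState y₀ none (!S.yRefs.isEmpty)
        (some r.code.1 :: some r.code.2 :: (msg.map some ++ [none])) [] := by
      have hle : y.incomingHead = y.incoming.length :=
        le_antisymm h.1.le (List.drop_eq_nil_iff.1 h.1.rest)
      refine ⟨h.1.state, ?_, h.1.buffer, ?_⟩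
      · rw [hy₀]
        rw [hle, List.drop_left]
        simp [written]
      grind
    refine (relay_step (S := { S with active := .requester }) rfl
      (fun c => (h0.step_fetch h.2 c).2.1) fun c => ?_).matches
    obtain ⟨h1, -, h2⟩ := h0.step_fetch h.2 c
    refine (relay_step (S := { S with active := .requester }) rfl
      (fun c => (h1.step_second h2 c).2.1) fun c => ?_).matches
    obtain ⟨h3, -, h4⟩ := h1.step_second h2 c
    exact relay_copy (S := { S with active := .requester }) rfl msg (List.nil_append msg)
      (fun y h5 h6 => relay_final hz h5 h6) _ h3 h4
  rest S z y q h hz ha := by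
    refine .stutter (σ := fun b => ((S.transport z (y.step none b).1 S.yRefs : Sys D E relayer).idle, q))
      (Sys.payoff_of_active (by simp [Sys.transport, ha])) ?_ fun c => .here ?_
    · rw [microStep_relayer ha, ← Sys.coin_bind_pure]
      congr 1
      funext b
      rw [(h.1.step_none b).2.1]
      simp only [Sys.yNext, PMF.pure_map]
    · obtain ⟨h1, -, h2⟩ := h.1.step_none c
      refine ⟨_, ⟨by simpa using h1, h2.trans_le h.2⟩, ?_⟩
      rw [Sys.transport_idle hz, Sys.idle_yRefs]

end

/-! ### The machine that realizes a strategy -/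

section

variable {σ : Strategy E.m} {rule : SidRule} {sec : ℕ} {B : Payoff} {α : Type*}
  {rel : α → Sys D E R × Micro σ → Prop} {p : PMF α}

/-- The environment has the tapes that it should have. -/
structure Tapes (S : Sys D E idler) (z : ITI E.Z) (buffer : Str) : Prop where
  caller : z.caller = S.z.caller
  control : z.control = S.z.control
  output : z.output = S.z.output
  buffer : z.buffer = buffer

/-- A configuration of the machine that realizes a strategy. -/
def microState (S : Sys D E idler) (st : σ.St) (y : ITI R.Y) (task : Task E.m) (z : ITI E.Z) :
    Sys D E R × Micro σ :=
  (S.transport z y S.yRefs, ⟨st, task, z.controlHead, z.peerHead⟩)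

variable {S : Sys D E idler} {st : σ.St} {y : ITI R.Y} {task : Task E.m}

theorem microState_step (ha : S.active = .environment) (z : ITI E.Z) :
    microStep σ rule sec (microState (R := R) S st y task z) = Sys.coin.bind fun b =>
      let r := (⟨st, task, z.controlHead, z.peerHead⟩ : Micro σ).step
        (z.observe (S.zLook (z.controlHead, z.peerHead z.controlHead)) b)
      (Sys.zNext rule sec (S.transport (z.perform r.2 b).1 y S.yRefs : Sys D E R)
        (z.perform r.2 b).2).map fun T => (T, r.1) := microStep_environment ha

theorem payoff_microState (ha : S.active = .environment) (z : ITI E.Z) :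
    (microState (R := R) S st y task z).1.payoff B = 0 :=
  Sys.payoff_of_active (by simp [microState, Sys.transport, ha])

/-- The machine goes on computing. -/
theorem micro_cont (ha : S.active = .environment) {z : ITI E.Z}
    (h : ∀ o, ((⟨st, task, z.controlHead, z.peerHead⟩ : Micro σ).step o).2.signal = none)
    (hm : ∀ b, (fun r : Micro σ × Op (EnvAct E.m) =>
      Matches (microStep σ rule sec) (fun s => s.1.payoff B) rel p
        (S.transport (z.perform r.2 b).1 y S.yRefs, r.1))
      ((⟨st, task, z.controlHead, z.peerHead⟩ : Micro σ).step
        (z.observe (S.zLook (z.controlHead, z.peerHead z.controlHead)) b))) :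
    MatchesPos (microStep σ rule sec) (fun s => s.1.payoff B) rel p
      (microState S st y task z) := by
  refine MatchesPos.stutter (payoff_microState ha z) ?_ hm
  rw [microState_step ha, ← Sys.coin_bind_pure]
  refine congrArg _ (funext fun b => ?_)
  dsimp only
  rw [show (z.perform ((⟨st, task, z.controlHead, z.peerHead⟩ : Micro σ).step
    (z.observe (S.zLook (z.controlHead, z.peerHead z.controlHead)) b)).2 b).2 = none by
      simp [ITI.perform, h]]
  simp only [Sys.zNext, PMF.pure_map]

/-- Where the control head should be. -/
def Task.target (st : σ.St) : Task E.m → ℕ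
  | .look => (σ.look st).1
  | .send pos _ _ => pos

theorem Micro.step_right {q : Micro σ} (h : q.control < q.task.target q.st) (o : Obs) :
    q.step o = (q.moveControl .right, { (Op.nop o : Op (EnvAct E.m)) with moveControl := .right }) := by
  unfold Micro.step
  cases ht : q.task with
  | look | send =>
    rw [ht] at h
    exact if_pos h

theorem Micro.step_left {q : Micro σ} (h : q.task.target q.st < q.control) (o : Obs) :
    q.step o = (q.moveControl .left, { (Op.nop o : Op (EnvAct E.m)) with moveControl := .left }) := by
  unfold Micro.step
  cases ht : q.task with
  | look | send =>
    rw [ht] at h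
    have h' := Nat.lt_asymm h
    simp only [Task.target] at h h'
    grind

/-- The effect of a move of the control head. -/
theorem micro_moveControl (ha : S.active = .environment) {z : ITI E.Z} {d : Dir}
    (h : ∀ o, (⟨st, task, z.controlHead, z.peerHead⟩ : Micro σ).step o =
      ((⟨st, task, z.controlHead, z.peerHead⟩ : Micro σ).moveControl d,
        { (Op.nop o : Op (EnvAct E.m)) with moveControl := d })) {buf : Str} (hz : Tapes S z buf)
    (hm : ∀ z', Tapes S z' buf → z'.controlHead = d.moveNat z.controlHead →
      Matches (microStep σ rule sec) (fun s => s.1.payoff B) rel p (microState S st y task z')) :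
    MatchesPos (microStep σ rule sec) (fun s => s.1.payoff B) rel p (microState S st y task z) := by
  refine micro_cont ha (fun o => by rw [h]; rfl) fun b => ?_
  rw [h]
  have hp : (z.perform { (Op.nop (z.observe (S.zLook (z.controlHead, z.peerHead z.controlHead)) b) :
      Op (EnvAct E.m)) with moveControl := d } b).1.peerHead = z.peerHead := by
    funext i
    simp only [ITI.perform, Op.nop]
    split_ifs <;> rfl
  have := hm (z.perform { (Op.nop (z.observe (S.zLook (z.controlHead, z.peerHead z.controlHead)) b) :
      Op (EnvAct E.m)) with moveControl := d } b).1
    ⟨hz.caller, hz.control, hz.output, by simp [ITI.perform, Op.nop, hz.buffer]⟩ rfl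
  unfold microState at this
  rw [hp] at this
  exact this

/-- Induction on the distance between the control head and its destination; each move is an
additional step with a wasted coin. -/
theorem micro_seek (ha : S.active = .environment) {buf : Str}
    (hm : ∀ z, Tapes S z buf → z.controlHead = task.target st →
      MatchesPos (microStep σ rule sec) (fun s => s.1.payoff B) rel p (microState S st y task z))
    (z : ITI E.Z) (hz : Tapes S z buf) :
    MatchesPos (microStep σ rule sec) (fun s => s.1.payoff B) rel p (microState S st y task z) := by
  obtain ⟨n, hn⟩ : ∃ n, (task.target st - z.controlHead) + (z.controlHead - task.target st) = n :=
    ⟨_, rfl⟩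
  induction n generalizing z with
  | zero => grind
  | succ n ih =>
    rcases lt_trichotomy z.controlHead (task.target st) with h | h | h
    · exact micro_moveControl ha (Micro.step_right h) hz fun z' hz' hh =>
        (ih z' hz' (by rw [hh]; simp only [Dir.moveNat]; omega)).matches
    · omega
    · exact micro_moveControl ha (Micro.step_left h) hz fun z' hz' hh =>
        (ih z' hz' (by rw [hh]; simp only [Dir.moveNat]; omega)).matches

/-- The effect of a move of a head on the output tape of a client. -/
theorem micro_movePeer (ha : S.active = .environment) {z : ITI E.Z} {d : Dir}
    (h : ∀ o, (⟨st, task, z.controlHead, z.peerHead⟩ : Micro σ).step o =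
      ((⟨st, task, z.controlHead, z.peerHead⟩ : Micro σ).movePeer d,
        { (Op.nop o : Op (EnvAct E.m)) with movePeer := d })) {buf : Str} (hz : Tapes S z buf)
    (hm : ∀ z', Tapes S z' buf → z'.controlHead = z.controlHead →
      z'.peerHead z.controlHead = d.moveNat (z.peerHead z.controlHead) →
      Matches (microStep σ rule sec) (fun s => s.1.payoff B) rel p (microState S st y task z')) :
    MatchesPos (microStep σ rule sec) (fun s => s.1.payoff B) rel p (microState S st y task z) := by
  refine micro_cont ha (fun o => by rw [h]; rfl) fun b => ?_
  rw [h]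
  exact hm (z.perform { (Op.nop (z.observe (S.zLook (z.controlHead, z.peerHead z.controlHead)) b) :
      Op (EnvAct E.m)) with movePeer := d } b).1
    ⟨hz.caller, hz.control, hz.output, by simp [ITI.perform, Op.nop, hz.buffer]⟩ rfl
    (by simp [ITI.perform])

/-- The control head is brought into place first, because each controlled client has an output head
of its own; then that one is moved, by induction on its distance. -/
theorem micro_seekPeer (ha : S.active = .environment) {buf : Str}
    (hm : ∀ z, Tapes S z buf → (z.controlHead, z.peerHead z.controlHead) = σ.look st →
      MatchesPos (microStep σ rule sec) (fun s => s.1.payoff B) rel p (microState S st y .look z))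
    (z : ITI E.Z) (hz : Tapes S z buf) :
    MatchesPos (microStep σ rule sec) (fun s => s.1.payoff B) rel p (microState S st y .look z) := by
  refine micro_seek ha (fun z hz hc => ?_) z hz
  obtain ⟨n, hn⟩ : ∃ n, ((σ.look st).2 - z.peerHead z.controlHead) +
    (z.peerHead z.controlHead - (σ.look st).2) = n := ⟨_, rfl⟩
  have hc' : z.controlHead = (σ.look st).1 := hc
  induction n generalizing z with
  | zero => grind
  | succ n ih =>
    have hlt : ¬ z.controlHead < (σ.look st).1 := by omega
    have hgt : ¬ (σ.look st).1 < z.controlHead := by omega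
    rcases lt_trichotomy (z.peerHead z.controlHead) (σ.look st).2 with h | h | h
    · refine micro_movePeer (d := .right) ha (fun o => ?_) hz fun z' hz' h1 h2 =>
        (ih z' hz' (h1.trans hc) ?_ (h1.trans hc')).matches
      · simp [Micro.step, hlt, hgt, h]
      · rw [h1, h2]; simp only [Dir.moveNat]; omega
    · omega
    · have h' := Nat.lt_asymm h
      refine micro_movePeer (d := .left) ha (fun o => ?_) hz fun z' hz' h1 h2 =>
        (ih z' hz' (h1.trans hc) ?_ (h1.trans hc')).matches
      · simp [Micro.step, hlt, hgt, h, h']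
      · rw [h1, h2]; simp only [Dir.moveNat]; omega

/-- The message is composed. -/
theorem micro_emit (ha : S.active = .environment) {pos : ℕ} {a : EnvAct E.m} (l : Str)
    {msg buf : Str} (hl : buf ++ l = msg) (hm : ∀ z, Tapes S z msg → z.controlHead = pos →
      MatchesPos (microStep σ rule sec) (fun s => s.1.payoff B) rel p
        (microState S st y (.send pos [] a) z))
    (z : ITI E.Z) (hz : Tapes S z buf) (hc : z.controlHead = pos) :
    MatchesPos (microStep σ rule sec) (fun s => s.1.payoff B) rel p
      (microState S st y (.send pos l a) z) := by
  induction l generalizing z buf with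
  | nil =>
    grind
  | cons e l ih =>
    have hstep : ∀ o, (⟨st, .send pos (e :: l) a, z.controlHead, z.peerHead⟩ : Micro σ).step o =
        (⟨st, .send pos l a, z.controlHead, z.peerHead⟩,
          { (Op.nop o : Op (EnvAct E.m)) with emit := some e }) := by
      intro o
      simp [Micro.step, hc]
    refine micro_cont ha (fun o => by rw [hstep]; rfl) fun b => ?_
    rw [hstep]
    set z' := (z.perform { (Op.nop (z.observe (S.zLook (z.controlHead,
      z.peerHead z.controlHead)) b) : Op (EnvAct E.m)) with emit := some e } b).1 with hz'
    have hp : z'.peerHead = z.peerHead := by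
      funext i
      simp only [hz', ITI.perform, Op.nop]
      split_ifs <;> rfl
    have := ih (buf := buf ++ [e]) (by grind) z'
      ⟨hz.caller, hz.control, hz.output, by simp [hz', ITI.perform, Op.nop, hz.buffer]⟩
      (by rw [← hc]; rfl)
    unfold microState at this
    rw [hp] at this
    exact this.matches

theorem micro_send {pos : ℕ} {a : EnvAct E.m} {msg : Str} (ha : S.active = .environment)
    (hm : ∀ z, Tapes S z msg → z.controlHead = pos →
      MatchesPos (microStep σ rule sec) (fun s => s.1.payoff B) rel p
        (microState S st y (.send pos [] a) z)) (z : ITI E.Z) (hz : Tapes S z []) :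
    MatchesPos (microStep σ rule sec) (fun s => s.1.payoff B) rel p
      (microState S st y (.send pos msg a) z) :=
  micro_seek ha (fun z hz hc => micro_emit ha msg (List.nil_append msg) hm z hz hc) z hz

/-- The message is sent. -/
theorem microState_signal (ha : S.active = .environment) {pos : ℕ} {a : EnvAct E.m} {msg : Str}
    {z : ITI E.Z} (hz : Tapes S z msg) (hc : z.controlHead = pos) :
    ∃ ζ : Bool → ITI E.Z, (∀ b, Tapes S (ζ b) [] ∧ (ζ b).controlHead = pos ∧
        (ζ b).peerHead = z.peerHead) ∧
      microStep σ rule sec (microState (R := R) S st y (.send pos [] a) z) = Sys.coin.bind fun b =>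
        (Sys.zAct rule sec (S.transport (ζ b) y S.yRefs : Sys D E R) msg a).map fun T =>
          (T, ⟨st, .look, pos, z.peerHead⟩) := by
  have hstep : ∀ o, (⟨st, .send pos [] a, z.controlHead, z.peerHead⟩ : Micro σ).step o =
      (⟨st, .look, pos, z.peerHead⟩,
        { (Op.nop o : Op (EnvAct E.m)) with signal := some (some a) }) := by
    intro o
    simp [Micro.step, hc]
  refine ⟨fun b => (z.perform { (Op.nop (z.observe (S.zLook (z.controlHead,
      z.peerHead z.controlHead)) b) : Op (EnvAct E.m)) with signal := some (some a) } b).1,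
    fun b => ⟨⟨hz.caller, hz.control, hz.output, rfl⟩, hc, ?_⟩, ?_⟩
  · funext i
    simp only [ITI.perform, Op.nop]
    split_ifs <;> rfl
  · rw [microState_step ha]
    refine congrArg _ (funext fun b => ?_)
    rw [hstep]
    simp [ITI.perform, Op.nop, Sys.zNext, hz.buffer]

/-- A configuration of the execution with a strategy, and one with the machine that realizes it. -/
def Compiled (Ready : ITI R.Y → Bool → Prop) (c : Macro D E σ) (s : Sys D E R × Micro σ) : Prop :=
  ∃ z y, Tapes c.sys z [] ∧ Ready y (!c.sys.yRefs.isEmpty) ∧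
    s = microState c.sys c.st y (.ofPend c.pend) z

end

theorem Lift.map_left' {α β γ : Type*} {p : PMF α} {q : PMF β} {s : γ → β → Prop} {f : α → γ}
    (h : Lift (fun a b => s (f a) b) p q) : Lift s (p.map f) q :=
  (h.symm.map_right' (s := fun b c => s c b) fun _ _ hab => hab).symm

theorem Matches.map_left {α β γ : Type*} {stepS : β → PMF β} {payS : β → ℝ≥0∞}
    {rel : γ → β → Prop} {f : α → γ} {p : PMF α} {b : β}
    (h : Matches stepS payS (fun a b => rel (f a) b) p b) : Matches stepS payS rel (p.map f) b := by
  induction h with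
  | here h => rw [PMF.pure_map]; exact .here h
  | sync h1 h2 => exact .sync h1 h2.map_left'
  | flip h1 h2 _ ih => rw [PMF.map_bind]; exact .flip h1 h2 ih
  | wait h1 _ ih => exact .wait h1 ih

theorem MatchesPos.map_left {α β γ : Type*} {stepS : β → PMF β} {payS : β → ℝ≥0∞}
    {rel : γ → β → Prop} {f : α → γ} {p : PMF α} {b : β}
    (h : MatchesPos stepS payS (fun a b => rel (f a) b) p b) :
    MatchesPos stepS payS rel (p.map f) b := by
  cases h with
  | sync h1 h2 => exact .sync h1 h2.map_left'
  | flip h1 h2 h3 => rw [PMF.map_bind]; exact .flip h1 h2 fun c => (h3 c).map_left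
  | wait h1 h2 => exact .wait h1 fun b hb => (h2 b hb).map_left

namespace Sys

variable {S : Sys D E R} {rule : SidRule} {sec : ℕ}

theorem zAct_yRefs {msg : Str} {a : EnvAct E.m} (ha : a ≠ .toRequester)
    {T : Sys D E R} (hT : T ∈ (S.zAct rule sec msg a).support) : T.yRefs = S.yRefs := by
  have h := swap_zAct (S := S) (Z := E.Z) (z := S.z) (y := S.y) (yr := S.yRefs) rfl rfl rfl rfl
    rule sec msg a ha
  change S.zAct rule sec msg a = _ at h
  have h' : S.zAct rule sec msg a = (S.zAct rule sec msg a).map fun T =>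
    (T.transport (S.z.sync T.z) S.y S.yRefs : Sys D E R) := h
  have hT' := hT
  rw [h'] at hT'
  rw [PMF.mem_support_map_iff] at hT'
  obtain ⟨T', -, rfl⟩ := hT'
  rfl

theorem step_yRefs (hw : R.reactive = false ∨ ∀ t ∈ S.sessions, t.owner = .environment)
    (h1 : S.active ≠ .environment) (h2 : S.active ≠ .requester) {T : Sys D E R}
    (hT : T ∈ (S.step rule sec).support) : T.yRefs = S.yRefs := by
  have h := transport_step (S := S) (z := S.z) (y := S.y) (yr := S.yRefs) rfl rule sec
    (hw.imp (fun h => ⟨h, h⟩) id) h1 h2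
  change S.step rule sec = _ at h
  have hT' := hT
  rw [h, PMF.mem_support_map_iff] at hT'
  obtain ⟨T', -, rfl⟩ := hT'
  rfl

end Sys

/-- The machine that realizes a strategy does so. -/
theorem simulates_micro {σ : Strategy E.m}
    {rule : SidRule} {sec : ℕ} {B : Payoff} (hB : ∀ w o, B w o ≤ 1)
    {live : Bool} {Ready : ITI R.Y → Bool → Prop}
    (hd : Delegate (D := D) σ rule sec B live R Ready) :
    Simulates (Macro.step (D := D) live rule sec) (Macro.payoff B)
      (microStep σ rule sec) (fun s => s.1.payoff B) (fun _ => False) (Compiled Ready) where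
  payW_le := Macro.payoff_le_step B
  payS_le := payoff_le_microStep B
  payW_le_one c := Sys.payoff_le_one hB c.sys
  payS_le_one s := Sys.payoff_le_one hB s.1
  bad_step _ h := h.elim
  step := by
    rintro c s ⟨z, y, hz, hy, rfl⟩
    by_cases hdone : c.sys.active = .done
    · refine .inr (.inr ⟨fun n => ?_, Macro.val_of_done hdone⟩)
      rw [val_of_absorbing (microStep_done (by exact hdone))]
      simp only [Sys.payoff, Macro.payoff, microState, Sys.transport, hz.output]
    refine .inr (.inl ⟨Sys.payoff_of_active hdone, ?_⟩)
    by_cases ha : c.sys.active = .environment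
    · cases hp : c.pend with
      | none =>
        rw [Macro.step_next ha hp]
        refine micro_seekPeer ha (fun z hz hl => ?_) z hz
        have hl1 : z.controlHead = (σ.look c.st).1 := congrArg Prod.fst hl
        have hl2 : z.peerHead z.controlHead = (σ.look c.st).2 := congrArg Prod.snd hl
        have hstep : ∀ o, (⟨c.st, .look, z.controlHead, z.peerHead⟩ : Micro σ).step o =
            (⟨(σ.next c.st o.caller o.peer o.coin).1, .ofPend (σ.next c.st o.caller o.peer o.coin).2,
              z.controlHead, z.peerHead⟩, Op.nop o) := by
          intro o
          simp [Micro.step, hl1]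
          grind
        set f : Bool → Macro D E σ := fun b =>
          ⟨c.sys, (σ.next c.st (decide (c.sys.z.caller = some (σ.look c.st).1))
            (c.sys.zLook (σ.look c.st)) b).1, (σ.next c.st (decide (c.sys.z.caller =
              some (σ.look c.st).1)) (c.sys.zLook (σ.look c.st)) b).2⟩ with hf
        change MatchesPos _ _ _ (Sys.coin.bind fun b => PMF.pure (f b)) _
        -- Only the step that reads the symbol and decides uses its coin. It is the coin that the
        -- strategy is given; all coins tossed while the heads were moving are wasted.
        refine MatchesPos.flip (σ := fun b => microState c.sys (f b).st y (.ofPend (f b).pend)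
          (z.perform (Op.nop (z.observe (c.sys.zLook (σ.look c.st)) b)) b).1)
          (payoff_microState ha z) ?_ fun b =>
            .here ⟨(z.perform (Op.nop (z.observe (c.sys.zLook (σ.look c.st)) b)) b).1, y,
              ⟨hz.caller, hz.control, hz.output, by simp [ITI.perform, Op.nop, hz.buffer]⟩, hy, rfl⟩
        rw [microState_step ha, ← Sys.coin_bind_pure]
        refine congrArg _ (funext fun b => ?_)
        rw [hstep, hl]
        have hph : (z.perform (Op.nop (z.observe (c.sys.zLook (σ.look c.st)) b) :
            Op (EnvAct E.m)) b).1.peerHead = z.peerHead := by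
          funext i
          simp only [ITI.perform, Op.nop]
          split_ifs <;> rfl
        simp only [microState, hph]
        simp only [ITI.perform, Op.nop, Option.map_none, Sys.zNext, PMF.pure_map, hf, ITI.observe,
          hz.caller, hl1]
        rfl
      | some o =>
        rw [Macro.step_pend ha hp]
        cases o with
        | own pos msg a =>
          refine micro_send ha (fun z hz hc => ?_) z hz
          obtain ⟨ζ, hζ, hstep⟩ := microState_signal (R := R) (σ := σ)
            (st := c.st) (y := y) (a := a.act) ha hz hc
          refine .sync (payoff_microState ha z) ?_
          rw [hstep, ← PMF.bind_const Sys.coin (PMF.map _ _)]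
          refine Lift.bind _ fun b _ => ?_
          obtain ⟨h1, h2, h3⟩ := hζ b
          have := Sys.swap_zAct (S := c.sys.zSeek pos) (Z := E.Z) (z := ζ b) (y := y)
            (yr := c.sys.yRefs) h1.caller h1.control h1.output h2 rule sec msg a.act a.act_ne
          have h4 : Sys.zAct rule sec (c.sys.transport (ζ b) y c.sys.yRefs : Sys D E R) msg a.act =
            ((c.sys.zSeek pos).zAct rule sec msg a.act).map fun T =>
              T.transport ((ζ b).sync T.z) y c.sys.yRefs := this
          rw [h4, PMF.map_comp]
          refine Lift.map _ fun T hT => ?_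
          have hyr : T.yRefs = c.sys.yRefs := Sys.zAct_yRefs (S := c.sys.zSeek pos) a.act_ne hT
          refine ⟨(ζ b).sync T.z, y, ⟨rfl, rfl, rfl, h1.buffer⟩, by rwa [hyr], ?_⟩
          simp only [microState, hyr, Function.comp]
          rw [← h2, ← h3]
          rfl
        | relay msg r =>
          refine micro_send ha (fun z hz hc => ?_) z hz
          obtain ⟨ζ, hζ, hstep⟩ := microState_signal (R := R) (σ := σ)
            (st := c.st) (y := y) (a := .toRequester) ha hz hc
          refine MatchesPos.stutter (σ := fun b =>
            (({ c.sys with active := .requester } : Sys D E idler).transport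
              { ζ b with outgoing := (ζ b).outgoing ++ written (r.code.1 :: r.code.2 :: msg) }
              { y with
                incoming := y.incoming ++ written (r.code.1 :: r.code.2 :: msg)
                caller := none } c.sys.yRefs, ⟨c.st, .look, 0, z.peerHead⟩))
            (payoff_microState ha z) ?_ fun b => ?_
          · rw [hstep, ← Sys.coin_bind_pure]
            refine congrArg _ (funext fun b => ?_)
            rw [Sys.zAct_toRequester, PMF.pure_map]
            rfl
          · obtain ⟨h1, h2, h3⟩ := hζ b
            -- The request is on the requester's incoming tape now; the rest of the match is the
            -- requester's business, described by `Delegate.run`.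
            refine Matches.map_left ((hd.run c.sys _ y _ msg r hy (by exact h1.caller)).mono ?_)
            rintro T s hT ⟨y', h4, rfl⟩
            have hTz : T.z.control = c.sys.z.control ∧ T.z.output = c.sys.z.output := by
              cases live with
              | true => exact Sys.request_z hT
              | false =>
                simp_all
            refine ⟨({ ζ b with
                outgoing := (ζ b).outgoing ++ written (r.code.1 :: r.code.2 :: msg) } :
                ITI E.Z).calledAs T.z, y',
              ⟨rfl, h1.control.trans hTz.1.symm, h1.output.trans hTz.2.symm,
              h1.buffer⟩, h4, ?_⟩
            rw [← h2, ← h3]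
            rfl
    · rw [Macro.step_of_ne ha]
      refine MatchesPos.map_left ?_
      by_cases hr : c.sys.active = .requester
      · rw [Sys.step_requester_halted rule sec hr rfl]
        refine (hd.rest c.sys z y ⟨c.st, .ofPend c.pend, z.controlHead, z.peerHead⟩ hy hz.caller
          hr).mono ?_
        rintro T s hT ⟨y', h4, rfl⟩
        obtain rfl := mem_pure.1 hT
        exact ⟨z.calledAs c.sys.idle.z, y', ⟨rfl, hz.control.trans (by simp), hz.output.trans (by simp), hz.buffer⟩, h4,
          rfl⟩
      · refine .sync (Sys.payoff_of_active hdone) ?_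
        have := Sys.transport_step (S := c.sys) (z := z) (y := y) (yr := c.sys.yRefs) (E' := E)
          (R' := R) hz.caller rule sec (.inl ⟨rfl, hd.reactive⟩) ha hr
        have h4 : microStep σ rule sec (microState c.sys c.st y (.ofPend c.pend) z) = _ :=
          microStep_of_ne (by exact ha)
        rw [h4, show (microState c.sys c.st y (.ofPend c.pend) z).1 =
          c.sys.transport z y c.sys.yRefs from rfl, this, PMF.map_comp]
        refine Lift.map_right _ fun T hT => ?_
        have hyr : T.yRefs = c.sys.yRefs := Sys.step_yRefs (.inl rfl) ha hr hT
        have hTz := Sys.step_calledAs (.inl rfl) ha hr hT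
        refine ⟨z.calledAs T.z, y, ⟨rfl, ?_, ?_, hz.buffer⟩, by rwa [hyr], ?_⟩
        · rw [← hTz]; exact hz.control
        · rw [← hTz]; exact hz.output
        · simp only [microState, hyr, Function.comp]
          rfl

theorem value_micro_eq {σ : Strategy E.m}
    {rule : SidRule} {sec : ℕ} {B : Payoff} (hB : ∀ w o, B w o ≤ 1)
    {live : Bool} {Ready : ITI R.Y → Bool → Prop}
    (hd : Delegate (D := D) σ rule sec B live R Ready) :
    value (microStep σ rule sec) (fun s => s.1.payoff B) (Sys.initial D E R sec, Micro.start σ) =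
      value (Macro.step live rule sec) (Macro.payoff B) (Macro.initial D E σ sec) :=
  (simulates_micro hB hd).value_eq ⟨_, _, ⟨rfl, rfl, rfl, rfl⟩, hd.initial, rfl⟩

/-! ## Machines that halt after a given number of steps -/

/-- The machine that halts after `B` steps. -/
def ITM.cap {A : Type} (M : ITM A) (B : ℕ) : ITM A where
  Q := M.Q × Fin (B + 1)
  finite := by
    have := M.finite
    infer_instance
  start := (M.start, 0)
  halt q := M.halt q.1 || decide (B ≤ q.2)
  δ q o := (((M.δ q.1 o).1, ⟨min (q.2 + 1) B, by omega⟩), (M.δ q.1 o).2)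

theorem ITM.cap_ppt {A : Type} (M : ITM A) (B : ℕ) : (M.cap B).PPT := by
  refine ⟨B, fun s hs => ?_⟩
  suffices h : s.randomness.length = s.state.2 by
    have := s.state.2.isLt
    omega
  induction hs with
  | create => rfl
  | step s p c _ hh ih =>
    simp only [ITI.halted, cap, Bool.or_eq_false_iff, decide_eq_false_iff_not] at hh
    simp [ITI.step, cap, ih]
    omega
  | extend s _ _ _ _ _ _ _ ih => exact ih

def Requester.cap (R : Requester) (B : ℕ) : Requester := ⟨R.Y.cap B, R.reactive⟩

theorem Requester.Oblivious.cap (h : R.Oblivious) (B : ℕ) : (R.cap B).Oblivious :=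
  ⟨h.1, fun q o p => by simp only [Requester.cap, ITM.cap, h.2]⟩

instance : Finite Protocol :=
  Finite.of_injective (fun p : Protocol => decide (p = .main)) fun p q => by
    cases p <;> cases q <;> simp

instance : Finite Obs :=
  Finite.of_injective (fun o : Obs =>
    (o.ident, o.input, o.work, o.incoming, o.control, o.caller, o.peer, o.coin)) fun o o' h => by
      cases o
      cases o'
      simpa using h

/-- The memory after the given observations. -/
def Micro.after {m : ℕ} (σ : Strategy m) (l : List Obs) : Micro σ :=
  l.foldl (fun q o => (q.step o).1) (Micro.start σ)

theorem Micro.after_append {m : ℕ} (σ : Strategy m) (l : List Obs) (o : Obs) :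
    Micro.after σ (l ++ [o]) = ((Micro.after σ l).step o).1 := by
  simp [Micro.after]

/-- The machine that follows a strategy for `T` steps. It memorizes all its observations. -/
def Strategy.machine {m : ℕ} (σ : Strategy m) (T : ℕ) : ITM (EnvAct m) where
  Q := {l : List Obs // l.length ≤ T}
  finite := (List.finite_length_le Obs T).to_subtype
  start := ⟨[], Nat.zero_le T⟩
  halt l := decide (T ≤ l.1.length)
  δ l o := (if h : l.1.length < T then ⟨l.1 ++ [o], by simpa using h⟩ else l,
    ((Micro.after σ l.1).step o).2)

/-- The number of steps is bounded by the constant `T`, which the additive term of the bound covers.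
As each security parameter is treated separately, `T` and all data of the strategy may be
hard-wired. -/
theorem Strategy.machine_ppt {m : ℕ} (σ : Strategy m) (T : ℕ) : (σ.machine T).PPT := by
  refine ⟨T, fun s hs => ?_⟩
  suffices h : s.randomness.length = s.state.1.length by
    have := s.state.2
    omega
  induction hs with
  | create => rfl
  | step s p c _ hh ih =>
    have hh : s.state.1.length < T := by
      simpa [ITI.halted, machine] using hh
    simp [ITI.step, machine, ih, hh]
  | extend s _ _ _ _ _ _ _ ih => exact ih

/-! ## The requester that passes on requests has one session of `π` -/

/-- The number of sessions of `π` that are initiated by an action. -/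
def RequesterAct.sessions : RequesterAct → ℕ
  | .initiate => 1
  | _ => 0

namespace Sys

variable {S : Sys D E R} {rule : SidRule} {sec : ℕ}

/-- The sessions on the control tape of the requester are its own. -/
structure Owned (S : Sys D E R) : Prop where
  consistent : Consistent D S.sessions S.zRefs S.z.control
  owner : ∀ i, Ref.session i ∈ S.yRefs → ∃ t, S.sessions[i]? = some t ∧ t.owner = .requester

theorem Owned.initial (sec : ℕ) : (Sys.initial D E R sec).Owned :=
  ⟨(Ghost.inv_initial (R := R) 0 sec).consistent, by simp [Sys.initial]⟩

theorem owner_of_grows {ss ss' : List Session} (hg : Grows ss ss') {i : ℕ}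
    (h : ∃ t, ss[i]? = some t ∧ t.owner = .requester) :
    ∃ t, ss'[i]? = some t ∧ t.owner = .requester := by
  obtain ⟨t, h1, h2⟩ := h
  obtain ⟨t', h3, h4, -⟩ := hg i t h1
  exact ⟨t', h3, h4.owner.trans h2⟩

theorem Owned.step (h : S.Owned) (ha : S.active ≠ .requester) {T : Sys D E R}
    (hT : T ∈ (S.step rule sec).support) : T.Owned := by
  have := Moves.step h.consistent ha hT
  refine ⟨this.consistent, fun i hi => ?_⟩
  rw [this.yRefs] at hi
  exact owner_of_grows this.grows (h.owner i hi)

theorem Owned.yAct (h : S.Owned) {msg : Str} {a : RequesterAct} {T : Sys D E R}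
    (hT : T ∈ (S.yAct rule sec msg a).support) :
    T.Owned ∧ T.y.state = S.y.state ∧ (mainIndices T.sessions).length ≤
      (mainIndices S.sessions).length + a.sessions := by
  have hidle : ∀ S' : Sys D E R, S'.sessions = S.sessions → S'.zRefs = S.zRefs →
      S'.z.control = S.z.control → (∀ i, Ref.session i ∈ S'.yRefs → .session i ∈ S.yRefs) →
      S'.Owned := fun S' h1 h2 h3 h4 =>
    ⟨by rw [h1, h2, h3]; exact h.consistent, fun i hi => by rw [h1]; exact h.owner i (h4 i hi)⟩
  cases a with
  | input =>
    obtain rfl := mem_pure.1 hT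
    cases ht : S.yTarget with
    | none =>
      simp only [writeClient]
      exact ⟨hidle _ (by simp) (by simp) (by simp) (by simp), by simp, by simp [RequesterAct.sessions]⟩
    | some j =>
      rw [writeClient_some]
      have hg : Grows S.sessions (S.sessions.modify j (Session.clientInput msg)) :=
        Grows.modify fun t ht => ⟨Session.evolves_clientInput _ _,
          by simp [Session.input, Session.clientInput, Session.mapClient]⟩
      refine ⟨⟨?_, fun i hi => owner_of_grows hg (h.owner i hi)⟩, rfl, ?_⟩
      · exact h.consistent.modify fun t ht => ⟨Session.evolves_clientInput _ _,
          by simp [Session.input, Session.clientInput, Session.mapClient], rfl⟩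
      · dsimp only
        rw [mainIndices_congr (by simp) hg]
        simp
  | initiate =>
    simp only [Sys.yAct] at hT
    rw [initiate_eq, PMF.mem_support_map_iff] at hT
    obtain ⟨sid, -, rfl⟩ := hT
    refine ⟨⟨?_, fun i hi => ?_⟩, rfl, ?_⟩
    · exact h.consistent.append_requester rfl ⟨rfl, Reachable.create _ _⟩ rfl
    · rcases List.mem_append.1 hi with hi | hi
      · exact owner_of_grows (Grows.append _ _) (h.owner i hi)
      · obtain rfl : i = S.sessions.length := by simpa using hi
        exact ⟨.fresh D sec .main .requester (D.client .main) msg sid, by simp [addSession], rfl⟩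
    · simp [addSession, mainIndices_append, Session.isMain, Session.fresh, RequesterAct.sessions]
  | delete =>
    rw [yAct_delete] at hT
    split at hT
    · simp_all
    · next j hj =>
      obtain ⟨h1, -⟩ := mainSession_eq_some hj
      obtain ⟨t, h2, h3⟩ := h.owner j (List.mem_of_getElem? h1)
      set S₁ := S.yEntry .deletion (.deletionOf j)
      rcases S₁.requestDeletion_cases j with ⟨t', tok, h4, h5, h6⟩ | h4
      · obtain rfl : t = t' := some_unique h2 h4
        rw [requestDeletion_eq rule sec _ h4 h5 h6, PMF.mem_support_map_iff] at hT
        obtain ⟨sid, -, rfl⟩ := hT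
        refine ⟨⟨?_, fun i hi => ?_⟩, rfl, ?_⟩
        · exact h.consistent.withDeletion h2 h6 rfl rfl rfl
            (fun _ => ⟨rfl, Reachable.create _ _⟩) (.inl ⟨h3, rfl, rfl⟩)
        · exact owner_of_grows (Grows.withDeletion h2 h6 _)
            (h.owner i (by simpa [S₁, addDeletion, yEntry] using hi))
        · exact (congrArg List.length (mainIndices_withDeletion h2 h6 rfl)).le.trans
            (Nat.le_add_right _ _)
      · rw [requestDeletion_eq_idle rule sec _ h4, mem_pure] at hT
        subst hT
        exact ⟨hidle _ (by simp [S₁, yEntry]) (by simp [S₁, yEntry]) (by simp [S₁, yEntry])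
          (by simp [S₁, yEntry]), by simp [S₁, yEntry], by simp [S₁, yEntry]⟩

end Sys

theorem relayMove_initiate {q : RelayMode × Bool} {o : Obs} {s : Option Sym}
    (h : (relayMove q o s).2.signal = some (some .initiate)) :
    q.2 = false ∧ (relayMove q o s).1.2 = true := by
  obtain ⟨mode, flag⟩ := q
  rcases s with _ | _ | e <;> rcases mode with _ | ⟨b, _ | b'⟩ <;>
    simp [relayMove, Op.nop, relayAct] at h ⊢
  grind

theorem relayMove_flag {q : RelayMode × Bool} {o : Obs} {s : Option Sym} (h : q.2 = true) :
    (relayMove q o s).1.2 = true := by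
  obtain ⟨mode, flag⟩ := q
  rcases s with _ | _ | e <;> rcases mode with _ | ⟨b, _ | b'⟩ <;>
    simp_all [relayMove, Op.nop]

/-- There is no session of `π` of the requester before its flag is set and at most one afterwards.
The flag is never unset, initiation occurs only while it is unset and sets it, and steps of other
machines do not create such sessions. -/
theorem relayer_representative (rule : SidRule) (D : DataCollector) (B : ℕ) :
    Representative rule D 1 (relayer.cap B) := by
  intro E _ sec n
  have key : ∀ S ∈ (run rule D E (relayer.cap B) sec n).support,
      S.Owned ∧ (mainIndices S.sessions).length ≤
        if (S.y.state : (RelayMode × Bool) × Fin (B + 1)).1.2 then 1 else 0 := by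
    rw [run_eq_iter]
    refine iter_invariant ⟨Sys.Owned.initial sec, Nat.zero_le _⟩ ?_ n
    rintro S ⟨h1, h2⟩ T hT
    by_cases ha : S.active = .requester
    · by_cases hh : S.y.halted = true
      · rw [Sys.step_requester_halted rule sec ha hh, mem_pure] at hT
        subst hT
        exact ⟨⟨by simpa using h1.consistent, by simpa using h1.owner⟩, by simpa using h2⟩
      · rw [Bool.not_eq_true] at hh
        rw [Sys.step_requester rule sec ha hh, PMF.mem_support_bind_iff] at hT
        obtain ⟨b, -, hT⟩ := hT
        set y' := (S.y.step S.yPeer b).1 with hy'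
        set S₁ : Sys D E (relayer.cap B) := { S with y := y' } with hS₁
        have h3 : S₁.Owned := ⟨h1.consistent, h1.owner⟩
        set q : RelayMode × Bool := (S.y.state : (RelayMode × Bool) × Fin (B + 1)).1 with hq
        have h4 : ((S₁.y.state : (RelayMode × Bool) × Fin (B + 1)).1.2) =
          (relayStep q (S.y.observe S.yPeer b)).1.2 := rfl
        have h5 : (S.y.step S.yPeer b).2 =
          (relayStep q (S.y.observe S.yPeer b)).2.signal.map fun a => a.map fun b' => (b',
            S.y.buffer ++ (relayStep q (S.y.observe S.yPeer b)).2.emit.toList) := rfl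
        have h6 : (mainIndices S.sessions).length ≤
            if (S₁.y.state : (RelayMode × Bool) × Fin (B + 1)).1.2 then 1 else 0 := by
          rw [h4]
          by_cases hf : q.2 = true
          · rw [relayStep, relayMove_flag hf]
            grind
          grind
        cases hs : (S.y.step S.yPeer b).2 with
        | none =>
          rw [hs] at hT
          simp [Sys.yNext] at hT
          grind
        | some r =>
          cases r with
          | none =>
            rw [hs] at hT
            obtain rfl := mem_pure.1 hT
            exact ⟨⟨by simpa using h3.consistent, by simpa using h3.owner⟩, by simpa using h6⟩
          | some r =>
            obtain ⟨a, msg⟩ := r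
            rw [hs] at hT
            obtain ⟨h7, h8, h9⟩ := h3.yAct hT
            refine ⟨h7, ?_⟩
            rw [h8]
            by_cases hi : a = .initiate
            · subst hi
              have h11 : (relayStep q (S.y.observe S.yPeer b)).2.signal = some (some .initiate) := by
                simp_all
              have h10 := relayMove_initiate h11
              rw [h4, relayStep, h10.2]
              rw [if_neg (by grind)] at h2
              have : (mainIndices S₁.sessions).length = (mainIndices S.sessions).length := rfl
              simp
              simp only [RequesterAct.sessions] at h9
              omega
            · cases a <;> first | exact (hi rfl).elim | exact h9.trans h6
    · have := Sys.Moves.step h1.consistent ha hT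
      obtain ⟨inc, c, hy⟩ := this.y
      refine ⟨h1.step ha hT, ?_⟩
      rw [this.mains, hy]
      exact h2
  intro S hS
  have := (key S hS).2
  rw [length_mainIndices] at this
  refine le_trans this ?_
  grind

/-- The same instance with another program, in a given state. -/
def ITI.recast {A : Type} {M N : ITM A} (s : ITI M) (q : N.Q) : ITI N where
  state := q
  ident := s.ident
  input := s.input
  output := s.output
  work := s.work
  incoming := s.incoming
  outgoing := s.outgoing
  randomness := s.randomness
  control := s.control
  identHead := s.identHead
  inputHead := s.inputHead
  workHead := s.workHead
  incomingHead := s.incomingHead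
  controlHead := s.controlHead
  peerHead := s.peerHead
  buffer := s.buffer
  caller := s.caller

namespace Sys

section

variable {E E' : Environment} {R R' : Requester} {S : Sys D E R}
  {z : ITI E'.Z} {y : ITI R'.Y} {rule : SidRule} {sec : ℕ}

theorem requestDeletion_y {i : ℕ} {C : ITM PartyAct} {T : Sys D E R}
    (hT : T ∈ (S.requestDeletion rule sec i C).support) : T.y = S.y := by
  rcases S.requestDeletion_cases i with ⟨t, tok, h3, h4, h5⟩ | h3
  · rw [requestDeletion_eq rule sec _ h3 h4 h5, PMF.mem_support_map_iff] at hT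
    obtain ⟨sid, -, rfl⟩ := hT
    rfl
  · rw [requestDeletion_eq_idle rule sec _ h3, mem_pure] at hT
    rw [hT, idle_y]

/-- If the control tapes of the two requesters agree beforehand, the new one can be read off from
the result. This gives an equality of distributions, stronger than the lifting in `transport_yAct`.
-/
theorem transport_yAct_eq (h1 : z.caller = S.z.caller) (h2 : y.controlHead = S.y.controlHead)
    (h3 : y.control = S.y.control) (rule : SidRule) (sec : ℕ) (msg : Str) (a : RequesterAct) :
    (S.transport z y S.yRefs : Sys D E' R').yAct rule sec msg a =
      (S.yAct rule sec msg a).map fun T =>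
        T.transport (z.calledAs T.z) { y with control := T.y.control } T.yRefs := by
  cases a with
  | input =>
    have ht : (S.transport z y S.yRefs : Sys D E' R').yTarget = S.yTarget := by
      unfold yTarget
      simp only [transport, h2]
      rfl
    simp only [yAct, PMF.pure_map]
    rw [ht, transport_writeClient h1, writeClient_yRefs]
    have : (S.writeClient S.yTarget msg).y = S.y := by
      cases S.yTarget <;> simp [writeClient]
    rw [this, ← h3]
  | initiate =>
    simp only [yAct, initiate_eq, PMF.map_comp]
    congr 1
    funext sid
    simp only [Function.comp, addSession, transport, h3]
    rw [show z.calledAs S.z = z from calledAs_self h1]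
  | delete =>
    have hm : (S.transport z y S.yRefs : Sys D E' R').mainSession
        ((S.transport z y S.yRefs : Sys D E' R').yRefs[(S.transport z y S.yRefs :
          Sys D E' R').y.controlHead]?) = S.mainSession (S.yRefs[S.y.controlHead]?) := by
      unfold mainSession
      simp only [transport, h2]
      rfl
    rw [yAct_delete, yAct_delete, hm]
    split
    · rw [PMF.pure_map, transport_idle h1, idle_yRefs, idle_y, ← h3]
    · next j hj =>
      have := transport_requestDeletion (S := S.yEntry .deletion (.deletionOf j)) (z := z)
        (y := { y with control := y.control ++ [.deletion] }) (yr := S.yRefs ++ [.deletionOf j])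
        (E' := E') (R' := R') h1 rule sec j (D.client .deletion)
      rw [show (S.transport z y S.yRefs : Sys D E' R').yEntry .deletion (.deletionOf j) =
        (S.yEntry .deletion (.deletionOf j)).transport z
          { y with control := y.control ++ [.deletion] } (S.yRefs ++ [.deletionOf j]) from rfl, this]
      refine map_congr_support fun T hT => ?_
      rw [requestDeletion_yRefs hT, requestDeletion_y hT, h3]
      rfl

theorem yAct_fields {msg : Str} {a : RequesterAct} {T : Sys D E R}
    (hT : T ∈ (S.yAct rule sec msg a).support) :
    S.z.calledAs T.z = T.z ∧ { S.y with control := T.y.control } = T.y := by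
  have h := transport_yAct_eq (S := S) (z := S.z) (y := S.y) rfl rfl rfl rule sec msg a
  change S.yAct rule sec msg a = _ at h
  have hT' := hT
  rw [h, PMF.mem_support_map_iff] at hT'
  obtain ⟨T', -, rfl⟩ := hT'
  exact ⟨rfl, rfl⟩

theorem step_y (hw : R.reactive = false) (h1 : S.active ≠ .environment)
    (h2 : S.active ≠ .requester) {T : Sys D E R} (hT : T ∈ (S.step rule sec).support) :
    T.y = S.y := by
  have h := transport_step (S := S) (z := S.z) (y := S.y) (yr := S.yRefs) rfl rule sec
    (.inl ⟨hw, hw⟩) h1 h2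
  change S.step rule sec = _ at h
  have hT' := hT
  rw [h, PMF.mem_support_map_iff] at hT'
  obtain ⟨T', -, rfl⟩ := hT'
  rfl

theorem zAct_y {msg : Str} {a : EnvAct E.m} (ha : a ≠ .toRequester)
    {T : Sys D E R} (hT : T ∈ (S.zAct rule sec msg a).support) : T.y = S.y := by
  have h := swap_zAct (S := S) (Z := E.Z) (z := S.z) (y := S.y) (yr := S.yRefs) rfl rfl rfl rfl
    rule sec msg a ha
  have h' : S.zAct rule sec msg a = (S.zAct rule sec msg a).map fun T =>
    (T.transport (S.z.sync T.z) S.y S.yRefs : Sys D E R) := h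
  have hT' := hT
  rw [h', PMF.mem_support_map_iff] at hT'
  obtain ⟨T', -, rfl⟩ := hT'
  rfl

/-! ### When the requester is activated -/

theorem idle_active_ne (S : Sys D E R) : S.idle.active ≠ .requester := by
  unfold idle
  grind

theorem writeClient_active_ne (S : Sys D E R) (i : Option ℕ) (msg : Str) :
    (S.writeClient i msg).active ≠ .requester := by
  cases i with
  | none => exact idle_active_ne S
  | some i => simp [writeClient]

theorem requestDeletion_active_ne {i : ℕ} {C : ITM PartyAct} {T : Sys D E R}
    (hT : T ∈ (S.requestDeletion rule sec i C).support) : T.active ≠ .requester := by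
  rcases S.requestDeletion_cases i with ⟨t, tok, h3, h4, h5⟩ | h3
  · rw [requestDeletion_eq rule sec _ h3 h4 h5, PMF.mem_support_map_iff] at hT
    obtain ⟨sid, -, rfl⟩ := hT
    simp [addDeletion]
  · rw [requestDeletion_eq_idle rule sec _ h3, mem_pure] at hT
    rw [hT]
    exact idle_active_ne S

theorem initiate_active_ne {p : Protocol} {w : Owner} {C : ITM PartyAct} {msg : Str}
    {T : Sys D E R} (hT : T ∈ (S.initiate rule sec p w C msg).support) :
    T.active ≠ .requester := by
  rw [initiate_eq, PMF.mem_support_map_iff] at hT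
  obtain ⟨sid, -, rfl⟩ := hT
  simp [addSession]

theorem yAct_active_ne {msg : Str} {a : RequesterAct} {T : Sys D E R}
    (hT : T ∈ (S.yAct rule sec msg a).support) : T.active ≠ .requester := by
  cases a with
  | input =>
    simp [yAct] at hT
    exact hT ▸ writeClient_active_ne _ _ _
  | initiate => exact initiate_active_ne hT
  | delete =>
    rw [yAct_delete] at hT
    split at hT
    · simp at hT
      exact hT ▸ idle_active_ne _
    · exact requestDeletion_active_ne hT

theorem zAct_active_ne {msg : Str} {a : EnvAct E.m} (ha : a ≠ .toRequester)
    {T : Sys D E R} (hT : T ∈ (S.zAct rule sec msg a).support) : T.active ≠ .requester := by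
  cases a with
  | toRequester => grind
  | toCollector | endAlive =>
    simp [zAct] at hT
    grind
  | input =>
    simp [zAct] at hT
    exact hT ▸ writeClient_active_ne _ _ _
  | initiate => exact initiate_active_ne hT
  | delete =>
    simp only [zAct] at hT
    split at hT
    · simp at hT
      exact hT ▸ idle_active_ne _
    · exact requestDeletion_active_ne hT
  | output =>
    simp [zAct] at hT
    exact hT ▸ idle_active_ne _

/-- A requester that does not react is activated by messages of the environment only, so no other
machine can start an activation of it. This matters for counting its steps. -/
theorem step_active_ne (hw : R.reactive = false) (h1 : S.active ≠ .environment)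
    (h2 : S.active ≠ .requester) {T : Sys D E R} (hT : T ∈ (S.step rule sec).support) :
    T.active ≠ .requester := by
  have hcore : S.active.IsCore → T.active ≠ .requester := by
    intro hco
    rw [step_core rule sec S hco, PMF.mem_support_map_iff] at hT
    obtain ⟨b, -, rfl⟩ := hT
    have h3 : (S.upd b).active ≠ .requester := fun h => by
      have := S.upd_active b
      rw [h] at this
      exact this
    unfold applyUpd finish
    split
    · exact h3
    · exact idle_active_ne _
    · split
      · exact h3
      · unfold notifyOwner
        split
        · simp
        · rw [hw]
          exact idle_active_ne _
  cases hact : S.active with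
  | requester => grind
  | environment => grind
  | collector => exact hcore (by rw [hact]; trivial)
  | client i => exact hcore (by rw [hact]; trivial)
  | server i => exact hcore (by rw [hact]; trivial)
  | scheduler =>
    rw [step_scheduler rule sec hact, schedule_eq] at hT
    split at hT
    · simp_all
    · split at hT
      · exact requestDeletion_active_ne hT
      · split at hT
        · split at hT <;> simp at hT <;>
            grind
        simp_all
  | done =>
    rw [step_done rule sec hact, mem_pure] at hT
    grind

end

/-! ### The machine of bounded length and that of unbounded length -/

variable {σ : Strategy E.m} {T B : ℕ} {rule : SidRule} {sec : ℕ}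

/-- The configuration without bounds. -/
def uncap (S : Sys D (E.withZ (σ.machine T)) (R.cap B)) : Sys D E R × Micro σ :=
  (S.transport (S.z.recast (M := σ.machine T) E.Z.start)
    (S.y.recast (M := R.Y.cap B) (N := R.Y) (S.y.state : R.Y.Q × Fin (B + 1)).1) S.yRefs,
    Micro.after σ (S.z.state : {l : List Obs // l.length ≤ T}).1)

/-- The counters are right. -/
structure Counted (S : Sys D (E.withZ (σ.machine T)) (R.cap B)) : Prop where
  environment : (S.z.state : {l : List Obs // l.length ≤ T}).1.length = S.z.randomness.length
  requester : ((S.y.state : R.Y.Q × Fin (B + 1)).2 : ℕ) = S.y.randomness.length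

variable {S : Sys D (E.withZ (σ.machine T)) (R.cap B)}

theorem uncap_idle : S.idle.uncap = (S.uncap.1.idle, S.uncap.2) := by
  unfold idle
  by_cases h : S.alive = true
  · rw [if_pos h, if_pos (show S.uncap.1.alive = true from h)]
    rfl
  · rw [if_neg h, if_neg (show ¬ S.uncap.1.alive = true from h)]
    rfl

theorem Counted.idle (h : S.Counted) : S.idle.Counted := by
  refine ⟨?_, ?_⟩
  · rw [idle_z_eq]
    exact h.environment
  · rw [idle_y]
    exact h.requester

theorem lift_zNext (h : S.Counted) (s : Option (Option (EnvAct E.m × Str))) :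
    Lift (fun S' t => t = S'.uncap ∧ S'.Counted) (S.zNext rule sec s)
      ((S.uncap.1.zNext rule sec s).map fun T' => (T', S.uncap.2)) := by
  rcases s with _ | _ | ⟨a, msg⟩
  · simp only [zNext, PMF.pure_map]
    exact Lift.pure ⟨rfl, h⟩
  · simp only [zNext, PMF.pure_map]
    exact Lift.pure ⟨uncap_idle.symm, h.idle⟩
  · by_cases ha : a = .toRequester
    · subst ha
      simp only [zNext, zAct_toRequester, PMF.pure_map]
      exact Lift.pure ⟨rfl, h.environment, h.requester⟩
    · have h1 := swap_zAct (E := E.withZ (σ.machine T)) (S := S) (Z := E.Z) (z := S.uncap.1.z) (y := S.uncap.1.y) (yr := S.yRefs)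
        rfl rfl rfl rfl rule sec msg a ha
      have h2 : S.uncap.1.zAct rule sec msg a = (S.zAct rule sec msg a).map fun T' =>
        (T'.transport (S.uncap.1.z.sync T'.z) S.uncap.1.y S.yRefs : Sys D E R) := h1
      simp only [zNext]
      rw [h2, PMF.map_comp]
      refine Lift.map_right _ fun T' hT => ?_
      have h3 := zAct_y (S := S) ha hT
      have h4 := zAct_sync (S := S) ha hT
      have h5 := zAct_yRefs (S := S) ha hT
      refine ⟨?_, ?_, ?_⟩
      · unfold uncap
        rw [← h4, h3, h5]
        rfl
      · rw [← h4]
        exact h.environment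
      · rw [h3]
        exact h.requester

theorem lift_yNext (h : S.Counted) (s : Option (Option (RequesterAct × Str))) :
    Lift (fun S' t => t = S'.uncap ∧ S'.Counted) (S.yNext rule sec s)
      ((S.uncap.1.yNext rule sec s).map fun T' => (T', S.uncap.2)) := by
  rcases s with _ | _ | ⟨a, msg⟩
  · simp only [yNext, PMF.pure_map]
    exact Lift.pure ⟨rfl, h⟩
  · simp only [yNext, PMF.pure_map]
    exact Lift.pure ⟨uncap_idle.symm, h.idle⟩
  · have h1 := transport_yAct_eq (S := S) (E' := E) (z := S.uncap.1.z) (y := S.uncap.1.y)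
      rfl rfl rfl rule sec msg a
    have h2 : S.uncap.1.yAct rule sec msg a = _ := h1
    simp only [yNext]
    rw [h2, PMF.map_comp]
    refine Lift.map_right _ fun T' hT => ?_
    obtain ⟨h3, h4⟩ := yAct_fields (S := S) hT
    refine ⟨?_, ?_, ?_⟩
    · unfold uncap
      rw [← h3, ← h4]
      rfl
    · rw [← h3]
      exact h.environment
    · rw [← h4]
      exact h.requester

/-- Before a bound is reached, the bounded machines do what the unbounded ones do: the environment
recomputes its memory from the list of its observations, and the requester merely carries a counter
along. -/
theorem lift_uncap (hr : R.reactive = false) (h : S.Counted) (hz : S.z.randomness.length < T)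
    (hy : S.y.randomness.length < B ∨ ∀ q, R.Y.halt q = true) :
    Lift (fun S' t => t = S'.uncap ∧ S'.Counted) (S.step rule sec)
      (microStep σ rule sec S.uncap) := by
  by_cases ha : S.active = .environment
  · have hl : (S.z.state : {l : List Obs // l.length ≤ T}).1.length < T := h.environment ▸ hz
    have hh : S.z.halted = false := by
      simpa [ITI.halted, Environment.withZ, Strategy.machine] using hl
    rw [step_environment rule sec ha hh, microStep_environment (s := S.uncap) ha]
    refine Lift.bind _ fun b _ => ?_
    set S₁ : Sys D (E.withZ (σ.machine T)) (R.cap B) :=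
      { S with z := (S.z.step S.zPeer b).1 } with hS₁
    have h1 : (S₁.z.state : {l : List Obs // l.length ≤ T}).1 =
        (S.z.state : {l : List Obs // l.length ≤ T}).1 ++ [S.z.observe S.zPeer b] := by
      have : (S₁.z.state : {l : List Obs // l.length ≤ T}) =
        if h : (S.z.state : {l : List Obs // l.length ≤ T}).1.length < T then
          ⟨(S.z.state : {l : List Obs // l.length ≤ T}).1 ++ [S.z.observe S.zPeer b],
            by simpa using h⟩ else S.z.state := rfl
      grind
    have h2 : S₁.Counted := by
      refine ⟨?_, h.requester⟩
      rw [h1]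
      simp [hS₁, ITI.step, h.environment]
    have := lift_zNext (rule := rule) (sec := sec) h2 (S.z.step S.zPeer b).2
    have h3 : S₁.uncap.2 = (S.uncap.2.step (S.uncap.1.z.observe S.uncap.1.zPeer b)).1 := by
      change Micro.after σ (S₁.z.state : {l : List Obs // l.length ≤ T}).1 = _
      rw [h1, Micro.after_append]
      rfl
    rw [h3] at this
    exact this
  · by_cases hq : S.active = .requester
    · rw [microStep_of_ne (s := S.uncap) ha]
      by_cases hh : R.Y.halt (S.y.state : R.Y.Q × Fin (B + 1)).1 = true
      · rw [step_requester_halted rule sec hq (by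
          simp only [ITI.halted, Requester.cap, ITM.cap, hh, Bool.true_or]),
          step_requester_halted (S := S.uncap.1) rule sec hq hh, PMF.pure_map]
        exact Lift.pure ⟨uncap_idle.symm, h.idle⟩
      · have hlt : ((S.y.state : R.Y.Q × Fin (B + 1)).2 : ℕ) < B := by
          rcases hy with hy | hy
          · rw [h.requester]
            exact hy
          grind
        rw [Bool.not_eq_true] at hh
        have hh' : S.y.halted = false := by
          simp [ITI.halted, Requester.cap, ITM.cap, hh, decide_eq_false_iff_not]
          omega
        rw [step_requester rule sec hq hh', step_requester (S := S.uncap.1) rule sec hq hh,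
          PMF.map_bind]
        refine Lift.bind _ fun b _ => ?_
        set S₁ : Sys D (E.withZ (σ.machine T)) (R.cap B) :=
          { S with y := (S.y.step S.yPeer b).1 } with hS₁
        have h2 : S₁.Counted := by
          refine ⟨h.environment, ?_⟩
          have h3 : ((S₁.y.state : R.Y.Q × Fin (B + 1)).2 : ℕ) =
            min (((S.y.state : R.Y.Q × Fin (B + 1)).2 : ℕ) + 1) B := rfl
          rw [h3, min_eq_left (by omega), h.requester]
          simp [hS₁, ITI.step]
        exact lift_yNext h2 (S.y.step S.yPeer b).2
    · rw [microStep_of_ne (s := S.uncap) ha]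
      have h1 := transport_step (S := S) (E' := E) (R' := R) (z := S.uncap.1.z)
        (y := S.uncap.1.y) (yr := S.yRefs) rfl rule sec (.inl ⟨hr, hr⟩) ha hq
      have h2 : S.uncap.1.step rule sec = _ := h1
      rw [h2, PMF.map_comp]
      refine Lift.map_right _ fun T' hT => ?_
      have h3 := step_calledAs (S := S) (.inl hr) ha hq hT
      have h4 := step_y (S := S) hr ha hq hT
      have h5 := step_yRefs (S := S) (.inl hr) ha hq hT
      refine ⟨?_, ?_, ?_⟩
      · unfold uncap
        rw [← h3, h4, h5]
        rfl
      · rw [← h3]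
        exact h.environment
      · rw [h4]
        exact h.requester

end Sys

/-- Every step of the machine ends the activation or reads a symbol of the incoming tape. -/
def ITM.Thrifty {A : Type} (M : ITM A) : Prop :=
  ∀ q o, M.halt q = false → (M.δ q o).2.signal.isSome = true ∨
    (o.incoming.isSome = true ∧ (M.δ q o).2.readIncoming = true)

theorem thrifty_of_halted {A : Type} {M : ITM A} (h : ∀ q, M.halt q = true) : M.Thrifty :=
  fun q o hq => by grind

theorem relayer_thrifty : relayer.Y.Thrifty := by
  rintro ⟨mode, flag⟩ o -
  change (relayMove (mode, flag) o o.incoming).2.signal.isSome = true ∨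
    (_ ∧ (relayMove (mode, flag) o o.incoming).2.readIncoming = true)
  rcases o.incoming with _ | _ | e <;> rcases mode with _ | ⟨b, _ | b'⟩ <;>
    simp [relayMove]

theorem length_written_le (m : Str) : (written m).length ≤ m.length + 1 := by
  unfold written
  grind

/-! ### The running time of the relaying requester -/

section

variable {σ : Strategy E.m} {rule : SidRule} {sec : ℕ}

/-- The number of steps of the requester is bounded by that of the environment. -/
def Budget (S : Sys D E R) : Prop :=
  S.y.randomness.length + (S.y.incoming.length - S.y.incomingHead) + S.z.buffer.length +
    (if S.active = .requester then 1 else 0) ≤ 3 * S.z.randomness.length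

/-- The constant `3` arises as follows. A step of the environment puts at most one symbol into its
buffer; when it sends, one separator is added and one activation begins. A step of a thrifty
requester is paid for by a symbol that ceases to be unread or by the end of an activation. Thus a
requester capped at `3 * T` steps never reaches its cap while the environment is within `T`. -/
theorem budget_microStep (hr : R.reactive = false) (ht : R.Y.Thrifty)
    {s : Sys D E R × Micro σ} (h : Budget s.1) {t : Sys D E R × Micro σ}
    (hs : t ∈ (microStep σ rule sec s).support) : Budget t.1 := by
  obtain ⟨S, q⟩ := s
  dsimp only at h
  by_cases ha : S.active = .environment
  · rw [microStep_environment (s := (S, q)) ha, PMF.mem_support_bind_iff] at hs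
    obtain ⟨b, -, hs⟩ := hs
    rw [PMF.mem_support_map_iff] at hs
    obtain ⟨T, hT, rfl⟩ := hs
    dsimp only at hT ⊢
    generalize (q.step (S.z.observe S.zPeer b)).2 = op at hT
    unfold Budget at h ⊢
    rw [if_neg (by simp [ha])] at h
    have hem : op.emit.toList.length ≤ 1 := by grind
    set S₁ : Sys D E R := { S with z := (S.z.perform op b).1 } with hS₁
    have h1 : S₁.z.randomness.length = S.z.randomness.length + 1 := by simp [hS₁, ITI.perform]
    have h2 : S₁.z.buffer = if op.signal.isSome then [] else S.z.buffer ++ op.emit.toList := rfl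
    have hlen : (S.z.buffer ++ op.emit.toList).length ≤ S.z.buffer.length + 1 := by
      grind
    have hy : S₁.y = S.y := rfl
    have ha₁ : S₁.active ≠ .requester := by grind
    have hsig : (S.z.perform op b).2 =
      op.signal.map fun a => a.map fun b => (b, S.z.buffer ++ op.emit.toList) := rfl
    rw [hsig] at hT
    cases hs : op.signal with
    | none =>
      rw [hs] at hT h2
      simp [Sys.zNext] at hT
      grind
    | some r =>
      rw [hs] at hT h2
      simp [Option.isSome_some] at h2
      have h3 : S₁.z.buffer.length = 0 := by rw [h2]; rfl
      cases r with
      | none =>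
        obtain rfl := mem_pure.1 hT
        rw [if_neg (Sys.idle_active_ne _), Sys.idle_z_eq, Sys.idle_y]
        grind
      | some a =>
        simp only [Option.map_some, Sys.zNext] at hT
        by_cases hto : a = .toRequester
        · subst hto
          rw [Sys.zAct_toRequester, mem_pure] at hT
          subst hT
          have := length_written_le (S.z.buffer ++ op.emit.toList)
          grind
        · rw [if_neg (Sys.zAct_active_ne hto hT), ← Sys.zAct_sync hto hT, Sys.zAct_y hto hT]
          change _ + S₁.z.buffer.length + _ ≤ 3 * S₁.z.randomness.length
          grind
  · rw [microStep_of_ne (s := (S, q)) ha, PMF.mem_support_map_iff] at hs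
    obtain ⟨T, hT, rfl⟩ := hs
    dsimp only at hT ⊢
    by_cases hq : S.active = .requester
    · unfold Budget at h ⊢
      rw [if_pos hq] at h
      by_cases hh : S.y.halted = true
      · rw [Sys.step_requester_halted rule sec hq hh, mem_pure] at hT
        subst hT
        rw [if_neg (Sys.idle_active_ne _), Sys.idle_z_eq, Sys.idle_y]
        grind
      · rw [Bool.not_eq_true] at hh
        rw [Sys.step_requester rule sec hq hh, PMF.mem_support_bind_iff] at hT
        obtain ⟨b, -, hT⟩ := hT
        have hth := ht S.y.state (S.y.observe S.yPeer b) hh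
        set S₁ : Sys D E R := { S with y := (S.y.step S.yPeer b).1 } with hS₁
        have h1 : S₁.y.randomness.length = S.y.randomness.length + 1 := by simp [hS₁, ITI.step]
        have h2 : S₁.y.incoming = S.y.incoming := rfl
        have h3 : S₁.y.incomingHead = if (R.Y.δ S.y.state (S.y.observe S.yPeer b)).2.readIncoming
          then S.y.incomingHead + 1 else S.y.incomingHead := rfl
        have h4 : S.y.incomingHead ≤ S₁.y.incomingHead := by
          grind
        have hsig : (S.y.step S.yPeer b).2 =
          (R.Y.δ S.y.state (S.y.observe S.yPeer b)).2.signal.map fun a => a.map fun b' =>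
            (b', S.y.buffer ++ (R.Y.δ S.y.state (S.y.observe S.yPeer b)).2.emit.toList) := rfl
        rw [hsig] at hT
        cases hs : (R.Y.δ S.y.state (S.y.observe S.yPeer b)).2.signal with
        | none =>
          rw [hs] at hT hth
          simp [Sys.yNext] at hT
          obtain ⟨h5, h6⟩ := hth.resolve_left (by simp)
          rw [h6, if_pos rfl] at h3
          have h7 : S.y.incomingHead < S.y.incoming.length := by
            simpa [ITI.observe] using h5
          grind
        | some r =>
          rw [hs] at hT
          cases r with
          | none =>
            obtain rfl := mem_pure.1 hT
            rw [if_neg (Sys.idle_active_ne _), Sys.idle_z_eq, Sys.idle_y]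
            grind
          | some a =>
            simp [Sys.yNext] at hT
            obtain ⟨h5, h6⟩ := Sys.yAct_fields hT
            rw [if_neg (Sys.yAct_active_ne hT), ← h5, ← h6]
            change S₁.y.randomness.length + (S₁.y.incoming.length - S₁.y.incomingHead) +
              S.z.buffer.length + 0 ≤ 3 * S.z.randomness.length
            rw [h1, h2]
            omega
    · unfold Budget at h ⊢
      rw [if_neg hq] at h
      rw [if_neg (Sys.step_active_ne hr ha hq hT), Sys.step_y hr ha hq hT,
        ← Sys.step_calledAs (.inl hr) ha hq hT]
      exact h

/-- The environment tosses at most one coin per step. -/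
theorem Sys.step_z_randomness {S T : Sys D E R} (hr : R.reactive = false)
    (hT : T ∈ (S.step rule sec).support) :
    S.z.randomness.length ≤ T.z.randomness.length ∧
      T.z.randomness.length ≤ S.z.randomness.length + 1 := by
  by_cases ha : S.active = .environment
  · by_cases hh : S.z.halted = true
    · rw [step_environment_halted rule sec ha hh, mem_pure] at hT
      aesop
    · rw [Bool.not_eq_true] at hh
      rw [step_environment rule sec ha hh, PMF.mem_support_bind_iff] at hT
      obtain ⟨b, -, hT⟩ := hT
      suffices h : T.z.randomness = (S.z.step S.zPeer b).1.randomness by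
        rw [h]
        simp [ITI.step]
      revert hT
      rcases (S.z.step S.zPeer b).2 with _ | _ | ⟨a, msg⟩ <;> intro hT
      · simp [zNext] at hT
        rw [hT]
      · simp [zNext] at hT
        rw [hT, idle_z_eq]
      · by_cases hto : a = .toRequester
        · subst hto
          simp only [zNext] at hT
          rw [zAct_toRequester, mem_pure] at hT
          rw [hT]
        · rw [← zAct_sync hto hT]
          rfl
  · suffices h : T.z.randomness = S.z.randomness by simp [h]
    by_cases hq : S.active = .requester
    · by_cases hh : S.y.halted = true
      · rw [step_requester_halted rule sec hq hh, mem_pure] at hT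
        rw [hT, idle_z_eq]
      · rw [Bool.not_eq_true] at hh
        rw [step_requester rule sec hq hh, PMF.mem_support_bind_iff] at hT
        obtain ⟨b, -, hT⟩ := hT
        revert hT
        rcases (S.y.step S.yPeer b).2 with _ | _ | ⟨a, msg⟩ <;> intro hT
        · simp [yNext] at hT
          rw [hT]
        · simp [yNext] at hT
          rw [hT, idle_z_eq]
        · rw [← (yAct_fields hT).1]
          rfl
    · rw [← step_calledAs (.inl hr) ha hq hT]
      rfl

end

/-- The distinguisher that looks at the state of the collector and the output of the environment,
provided that the environment has made less than `T` steps. -/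
def timely (C : (ℤ → Option Bool) → List Sym → PMF Bool) (T : ℕ) : Distinguisher := fun o =>
  if o.2.randomness.length < T then C o.1 o.2.output else PMF.pure false

/-! ### Cutting off after `T` steps, and letting `T` grow -/

section

variable {σ : Strategy E.m} {rule : SidRule}
  {sec T : ℕ} {C : (ℤ → Option Bool) → List Sym → PMF Bool}
  {S : Sys D (E.withZ (σ.machine T)) (R.cap (3 * T))}

theorem pay_timely (hz : S.z.randomness.length < T) :
    S.pay (timely C T) = S.uncap.1.payoff fun w o => C w o true := by
  unfold Sys.pay Sys.payoff timely
  simp [Sys.outcome, hz]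
  rfl

/-- The number of steps of the environment never decreases, so an execution that is late remains
late and pays nothing. -/
theorem val_timely_eq_zero (hr : R.reactive = false) (n : ℕ) (hz : T ≤ S.z.randomness.length) :
    val (Sys.step rule sec) (Sys.pay (timely C T)) n S = 0 := by
  induction n generalizing S with
  | zero =>
    unfold val Sys.pay timely
    simp [Sys.outcome, not_lt.2 hz]
  | succ n ih =>
    rw [val, ev_congr (g := fun _ => 0) fun S' hS => ih
      (hz.trans (Sys.step_z_randomness (S := S) hr hS).1), ev_const]

theorem Budget.requester_lt (h : Budget S.uncap.1) (hz : S.z.randomness.length < T) :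
    S.y.randomness.length < 3 * T := by
  have h1 : S.y.randomness.length + (S.y.incoming.length - S.y.incomingHead) + S.z.buffer.length +
    (if S.active = .requester then 1 else 0) ≤ 3 * S.z.randomness.length := h
  omega

/-- Cutting off can only lose: while the environment is in time the executions coincide, and
afterwards the left-hand side vanishes. -/
theorem val_timely_le (hr : R.reactive = false) (ht : R.Y.Thrifty) (n : ℕ) (hc : S.Counted)
    (hb : Budget S.uncap.1) :
    val (Sys.step rule sec) (Sys.pay (timely C T)) n S ≤
      val (microStep σ rule sec) (fun s => s.1.payoff fun w o => C w o true) n S.uncap := by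
  induction n generalizing S with
  | zero =>
    by_cases hz : S.z.randomness.length < T
    · exact (pay_timely hz).le
    · rw [val_timely_eq_zero hr 0 (not_lt.1 hz)]
      exact zero_le
  | succ n ih =>
    by_cases hz : S.z.randomness.length < T
    · refine (Sys.lift_uncap hr hc hz
        (.inl (hb.requester_lt hz))).support_both.1 _ _ ?_
      rintro S' t ⟨⟨rfl, h1⟩, -, h2⟩
      exact ih h1 (budget_microStep hr ht hb h2)
    · rw [val_timely_eq_zero hr _ (not_lt.1 hz)]
      exact zero_le

/-- Each step of the execution involves at most one step of the environment, so under `hz` it is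
still in time after `n` further steps and nothing is lost. -/
theorem le_val_timely (hr : R.reactive = false) (ht : R.Y.Thrifty) (n : ℕ) (hc : S.Counted)
    (hb : Budget S.uncap.1) (hz : S.z.randomness.length + n < T) :
    val (microStep σ rule sec) (fun s => s.1.payoff fun w o => C w o true) n S.uncap ≤
      val (Sys.step rule sec) (Sys.pay (timely C T)) n S := by
  induction n generalizing S with
  | zero => exact (pay_timely (by omega)).ge
  | succ n ih =>
    refine (Sys.lift_uncap hr hc (by omega)
      (.inl (hb.requester_lt (by omega)))).support_both.2 _ _ ?_
    rintro S' t ⟨⟨rfl, h1⟩, h2, h3⟩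
    have h4 := Sys.step_z_randomness (S := S) hr h2
    exact ih h1 (budget_microStep hr ht hb h3) (by omega)

theorem counted_initial : (Sys.initial D (E.withZ (σ.machine T)) (R.cap (3 * T)) sec).Counted :=
  ⟨rfl, rfl⟩

variable {live : Bool} {Ready : ITI R.Y → Bool → Prop}

theorem prob_timely_le (ht : R.Y.Thrifty)
    (hd : Delegate (D := D) σ rule sec (fun w o => C w o true) live R Ready) (T : ℕ) :
    prob rule D (E.withZ (σ.machine T)) (R.cap (3 * T)) sec (timely C T) ≤
      value (Macro.step live rule sec) (Macro.payoff fun w o => C w o true)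
        (Macro.initial D E σ sec) := by
  rw [← value_micro_eq (fun w o => PMF.coe_le_one _ _) hd, prob_eq_value]
  exact iSup_mono fun n => val_timely_le hd.reactive ht n counted_initial (by
    simp [Budget, Sys.uncap, Sys.initial, Sys.transport, ITI.recast, ITI.create])

theorem le_prob_timely (ht : R.Y.Thrifty)
    (hd : Delegate (D := D) σ rule sec (fun w o => C w o true) live R Ready) {δ : ℝ≥0∞}
    (hδ : δ ≠ 0) :
    ∃ T₀, ∀ T, T₀ ≤ T →
      value (Macro.step live rule sec) (Macro.payoff fun w o => C w o true)
        (Macro.initial D E σ sec) ≤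
      prob rule D (E.withZ (σ.machine T)) (R.cap (3 * T)) sec (timely C T) + δ := by
  rw [← value_micro_eq (fun w o => PMF.coe_le_one _ _) hd]
  set V := value (microStep (D := D) (R := R) σ rule sec)
    (fun s => s.1.payoff fun w o => C w o true) (Sys.initial D E R sec, Micro.start σ) with hV
  obtain ⟨n, hn⟩ : ∃ n, V ≤ val (microStep (D := D) (R := R) σ rule sec)
      (fun s => s.1.payoff fun w o => C w o true) n (Sys.initial D E R sec, Micro.start σ) + δ := by
    by_cases h0 : V = 0
    · exact ⟨0, by rw [h0]; exact zero_le⟩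
    have hV1 : V ≠ ⊤ := ne_top_of_le_ne_top ENNReal.one_ne_top
      (value_le_one (pay := fun s : Sys D E R × Micro σ => s.1.payoff fun w o => C w o true)
        (fun s => Sys.payoff_le_one (fun w o => PMF.coe_le_one _ _) s.1) _)
    obtain ⟨n, hn⟩ := lt_iSup_iff.1 (show V - δ < _ from ENNReal.sub_lt_self hV1 h0 hδ)
    exact ⟨n, tsub_le_iff_right.1 hn.le⟩
  -- Within the `n` steps that yield all but `δ` of the value, the environment makes fewer than `n +
  -- 1` steps.
  refine ⟨n + 1, fun T hT => hn.trans ?_⟩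
  gcongr
  rw [prob_eq_value]
  refine le_trans ?_ (val_le_value (step := Sys.step rule sec) n _)
  exact le_val_timely hd.reactive ht n counted_initial
    (by simp [Budget, Sys.uncap, Sys.initial, Sys.transport, ITI.recast, ITI.create])
    (by simp [Sys.initial, ITI.create]; omega)

end

theorem ofReal_advantage_le {rule : SidRule}
    {sec : ℕ} {C : Requester → Prop} (hE : E.PPT) (hR : R.Y.PPT) (hC : C R) (A : Distinguisher) :
    ENNReal.ofReal (advantage rule D E R sec A) ≤ complianceError rule D C sec := by
  unfold complianceError
  exact le_iSup_of_le E (le_iSup_of_le hE (le_iSup_of_le R (le_iSup_of_le hR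
    (le_iSup_of_le hC (le_iSup_of_le A le_rfl)))))

theorem prob_le_one (rule : SidRule) (D : DataCollector) (E : Environment) (R : Requester)
    (sec : ℕ) (A : Distinguisher) : prob rule D E R sec A ≤ 1 :=
  iSup_le fun _ => PMF.coe_le_one _ _

theorem le_add_ofReal_abs {a b : ℝ≥0∞} (ha : a ≤ 1) (hb : b ≤ 1) :
    a ≤ b + ENNReal.ofReal |a.toReal - b.toReal| := by
  have ha' := ne_top_of_le_ne_top ENNReal.one_ne_top ha
  have hb' := ne_top_of_le_ne_top ENNReal.one_ne_top hb
  rw [← ENNReal.ofReal_toReal ha', ← ENNReal.ofReal_toReal hb',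
    ← ENNReal.ofReal_add ENNReal.toReal_nonneg (abs_nonneg _)]
  refine ENNReal.ofReal_le_ofReal ?_
  rw [ENNReal.toReal_ofReal ENNReal.toReal_nonneg, ENNReal.toReal_ofReal ENNReal.toReal_nonneg]
  grind

/-- Whether or not the requests of a strategy are met makes little difference. -/
theorem Macro.value_le_add (hE : ∀ i, (E.adv i).PPT)
    (σ : Strategy E.m) (rule : SidRule) (sec : ℕ) (C : (ℤ → Option Bool) → List Sym → PMF Bool) :
    value (Macro.step true rule sec) (Macro.payoff fun w o => C w o true)
        (Macro.initial D E σ sec) ≤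
      value (Macro.step false rule sec) (Macro.payoff fun w o => C w o true)
        (Macro.initial D E σ sec) + representativeError rule D 1 sec ∧
    value (Macro.step false rule sec) (Macro.payoff fun w o => C w o true)
        (Macro.initial D E σ sec) ≤
      value (Macro.step true rule sec) (Macro.payoff fun w o => C w o true)
        (Macro.initial D E σ sec) + representativeError rule D 1 sec := by
  have hl := relayer_delegate (D := D) σ rule sec fun w o => C w o true
  have hd := idler_delegate (D := D) σ rule sec fun w o => C w o true
  have hi : ∀ q, idler.Y.halt q = true := fun _ => rfl
  -- For each `T` this is an advantage: the capped relayer is 1-representative and PPT, and the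
  -- execution with the capped idle requester has the same success probability as the ideal one.
  have key : ∀ T, ENNReal.ofReal |(prob rule D (E.withZ (σ.machine T)) (relayer.cap (3 * T)) sec
        (timely C T)).toReal - (prob rule D (E.withZ (σ.machine T)) (idler.cap (3 * T)) sec
        (timely C T)).toReal| ≤ representativeError rule D 1 sec := by
    intro T
    have hE' : (E.withZ (σ.machine T)).PPT := ⟨σ.machine_ppt T, hE⟩
    have ho : idler.Oblivious := ⟨rfl, fun _ _ _ => rfl⟩
    rw [prob_of_halted (R := idler.cap (3 * T)) (fun q => by
      aesop) (ho.cap _) hE']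
    exact ofReal_advantage_le hE' (relayer.Y.cap_ppt _) (relayer_representative rule D _) _
  constructor
  · refine ENNReal.le_of_forall_pos_le_add fun ε hε _ => ?_
    -- A single large `T` suffices, chosen for the side to be estimated; on the other side the
    -- cut-off only decreases the probability, whatever `T` is.
    obtain ⟨T, hT⟩ := le_prob_timely relayer_thrifty hl (δ := ε) (by simpa using hε.ne')
    refine (hT T le_rfl).trans ?_
    gcongr
    refine (le_add_ofReal_abs (prob_le_one ..) (prob_le_one ..)).trans (add_le_add ?_ (key T))
    exact prob_timely_le (thrifty_of_halted hi) hd T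
  · refine ENNReal.le_of_forall_pos_le_add fun ε hε _ => ?_
    obtain ⟨T, hT⟩ := le_prob_timely (thrifty_of_halted hi) hd (δ := ε) (by simpa using hε.ne')
    refine (hT T le_rfl).trans ?_
    gcongr
    have := key T
    rw [abs_sub_comm] at this
    refine (le_add_ofReal_abs (prob_le_one ..) (prob_le_one ..)).trans (add_le_add ?_ this)
    exact prob_timely_le relayer_thrifty hl T

/-! ## The environment that runs the requester itself, but for one session -/

/-- What can be done to a session of the requester. -/
inductive Chore
  | run
  | delete
  | runDeletion
  deriving DecidableEq

def Chore.relay : Chore → Relay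
  | .run => .input
  | .delete => .delete
  | .runDeletion => .inputDeletion

/-- How often the procedure of the terminate phase may do it. -/
def Chore.limit (T : ℕ) : Chore → ℕ
  | .delete => 1
  | _ => T

/-- What is going on. `wake` is the phase of finding out who has caused the activation. -/
inductive Mode
  | wake (n : ℕ)
  | environment
  | requester
  | scheduler
  | ending

/-- The memory of an environment that runs the environment `E` and the requester `R`. It knows the
sessions of `R` by their ordinals. `clients`, `main` and `deletion` tell the positions on its control
tape, which has length `len`, of the clients of the environment, of those of the sessions of `R` and
of those of their deletions. `counts` tells what the procedure of the terminate phase has done. -/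
structure Mind (E : Environment) (R : Requester) where
  z : ITI E.Z
  y : ITI R.Y
  entries : List (Bool × ℕ)
  count : ℕ
  clients : List ℕ
  main : ℕ → ℕ
  deletion : ℕ → ℕ
  len : ℕ
  alive : Bool
  mode : Mode
  counts : Chore → ℕ → ℕ

/-- The environment with the client programs of the collector at its disposal. -/
def Environment.extend (E : Environment) (D : DataCollector) : Environment where
  m := E.m + 2
  Z :=
    { Q := Unit
      finite := inferInstance
      start := ()
      halt := fun _ => true
      δ := fun _ o => ((), Op.nop o) }
  adv := Fin.addCases (motive := fun _ => ITM PartyAct) E.adv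
    fun i => D.client (if i = 0 then .main else .deletion)

theorem Environment.extend_ppt (h : E.PPT) (D : DataCollector)
    (i : Fin (E.extend D).m) : ((E.extend D).adv i).PPT := by
  refine Fin.addCases (m := E.m) (n := 2) (fun i => ?_) (fun i => ?_) i
  · simpa only [extend, Fin.addCases_left] using h.2 i
  · simpa only [extend, Fin.addCases_right] using D.client_ppt _

/-- The client program of the environment. -/
def Environment.old (E : Environment) (D : DataCollector) (i : Fin E.m) : Fin (E.extend D).m :=
  Fin.castAdd 2 i

/-- The client program of the collector. -/
def Environment.client (E : Environment) (D : DataCollector) (p : Protocol) :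
    Fin (E.extend D).m :=
  Fin.natAdd E.m (if p = .main then 0 else 1)

theorem Environment.adv_old (E : Environment) (D : DataCollector) (i : Fin E.m) :
    (E.extend D).adv (E.old D i) = E.adv i := by
  change Fin.addCases (m := E.m) (n := 2) (motive := fun _ => ITM PartyAct) E.adv
    (fun i => D.client (if i = 0 then .main else .deletion)) (Fin.castAdd 2 i) = _
  grind

theorem Environment.adv_client (E : Environment) (D : DataCollector) (p : Protocol) :
    (E.extend D).adv (E.client D p) = D.client p := by
  change Fin.addCases (m := E.m) (n := 2) (motive := fun _ => ITM PartyAct) E.adv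
    (fun i => D.client (if i = 0 then .main else .deletion)) (Fin.natAdd E.m _) = _
  rw [Fin.addCases_right]
  cases p <;> simp

namespace Mind

/-- The position of the client with a given position on the control tape of `E`. -/
def pos (s : Mind E R) (h : ℕ) : ℕ := (s.clients[h]?).getD s.len

/-- Nobody has been written to. -/
def idle (s : Mind E R) : Mind E R :=
  if s.alive then { s with z := { s.z with caller := none }, mode := .environment }
  else { s with mode := .scheduler }

def newClient (s : Mind E R) (p : Protocol) : Mind E R :=
  { s with
    z := { s.z with control := s.z.control ++ [p] }
    clients := s.clients ++ [s.len]
    len := s.len + 1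
    mode := .wake 0 }

/-- Treat the session with ordinal `q`, which is that of the other requester if `q` is `d`. -/
def treat (s : Mind E R) (D : DataCollector) (d : ℕ) (p : Chore) (q : ℕ) (msg : Str) :
    Mind E R × Option (Order (E.extend D).m) :=
  if q < d then
    match p with
    | .run => ({ s with mode := .wake 0 }, some (.own (s.main q) msg .input))
    | .runDeletion => ({ s with mode := .wake 0 }, some (.own (s.deletion q) msg .input))
    | .delete => ({ s with
          deletion := Function.update s.deletion q s.len
          len := s.len + 1
          mode := .wake 0 }, some (.own (s.main q) [] (.delete (E.client D .deletion))))
  else if q = d then ({ s with mode := .wake 0 }, some (.relay msg p.relay))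
  else (s.idle, none)

/-- Output of `E` and the end of its alive phase take place in the mind only: the actual output tape
stays empty and the actual alive phase goes on until the terminate phase has been emulated. A
deletion is ordered only if the emulated control tape shows a session of `π`, because otherwise no
entry may be added to the control tape. -/
def zAct (s : Mind E R) (D : DataCollector) (msg : Str) :
    EnvAct E.m → Mind E R × Option (Order (E.extend D).m)
  | .toRequester => ({ s with
      z := { s.z with outgoing := s.z.outgoing ++ written msg }
      y := { s.y with incoming := s.y.incoming ++ written msg, caller := none }
      mode := .requester }, none)
  | .toCollector => ({ s with mode := .wake 0 }, some (.own 0 [] .toCollector))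
  | .input => ({ s with mode := .wake 0 }, some (.own (s.pos s.z.controlHead) msg .input))
  | .initiate p i => (s.newClient p, some (.own 0 msg (.initiate p (E.old D i))))
  | .delete i =>
    if s.z.control[s.z.controlHead]? = some .main then
      (s.newClient .deletion, some (.own (s.pos s.z.controlHead) [] (.delete (E.old D i))))
    else (s.idle, none)
  | .output => (idle { s with z := { s.z with output := s.z.output ++ written msg } }, none)
  | .endAlive => ({ s with alive := false, mode := .scheduler }, none)

/-- Sessions with ordinals below `d` are run by the environment itself, that with ordinal `d` is
relayed, and later ones exist in neither of the two hybrids, so that activation is just passed on.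
-/
def yAct (s : Mind E R) (D : DataCollector) (d : ℕ) (msg : Str) :
    RequesterAct → Mind E R × Option (Order (E.extend D).m)
  | .input =>
    match s.entries[s.y.controlHead]? with
    | some (b, q) => s.treat D d (if b then .runDeletion else .run) q msg
    | none => (s.idle, none)
  | .initiate =>
    let s' : Mind E R := { s with
      y := { s.y with control := s.y.control ++ [.main] }
      entries := s.entries ++ [(false, s.count)]
      count := s.count + 1 }
    if s.count < d then
      ({ s' with main := Function.update s.main s.count s.len, len := s.len + 1, mode := .wake 0 },
        some (.own 0 msg (.initiate .main (E.client D .main))))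
    else if s.count = d then ({ s' with mode := .wake 0 }, some (.relay msg .initiate))
    else (s'.idle, none)
  | .delete =>
    match s.entries[s.y.controlHead]? with
    | some (false, q) =>
      treat { s with
        y := { s.y with control := s.y.control ++ [.deletion] }
        entries := s.entries ++ [(true, q)] } D d .delete q []
    | _ => (s.idle, none)

/-- The first session for which something is still to be done. -/
def first (s : Mind E R) (d T : ℕ) (p : Chore) : Option ℕ :=
  (List.range (min s.count (d + 1))).find? fun q => decide (s.counts p q < p.limit T)

/-- What is to be done next in the terminate phase. -/
def chore (s : Mind E R) (d T : ℕ) : Option (Chore × ℕ) :=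
  match s.first d T .run with
  | some q => some (.run, q)
  | none =>
    match s.first d T .delete with
    | some q => some (.delete, q)
    | none => (s.first d T .runDeletion).map (.runDeletion, ·)

def tick (s : Mind E R) (p : Chore) (q : ℕ) : Mind E R :=
  { s with counts := fun p' q' => if p' = p ∧ q' = q then s.counts p q + 1 else s.counts p' q' }

def view (s : Mind E R) : View :=
  ⟨s.z.input, s.z.output, s.z.incoming, s.z.outgoing, s.z.randomness, s.z.control⟩

/-- One step. -/
def next (D : DataCollector) (d T : ℕ) (enc : View → ℕ) (s : Mind E R) (caller : Bool)
    (peer : Option Sym) (coin : Bool) : Mind E R × Option (Order (E.extend D).m) :=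
  match s.mode with
  | .wake n =>
    if n < s.clients.length then
      if caller then ({ s with z := { s.z with caller := some n }, mode := .environment }, none)
      else ({ s with mode := .wake (n + 1) }, none)
    else (s.idle, none)
  | .environment =>
    if s.z.halted then ({ s with alive := false, mode := .scheduler }, none)
    else
      match (s.z.step peer coin).2 with
      | none => ({ s with z := (s.z.step peer coin).1 }, none)
      | some none => (idle { s with z := (s.z.step peer coin).1 }, none)
      | some (some (a, msg)) => zAct { s with z := (s.z.step peer coin).1 } D msg a
  | .requester =>
    if s.y.halted then (s.idle, none)
    else
      match (s.y.step none coin).2 with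
      | none => ({ s with y := (s.y.step none coin).1 }, none)
      | some none => (idle { s with y := (s.y.step none coin).1 }, none)
      | some (some (a, msg)) => yAct { s with y := (s.y.step none coin).1 } D d msg a
  | .scheduler =>
    match s.chore d T with
    | some (p, q) => (s.tick p q).treat D d p q []
    | none => ({ s with mode := .ending },
        some (.own 0 (List.replicate (enc s.view + 1) true) .output))
  | .ending => (s, some (.own 0 [] .endAlive))

/-- While waking up only the information on the caller matters, not the symbol seen; in the modes
covered by the last case what is seen is ignored altogether. -/
def look (s : Mind E R) : ℕ × ℕ :=
  match s.mode with
  | .wake n => (s.pos n, 0)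
  | .environment => (s.pos s.z.controlHead, s.z.peerHead s.z.controlHead)
  | _ => (0, 0)

def start (E : Environment) (R : Requester) (sec : ℕ) : Mind E R where
  z := ITI.create E.Z [] (unary sec)
  y := ITI.create R.Y [] (unary sec)
  entries := []
  count := 0
  clients := []
  main := fun _ => 0
  deletion := fun _ => 0
  len := 0
  alive := true
  mode := .environment
  counts := fun _ _ => 0

/-- The strategy of this environment. -/
def plan (D : DataCollector) (E : Environment) (R : Requester) (d T : ℕ) (enc : View → ℕ)
    (sec : ℕ) : Strategy (E.extend D).m where
  St := Mind E R
  start := start E R sec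
  look := look
  next := next D d T enc

@[simp] theorem idle_clients (s : Mind E R) : s.idle.clients = s.clients := by
  unfold idle; split <;> rfl
@[simp] theorem idle_main (s : Mind E R) : s.idle.main = s.main := by
  unfold idle; split <;> rfl
@[simp] theorem idle_deletion (s : Mind E R) : s.idle.deletion = s.deletion := by
  unfold idle; split <;> rfl
@[simp] theorem idle_len (s : Mind E R) : s.idle.len = s.len := by
  unfold idle; split <;> rfl
@[simp] theorem idle_counts (s : Mind E R) : s.idle.counts = s.counts := by
  unfold idle; split <;> rfl
@[simp] theorem idle_entries (s : Mind E R) : s.idle.entries = s.entries := by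
  unfold idle; split <;> rfl
@[simp] theorem idle_count (s : Mind E R) : s.idle.count = s.count := by
  unfold idle; split <;> rfl

end Mind

/-! ## References of the two environments -/

def Ref.index : Ref → ℕ
  | .session i => i
  | .deletionOf i => i

/-- The references `zr` are found at the positions `l` of `zr'`, the other entries of which refer to
sessions of the requester. -/
structure RefMap (ss : List Session) (zr zr' : List Ref) (l : List ℕ) : Prop where
  sorted : l.Pairwise (· < ·)
  length : l.length = zr.length
  ref : ∀ h p : ℕ, l[h]? = some p → zr'[p]? = zr[h]?
  other : ∀ (p : ℕ) (r : Ref), zr'[p]? = some r → p ∉ l →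
    ∃ t, ss[r.index]? = some t ∧ t.owner = .requester

namespace RefMap

variable {ss ss' : List Session} {zr zr' : List Ref} {l : List ℕ} {zc : List Protocol}

theorem lt (h : RefMap ss zr zr' l) {p : ℕ} (hp : p ∈ l) : p < zr'.length := by
  obtain ⟨k, hk, rfl⟩ := List.getElem_of_mem hp
  have h1 := h.ref k _ (List.getElem?_eq_getElem hk)
  rw [h.length] at hk
  grind

/-- The default position lies just past the end of the tape, so that an entry that does not exist
for the emulated environment does not exist for the emulating one. -/
theorem lookup (h : RefMap ss zr zr' l) (k : ℕ) : zr'[(l[k]?).getD zr'.length]? = zr[k]? := by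
  cases hk : l[k]? with
  | none =>
    rw [List.getElem?_eq_none_iff, h.length] at hk
    simp [hk]
  | some p => exact h.ref k p hk

theorem grows (h : RefMap ss zr zr' l) (hg : Grows ss ss') : RefMap ss' zr zr' l :=
  ⟨h.sorted, h.length, h.ref, fun p r h1 h2 => Sys.owner_of_grows hg (h.other p r h1 h2)⟩

theorem append_right (h : RefMap ss zr zr' l) {r : Ref}
    (hr : ∃ t, ss[r.index]? = some t ∧ t.owner = .requester) : RefMap ss zr (zr' ++ [r]) l := by
  refine ⟨h.sorted, h.length, fun k p hk => ?_, fun p r' hp hl => ?_⟩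
  · rw [List.getElem?_append_left (h.lt (List.mem_of_getElem? hk))]
    exact h.ref k p hk
  · rw [List.getElem?_append] at hp
    split_ifs at hp with h1
    · exact h.other p r' hp hl
    grind

theorem append_both (h : RefMap ss zr zr' l) (r : Ref) :
    RefMap ss (zr ++ [r]) (zr' ++ [r]) (l ++ [zr'.length]) := by
  refine ⟨?_, by simp [h.length], fun k p hk => ?_, fun p r' hp hl => ?_⟩
  · rw [List.pairwise_append]
    exact ⟨h.sorted, by simp, fun p hp q hq => by
      obtain rfl := List.mem_singleton.1 hq
      exact h.lt hp⟩
  · rw [List.getElem?_append] at hk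
    split_ifs at hk with h1
    · rw [List.getElem?_append_left (h.lt (List.mem_of_getElem? hk)),
        List.getElem?_append_left (h.length ▸ h1)]
      exact h.ref k p hk
    · rw [List.getElem?_singleton] at hk
      split_ifs at hk with h2
      cases hk
      obtain rfl : k = l.length := by omega
      rw [h.length]
      simp
  · rw [List.mem_append, not_or, List.mem_singleton] at hl
    rw [List.getElem?_append] at hp
    split_ifs at hp with h1
    · exact h.other p r' hp hl.1
    grind

theorem injective (h : RefMap ss zr zr' l) {k k' p : ℕ} (h1 : l[k]? = some p)
    (h2 : l[k']? = some p) : k = k' := by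
  obtain ⟨h3, h4⟩ := List.getElem?_eq_some_iff.1 h1
  obtain ⟨h5, h6⟩ := List.getElem?_eq_some_iff.1 h2
  have := List.pairwise_iff_getElem.1 h.sorted
  grind

/-- The caller is the first entry that resolves to the session. Entries outside `l` belong to the
requester, and so do the deletions they resolve to, hence they cannot come in between; among the
entries in `l` the order is that of `zr`, since `l` is increasing. -/
theorem findIdx_environment (h : RefMap ss zr zr' l) (hc : Consistent D ss zr zc) {i k : ℕ}
    {t : Session} (ht : ss[i]? = some t) (ho : t.owner = .environment)
    (hk : zr.findIdx? (fun r => decide (resolveIn ss r = some i)) = some k) :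
    ∃ p, l[k]? = some p ∧ zr'.findIdx? (fun r => decide (resolveIn ss r = some i)) = some p := by
  rw [List.findIdx?_eq_some_iff_getElem] at hk
  obtain ⟨h1, h2, h3⟩ := hk
  have hl : k < l.length := h.length ▸ h1
  refine ⟨l[k], List.getElem?_eq_getElem hl, ?_⟩
  have h4 := h.ref k _ (List.getElem?_eq_getElem hl)
  rw [List.getElem?_eq_getElem h1] at h4
  obtain ⟨h5, h6⟩ := List.getElem?_eq_some_iff.1 h4
  rw [List.findIdx?_eq_some_iff_getElem]
  refine ⟨h5, by grind, fun j hj hP => ?_⟩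
  have hj' : j < zr'.length := hj.trans h5
  rw [decide_eq_true_eq] at hP
  by_cases hm : j ∈ l
  · obtain ⟨k', hk', rfl⟩ := List.getElem_of_mem hm
    have hlt : k' < k := by
      by_contra hge
      rcases eq_or_lt_of_le (not_lt.1 hge) with h7 | h7
      · grind
      · have := List.pairwise_iff_getElem.1 h.sorted k k' hl hk' h7
        omega
    have h7 := h.ref k' _ (List.getElem?_eq_getElem hk')
    grind
  · obtain ⟨u, h7, h8⟩ := h.other j _ (List.getElem?_eq_getElem hj') hm
    generalize zr'[j] = r at hP h7
    cases r with
    | session i' =>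
      obtain rfl : i' = i := by simpa [resolveIn] using hP
      rw [show (Ref.session i').index = i' from rfl, ht] at h7
      grind
    | deletionOf i' =>
      rw [show (Ref.deletionOf i').index = i' from rfl] at h7
      simp [resolveIn, h7] at hP
      obtain ⟨v, h9, h10, -⟩ := hc.deletion i' u i h7 hP
      grind

theorem findIdx_requester (h : RefMap ss zr zr' l) (hc : Consistent D ss zr zc) {i p : ℕ}
    {t : Session} (ht : ss[i]? = some t) (ho : t.owner = .requester)
    (hp : zr'.findIdx? (fun r => decide (resolveIn ss r = some i)) = some p) : p ∉ l := by
  intro hm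
  rw [List.findIdx?_eq_some_iff_getElem] at hp
  obtain ⟨h1, h2, -⟩ := hp
  obtain ⟨k, hk, rfl⟩ := List.getElem_of_mem hm
  have h3 := h.ref k _ (List.getElem?_eq_getElem hk)
  rw [List.getElem?_eq_getElem h1] at h3
  obtain ⟨u, h4, h5⟩ := hc.target h3.symm (by simpa using h2)
  grind

end RefMap

namespace Sys

variable {E E' : Environment} {R R' : Requester} {W : Sys D E R} {S : Sys D E' R'}

theorem Agree.resolveIn (h : Agree W S) (r : Ref) :
    resolveIn S.sessions r = resolveIn W.sessions r := by
  cases r with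
  | session i => rfl
  | deletionOf i =>
    simp only [DeletionCompliance.resolveIn]
    cases ht : W.sessions[i]? with
    | none => rw [h.get_none ht]
    | some t =>
      obtain ⟨w, h1⟩ := h.get_some ht
      grind

theorem Agree.addSession (h : Agree W S) (p : Protocol) {u u' : Session} (hu : u'.erase = u.erase) :
    Agree (W.addSession p u) (S.addSession p u') :=
  ⟨by simp [Sys.addSession, h.x], by simp [Sys.addSession, h.sessions, hu]⟩

theorem Agree.addDeletion (h : Agree W S) (i : ℕ) {u u' : Session} (hu : u'.erase = u.erase) :
    Agree (W.addDeletion i u) (S.addDeletion i u') := by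
  have h1 := (h.modify (x := W.x) (i := i) (f := fun t => { t with deletion := some W.sessions.length })
    (fun t => rfl) (a := W.active) (a' := S.active)).sessions
  simp only [core] at h1
  exact ⟨by simp [Sys.addDeletion, h.x], by simp [Sys.addDeletion, withDeletion, h.length, h1, hu]⟩

end Sys

/-! ## Effects on both executions -/

/-- What any machine but the environment and the requester does to an execution. -/
structure Advance (W W' : Sys D E R) :
    Prop where
  grows : Grows W.sessions W'.sessions
  token : ∀ (i : ℕ) (t t' : Session) (j : ℕ), W.sessions[i]? = some t → W'.sessions[i]? = some t' →
    t.deletion = none → t'.deletion = some j → D.tokenOf t ≠ none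
  z : W.z.calledAs W'.z = W'.z
  y : W'.y = W.y
  alive : W'.alive = W.alive

/-- The second execution has the same collector and sessions, but some sessions of the requester are
those of the environment there. -/
structure Same (W : Sys D E R) (S : Sys D (E.extend D) idler) : Prop where
  agree : W.Agree S
  alive : S.alive = true
  output : S.z.output = []
  owner : ∀ (i : ℕ) (t' : Session), S.sessions[i]? = some t' → t'.owner = .requester →
    ∃ t, W.sessions[i]? = some t ∧ t.owner = .requester

/-- The pointers in the mind of the environment are right. `zr'` and `yr'` are the references of the
environment and the requester in the second execution, `ix` the sessions of `π` of the requester, and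
`P` tells for which of them the deletion has been requested. -/
structure Pointers (d : ℕ) (P : ℕ → Prop) (ix : List ℕ)
    (ss : List Session) (zr zr' yr' : List Ref) (s : Mind E R) : Prop where
  len : s.len = zr'.length
  refs : RefMap ss zr zr' s.clients
  main : ∀ q i : ℕ, q < d → ix[q]? = some i → zr'[s.main q]? = some (.session i)
  deletion : ∀ q i : ℕ, q < d → P q → ix[q]? = some i → zr'[s.deletion q]? = some (.deletionOf i)
  none : ix[d]? = none → yr' = []
  own : ∀ i : ℕ, ix[d]? = some i →
    ∃ n, yr' = .session i :: List.replicate n (.deletionOf i) ∧ (P d → 0 < n)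

/-- Where activation is in both executions after an action. `l` tells which clients of the
environment in the second execution it has in the first one. -/
def Met (W : Sys D E R) (S : Sys D (E.extend D) idler) (l : List ℕ) : Prop :=
  (W.active.IsCore ∧ S.active = W.active) ∨
  (W.active = .environment ∧ S.active = .environment ∧
    ∃ h p : ℕ, l[h]? = some p ∧ W.z.caller = some h ∧ S.z.caller = some p) ∨
  (S.active = .environment ∧ (W.alive = true → W.active = .environment ∧ W.z.caller = none) ∧
    (W.alive = false → W.active = .scheduler) ∧ ∀ p : ℕ, S.z.caller = some p → p ∉ l)

/-- The situation after an action. -/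
structure Landed (d : ℕ) (P : ℕ → Prop)
    (ix : List ℕ) (W W' : Sys D E R) (S' : Sys D (E.extend D) idler) (s : Mind E R) : Prop where
  advance : Advance W W'
  same : Same W' S'
  pointers : Pointers d P ix W'.sessions W'.zRefs S'.zRefs S'.yRefs s
  met : Met W' S' s.clients

namespace Pointers

variable {d : ℕ} {P P' : ℕ → Prop} {ix : List ℕ}
  {ss ss' : List Session} {zr zr' yr' : List Ref} {s s' : Mind E R}

theorem grows (h : Pointers d P ix ss zr zr' yr' s) (hg : Grows ss ss') :
    Pointers d P ix ss' zr zr' yr' s :=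
  ⟨h.len, h.refs.grows hg, h.main, h.deletion, h.none, h.own⟩

theorem congr (h : Pointers d P ix ss zr zr' yr' s) (h1 : s'.len = s.len)
    (h2 : s'.clients = s.clients) (h3 : s'.main = s.main) (h4 : s'.deletion = s.deletion)
    (hP : ∀ (q i : ℕ), q ≤ d → ix[q]? = some i → P' q → P q) :
    Pointers d P' ix ss zr zr' yr' s' := by
  refine ⟨h1.trans h.len, h2 ▸ h.refs, by rw [h3]; exact h.main, fun q i hq hp hi => ?_, h.none,
    fun i hi => ?_⟩
  · rw [h4]
    exact h.deletion q i hq (hP q i hq.le hi hp) hi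
  · obtain ⟨n, h5, h6⟩ := h.own i hi
    grind

theorem newClient (h : Pointers d P ix ss zr zr' yr' s) (r : Ref) (p : Protocol) :
    Pointers d P ix ss (zr ++ [r]) (zr' ++ [r]) yr' (s.newClient p) := by
  have hlt : ∀ {k : ℕ} {r' : Ref}, zr'[k]? = some r' → (zr' ++ [r])[k]? = some r' := fun hk => by
    grind
  refine ⟨by simp [Mind.newClient, h.len], ?_, fun q i h1 h2 => hlt (h.main q i h1 h2),
    fun q i h1 h2 h3 => hlt (h.deletion q i h1 h2 h3), h.none, h.own⟩
  have := h.refs.append_both r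
  rwa [← h.len] at this

/-- If the deletion is requested repeatedly, the latest position replaces the former one. This is
harmless, as all these entries refer to the deletion of the same session. -/
theorem delete (h : Pointers d P ix ss zr zr' yr' s) {q i : ℕ} {t : Session}
    (hq : q < d) (hi : ix[q]? = some i) (ht : ss[i]? = some t) (ho : t.owner = .requester)
    (m : Mode) :
    Pointers d (fun q' => P q' ∨ q' = q) ix ss zr (zr' ++ [.deletionOf i]) yr' { s with
        deletion := Function.update s.deletion q s.len
        len := s.len + 1
        mode := m } := by
  have hlt : ∀ {k : ℕ} {r' : Ref}, zr'[k]? = some r' →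
      (zr' ++ [.deletionOf i])[k]? = some r' := fun hk => by
    grind
  refine ⟨by simp [h.len], h.refs.append_right ⟨t, ht, ho⟩, fun q' i' h1 h2 => hlt (h.main q' i' h1 h2),
    fun q' i' h1 h2 h3 => ?_, h.none, fun i' h1 => ?_⟩
  · by_cases hqq : q' = q
    · subst hqq
      obtain rfl := some_unique hi h3
      simp [h.len]
    · simp only [Function.update_of_ne hqq]
      exact hlt (h.deletion q' i' h1 (h2.resolve_right hqq) h3)
  · obtain ⟨n, h2, h3⟩ := h.own i' h1
    grind

theorem deleteOwn (h : Pointers d P ix ss zr zr' yr' s) {i : ℕ} (hi : ix[d]? = some i) :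
    Pointers d (fun q => P q ∨ q = d) ix ss zr zr' (yr' ++ [.deletionOf i]) s := by
  refine ⟨h.len, h.refs, h.main, fun q i' h1 h2 h3 => h.deletion q i' h1 (h2.resolve_right h1.ne) h3,
    fun h1 => by grind, fun i' h1 => ?_⟩
  obtain rfl := some_unique hi h1
  obtain ⟨n, h2, -⟩ := h.own i hi
  exact ⟨n + 1, by rw [h2, List.replicate_succ']; rfl, fun _ => n.succ_pos⟩

theorem initiate (h : Pointers d P ix ss zr zr' yr' s) (hd : ix.length < d) (hP : ¬P ix.length)
    {n : ℕ} {t : Session} (ht : ss[n]? = some t) (ho : t.owner = .requester)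
    (h1 : s'.len = s.len + 1) (h2 : s'.clients = s.clients)
    (h3 : s'.main = Function.update s.main ix.length s.len) (h4 : s'.deletion = s.deletion) :
    Pointers d P (ix ++ [n]) ss zr (zr' ++ [.session n]) yr' s' := by
  have hlt : ∀ {k : ℕ} {r' : Ref}, zr'[k]? = some r' →
      (zr' ++ [.session n])[k]? = some r' := fun hk => by
    grind
  have hix : ∀ {q i : ℕ}, (ix ++ [n])[q]? = some i → (q = ix.length ∧ i = n) ∨ ix[q]? = some i := by
    grind
  refine ⟨by simp [h.len, h1], by rw [h2]; exact h.refs.append_right ⟨t, ht, ho⟩, fun q i h5 h6 => ?_,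
    fun q i h5 h6 h7 => ?_, fun _ => h.none (List.getElem?_eq_none hd.le), fun i h5 => ?_⟩
  · rw [h3]
    by_cases hq : q = ix.length
    · subst hq
      have : i = n := by grind
      simp [this, h.len]
    · rw [Function.update_of_ne hq]
      exact hlt (h.main q i h5 ((hix h6).resolve_left fun h => hq h.1))
  · rw [h4]
    refine hlt (h.deletion q i h5 h6 ((hix h7).resolve_left fun h => ?_))
    grind
  grind

theorem initiateOwn (h : Pointers d P ix ss zr zr' yr' s) (hd : ix.length = d) (hP : ¬P d) (n : ℕ) :
    Pointers d P (ix ++ [n]) ss zr zr' (yr' ++ [.session n]) s := by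
  have hix : ∀ {q i : ℕ}, q < d → (ix ++ [n])[q]? = some i → ix[q]? = some i := fun h1 h2 => by
    grind
  refine ⟨h.len, h.refs, fun q i h1 h2 => h.main q i h1 (hix h1 h2),
    fun q i h1 h2 h3 => h.deletion q i h1 h2 (hix h1 h3), fun h1 => ?_, fun i h1 => ?_⟩
  · grind
  · have h2 := h.none (List.getElem?_eq_none hd.le)
    grind

end Pointers

section

variable {W : Sys D E R}
  {S : Sys D (E.extend D) idler} {s : Mind E R} {d : ℕ} {P : ℕ → Prop} {ix : List ℕ}
  {rule : SidRule} {sec : ℕ}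

theorem Advance.refl (W : Sys D E R) : Advance W W :=
  ⟨.refl _, fun i t t' j h1 h2 h3 h4 => by
    grind, rfl, rfl, rfl⟩

theorem Advance.idle {W' : Sys D E R} (h : Advance W W') : Advance W W'.idle := by
  refine ⟨by simpa using h.grows, fun i t t' j h1 h2 => h.token i t t' j h1 (by simpa using h2), ?_,
    by simpa using h.y, by simpa using h.alive⟩
  have := h.z
  unfold Sys.idle
  split
  · change W.z.calledAs _ = _
    rw [← this]
    rfl
  · exact this

theorem Same.idle (h : Same W S) : Same W.idle S.idle := by
  refine ⟨⟨by simp [h.agree.x], by simp [h.agree.sessions]⟩, by simp [h.alive], ?_,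
    by simpa using h.owner⟩
  rw [Sys.idle_z_output]
  exact h.output

/-- Changes that do not matter. -/
theorem Same.congr (h : Same W S) {W' : Sys D E R} {S' : Sys D (E.extend D) idler}
    (h1 : W'.x = W.x) (h2 : W'.sessions = W.sessions) (h3 : S'.x = S.x)
    (h4 : S'.sessions = S.sessions) (h5 : S'.alive = S.alive) (h6 : S'.z.output = S.z.output) :
    Same W' S' :=
  ⟨⟨by rw [h1, h3, h.agree.x], by rw [h2, h4, h.agree.sessions]⟩, h5.trans h.alive,
    h6.trans h.output, by rw [h2, h4]; exact h.owner⟩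

/-- The second execution is always in its alive phase, so there activation goes to the environment
without a caller, even when in the first one it goes to the procedure of the terminate phase. -/
theorem Met.idle (h : Same W S) (l : List ℕ) : Met W.idle S.idle l := by
  refine .inr (.inr ?_)
  have hS : S.idle = { S with z := { S.z with caller := none }, active := .environment } := by
    unfold Sys.idle
    rw [if_pos h.alive]
  rw [hS]
  refine ⟨rfl, fun ha => ?_, fun ha => ?_, fun p hp => by cases hp⟩ <;> rw [Sys.idle_alive] at ha
  · unfold Sys.idle
    grind
  · unfold Sys.idle
    grind

theorem Landed.idle (h : Same W S) (hp : Pointers d P ix W.sessions W.zRefs S.zRefs S.yRefs s) :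
    Landed d P ix W W.idle S.idle s :=
  ⟨(Advance.refl W).idle, h.idle, by simpa using hp, .idle h _⟩

theorem map_owner_modify {ss : List Session} {i : ℕ} {f : Session → Session}
    (h : ∀ t, ss[i]? = some t → (f t).owner = t.owner) :
    (ss.modify i f).map Session.owner = ss.map Session.owner := by
  apply List.ext_getElem?
  grind

theorem Same.modify (h : Same W S) {x : ITI D.X} {i : ℕ} {f : Session → Session}
    (hf : ∀ t, (f t).erase = f t.erase) (hW : ∀ t, W.sessions[i]? = some t → (f t).owner = t.owner)
    (hS : ∀ t, S.sessions[i]? = some t → (f t).owner = t.owner) (a a' : Active) :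
    Same (W.core x (W.sessions.modify i f) a) (S.core x (S.sessions.modify i f) a') := by
  refine ⟨h.agree.modify hf, h.alive, h.output, fun j t' h1 h2 => ?_⟩
  have h3 := congrArg (fun l : List Owner => l[j]?) (map_owner_modify hS)
  have h4 := congrArg (fun l : List Owner => l[j]?) (map_owner_modify hW)
  simp only [List.getElem?_map] at h3 h4
  change (S.sessions.modify i f)[j]? = some t' at h1
  rw [h1, Option.map_some, h2, eq_comm, Option.map_eq_some_iff] at h3
  obtain ⟨u, h5, h6⟩ := h3
  obtain ⟨t, h7, h8⟩ := h.owner j u h5 h6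
  rw [h7, Option.map_some, h8, Option.map_eq_some_iff] at h4
  exact h4

theorem Advance.modify {x : ITI D.X} {i : ℕ} {f : Session → Session}
    (hf : ∀ t, W.sessions[i]? = some t → t.Evolves (f t) ∧ t.input.length ≤ (f t).input.length ∧
      (f t).deletion = t.deletion) (a : Active) :
    Advance W (W.core x (W.sessions.modify i f) a) := by
  refine ⟨Grows.modify fun t ht => ⟨(hf t ht).1, (hf t ht).2.1⟩, fun k t t' j h1 h2 h3 h4 => ?_,
    rfl, rfl, rfl⟩
  change (W.sessions.modify i f)[k]? = _ at h2
  grind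

/-- Both executions undergo the same update (`Agree.upd`) and can differ only in who is notified of
an output. As sessions of the requester in the second execution are its sessions in the first one,
only one case is critical: a session of `R` that the new environment runs. -/
theorem Landed.core (h : Same W S) (hp : Pointers d P ix W.sessions W.zRefs S.zRefs S.yRefs s)
    (hc : Consistent D W.sessions W.zRefs W.z.control) (hR : R.reactive = false)
    (ha : S.active = W.active) (b : Bool) :
    Landed d P ix W (W.applyUpd (W.upd b)) (S.applyUpd (S.upd b)) s := by
  have hq := fun t ht => W.upd_quiet (t := t) b ht
  have hqS := fun t ht => S.upd_quiet (t := t) b ht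
  have hcore := W.upd_active b
  have her := W.upd_erase b
  rw [h.agree.upd ha] at hqS ⊢
  generalize W.upd b = u at hq hqS hcore her
  have h1 : Same (W.core u.x (W.sessions.modify u.idx u.f) u.active)
      (S.core u.x (S.sessions.modify u.idx u.f) u.active) :=
    h.modify her (fun t ht => (hq t ht).evolves.owner) (fun t ht => (hqS t ht).evolves.owner) _ _
  have hf : ∀ t, W.sessions[u.idx]? = some t → t.Evolves (u.f t) ∧
      t.input.length ≤ (u.f t).input.length ∧ (u.f t).deletion = t.deletion := fun t ht =>
    ⟨(hq t ht).evolves, by rw [(hq t ht).input], (hq t ht).deletion⟩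
  have h2 : Advance W (W.core u.x (W.sessions.modify u.idx u.f) u.active) := .modify hf _
  have hc' : Consistent D (W.sessions.modify u.idx u.f) W.zRefs W.z.control := hc.modify hf
  have hp' := hp.grows h2.grows
  unfold Sys.applyUpd
  have hl : ∀ W' : Sys D E R, ∀ S' : Sys D (E.extend D) idler,
      W' = W.core u.x (W.sessions.modify u.idx u.f) u.active →
      S' = S.core u.x (S.sessions.modify u.idx u.f) u.active →
      Landed d P ix W (W'.finish u.event) (S'.finish u.event) s := by
    intro W' S' hW hS
    rw [← hW] at h1 h2
    rw [← hS] at h1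
    have hz : W'.zRefs = W.zRefs := by rw [hW]; rfl
    have hz' : S'.zRefs = S.zRefs := by rw [hS]; rfl
    have hy' : S'.yRefs = S.yRefs := by rw [hS]; rfl
    have ha1 : W'.active = u.active := by rw [hW]; rfl
    have ha2 : S'.active = u.active := by rw [hS]; rfl
    replace hp' : Pointers d P ix W'.sessions W'.zRefs S'.zRefs S'.yRefs s := by
      grind
    replace hc' : Consistent D W'.sessions W'.zRefs W'.z.control := by rw [hW]; exact hc'
    have hcont : Landed d P ix W W' S' s := ⟨h2, h1, hp', .inl ⟨by rwa [ha1], ha2.trans ha1.symm⟩⟩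
    have hidle : Landed d P ix W W'.idle S'.idle s :=
      ⟨h2.idle, h1.idle, by simpa using hp', .idle h1 _⟩
    cases u.event with
    | cont => exact hcont
    | idle => exact hidle
    | output i =>
      unfold Sys.finish
      dsimp only
      cases ht : W'.sessions[i]? with
      | none =>
        rw [h1.agree.get_none ht]
        exact hcont
      | some t =>
        obtain ⟨w, hw⟩ := h1.agree.get_some ht
        rw [hw]
        dsimp only
        have hres : ∀ r, S'.resolve r = resolveIn W'.sessions r := fun r => by
          rw [Sys.resolve_eq, h1.agree.resolveIn]
        unfold Sys.notifyOwner
        simp only [hres, Sys.resolve_eq]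
        have hadv : ∀ (c : Option ℕ) (a : Active),
            Advance W { W' with z := { W'.z with caller := c }, active := a } := fun c a =>
          ⟨h2.grows, h2.token, by rw [← h2.z]; rfl, h2.y, h2.alive⟩
        cases ho : t.owner with
        | environment =>
          obtain rfl : w = .environment := by
            cases w with
            | environment => rfl
            | requester =>
              obtain ⟨t₂, h3, h4⟩ := h1.owner i _ hw rfl
              grind
          have hk : ∃ k, W'.zRefs.findIdx? (fun r => decide (resolveIn W'.sessions r = some i)) =
              some k := by
            obtain ⟨r, hr, hr'⟩ := hc'.referred i t ht ho
            have : (W'.zRefs.findIdx? fun r => decide (resolveIn W'.sessions r = some i)).isSome := by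
              grind
            exact Option.isSome_iff_exists.1 this
          obtain ⟨k, hk⟩ := hk
          obtain ⟨p, hp1, hp2⟩ := hp'.refs.findIdx_environment hc' ht ho hk
          refine ⟨hadv _ _, h1.congr rfl rfl rfl rfl rfl rfl, hp', .inr (.inl ?_)⟩
          grind
        | requester =>
          simp [hR]
          cases w with
          | requester => exact hidle
          -- A session that the new environment runs on behalf of `R`: its output activates this
          -- environment, while in the first execution `R` disregards it. The calling position is
          -- not that of a client of `E`, which puts the executions into the last case of `Met`.
          | environment =>
            refine ⟨hidle.advance, hidle.same.congr (by simp) (by simp) (by simp) (by simp) (by simp)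
              (by simp), by simpa using hp', .inr (.inr ⟨rfl, ?_, ?_, fun p hp => ?_⟩)⟩
            · intro ha
              rw [Sys.idle_alive] at ha
              unfold Sys.idle
              grind
            · intro ha
              rw [Sys.idle_alive] at ha
              unfold Sys.idle
              grind
            · exact hp'.refs.findIdx_requester hc' ht ho hp
  grind

theorem Landed.writeClient (h : Same W S)
    (hp : Pointers d P ix W.sessions W.zRefs S.zRefs S.yRefs s) (i : Option ℕ) (msg : Str) :
    Landed d P ix W (W.writeClient i msg) (S.writeClient i msg) s := by
  cases i with
  | none => exact .idle h hp
  | some i =>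
    rw [Sys.writeClient_some, Sys.writeClient_some]
    have h1 : Advance W (W.core W.x (W.sessions.modify i (Session.clientInput msg)) (.client i)) :=
      .modify (fun t _ => ⟨Session.evolves_clientInput _ _,
        by simp [Session.input, Session.clientInput, Session.mapClient], rfl⟩) _
    have h2 : Same (W.core W.x (W.sessions.modify i (Session.clientInput msg)) (.client i))
        (S.core W.x (S.sessions.modify i (Session.clientInput msg)) (.client i)) :=
      h.modify (f := Session.clientInput msg) (fun t => rfl) (fun t _ => rfl) (fun t _ => rfl) _ _
    rw [← h.agree.x] at h2
    exact ⟨⟨h1.grows, h1.token, rfl, rfl, rfl⟩, h2.congr h.agree.x.symm rfl rfl rfl rfl rfl,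
      hp.grows h1.grows, .inl ⟨trivial, rfl⟩⟩

/-- The law of the identifier depends only on the security parameter and the previous identifiers,
which agree, so one draw serves both executions. A session of the requester may become one of the
environment in the second execution, but not conversely. -/
theorem Landed.initiate (h : Same W S) (p : Protocol) {w w' : Owner}
    (hw : w' = .requester → w = .requester) (C : ITM PartyAct) (msg : Str)
    (hp : ∀ ss, Grows W.sessions ss → (∃ t, ss[W.sessions.length]? = some t ∧ t.owner = w) →
      Pointers d P ix ss W.zRefs S.zRefs S.yRefs s) :
    Lift (fun W' S' => Landed d P ix W W' S' s) (W.initiate rule sec p w C msg)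
      (S.initiate rule sec p w' C msg) := by
  rw [Sys.initiate_eq, Sys.initiate_eq, h.agree.sids]
  refine Lift.map _ fun sid _ => ⟨⟨.append _ _, fun i t t' j h1 h2 h3 h4 => ?_, rfl, rfl, rfl⟩,
    ⟨h.agree.addSession p rfl, h.alive, h.output, fun i t' h1 h2 => ?_⟩, ?_, ?_⟩
  · change (W.sessions ++ [_])[i]? = some t' at h2
    grind
  · change (S.sessions ++ [_])[i]? = some t' at h1
    change ∃ t, (W.sessions ++ [_])[i]? = some t ∧ _
    rw [List.getElem?_append] at h1 ⊢
    rw [← h.agree.length]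
    split_ifs at h1 ⊢ with hi
    · exact h.owner i t' h1 h2
    · rw [List.getElem?_singleton] at h1 ⊢
      split_ifs at h1 ⊢
      obtain rfl := Option.some.inj h1
      exact ⟨_, rfl, hw h2⟩
  · exact hp _ (.append _ _) ⟨_, by simp [Sys.addSession]; rfl, rfl⟩
  · exact .inl ⟨trivial, congrArg Active.client h.agree.length⟩

/-- Whether there is a deletion token, and which one, is determined by identifier, transcript and
the state of the client, not by the owner. -/
theorem Landed.requestDeletion (h : Same W S)
    (hp : Pointers d P ix W.sessions W.zRefs S.zRefs S.yRefs s) (i : ℕ) (C : ITM PartyAct) :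
    Lift (fun W' S' => Landed d P ix W W' S' s) (W.requestDeletion rule sec i C)
      (S.requestDeletion rule sec i C) := by
  rcases W.requestDeletion_cases i with ⟨t, tok, h1, h2, h3⟩ | h1
  · obtain ⟨w, hw⟩ := h.agree.get_some h1
    have hw' : w = .requester → t.owner = .requester := fun h4 => by
      obtain ⟨t₂, h5, h6⟩ := h.owner i _ hw h4
      grind
    rw [Sys.requestDeletion_eq rule sec C h1 h2 h3, Sys.requestDeletion_eq rule sec C hw h2 h3,
      h.agree.sids]
    refine Lift.map _ fun sid _ => ⟨⟨.withDeletion h1 h3 _, fun j v v' k h4 h5 h6 h7 => ?_, rfl, rfl,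
      rfl⟩, ⟨h.agree.addDeletion i rfl, h.alive, h.output, fun j t' h4 h5 => ?_⟩,
      hp.grows (.withDeletion h1 h3 _), .inl ⟨trivial, congrArg Active.client h.agree.length⟩⟩
    · rcases getElem?_withDeletion h5 with ⟨rfl, -⟩ | ⟨v₂, h8, h9⟩
      · simp at h4
      grind
    · rcases getElem?_withDeletion h4 with ⟨rfl, rfl⟩ | ⟨v, h6, h7⟩
      · rw [h.agree.length]
        exact ⟨_, getElem?_withDeletion_length _ _ _, hw' h5⟩
      · have h8 : v.owner = .requester := by
          grind
        obtain ⟨t₂, h9, h10⟩ := h.owner j v h6 h8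
        obtain ⟨t₃, h11, h12, -⟩ := Grows.withDeletion h1 h3
          (Session.fresh D sec .deletion t.owner C tok sid) j t₂ h9
        exact ⟨t₃, h11, h12.owner.trans h10⟩
  · rw [Sys.requestDeletion_eq_idle rule sec C h1, Sys.requestDeletion_eq_idle rule sec C]
    · exact Lift.pure (.idle h hp)
    · intro t' ht'
      obtain ⟨w, hw⟩ := h.agree.symm.get_some ht'
      have h2 := h1 _ hw
      exact h2

end

/-! ## Actions in both executions -/

/-- The sessions with the given indices are sessions of `π` of the requester. -/
def MainSessions (ss : List Session) (ix : List ℕ) : Prop :=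
  ∀ q i : ℕ, ix[q]? = some i →
    ∃ t, ss[i]? = some t ∧ t.protocol = .main ∧ t.owner = .requester

/-- Do something to a session. -/
def Ghost.poke (rule : SidRule) (sec : ℕ)
    (g : Ghost D E R) (q : ℕ) (msg : Str) : Chore → PMF (Sys D E R)
  | .run => PMF.pure (g.sys.writeClient (g.target (false, q)) msg)
  | .runDeletion => PMF.pure (g.sys.writeClient (g.target (true, q)) msg)
  | .delete =>
    match g.indices[q]? with
    | some j => g.sys.requestDeletion rule sec j (D.client .deletion)
    | none => PMF.pure g.sys.idle

section

variable {W : Sys D E R}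
  {S : Sys D (E.extend D) idler} {s : Mind E R} {d : ℕ} {P : ℕ → Prop} {ix : List ℕ}
  {rule : SidRule} {sec : ℕ} {live : Bool}

theorem Same.zSeek (h : Same W S) (pos : ℕ) : Same W (S.zSeek pos) := h.congr rfl rfl rfl rfl rfl rfl

theorem Same.ySeek (h : Same W S) (pos : ℕ) : Same W (S.ySeek pos) := h.congr rfl rfl rfl rfl rfl rfl

/-- A new entry of the control tape of the environment. -/
def _root_.DeletionCompliance.Sys.zEntry (S : Sys D E R) (p : Protocol) (r : Ref) : Sys D E R :=
  { S with z := { S.z with control := S.z.control ++ [p] }, zRefs := S.zRefs ++ [r] }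

theorem _root_.DeletionCompliance.Sys.zAct_initiate
    (S : Sys D E R) (msg : Str) (p : Protocol) (i : Fin E.m) :
    S.zAct rule sec msg (.initiate p i) =
      (S.zEntry p (.session S.sessions.length)).initiate rule sec p .environment (E.adv i) msg := rfl

theorem _root_.DeletionCompliance.Sys.zAct_delete (S : Sys D E R) (msg : Str) (i : Fin E.m) {j : ℕ}
    (h : S.mainSession (S.zRefs[S.z.controlHead]?) = some j) :
    S.zAct rule sec msg (.delete i) =
      (S.zEntry .deletion (.deletionOf j)).requestDeletion rule sec j (E.adv i) := by
  simp only [Sys.zAct, h]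
  rfl

theorem Same.zEntry_right (h : Same W S) (p : Protocol) (r : Ref) : Same W (S.zEntry p r) :=
  h.congr rfl rfl rfl rfl rfl rfl

theorem Same.zEntry (h : Same W S) (p : Protocol) (r : Ref) :
    Same (W.zEntry p r) (S.zEntry p r) := h.congr rfl rfl rfl rfl rfl rfl

theorem Same.yEntry (h : Same W S) (p : Protocol) (r : Ref) : Same W (S.yEntry p r) :=
  h.congr rfl rfl rfl rfl rfl rfl

theorem Same.resolve (h : Same W S) (r : Ref) : S.resolve r = W.resolve r := by
  rw [Sys.resolve_eq, Sys.resolve_eq, h.agree.resolveIn]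

theorem Same.mainSession (h : Same W S) (r : Option Ref) : S.mainSession r = W.mainSession r := by
  unfold Sys.mainSession
  split
  · next i =>
    have : (S.sessions[i]?).map Session.protocol = (W.sessions[i]?).map Session.protocol := by
      cases ht : W.sessions[i]? with
      | none => rw [h.agree.get_none ht]
      | some t =>
        obtain ⟨w, hw⟩ := h.agree.get_some ht
        grind
    rw [this]
  · rfl

theorem mainSession_of {i : ℕ} {t : Session} (ht : W.sessions[i]? = some t)
    (hp : t.protocol = .main) : W.mainSession (some (.session i)) = some i := by
  simp [Sys.mainSession, ht, hp]

/-- Something is done to a session of the requester. -/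
theorem Landed.treat {g : Ghost D E R} (hS : Same g.sys S)
    (hp : Pointers d P g.indices g.sys.sessions g.sys.zRefs S.zRefs S.yRefs s)
    (hm : MainSessions g.sys.sessions g.indices) (hlive : live = false → g.indices.length ≤ d)
    (p : Chore) {q : ℕ} (msg : Str) (hq : q < d → q < g.indices.length) (hqd : q ≤ d)
    (hP : p = .runDeletion → P q) :
    ∃ o, (s.treat D d p q msg).2 = some o ∧
      Lift (fun W' S' => Landed d (fun q' => P q' ∨ p = .delete ∧ q' = q) g.indices g.sys W' S'
        (s.treat D d p q msg).1) (g.poke rule sec q msg p) (S.perform live rule sec o) := by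
  have hcongr : ∀ {zr' yr' : List Ref}, p ≠ .delete ∨ d < g.indices.length ∧ False ∨
      g.indices[q]? = none →
      Pointers d P g.indices g.sys.sessions g.sys.zRefs zr' yr' s →
      Pointers d (fun q' => P q' ∨ p = .delete ∧ q' = q) g.indices g.sys.sessions g.sys.zRefs zr'
        yr' { s with mode := .wake 0 } := fun h1 h2 =>
    h2.congr rfl rfl rfl rfl fun q' i _ h3 h4 => h4.resolve_right fun h5 => by
      grind
  rcases hqd.lt_or_eq with hlt | rfl
  · obtain ⟨i, hi⟩ : ∃ i, g.indices[q]? = some i := ⟨_, List.getElem?_eq_getElem (hq hlt)⟩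
    obtain ⟨t, ht, hpr, ho⟩ := hm q i hi
    have h1 := hp.main q i hlt hi
    cases p with
    | run =>
      simp only [Mind.treat, if_pos hlt]
      refine ⟨_, rfl, Lift.pure ?_⟩
      have h2 : (S.zSeek (s.main q)).zTarget = some i := by
        change (S.zRefs[s.main q]?).bind _ = _
        rw [h1]
        rfl
      have h3 : g.target (false, q) = some i := by simp [Ghost.target, hi]
      rw [h2, h3]
      exact .writeClient (hS.zSeek (s.main q)) (hcongr (.inl (by simp)) hp) _ _
    | runDeletion =>
      simp only [Mind.treat, if_pos hlt]
      refine ⟨_, rfl, Lift.pure ?_⟩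
      have h2 : (S.zSeek (s.deletion q)).zTarget = g.target (true, q) := by
        change (S.zRefs[s.deletion q]?).bind S.resolve = _
        rw [hp.deletion q i hlt (hP rfl) hi]
        simp [Ghost.target, hi, hS.resolve]
        rfl
      rw [h2]
      exact .writeClient (hS.zSeek (s.deletion q)) (hcongr (.inl (by simp)) hp) _ _
    | delete =>
      simp only [Mind.treat, if_pos hlt]
      refine ⟨_, rfl, ?_⟩
      have h2 : (S.zSeek (s.main q)).mainSession
          ((S.zSeek (s.main q)).zRefs[(S.zSeek (s.main q)).z.controlHead]?) = some i := by
        rw [(hS.zSeek _).mainSession]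
        change g.sys.mainSession (S.zRefs[s.main q]?) = _
        rw [h1, mainSession_of ht hpr]
      simp only [Ghost.poke, hi]
      change Lift _ _ ((S.zSeek (s.main q)).zAct rule sec [] (.delete _))
      rw [Sys.zAct_delete _ _ _ h2, Environment.adv_client]
      refine Landed.requestDeletion ((hS.zSeek (s.main q)).zEntry_right _ _) ?_ _ _
      exact (hp.delete hlt hi ht ho (.wake 0)).congr rfl rfl rfl rfl fun q' _ _ _ h => by simpa using h
  · simp only [Mind.treat, lt_irrefl, if_false, if_true]
    refine ⟨_, rfl, ?_⟩
    -- If session `d` has not come into being, the request is either disregarded or finds the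
    -- control tape of the requester empty. Both just pass activation on.
    cases hi : g.indices[q]? with
    | none =>
      have h1 : S.perform live rule sec (.relay msg p.relay) = PMF.pure S.idle ∨
          ∃ n, S.perform live rule sec (.relay msg p.relay) = PMF.pure (S.ySeek n).idle := by
        have hy := hp.none hi
        have hn : ∀ n, (S.ySeek n).yTarget = none := fun n => by
          change (S.yRefs[n]?).bind _ = none
          grind
        cases live
        · exact .inl rfl
        · cases p with
          | run =>
            refine .inr ⟨0, ?_⟩
            change PMF.pure ((S.ySeek 0).writeClient (S.ySeek 0).yTarget msg) = _
            rw [hn]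
            rfl
          | runDeletion =>
            refine .inr ⟨1, ?_⟩
            change PMF.pure ((S.ySeek 1).writeClient (S.ySeek 1).yTarget msg) = _
            rw [hn]
            rfl
          | delete =>
            refine .inr ⟨0, ?_⟩
            change (S.ySeek 0).yAct rule sec msg .delete = _
            rw [Sys.yAct_delete]
            change (match (S.ySeek 0).mainSession (S.yRefs[0]?) with | none => _ | some j => _) = _
            rw [hy]
            rfl
      have h2 : g.poke rule sec q msg p = PMF.pure g.sys.idle := by
        cases p <;> simp [Ghost.poke, hi, Ghost.target] <;> rfl
      rw [h2]
      rcases h1 with h1 | ⟨n, h1⟩ <;> rw [h1]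
      · exact Lift.pure (.idle hS (hcongr (.inr (.inr hi)) hp))
      · exact Lift.pure (.idle (hS.ySeek n) (hcongr (.inr (.inr hi)) hp))
    | some i =>
      obtain ⟨t, ht, hpr, ho⟩ := hm q i hi
      obtain ⟨n, hy, hn⟩ := hp.own i hi
      have hl : live = true := by
        grind
      subst hl
      cases p with
      | run =>
        refine Lift.pure ?_
        have h2 : (S.ySeek 0).yTarget = some i := by
          change (S.yRefs[0]?).bind _ = _
          rw [hy]
          rfl
        have h3 : g.target (false, q) = some i := by simp [Ghost.target, hi]
        rw [h2, h3]
        exact .writeClient (hS.ySeek 0) (hcongr (.inl (by simp)) hp) _ _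
      | runDeletion =>
        refine Lift.pure ?_
        have h2 : (S.ySeek 1).yTarget = g.target (true, q) := by
          change (S.yRefs[1]?).bind S.resolve = _
          -- The deletion has been requested before (`hP`), so there is an entry for it at position
          -- `1`, where the request looks.
          obtain ⟨m, rfl⟩ : ∃ m, n = m + 1 := ⟨n - 1, by grind⟩
          rw [hy]
          simp [List.replicate_succ, Ghost.target, hi]
          exact hS.resolve (.deletionOf i)
        rw [h2]
        exact .writeClient (hS.ySeek 1) (hcongr (.inl (by simp)) hp) _ _
      | delete =>
        simp only [Ghost.poke, hi]
        change Lift _ _ ((S.ySeek 0).yAct rule sec msg .delete)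
        rw [Sys.yAct_delete, (hS.ySeek 0).mainSession]
        change Lift _ _ (match g.sys.mainSession (S.yRefs[0]?) with | none => _ | some j => _)
        rw [hy]
        change Lift _ _ (match g.sys.mainSession (some (.session i)) with | none => _ | some j => _)
        rw [mainSession_of ht hpr]
        refine Landed.requestDeletion ((hS.ySeek 0).yEntry _ _) ?_ _ _
        exact (hp.deleteOwn hi).congr rfl rfl rfl rfl fun q' _ _ _ h => by simpa using h

theorem Mind.treat_fst {p : Chore} {q : ℕ} (hq : q ≤ d) (msg : Str) :
    ∃ del len, (s.treat D d p q msg).1 = { s with deletion := del, len := len, mode := .wake 0 } := by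
  unfold treat
  rcases hq.lt_or_eq with h | rfl
  · rw [if_pos h]
    aesop
  grind

/-- The requester initiates a session that comes into being. -/
theorem Landed.initiateMain (hS : Same W S)
    (hp : Pointers d P ix W.sessions W.zRefs S.zRefs S.yRefs s) (hP : ¬P ix.length) (msg : Str)
    {s' : Mind E R} {o : Order (E.extend D).m}
    (h2 : s'.clients = s.clients) (h4 : s'.deletion = s.deletion)
    (h : (ix.length < d ∧ s'.len = s.len + 1 ∧ s'.main = Function.update s.main ix.length s.len ∧
        o = .own 0 msg (.initiate .main (E.client D .main))) ∨
      (ix.length = d ∧ live = true ∧ s'.len = s.len ∧ s'.main = s.main ∧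
        o = .relay msg .initiate)) :
    Lift (fun W' S' => Landed d P (ix ++ [W.sessions.length]) W W' S' s')
      (W.initiate rule sec .main .requester (D.client .main) msg) (S.perform live rule sec o) := by
  rcases h with ⟨hd, h1, h3, rfl⟩ | ⟨hd, rfl, h1, h3, rfl⟩
  · change Lift _ _ ((S.zSeek 0).zAct rule sec msg (.initiate .main (E.client D .main)))
    rw [Sys.zAct_initiate, Environment.adv_client]
    refine Landed.initiate ((hS.zSeek 0).zEntry_right _ _) _ (fun h => by cases h) _ _ ?_
    rintro ss hg ⟨t, ht, ho⟩
    have := (hp.grows hg).initiate hd hP ht ho h1 h2 h3 h4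
    rwa [← hS.agree.length] at this ⊢
  · have hy := hp.none (List.getElem?_eq_none hd.le)
    change Lift _ _ (if S.yRefs = [] then (S.ySeek 0).yAct rule sec msg .initiate
      else PMF.pure S.idle)
    rw [if_pos hy]
    change Lift _ _ (((S.ySeek 0).yEntry .main (.session S.sessions.length)).initiate rule sec .main
      .requester (D.client .main) msg)
    refine Landed.initiate ((hS.ySeek 0).yEntry _ _) _ (fun _ => rfl) _ _ ?_
    rintro ss hg ⟨t, ht, ho⟩
    have := ((hp.grows hg).initiateOwn hd (hd ▸ hP) W.sessions.length).congr h1 h2 h3 h4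
      (P' := P) fun _ _ _ _ h => h
    rwa [← hS.agree.length] at this ⊢

/-- The environment acts. -/
theorem Landed.zAct (hS : Same W S) (hp : Pointers d P ix W.sessions W.zRefs S.zRefs S.yRefs s)
    (hc : Consistent D W.sessions W.zRefs W.z.control) (hz : s.z = W.z) (msg : Str)
    {a : EnvAct E.m} {o : Order (E.extend D).m} (ho : (s.zAct D msg a).2 = some o) :
    Lift (fun W' S' => Landed d P ix { W with z := (s.zAct D msg a).1.z } W' S'
      (s.zAct D msg a).1) (W.zAct rule sec msg a) (S.perform live rule sec o) := by
  have hpos : ∀ h, S.zRefs[s.pos h]? = W.zRefs[h]? := fun h => by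
    rw [← hp.refs.lookup h, Mind.pos, hp.len]
  cases a with
  | toRequester => cases ho
  | toCollector =>
    obtain rfl := Option.some.inj ho
    refine Lift.pure ⟨⟨.refl _, fun i t t' j h1 h2 => (Advance.refl W).token i t t' j h1 h2,
      by change s.z.calledAs W.z = W.z; rw [hz]; rfl, rfl, rfl⟩,
      ⟨⟨congrArg (fun x : ITI D.X => { x with caller := none }) hS.agree.x, hS.agree.sessions⟩, hS.alive, hS.output, hS.owner⟩,
      hp.congr rfl rfl rfl rfl fun _ _ _ _ h => h, .inl ⟨trivial, rfl⟩⟩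
  | input =>
    obtain rfl := Option.some.inj ho
    refine Lift.pure ?_
    have h1 : (S.zSeek (s.pos s.z.controlHead)).zTarget = W.zTarget := by
      change (S.zRefs[s.pos s.z.controlHead]?).bind S.resolve = _
      rw [hpos, hz]
      unfold Sys.zTarget
      congr 1
      exact funext hS.resolve
    have h2 : ({ W with z := s.z } : Sys D E R) = W := by rw [hz]
    change Landed d P ix { W with z := s.z } (W.writeClient W.zTarget msg)
      ((S.zSeek (s.pos s.z.controlHead)).writeClient (S.zSeek (s.pos s.z.controlHead)).zTarget msg)
      { s with mode := .wake 0 }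
    rw [h1, h2]
    refine .writeClient (hS.zSeek (s.pos s.z.controlHead)) ?_ _ _
    exact hp.congr rfl rfl rfl rfl fun _ _ _ _ h => h
  | initiate p i =>
    obtain rfl := Option.some.inj ho
    have h2 : ({ W with z := (s.newClient p).z } : Sys D E R) =
        { W with z := { W.z with control := W.z.control ++ [p] } } := by rw [← hz]; rfl
    change Lift (fun W' S' => Landed d P ix { W with z := (s.newClient p).z } W' S' (s.newClient p))
      _ ((S.zSeek 0).zAct rule sec msg (.initiate p (E.old D i)))
    rw [Sys.zAct_initiate, Sys.zAct_initiate, Environment.adv_old, h2]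
    have h3 : (S.zSeek 0).sessions.length = W.sessions.length := hS.agree.length
    rw [h3]
    refine (Landed.initiate (P := P) (ix := ix) (d := d) (s := s.newClient p)
      ((hS.zSeek 0).zEntry p (.session W.sessions.length)) _ (fun h => by cases h) _ _ ?_).mono
        fun _ _ h => ⟨⟨h.advance.grows, h.advance.token, h.advance.z, h.advance.y, h.advance.alive⟩,
          h.same, h.pointers, h.met⟩
    rintro ss hg -
    exact (hp.grows hg).newClient (.session W.sessions.length) p
  | delete i =>
    simp only [Mind.zAct] at ho ⊢
    split_ifs at ho ⊢ with h1
    obtain rfl := Option.some.inj ho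
    rw [hz] at h1
    have hlt := (List.getElem?_eq_some_iff.1 h1).1
    rw [← hc.length] at hlt
    have h3 := List.getElem?_eq_getElem hlt
    -- An entry labelled `main` cannot refer to the deletion of a session, since consistency labels
    -- such entries `deletion`.
    obtain ⟨j, h4⟩ : ∃ j, W.zRefs[W.z.controlHead]? = some (.session j) := by
      cases hr : W.zRefs[W.z.controlHead] with
      | session j => grind
      | deletionOf j =>
        rw [hr] at h3
        obtain ⟨t, -, -, h5⟩ := hc.deletionOf _ _ h3
        grind
    obtain ⟨t, ht, -, h5⟩ := hc.session _ _ h4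
    have h6 : t.protocol = .main := by
      grind
    have h7 : (S.zSeek (s.pos s.z.controlHead)).mainSession
        ((S.zSeek (s.pos s.z.controlHead)).zRefs[(S.zSeek (s.pos s.z.controlHead)).z.controlHead]?) =
        some j := by
      rw [(hS.zSeek _).mainSession]
      change W.mainSession (S.zRefs[s.pos s.z.controlHead]?) = _
      rw [hpos, hz, h4, mainSession_of ht h6]
    have h2 : ({ W with z := (s.newClient .deletion).z } : Sys D E R) =
        { W with z := { W.z with control := W.z.control ++ [.deletion] } } := by rw [← hz]; rfl
    change Lift _ _ ((S.zSeek (s.pos s.z.controlHead)).zAct rule sec [] (.delete (E.old D i)))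
    rw [Sys.zAct_delete _ _ _ h7, Sys.zAct_delete (j := j) _ _ _ (by rw [h4, mainSession_of ht h6]),
      Environment.adv_old]
    rw [h2]
    exact (Landed.requestDeletion (P := P) (ix := ix) (d := d) (s := s.newClient .deletion)
      ((hS.zSeek (s.pos s.z.controlHead)).zEntry .deletion (.deletionOf j))
      (hp.newClient (.deletionOf j) .deletion) _ _).mono
        fun _ _ h => ⟨⟨h.advance.grows, h.advance.token, h.advance.z, h.advance.y, h.advance.alive⟩,
          h.same, h.pointers, h.met⟩
  | output => cases ho
  | endAlive => cases ho

end

open Sys (firstMain pendingDeletion firstMain_eq_none)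

/-! ## The procedure of the terminate phase, session by session -/

/-- The deletion of the session has been requested. -/
def Mind.Requested (s : Mind E R) (q : ℕ) : Prop :=
  (true, q) ∈ s.entries ∨ 0 < s.counts .delete q

/-- The procedure of the terminate phase has had its effect as often as `k` tells. -/
structure Paid (ix : List ℕ) (W : Sys D E R) (count : ℕ) (k : Chore → ℕ → ℕ) : Prop where
  run : ∀ (q i : ℕ) (t : Session), ix[q]? = some i → W.sessions[i]? = some t →
    t.clientHalted = false → k .run q ≤ t.steps + if W.active = .client i then 1 else 0
  delete : ∀ (q i : ℕ) (t : Session), ix[q]? = some i → W.sessions[i]? = some t →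
    0 < k .delete q → t.clientHalted = true ∧ (D.tokenOf t = none ∨ t.deletion ≠ none)
  runDeletion : ∀ (q i j : ℕ) (t u : Session), ix[q]? = some i → W.sessions[i]? = some t →
    t.deletion = some j → W.sessions[j]? = some u → u.clientHalted = false →
    k .runDeletion q ≤ u.steps + if W.active = .client j then 1 else 0
  order : ∀ q, 0 < k .runDeletion q → 0 < k .delete q
  fresh : ∀ q, count ≤ q → ∀ p, k p q = 0

section

variable {W W' : Sys D E R} {ix : List ℕ} {count : ℕ} {k : Chore → ℕ → ℕ}

theorem Session.Evolves.of_unhalted {t t' : Session} (h : t.Evolves t')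
    (ht : t'.clientHalted = false) : t.clientHalted = false := by
  by_contra hh
  rw [Bool.not_eq_false] at hh
  rw [h.halted hh] at ht
  cases ht

/-- An activated client has a credit of one step. If it has not halted, its next step turns the
credit into an actual step (`hstep`). As to deletions, the transcript is frozen once the client has
halted, so that a missing token remains missing and a request found void stays void. -/
theorem Paid.advance {zr : List Ref} {zc : List Protocol} (h : Paid ix W count k)
    (ha : Advance W W') (hm : MainSessions W.sessions ix) (hc : Consistent D W.sessions zr zc)
    (hstep : ∀ (i : ℕ) (t t' : Session), W.active = .client i → W.sessions[i]? = some t →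
      W'.sessions[i]? = some t' → t.clientHalted = false → t.steps + 1 ≤ t'.steps) :
    Paid ix W' count k := by
  have key : ∀ (i n : ℕ) (t t' : Session), W.sessions[i]? = some t → W'.sessions[i]? = some t' →
      t.Evolves t' → t'.clientHalted = false →
      n ≤ t.steps + (if W.active = .client i then 1 else 0) →
      n ≤ t'.steps + if W'.active = .client i then 1 else 0 := by
    intro i n t t' h1 h2 h3 h4 h5
    have h6 := h3.steps
    split_ifs at h5 with h7
    · have := hstep i t t' h7 h1 h2 (h3.of_unhalted h4)
      omega
    · omega
  refine ⟨fun q i t' h1 h2 h3 => ?_, fun q i t' h1 h2 h3 => ?_, fun q i j t' u' h1 h2 h3 h4 h5 => ?_,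
    h.order, h.fresh⟩ <;>
    obtain ⟨t, ht, -, -⟩ := hm q i h1 <;>
    obtain ⟨t₁, h6, h7, -⟩ := ha.grows i t ht <;>
    obtain rfl := some_unique h2 h6
  · exact key i _ t t' ht h2 h7 h3 (h.run q i t h1 ht (h7.of_unhalted h3))
  · obtain ⟨h8, h9⟩ := h.delete q i t h1 ht h3
    refine ⟨h7.halted h8, h9.imp (fun h => by rw [h7.tokenOf h8, h]) fun h => ?_⟩
    obtain ⟨j, hj⟩ := Option.ne_none_iff_exists'.1 h
    rw [h7.deletion j hj]
    simp
  · cases hd : t.deletion with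
    | none =>
      -- A deletion that comes into being just now shows that there was a token and no deletion
      -- before. So the deletion has not yet been ordered by the procedure and, by `order`, its
      -- client has not been activated by it.
      have h8 := ha.token i t t' j ht h2 hd h3
      have h9 : k .runDeletion q = 0 := by
        by_contra hne
        obtain ⟨-, h9⟩ := h.delete q i t h1 ht (h.order q (Nat.pos_of_ne_zero hne))
        grind
      omega
    | some j' =>
      obtain rfl : j' = j := Option.some.inj ((h7.deletion j' hd).symm.trans h3)
      obtain ⟨u, hu, -, -⟩ := hc.deletion i t j' ht hd
      obtain ⟨u₁, h8, h9, -⟩ := ha.grows j' u hu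
      obtain rfl := some_unique h4 h8
      exact key j' _ u u' hu h4 h9 h5 (h.runDeletion q i j' t u h1 ht hd hu (h9.of_unhalted h5))

theorem Paid.congr (h : Paid ix W count k) (h1 : W'.sessions = W.sessions)
    (h2 : ∀ i, W.active ≠ .client i) : Paid ix W' count k := by
  have h3 : ∀ i n, n ≤ n + if W'.active = .client i then 1 else 0 := fun _ _ => Nat.le_add_right _ _
  refine ⟨fun q i t h4 h5 h6 => ?_, by rw [h1]; exact h.delete,
    fun q i j t u h4 h5 h6 h7 h8 => ?_, h.order, h.fresh⟩
  · rw [h1] at h5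
    have := h.run q i t h4 h5 h6
    grind
  · rw [h1] at h5 h7
    have := h.runDeletion q i j t u h4 h5 h6 h7 h8
    grind

theorem Paid.count_le (h : Paid ix W count k) {count' : ℕ} (hc : count ≤ count') :
    Paid ix W count' k :=
  ⟨h.run, h.delete, h.runDeletion, h.order, fun q hq => h.fresh q (hc.trans hq)⟩

theorem Paid.initiate (h : Paid ix W count k) (hl : ix.length = count) (n : ℕ) :
    Paid (ix ++ [n]) W (count + 1) k := by
  have hix : ∀ {q i : ℕ}, (ix ++ [n])[q]? = some i → (∀ p, k p q = 0) ∨ ix[q]? = some i := by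
    intro q i hq
    rw [List.getElem?_append] at hq
    split_ifs at hq with hlt
    · exact .inr hq
    · exact .inl (h.fresh q (by omega))
  refine ⟨fun q i t h1 h2 h3 => ?_, fun q i t h1 h2 h3 => ?_, fun q i j t u h1 h2 h3 h4 h5 => ?_,
    h.order, fun q hq => h.fresh q (by omega)⟩ <;> rcases hix h1 with h6 | h6
  · grind
  · exact h.run q i t h6 h2 h3
  · grind
  · exact h.delete q i t h6 h2 h3
  · grind
  · exact h.runDeletion q i j t u h6 h2 h3 h4 h5

theorem Session.clientInput_nil : Session.clientInput [] = id := by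
  funext t
  simp [Session.clientInput, Session.mapClient, written]

theorem Sys.writeClient_nil (W : Sys D E R) (i : ℕ) :
    W.writeClient (some i) [] = { W with active := .client i } := by
  rw [writeClient_some, Session.clientInput_nil, List.modify_id]

theorem firstMain_of {ss : List Session} {P : Session → Bool} {q i : ℕ} {t : Session}
    (h1 : (mainIndices ss)[q]? = some i) (h2 : ss[i]? = some t) (h3 : P t = true)
    (h4 : ∀ q' < q, ∀ (i' : ℕ) (t' : Session), (mainIndices ss)[q']? = some i' →
      ss[i']? = some t' → P t' = false) : firstMain ss P = some i := by
  obtain ⟨h5, h6⟩ := List.getElem?_eq_some_iff.1 h1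
  rw [firstMain, List.find?_eq_some_iff_getElem]
  grind

theorem firstMain_none_of {ss : List Session} {P : Session → Bool}
    (h : ∀ (q i : ℕ) (t : Session), (mainIndices ss)[q]? = some i → ss[i]? = some t →
      P t = false) : firstMain ss P = none := by
  refine firstMain_eq_none.2 fun i t h1 h2 => ?_
  obtain ⟨q, hq, hq'⟩ := List.getElem_of_mem (mem_mainIndices.2 ⟨t, h1, h2⟩)
  exact h q i t (by grind) h1

/-- A bound on the number of steps of the clients of the requester. -/
def Bounded (D : DataCollector) (L T : ℕ) : Prop :=
  0 < T ∧ ∀ (p : Protocol) (c : ITI (D.client p)), Reachable (D.client p) c → c.input.length ≤ L →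
    c.randomness.length < T

theorem exists_bounded (D : DataCollector) (L : ℕ) : ∃ T, Bounded D L T := by
  obtain ⟨a, ha⟩ := D.client_ppt .main
  obtain ⟨b, hb⟩ := D.client_ppt .deletion
  -- The sum of the polynomial bounds of the two honest clients at input length `L`, plus one for
  -- strictness and positivity.
  refine ⟨L ^ a + a + (L ^ b + b) + 1, by omega, fun p c hc hl => ?_⟩
  cases p with
  | main =>
    have h1 := ha c hc
    have h2 := Nat.pow_le_pow_left hl a
    omega
  | deletion =>
    have h1 := hb c hc
    have h2 := Nat.pow_le_pow_left hl b
    omega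

/-- Clients of the requester run the honest programs (`Consistent.program`), so the bound for these
applies as long as no input is long. -/
theorem Bounded.steps {L T : ℕ} (h : Bounded D L T) {g : Ghost D E R} {zr : List Ref}
    {zc : List Protocol} (hc : Consistent D g.sys.sessions zr zc) (hL : ¬g.Long L) {i : ℕ}
    {t : Session} (ht : g.sys.sessions[i]? = some t) (ho : t.owner = .requester) : t.steps < T := by
  have h1 : t.input.length ≤ L := by
    by_contra hlt
    exact hL ⟨i, t, ht, ho, not_le.1 hlt⟩
  obtain ⟨h2, h3⟩ := hc.program i t ht ho
  revert h1 h3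
  unfold Session.input Session.steps
  generalize t.client = c at h2 ⊢
  obtain ⟨M, c⟩ := c
  dsimp only at h2 ⊢
  subst h2
  exact fun h1 h3 => h.2 _ c h3 h1

end

section

variable {g : Ghost D E R} {s : Mind E R} {d T L lim sec : ℕ} {rule : SidRule}

theorem Mind.first_eq_some {p : Chore} {q : ℕ} (h : s.first d T p = some q) :
    q < min s.count (d + 1) ∧ s.counts p q < p.limit T ∧ ∀ q' < q, p.limit T ≤ s.counts p q' := by
  rw [first, List.find?_range_eq_some] at h
  obtain ⟨h1, h2, h3⟩ := h
  exact ⟨List.mem_range.1 h2, by simpa using h1, fun q' hq' => by simpa using h3 q' hq'⟩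

theorem Mind.first_eq_none {p : Chore} (h : s.first d T p = none) :
    ∀ q < min s.count (d + 1), p.limit T ≤ s.counts p q := by
  intro q hq
  rw [first, List.find?_eq_none] at h
  simpa using h q (List.mem_range.2 hq)

/-- Nothing is left to be done. -/
structure Finished (D : DataCollector) (ss : List Session) : Prop where
  run : firstMain ss (fun t => !t.clientHalted) = none
  delete : firstMain ss (fun t => (D.tokenOf t).isSome && t.deletion.isNone) = none
  runDeletion : firstMain ss (fun t => (pendingDeletion ss t).isSome) = none

theorem Finished.schedule {W : Sys D E R} (h : Finished D W.sessions) :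
    W.schedule rule sec = PMF.pure { W with active := .done } := by
  rw [Sys.schedule_eq, h.run, h.delete, h.runDeletion]

theorem Ghost.Inv.mainSessions (hI : g.Inv lim sec) : MainSessions g.sys.sessions g.indices :=
  fun q i hq => by
    rw [hI.indices] at hq
    obtain ⟨t, h1, h2⟩ := mem_mainIndices.1 (List.mem_of_getElem? hq)
    simp [Session.isMain] at h2
    grind

/-- The procedure of the terminate phase agrees with the chores. -/
theorem schedule_chore (hI : g.Inv lim sec) (hlim : lim ≤ d + 1) (ha : g.sys.active = .scheduler)
    (hal : g.sys.alive = false) (hB : Bounded D L T) (hL : ¬g.Long L) (hc : s.count = g.count)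
    (hP : Paid g.indices g.sys g.count s.counts) :
    match s.chore d T with
    | some (p, q) =>
      q < s.count ∧ q ≤ d ∧ s.counts p q < p.limit T ∧
      (p = .runDeletion → 0 < s.counts .delete q) ∧
      ((g.sys.schedule rule sec = g.poke rule sec q [] p ∧
          ∀ W' ∈ (g.poke rule sec q [] p).support, Advance g.sys W' →
            Paid g.indices W' g.count (s.tick p q).counts) ∨
        (Paid g.indices g.sys g.count (s.tick p q).counts ∧
          (g.poke rule sec q [] p = PMF.pure g.sys ∨
            ∃ (i : ℕ) (t : Session), g.poke rule sec q [] p =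
              PMF.pure { g.sys with active := .client i } ∧ g.sys.sessions[i]? = some t ∧
                t.clientHalted = true)))
    | none => Finished D g.sys.sessions := by
  -- With the procedure active in the terminate phase, passing on activation changes nothing, so a
  -- chore without effect leaves the first execution exactly where it is.
  have hidle : g.sys.idle = g.sys := by
    unfold Sys.idle
    rw [if_neg (by simp [hal]), ← ha]
  have hlt : ∀ {q i : ℕ}, g.indices[q]? = some i → q < min s.count (d + 1) := fun {q i} hq => by
    have := (List.getElem?_eq_some_iff.1 hq).1
    rw [hI.length] at this
    omega
  have hm := hI.mainSessions
  have hnc : ∀ i, g.sys.active ≠ .client i := fun i h => by rw [ha] at h; cases h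
  -- Every activation counted has led to a step, and fewer than `T` steps are made in all; so a
  -- client that has used up its quota of `T` activations must have halted.
  have hrun : ∀ (q i : ℕ) (t : Session), g.indices[q]? = some i → g.sys.sessions[i]? = some t →
      t.clientHalted = false → s.counts .run q ≤ t.steps ∧ s.counts .run q < T := by
    intro q i t h1 h2 h3
    have h4 := hP.run q i t h1 h2 h3
    rw [if_neg (hnc i)] at h4
    obtain ⟨t', h5, -, h6⟩ := hm q i h1
    obtain rfl := some_unique h2 h5
    have := hB.steps hI.consistent hL h2 h6
    exact ⟨h4, by omega⟩
  have hdel : ∀ (q i j : ℕ) (t u : Session), g.indices[q]? = some i →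
      g.sys.sessions[i]? = some t → t.deletion = some j → g.sys.sessions[j]? = some u →
      u.clientHalted = false →
      s.counts .runDeletion q ≤ u.steps ∧ s.counts .runDeletion q < T := by
    intro q i j t u h1 h2 h3 h4 h5
    have h6 := hP.runDeletion q i j t u h1 h2 h3 h4 h5
    rw [if_neg (hnc j)] at h6
    obtain ⟨t', h7, -, h8⟩ := hm q i h1
    obtain rfl := some_unique h2 h7
    obtain ⟨u', h9, h10, -⟩ := hI.consistent.deletion i t j h2 h3
    obtain rfl := some_unique h4 h9
    have := hB.steps hI.consistent hL h4 (h10.trans h8)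
    exact ⟨h6, by omega⟩
  have hfresh : ∀ {p : Chore} {q : ℕ}, q < s.count → ∀ q', g.count ≤ q' → ∀ p',
      (s.tick p q).counts p' q' = 0 := fun {p q} hq q' hq' p' => by
    simp only [Mind.tick]
    rw [if_neg (by rintro ⟨-, rfl⟩; omega)]
    exact hP.fresh q' hq' p'
  have htick : ∀ {p p' : Chore} {q q' : ℕ}, (s.tick p q).counts p' q' =
      if p' = p ∧ q' = q then s.counts p q + 1 else s.counts p' q' := rfl
  -- An exhausted quota means that the procedure itself finds nothing of this kind to do for the
  -- session. Hence the first ordinal with quota left is the procedure's choice if there is really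
  -- something to do for it. The next two claims say the same for the other chores.
  have hA1 : ∀ {q : ℕ}, (∀ q' < q, (Chore.run).limit T ≤ s.counts .run q') → ∀ q' < q,
      ∀ (i' : ℕ) (t' : Session), (mainIndices g.sys.sessions)[q']? = some i' →
      g.sys.sessions[i']? = some t' → (!t'.clientHalted) = false := by
    intro q h q' hq' i' t' h1 h2
    by_contra hne
    have h3 := (hrun q' i' t' (hI.indices ▸ h1) h2 (by simpa using hne)).2
    have := h q' hq'
    simp only [Chore.limit] at this
    omega
  have hA2 : ∀ {q : ℕ}, (∀ q' < q, (Chore.delete).limit T ≤ s.counts .delete q') → ∀ q' < q,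
      ∀ (i' : ℕ) (t' : Session), (mainIndices g.sys.sessions)[q']? = some i' →
      g.sys.sessions[i']? = some t' → ((D.tokenOf t').isSome && t'.deletion.isNone) = false := by
    intro q h q' hq' i' t' h1 h2
    rcases (hP.delete q' i' t' (hI.indices ▸ h1) h2 (h q' hq')).2 with h3 | h3
    · simp [h3]
    · obtain ⟨j, hj⟩ := Option.ne_none_iff_exists'.1 h3
      simp [hj]
  have hA3 : ∀ {q : ℕ}, (∀ q' < q, (Chore.runDeletion).limit T ≤ s.counts .runDeletion q') →
      ∀ q' < q, ∀ (i' : ℕ) (t' : Session), (mainIndices g.sys.sessions)[q']? = some i' →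
      g.sys.sessions[i']? = some t' → (pendingDeletion g.sys.sessions t').isSome = false := by
    intro q h q' hq' i' t' h1 h2
    cases hd : t'.deletion with
    | none => simp [pendingDeletion, hd]
    | some j =>
      obtain ⟨u, hu, -⟩ := hI.consistent.deletion i' t' j h2 hd
      have hh : u.clientHalted = true := by
        by_contra hne
        have h3 := (hdel q' i' j t' u (hI.indices ▸ h1) h2 hd hu (by simpa using hne)).2
        have := h q' hq'
        simp only [Chore.limit] at this
        omega
      simp [pendingDeletion, hd, hu, hh, Option.filter]
  have hall : ∀ {p : Chore} {P : Session → Bool}, s.first d T p = none →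
      (∀ {q : ℕ}, (∀ q' < q, p.limit T ≤ s.counts p q') → ∀ q' < q, ∀ (i' : ℕ) (t' : Session),
        (mainIndices g.sys.sessions)[q']? = some i' → g.sys.sessions[i']? = some t' →
        P t' = false) → firstMain g.sys.sessions P = none := by
    intro p P h1 h2
    refine firstMain_none_of fun q i t h3 h4 => ?_
    refine h2 (q := min s.count (d + 1)) (fun q' hq' => Mind.first_eq_none h1 q' hq') q
      (hlt (hI.indices ▸ h3)) i t h3 h4
  have hnone : ∀ {p : Chore} {q : ℕ}, g.indices[q]? = none →
      g.poke rule sec q [] p = PMF.pure g.sys := fun {p q} hq => by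
    cases p <;> simp [Ghost.poke, Ghost.target, hq, Sys.writeClient, hidle]
  unfold Mind.chore
  cases h1 : s.first d T .run with
  | some q =>
    obtain ⟨hq1, hq2, hq3⟩ := Mind.first_eq_some h1
    refine ⟨by omega, by omega, hq2, (fun h => nomatch h), ?_⟩
    have hpaid : ∀ W' : Sys D E R, W'.sessions = g.sys.sessions →
        (∀ i t, g.indices[q]? = some i → g.sys.sessions[i]? = some t → t.clientHalted = false →
          W'.active = .client i) →
        Paid g.indices W' g.count (s.tick .run q).counts := by
      intro W' h2 h3
      have h4 := hP.congr h2 hnc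
      refine ⟨fun q' i t h5 h6 h7 => ?_, h4.delete, h4.runDeletion, h4.order, hfresh (by omega)⟩
      rw [htick]
      split_ifs with h8 h9 h9
      · obtain ⟨-, rfl⟩ := h8
        have := (hrun q' i t h5 (h2 ▸ h6) h7).1
        omega
      · obtain ⟨-, rfl⟩ := h8
        exact absurd (h3 i t h5 (h2 ▸ h6) h7) h9
      · have := (hrun q' i t h5 (h2 ▸ h6) h7).1
        omega
      · exact (hrun q' i t h5 (h2 ▸ h6) h7).1
    -- The requester has asked for a session with this ordinal, but the session may lie beyond the
    -- limit and not exist; then the chore is void.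
    cases hi : g.indices[q]? with
    | none =>
      exact .inr ⟨hpaid _ rfl fun i t h => by simp [hi] at h, .inl (hnone hi)⟩
    | some i =>
      obtain ⟨t, ht, -⟩ := hm q i hi
      have hp : g.poke rule sec q [] .run = PMF.pure { g.sys with active := .client i } := by
        simp [Ghost.poke, Ghost.target, hi, Sys.writeClient_nil]
      cases hh : t.clientHalted with
      | true =>
        refine .inr ⟨hpaid _ rfl fun i' t' h2 h3 h4 => ?_, .inr ⟨i, t, hp, ht, hh⟩⟩
        obtain rfl := some_unique hi h2
        obtain rfl := some_unique ht h3
        rw [hh] at h4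
        cases h4
      | false =>
        refine .inl ⟨?_, fun W' hW' _ => ?_⟩
        · rw [hp, Sys.schedule_eq, firstMain_of (hI.indices ▸ hi) ht (by simp [hh]) (hA1 hq3)]
        · rw [hp, mem_pure] at hW'
          subst hW'
          refine hpaid _ rfl fun i' t' h2 _ _ => ?_
          rw [some_unique h2 hi]
  | none =>
    have hf1 := hall h1 hA1
    cases h2 : s.first d T .delete with
    | some q =>
      obtain ⟨hq1, hq2, hq3⟩ := Mind.first_eq_some h2
      refine ⟨by omega, by omega, hq2, (fun h => nomatch h), ?_⟩
      have hpaid : ∀ W' : Sys D E R, Paid g.indices W' g.count s.counts →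
          (∀ i t, g.indices[q]? = some i → W'.sessions[i]? = some t →
            t.clientHalted = true ∧ (D.tokenOf t = none ∨ t.deletion ≠ none)) →
          Paid g.indices W' g.count (s.tick .delete q).counts := by
        intro W' h3 h4
        refine ⟨h3.run, fun q' i t h5 h6 h7 => ?_, h3.runDeletion, fun q' h5 => ?_,
          hfresh (by omega)⟩
        · rw [htick] at h7
          split_ifs at h7 with h8
          · obtain ⟨-, rfl⟩ := h8
            exact h4 i t h5 h6
          · exact h3.delete q' i t h5 h6 h7
        · have := h3.order q' h5
          rw [htick]
          split_ifs <;> omega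
      cases hi : g.indices[q]? with
      | none =>
        exact .inr ⟨hpaid _ hP fun i t h => by simp [hi] at h, .inl (hnone hi)⟩
      | some i =>
        obtain ⟨t, ht, -⟩ := hm q i hi
        have hp : g.poke rule sec q [] .delete =
            g.sys.requestDeletion rule sec i (D.client .deletion) := by
          simp only [Ghost.poke, hi]
        have hh : t.clientHalted = true := by
          have := (firstMain_eq_none.1 hf1) i t ht
            (by
              obtain ⟨t', h3, h4, h5⟩ := hm q i hi
              obtain rfl := some_unique ht h3
              simp [Session.isMain, h4, h5])
          simpa using this
        rcases g.sys.requestDeletion_cases i with ⟨t', tok, h3, h4, h5⟩ | h3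
        · obtain rfl := some_unique ht h3
          refine .inl ⟨?_, fun W' hW' hadv => ?_⟩
          · rw [hp, Sys.schedule_eq, hf1,
              firstMain_of (hI.indices ▸ hi) ht (by simp [h4, h5]) (hA2 hq3)]
          · have h6 := hP.advance hadv hm hI.consistent fun i' _ _ h => absurd h (hnc i')
            refine hpaid W' h6 fun i' t₂ h7 h8 => ?_
            obtain rfl := some_unique hi h7
            rw [hp, Sys.requestDeletion_eq rule sec _ h3 h4 h5, PMF.mem_support_map_iff] at hW'
            obtain ⟨sid, -, rfl⟩ := hW'
            have h9 := getElem?_withDeletion_self ht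
              (Session.fresh D sec .deletion t.owner (D.client .deletion) tok sid)
            obtain rfl := some_unique h8 h9
            exact ⟨hh, .inr (by simp)⟩
        · refine .inr ⟨hpaid _ hP fun i' t' h4 h5 => ?_, .inl ?_⟩
          · obtain rfl := some_unique hi h4
            obtain rfl := some_unique ht h5
            exact ⟨hh, h3 t ht⟩
          · rw [hp, Sys.requestDeletion_eq_idle rule sec _ h3, hidle]
    | none =>
      have hf2 := hall h2 hA2
      cases h3 : s.first d T .runDeletion with
      | none => exact ⟨hf1, hf2, hall h3 hA3⟩
      | some q =>
        obtain ⟨hq1, hq2, hq3⟩ := Mind.first_eq_some h3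
        have hqd : 0 < s.counts .delete q := Mind.first_eq_none h2 q hq1
        refine ⟨by omega, by omega, hq2, fun _ => hqd, ?_⟩
        have hpaid : ∀ W' : Sys D E R, W'.sessions = g.sys.sessions →
            (∀ i j t u, g.indices[q]? = some i → g.sys.sessions[i]? = some t →
              t.deletion = some j → g.sys.sessions[j]? = some u → u.clientHalted = false →
              W'.active = .client j) →
            Paid g.indices W' g.count (s.tick .runDeletion q).counts := by
          intro W' h4 h5
          have h6 := hP.congr h4 hnc
          refine ⟨h6.run, h6.delete, fun q' i j t u h7 h8 h9 h10 h11 => ?_, fun q' h7 => ?_,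
            hfresh (by omega)⟩
          · rw [h4] at h8 h10
            have h13 := (hdel q' i j t u h7 h8 h9 h10 h11).1
            rw [htick]
            split_ifs with h12 h14 h14
            · obtain ⟨-, rfl⟩ := h12
              omega
            · obtain ⟨-, rfl⟩ := h12
              exact absurd (h5 i j t u h7 h8 h9 h10 h11) h14
            · omega
            · omega
          · rw [htick] at h7
            split_ifs at h7 with h8
            · rw [h8.2]; exact hqd
            · exact h6.order q' h7
        cases hi : g.indices[q]? with
        | none =>
          exact .inr ⟨hpaid _ rfl fun i j t u h => by simp [hi] at h, .inl (hnone hi)⟩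
        | some i =>
          obtain ⟨t, ht, -⟩ := hm q i hi
          have htar : g.target (true, q) = t.deletion := by
            simp [Ghost.target, hi, ht]
          cases hd : t.deletion with
          | none =>
            refine .inr ⟨hpaid _ rfl fun i' j' t' u' h4 h5 h6 => ?_, .inl ?_⟩
            · obtain rfl := some_unique hi h4
              obtain rfl := some_unique ht h5
              rw [hd] at h6
              cases h6
            · simp only [Ghost.poke, htar, hd, Sys.writeClient, hidle]
          | some j =>
            obtain ⟨u, hu, -⟩ := hI.consistent.deletion i t j ht hd
            have hp : g.poke rule sec q [] .runDeletion =
                PMF.pure { g.sys with active := .client j } := by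
              simp only [Ghost.poke, htar, hd, Sys.writeClient_nil]
            cases hh : u.clientHalted with
            | true =>
              refine .inr ⟨hpaid _ rfl fun i' j' t' u' h4 h5 h6 h7 h8 => ?_, .inr ⟨j, u, hp, hu, hh⟩⟩
              obtain rfl := some_unique hi h4
              obtain rfl := some_unique ht h5
              obtain rfl := some_unique hd h6
              obtain rfl := some_unique hu h7
              rw [hh] at h8
              cases h8
            | false =>
              have hpd : pendingDeletion g.sys.sessions t = some j := by
                simp [pendingDeletion, hd, hu, hh, Option.filter]
              refine .inl ⟨?_, fun W' hW' _ => ?_⟩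
              · rw [hp, Sys.schedule_eq, hf1, hf2,
                  firstMain_of (hI.indices ▸ hi) ht (by simp [hpd]) (hA3 hq3)]
                simp [ht, hpd]
              · rw [hp, mem_pure] at hW'
                subst hW'
                refine hpaid _ rfl fun i' j' t' u' h4 h5 h6 _ _ => ?_
                obtain rfl := some_unique hi h4
                obtain rfl := some_unique ht h5
                rw [some_unique h6 hd]

end

open Sys (firstMain pendingDeletion firstMain_eq_none)

/-! ## The coupling of the two executions -/

/-- The mind of the environment is right about the execution that it emulates. -/
structure Linked (d : ℕ) (g : Ghost D E R)
    (S : Sys D (E.extend D) idler) (s : Mind E R) : Prop where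
  same : Same g.sys S
  pointers : Pointers d s.Requested g.indices g.sys.sessions g.sys.zRefs S.zRefs S.yRefs s
  z : s.z.calledAs g.sys.z = g.sys.z
  y : s.y = g.sys.y
  entries : s.entries = g.entries
  count : s.count = g.count
  alive : s.alive = g.sys.alive

/-- The mind of the environment is about to do what the other execution does. -/
def Ready (g : Ghost D E R) (s : Mind E R) : Prop :=
  (s.mode = .environment ∧ g.sys.active = .environment ∧ s.z = g.sys.z) ∨
  (s.mode = .requester ∧ g.sys.active = .requester) ∨
  (s.mode = .scheduler ∧ g.sys.active = .scheduler ∧ g.sys.alive = false)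

/-- The relation of the two executions. -/
inductive Coupled (d : ℕ) (enc : View → ℕ)
    (g : Ghost D E R) (S : Sys D (E.extend D) idler) (s : Mind E R) : Prop
  | meeting : s.mode = .wake 0 → Linked d g S s → Paid g.indices g.sys g.count s.counts →
      Met g.sys S s.clients → Coupled d enc g S s
  | ready : S.active = .environment → Linked d g S s → Paid g.indices g.sys g.count s.counts →
      Ready g s → Coupled d enc g S s
  | done : g.sys.active = .done → S.active = .done → S.x = g.sys.x →
      S.z.output = written (List.replicate (enc g.sys.outcome.2 + 1) true) → Coupled d enc g S s

/-- If `a` and `b` were unrelated, the indicator of `b` would be dominated by that of the complement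
of `a`, the expectation of which is `0`; so `b` would have probability `0`. -/
theorem Lift.of_pure_left {α β : Type*} {r : α → β → Prop} {a : α} {q : PMF β}
    (h : Lift r (PMF.pure a) q) {b : β} (hb : b ∈ q.support) : r a b := by
  classical
  by_contra hr
  have h1 := h.2 (fun x => if x = a then 0 else 1) (fun y => if y = b then 1 else 0) fun x y hxy => by
    by_cases hy : y = b
    · grind
    · simp [hy]
  rw [ev_pure, if_pos rfl, nonpos_iff_eq_zero] at h1
  unfold ev at h1
  simp_all

section

variable {g : Ghost D E R}
  {S : Sys D (E.extend D) idler} {s : Mind E R} {d T L lim sec : ℕ} {rule : SidRule} {live : Bool}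
  {enc : View → ℕ}

theorem ITI.eq_of_calledAs {A : Type} {M : ITM A} {z w : ITI M} (h : z.calledAs w = w)
    {c : Option ℕ} (hc : w.caller = c) : { z with caller := c } = w := by
  aesop

theorem Landed.linked {P : ℕ → Prop} {W : Sys D E R} (h : Landed d P g.indices W g.sys S s)
    (hP : ∀ q, s.Requested q → P q) (hz : s.z.calledAs W.z = W.z) (hy : s.y = W.y)
    (hal : s.alive = W.alive) (he : s.entries = g.entries) (hc : s.count = g.count) :
    Linked d g S s := by
  refine ⟨h.same, h.pointers.congr rfl rfl rfl rfl fun q _ _ _ => hP q, ?_, hy.trans h.advance.y.symm,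
    he, hc, hal.trans h.advance.alive.symm⟩
  have h1 : s.z.calledAs g.sys.z = (s.z.calledAs W.z).calledAs g.sys.z := rfl
  rw [h1, hz, h.advance.z]

theorem Linked.idle (h : Linked d g S s) :
    Linked d { g with sys := g.sys.idle } S s.idle := by
  refine ⟨h.same.congr (by simp) (by simp) rfl rfl rfl rfl, ?_, ?_, ?_, by simp [h.entries],
    by simp [h.count], ?_⟩
  · dsimp only
    rw [Sys.idle_sessions, Sys.idle_zRefs]
    exact h.pointers.congr (by simp) (by simp) (by simp) (by simp) fun q _ _ _ h1 => by
      simpa [Mind.Requested] using h1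
  · unfold Mind.idle Sys.idle
    rw [h.alive]
    split
    · have := h.z
      change _ = { g.sys.z with caller := none }
      rw [← this]
      rfl
    · exact h.z
  · unfold Mind.idle
    rw [Sys.idle_y]
    split <;> exact h.y
  · unfold Mind.idle
    rw [Sys.idle_alive]
    split <;> exact h.alive

/-- Only the first execution passes activation on. In the second one the environment stays active
and merely changes its mind. -/
theorem Coupled.idle (ha : S.active = .environment) (h : Linked d g S s)
    (hp : Paid g.indices g.sys.idle g.count s.counts) :
    Coupled d enc { g with sys := g.sys.idle } S s.idle := by
  refine .ready ha h.idle (by simpa using hp) ?_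
  have h1 := h.alive
  cases hal : g.sys.alive with
  | true =>
    rw [hal] at h1
    refine .inl ⟨?_, ?_, ?_⟩
    · simp [Mind.idle, h1]
    · simp [Sys.idle, hal]
    · simp only [Mind.idle, h1, Sys.idle, hal, if_true]
      rw [← h.z]
      rfl
  | false =>
    rw [hal] at h1
    refine .inr (.inr ⟨?_, ?_, ?_⟩)
    · simp [Mind.idle, h1]
    · simp [Sys.idle, hal]
    · simp [hal]

/-- The relation of the two processes. -/
def Coupling (D : DataCollector) (E : Environment) (R : Requester) (d T : ℕ) (enc : View → ℕ)
    (sec : ℕ) (g : Ghost D E R) (c : Macro D (E.extend D) (Mind.plan D E R d T enc sec)) : Prop :=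
  c.pend = none ∧ Coupled d enc g c.sys c.st

/-- The configuration of the second execution. -/
def conf (d T : ℕ) (enc : View → ℕ) (sec : ℕ) (S : Sys D (E.extend D) idler) (s : Mind E R)
    (o : Option (Order (E.extend D).m)) : Macro D (E.extend D) (Mind.plan D E R d T enc sec) :=
  ⟨S, s, o⟩

variable {B : Payoff} {p : PMF (Ghost D E R)} {o : Option (Order (E.extend D).m)}

theorem payoff_conf (ha : S.active ≠ .done) : (conf d T enc sec S s o).payoff B = 0 :=
  Sys.payoff_of_active ha

theorem payoff_conf_environment (ha : S.active = .environment) :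
    (conf d T enc sec S s o).payoff B = 0 := payoff_conf (by simp [ha])

theorem step_conf (ha : S.active = .environment) :
    Macro.step live rule sec (conf d T enc sec S s none) = Sys.coin.map fun b =>
      conf d T enc sec S
        (s.next D d T enc (decide (S.z.caller = some s.look.1)) (S.zLook s.look) b).1
        (s.next D d T enc (decide (S.z.caller = some s.look.1)) (S.zLook s.look) b).2 :=
  Macro.step_next ha rfl

theorem step_conf_pure (ha : S.active = .environment) {r : Mind E R × Option (Order (E.extend D).m)}
    (h : ∀ b, s.next D d T enc (decide (S.z.caller = some s.look.1)) (S.zLook s.look) b = r) :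
    Macro.step live rule sec (conf d T enc sec S s none) =
      PMF.pure (conf d T enc sec S r.1 r.2) := by
  rw [step_conf ha]
  simp only [h]
  exact Sys.coin_map_const _

theorem step_conf_pend (ha : S.active = .environment) {o : Order (E.extend D).m} :
    Macro.step live rule sec (conf d T enc sec S s (some o)) =
      (S.perform live rule sec o).map fun S' => conf d T enc sec S' s none :=
  Macro.step_pend ha rfl

theorem step_conf_ne (ha : S.active ≠ .environment) :
    Macro.step live rule sec (conf d T enc sec S s o) =
      (S.step rule sec).map fun S' => conf d T enc sec S' s o :=
  Macro.step_of_ne ha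

variable (live rule B) in
/-- The execution `p` is matched by the second one. -/
abbrev Matched (d T : ℕ) (enc : View → ℕ) (sec : ℕ) (p : PMF (Ghost D E R))
    (S : Sys D (E.extend D) idler) (s : Mind E R) (o : Option (Order (E.extend D).m)) : Prop :=
  Matches (Macro.step live rule sec) (Macro.payoff B) (Coupling D E R d T enc sec) p
    (conf d T enc sec S s o)

variable (live rule B) in
/-- As `Matched`, with at least one step of the second execution. -/
abbrev MatchedPos (d T : ℕ) (enc : View → ℕ) (sec : ℕ) (p : PMF (Ghost D E R))
    (S : Sys D (E.extend D) idler) (s : Mind E R) (o : Option (Order (E.extend D).m)) : Prop :=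
  MatchesPos (Macro.step live rule sec) (Macro.payoff B) (Coupling D E R d T enc sec) p
    (conf d T enc sec S s o)

theorem Coupled.matched (h : Coupled d enc g S s) :
    Matched rule live B d T enc sec (PMF.pure g) S s none := .here ⟨rfl, h⟩

theorem matched_of_lift {q : PMF (Sys D E R)} {f : Sys D E R → Ghost D E R}
    {o : Order (E.extend D).m} (ha : S.active = .environment) (hm : s.mode = .wake 0)
    (h : Lift (fun W' S' => Linked d (f W') S' s ∧
      Paid (f W').indices (f W').sys (f W').count s.counts ∧ Met (f W').sys S' s.clients) q
      (S.perform live rule sec o)) :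
    Matched rule live B d T enc sec (q.map f) S s (some o) := by
  refine .sync (payoff_conf_environment ha) ?_
  rw [step_conf_pend ha]
  exact Lift.map_left' (h.map_right' fun W' S' h1 => ⟨rfl, .meeting hm h1.1 h1.2.1 h1.2.2⟩)

/-- The positions of clients that are not the caller are ruled out one after the other, at the cost
of one step with a wasted coin each. -/
theorem wake_start (ha : S.active = .environment) {n : ℕ} (hn : n ≤ s.clients.length)
    (hc : ∀ k < n, S.z.caller ≠ some (s.pos k))
    (h : MatchedPos rule live B d T enc sec p S { s with mode := .wake n } none) :
    MatchedPos rule live B d T enc sec p S { s with mode := .wake 0 } none := by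
  induction n with
  | zero => exact h
  | succ n ih =>
    refine ih (by omega) (fun k hk => hc k (by omega)) ?_
    refine .det (payoff_conf_environment ha) (step_conf_pure ha (r := (_, none)) fun b => ?_)
      h.matches
    have h1 : n < s.clients.length := hn
    have h2 : decide (S.z.caller = some ({ s with mode := .wake n } : Mind E R).look.1) = false := by
      exact decide_eq_false (hc n n.lt_succ_self)
    rw [h2]
    simp [Mind.next, h1]

/-- The environment finds out who has caused its activation. -/
theorem exists_ready (ha : S.active = .environment) (hm : s.mode = .wake 0) (h : Linked d g S s)
    (hmet : Met g.sys S s.clients) :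
    ∃ s' : Mind E R, s'.counts = s.counts ∧ s'.count = s.count ∧ Linked d g S s' ∧ Ready g s' ∧
      ∀ p : PMF (Ghost D E R), Matched rule live B d T enc sec p S s' none →
        MatchedPos rule live B d T enc sec p S s none := by
  have hs : s = { s with mode := .wake 0 } := by rw [← hm]
  rcases hmet with ⟨h1, h2⟩ | ⟨h1, -, k, q, h2, h3, h4⟩ | ⟨-, h1, h2, h3⟩
  · rw [← h2, ha] at h1
    exact h1.elim
  · have hz : { s.z with caller := some k } = g.sys.z := ITI.eq_of_calledAs h.z h3
    refine ⟨{ s with z := { s.z with caller := some k }, mode := .environment }, rfl, rfl,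
      ⟨h.same, h.pointers.congr rfl rfl rfl rfl fun _ _ _ _ h => h, h.z, h.y, h.entries, h.count,
        h.alive⟩, .inl ⟨rfl, h1, hz⟩, fun p hp => ?_⟩
    have hk := (List.getElem?_eq_some_iff.1 h2).1
    have hpos : s.pos k = q := by simp [Mind.pos, h2]
    rw [hs]
    refine wake_start ha hk.le (fun j hj hj' => ?_) ?_
    · rw [h4] at hj'
      have h5 : s.clients[j]? = some (s.pos j) := by
        have := List.getElem?_eq_getElem (hj.trans hk)
        simp [Mind.pos, this]
      rw [← Option.some.inj hj'] at h5
      exact hj.ne (h.pointers.refs.injective h5 h2)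
    · refine .det (payoff_conf_environment ha) (step_conf_pure ha (r := (_, none)) fun b => ?_) hp
      have h5 : decide (S.z.caller = some ({ s with mode := .wake k } : Mind E R).look.1) = true := by
        rw [h4]
        exact decide_eq_true (congrArg some hpos.symm)
      rw [h5]
      simp [Mind.next, hk]
  · refine ⟨s.idle, by simp, by simp, ⟨h.same, h.pointers.congr (by simp) (by simp) (by simp)
      (by simp) fun q _ _ _ h4 => by simpa [Mind.Requested] using h4, ?_, ?_, by simp [h.entries],
      by simp [h.count], ?_⟩, ?_, fun p hp => ?_⟩
    · unfold Mind.idle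
      split
      · exact h.z
      · exact h.z
    · unfold Mind.idle
      split <;> exact h.y
    · unfold Mind.idle
      split <;> exact h.alive
    · cases hal : g.sys.alive with
      | true =>
        have h4 := h.alive.trans hal
        refine .inl ⟨by simp [Mind.idle, h4], (h1 hal).1, ?_⟩
        simp [Mind.idle, h4]
        exact ITI.eq_of_calledAs h.z (h1 hal).2
      | false =>
        have h4 := h.alive.trans hal
        exact .inr (.inr ⟨by simp [Mind.idle, h4], h2 hal, hal⟩)
    · rw [hs]
      refine wake_start ha le_rfl (fun j hj hj' => ?_) ?_
      · have h5 : s.clients[j]? = some (s.pos j) := by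
          have := List.getElem?_eq_getElem hj
          simp [Mind.pos, this]
        grind
      · refine .det (payoff_conf_environment ha) (step_conf_pure ha (r := (s.idle, none)) fun b => ?_)
          hp
        simp [Mind.next]
        rfl

/-- Something is done to a session of the requester. -/
theorem matched_treat {P : ℕ → Prop} (ha : S.active = .environment) (hS : Same g.sys S)
    (hp : Pointers d P g.indices g.sys.sessions g.sys.zRefs S.zRefs S.yRefs s)
    (hz : s.z.calledAs g.sys.z = g.sys.z) (hy : s.y = g.sys.y) (he : s.entries = g.entries)
    (hc : s.count = g.count) (hal : s.alive = g.sys.alive)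
    (hm : MainSessions g.sys.sessions g.indices) (hl : g.indices.length = min g.count lim)
    (hlim : lim = if live then d + 1 else d) {q : ℕ} {c : Chore} {msg : Str}
    (hpaid : ∀ W' ∈ (g.poke rule sec q msg c).support, Advance g.sys W' →
      Paid g.indices W' g.count s.counts)
    (hreq : ∀ q', s.Requested q' → P q' ∨ c = .delete ∧ q' = q) (hP : c = .runDeletion → P q)
    (hq : q < g.count) :
    Matched rule live B d T enc sec ((g.poke rule sec q msg c).map fun W' => { g with sys := W' })
      S (s.treat D d c q msg).1 (s.treat D d c q msg).2 := by
  have hdl : d ≤ lim := by grind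
  rcases le_or_gt q d with hqd | hqd
  · obtain ⟨o, h1, h2⟩ := Landed.treat (rule := rule) (sec := sec) (live := live) hS hp hm
      (fun h => by grind) c msg (fun h => by omega) hqd hP
    obtain ⟨del, len, h3⟩ := Mind.treat_fst (s := s) (D := D) (d := d) (p := c) hqd msg
    rw [h1]
    rw [h3] at h2 ⊢
    refine matched_of_lift ha rfl (h2.support_left.mono fun W' S' h => ⟨?_,
      hpaid W' h.2 h.1.advance, h.1.met⟩)
    exact Landed.linked (g := { g with sys := W' }) h.1 hreq hz hy hal he hc
  -- Beyond `d` no session exists in either hybrid, and the request never leaves the mind.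
  · have h1 : s.treat D d c q msg = (s.idle, none) := by
      unfold Mind.treat
      grind
    have h2 : g.indices[q]? = none := List.getElem?_eq_none (by
      grind)
    have h3 : g.poke rule sec q msg c = PMF.pure g.sys.idle := by
      cases c <;> simp [Ghost.poke, Ghost.target, h2, Sys.writeClient]
    rw [h1, h3, PMF.pure_map]
    refine (Coupled.idle ha ⟨hS, hp.congr rfl rfl rfl rfl fun q' _ hq' _ h5 => ?_, hz, hy, he, hc, hal⟩
      (hpaid g.sys.idle (by rw [h3]; simp) (Advance.refl _).idle)).matched
    grind

end

/-! ## The steps of the environment and of the requester -/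

section

variable {g : Ghost D E R}
  {S : Sys D (E.extend D) idler} {s : Mind E R} {d T L lim sec : ℕ} {rule : SidRule} {live : Bool}
  {enc : View → ℕ} {B : Payoff}

theorem Linked.setZ (h : Linked d g S s) (z : ITI E.Z) (m : Mode) :
    Linked d { g with sys := { g.sys with z := z } } S { s with z := z, mode := m } :=
  ⟨h.same.congr rfl rfl rfl rfl rfl rfl, h.pointers.congr rfl rfl rfl rfl fun _ _ _ _ h => h,
    rfl, h.y, h.entries, h.count, h.alive⟩

theorem Mind.zAct_fst {msg : Str} {a : EnvAct E.m} {o : Order (E.extend D).m}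
    (h : (s.zAct D msg a).2 = some o) :
    ∃ z cl len, (s.zAct D msg a).1 =
      { s with z := z, clients := cl, len := len, mode := .wake 0 } := by
  unfold zAct at h ⊢
  cases a with
  | toRequester => cases h
  | toCollector => grind
  | input => grind
  | initiate p i => exact ⟨_, _, _, rfl⟩
  | delete i =>
    dsimp only at h ⊢
    aesop
  | output => cases h
  | endAlive => cases h

/-- Actions that reach other machines than the requester become orders. The remaining ones (message
to the requester, output, end of the alive phase, void deletion) happen in the mind, and the second
execution need not move. -/
theorem matched_zAct (hI : g.Inv lim sec) (hS : S.active = .environment) (hL : Linked d g S s)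
    (hP : Paid g.indices g.sys g.count s.counts) (ha : g.sys.active = .environment)
    (hz : s.z = g.sys.z) (msg : Str) (a : EnvAct E.m) :
    Matched rule live B d T enc sec ((g.sys.zAct rule sec msg a).map fun W => { g with sys := W })
      S (s.zAct D msg a).1 (s.zAct D msg a).2 := by
  have hac : ∀ i, g.sys.active ≠ .client i := by simp [ha]
  cases ho : (s.zAct D msg a).2 with
  | some o =>
    have h1 := Landed.zAct (rule := rule) (sec := sec) (live := live) hL.same hL.pointers
      hI.consistent hz msg ho
    obtain ⟨z, cl, len, h2⟩ := Mind.zAct_fst ho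
    rw [h2] at h1 ⊢
    refine matched_of_lift hS rfl (h1.mono fun W' S' h => ⟨?_, ?_, h.met⟩)
    · exact Landed.linked (g := { g with sys := W' }) h (fun _ h => h) rfl
        hL.y hL.alive hL.entries hL.count
    · exact Paid.advance (W := { g.sys with z := z }) (hP.congr rfl hac) h.advance hI.mainSessions
        hI.consistent fun i _ _ h3 => (hac i h3).elim
  | none =>
    cases a with
    | toCollector => cases ho
    | input => cases ho
    | initiate p i => cases ho
    | toRequester =>
      simp only [Sys.zAct, PMF.pure_map]
      refine Coupled.matched (.ready hS ⟨hL.same.congr rfl rfl rfl rfl rfl rfl,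
        hL.pointers.congr rfl rfl rfl rfl fun _ _ _ _ h => h, ?_, ?_, hL.entries, hL.count,
        hL.alive⟩ (hP.congr rfl hac) (.inr (.inl ⟨rfl, rfl⟩)))
      · change ITI.calledAs { s.z with outgoing := _ } { g.sys.z with outgoing := _ } = _
        rw [hz]
        rfl
      · simp only [Mind.zAct, hL.y]
    | delete i =>
      have h1 : ¬g.sys.z.control[g.sys.z.controlHead]? = some .main := fun h => by
        rw [Mind.zAct, hz, if_pos h] at ho
        cases ho
      have h2 : g.sys.mainSession (g.sys.zRefs[g.sys.z.controlHead]?) = none := by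
        by_contra h3
        obtain ⟨j, h3⟩ := Option.ne_none_iff_exists'.1 h3
        obtain ⟨h4, t, h5, h6⟩ := Sys.mainSession_eq_some h3
        obtain ⟨t', h7, -, h8⟩ := hI.consistent.session _ _ h4
        grind
      simp only [Sys.zAct, h2, PMF.pure_map, Mind.zAct, hz, if_neg h1]
      exact (Coupled.idle hS hL (hP.congr (by simp) hac)).matched
    | output =>
      simp only [Sys.zAct, PMF.pure_map, Mind.zAct]
      rw [hz]
      exact (Coupled.idle hS (hL.setZ { g.sys.z with output := g.sys.z.output ++ written msg } s.mode)
        (hP.congr (by simp) hac)).matched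
    | endAlive =>
      simp only [Sys.zAct, PMF.pure_map]
      exact Coupled.matched (.ready hS ⟨hL.same.congr rfl rfl rfl rfl rfl rfl,
        hL.pointers.congr rfl rfl rfl rfl fun _ _ _ _ h => h, hL.z, hL.y, hL.entries, hL.count,
        rfl⟩ (hP.congr rfl hac) (.inr (.inr ⟨rfl, rfl, rfl⟩)))

theorem environment_step (hI : g.Inv lim sec) (hS : S.active = .environment) (hL : Linked d g S s)
    (hP : Paid g.indices g.sys g.count s.counts) (hm : s.mode = .environment)
    (ha : g.sys.active = .environment) (hz : s.z = g.sys.z) :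
    MatchedPos rule live B d T enc sec (g.step lim rule sec) S s none := by
  have hac : ∀ i, g.sys.active ≠ .client i := by simp [ha]
  rw [Ghost.step_of_ne (by simp [ha])]
  cases hh : g.sys.z.halted with
  | true =>
    rw [Sys.step_environment_halted rule sec ha hh, PMF.pure_map]
    refine .det (payoff_conf_environment hS)
      (step_conf_pure hS (r := ({ s with alive := false, mode := .scheduler }, none)) fun b => ?_)
      (Coupled.matched (.ready hS ⟨hL.same.congr rfl rfl rfl rfl rfl rfl,
        hL.pointers.congr rfl rfl rfl rfl fun _ _ _ _ h => h, hL.z, hL.y, hL.entries, hL.count,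
        rfl⟩ (hP.congr rfl hac) (.inr (.inr ⟨rfl, rfl, rfl⟩))))
    simp [Mind.next, hm, hz, hh]
  | false =>
    rw [Sys.step_environment rule sec ha hh, PMF.map_bind]
    refine .flip (payoff_conf_environment hS) (step_conf hS) fun b => ?_
    -- The translated position leads to the same client, whose output tape is the same in both
    -- executions; thus the emulated environment makes its step with the right symbol and the same
    -- coin.
    have hlook : S.zLook s.look = g.sys.zPeer := by
      simp only [Sys.zLook, Sys.zPeer, Mind.look, hm, Sys.zTarget, hz, Mind.pos]
      rw [hL.pointers.len, hL.pointers.refs.lookup, hL.same.agree.clientOutput]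
      congr 1
      exact congrArg _ (funext hL.same.resolve)
    rw [hlook]
    simp [Mind.next, hm, hz, hh]
    have h1 := hL.setZ (g.sys.z.step g.sys.zPeer b).1 .environment
    have h2 : Paid g.indices { g.sys with z := (g.sys.z.step g.sys.zPeer b).1 } g.count s.counts :=
      hP.congr rfl hac
    rcases (g.sys.z.step g.sys.zPeer b).2 with _ | _ | ⟨a, msg⟩ <;> dsimp only [Sys.zNext]
    · rw [PMF.pure_map]
      exact Coupled.matched (.ready hS h1 h2 (.inl ⟨rfl, ha, rfl⟩))
    · rw [PMF.pure_map]
      exact (Coupled.idle hS h1 (h2.congr (by simp) hac)).matched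
    · exact matched_zAct (g := { g with sys := { g.sys with z := (g.sys.z.step g.sys.zPeer b).1 } })
        ⟨hI.consistent, hI.indices, hI.length, hI.entries, hI.reachable, hI.input⟩ hS h1 h2 ha rfl
        msg a

theorem Linked.setY (h : Linked d g S s) (y : ITI R.Y) (m : Mode) :
    Linked d (g.withY y) S { s with y := y, mode := m } :=
  ⟨h.same.congr rfl rfl rfl rfl rfl rfl, h.pointers.congr rfl rfl rfl rfl fun _ _ _ _ h => h,
    h.z, rfl, h.entries, h.count, h.alive⟩

/-- The hypothesis `hlim` ties the limit to `live`: an action on session `d` has an effect in the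
hybrid exactly if the actual requester meets requests. The invariants enter as separate hypotheses,
because the requester has already made its step here. -/
theorem matched_yAct (hc : Consistent D g.sys.sessions g.sys.zRefs g.sys.z.control)
    (hm : MainSessions g.sys.sessions g.indices) (hl : g.indices.length = min g.count lim)
    (he : ∀ e ∈ g.entries, e.2 < g.count) (hlim : lim = if live then d + 1 else d)
    (hS : S.active = .environment) (hL : Linked d g S s)
    (hP : Paid g.indices g.sys g.count s.counts) (ha : g.sys.active = .requester)
    (msg : Str) (a : RequesterAct) :
    Matched rule live B d T enc sec (g.act lim rule sec msg a)
      S (s.yAct D d msg a).1 (s.yAct D d msg a).2 := by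
  have hac : ∀ i, g.sys.active ≠ .client i := by simp [ha]
  have hadv : ∀ {W W' : Sys D E R}, W.sessions = g.sys.sessions → W.zRefs = g.sys.zRefs →
      W.active = g.sys.active → Advance W W' → Paid g.indices W' g.count s.counts :=
    fun {W W'} h1 h2 h3 h4 => (hP.congr h1 hac).advance h4 (h1 ▸ hm) (h1 ▸ h2 ▸ hc)
      fun i _ _ h5 => (hac i (h3 ▸ h5)).elim
  have hidle := hP.congr (W' := g.sys.idle) (by simp) hac
  cases a with
  | input =>
    simp only [Ghost.act, Mind.yAct, hL.entries, hL.y]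
    cases hq : g.entries[g.sys.y.controlHead]? with
    | none => exact (Coupled.idle hS hL hidle).matched
    | some e =>
      obtain ⟨b, q⟩ := e
      have hmem := List.mem_of_getElem? hq
      have key := fun c h => matched_treat (T := T) (enc := enc) (rule := rule) (sec := sec) (B := B)
        (q := q) (c := c) (msg := msg) hS hL.same hL.pointers hL.z hL.y hL.entries hL.count hL.alive
        hm hl hlim (fun _ _ => hadv rfl rfl rfl) (fun q' h => .inl h) h (he _ hmem)
      cases b with
      | false =>
        have := key .run (fun h => by cases h)
        simp only [Ghost.poke, PMF.pure_map] at this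
        exact this
      | true =>
        have := key .runDeletion fun _ => .inl (hL.entries ▸ hmem)
        simp only [Ghost.poke, PMF.pure_map] at this
        exact this
  | initiate =>
    have hreq : ∀ q n, ((true, q) ∈ s.entries ++ [(false, n)] ∨ 0 < s.counts .delete q) →
        s.Requested q := fun q n h => h.imp_left fun h => by simpa using h
    set W : Sys D E R := { g.sys with
      y := { g.sys.y with control := g.sys.y.control ++ [.main] }
      yRefs := g.sys.yRefs ++ [.session g.sys.sessions.length] } with hW
    have hsame : Same W S := hL.same.congr rfl rfl rfl rfl rfl rfl
    have hy : ({ s.y with control := s.y.control ++ [.main] } : ITI R.Y) = W.y := by rw [hL.y]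
    simp only [Ghost.act, Mind.yAct, hL.count]
    rw [← hW]
    by_cases h : g.count < lim
    · rw [if_pos h]
      have hlen : g.indices.length = g.count := by omega
      -- Entries and counts speak only of ordinals already in use, so no deletion of the new session
      -- can have been requested.
      have hnew : ¬s.Requested g.indices.length := by
        rw [hlen]
        rintro (h1 | h1)
        · exact lt_irrefl _ (he _ (hL.entries ▸ h1))
        · rw [hP.fresh _ le_rfl] at h1
          grind
      have key : ∀ (s' : Mind E R) (o : Order (E.extend D).m), s'.y = W.y → s'.mode = .wake 0 →
          s'.entries = s.entries ++ [(false, g.count)] → s'.count = g.count + 1 → s'.z = s.z →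
          s'.alive = s.alive → s'.counts = s.counts → s'.clients = s.clients →
          s'.deletion = s.deletion →
          ((g.indices.length < d ∧ s'.len = s.len + 1 ∧
              s'.main = Function.update s.main g.indices.length s.len ∧
              o = .own 0 msg (.initiate .main (E.client D .main))) ∨
            (g.indices.length = d ∧ live = true ∧ s'.len = s.len ∧ s'.main = s.main ∧
              o = .relay msg .initiate)) →
          Matched rule live B d T enc sec
            ((W.initiate rule sec .main .requester (D.client .main) msg).map fun S' =>
              { sys := S'
                entries := g.entries ++ [(false, g.count)]
                indices := g.indices ++ [g.sys.sessions.length]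
                count := g.count + 1 }) S s' (some o) := by
        intro s' o h1 h2 h3 h4 h5 h6 h7 h8 h9 h10
        refine matched_of_lift hS h2 ((Landed.initiateMain hsame hL.pointers hnew msg h8 h9 h10).mono
          fun W' S' h11 => ⟨?_, ?_, h11.met⟩)
        · refine Landed.linked (W := W) (g := ⟨W', _, _, _⟩) h11 (fun q hq => hreq q g.count ?_) ?_ h1
            (h6.trans hL.alive) (by rw [h3, hL.entries]) h4
          · rwa [← h3, ← h7]
          · rw [h5]
            exact hL.z
        · rw [h7]
          exact (hadv (W := W) rfl rfl rfl h11.advance).initiate hlen _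
      grind
    · rw [if_neg h]
      have hdl : ¬g.count < d := by
        grind
      have hp : Pointers d s.Requested g.indices W.sessions W.zRefs S.zRefs S.yRefs s := hL.pointers
      rw [if_neg hdl]
      by_cases hd : g.count = d
      · rw [if_pos hd]
        cases live with
        | true => grind
        -- Here the two hybrids part. With limit `d` this session does not come into being, and
        -- accordingly the relayed request is disregarded; the ordinal is used up all the same.
        | false =>
          have := matched_of_lift (T := T) (enc := enc) (rule := rule) (sec := sec) (B := B)
            (live := false) (q := PMF.pure W.idle) (s := { s with
              y := { s.y with control := s.y.control ++ [.main] }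
              entries := s.entries ++ [(false, g.count)]
              count := g.count + 1
              mode := .wake 0 }) (o := .relay msg .initiate)
            (f := fun W' => { g with
              sys := W', entries := g.entries ++ [(false, g.count)], count := g.count + 1 }) hS rfl (by
            refine Lift.pure ⟨?_, ?_, (Landed.idle hsame (hp.congr rfl rfl rfl rfl
              fun _ _ _ _ h => h)).met⟩
            · refine Landed.linked (P := s.Requested) (W := W) (Landed.idle hsame
                (hp.congr rfl rfl rfl rfl fun _ _ _ _ h => h)) (fun q hq => hreq q g.count hq) ?_ hy
                hL.alive ?_ rfl
              · exact hL.z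
              · exact congrArg (· ++ _) hL.entries
            · exact (hP.congr (by simp [hW]) hac).count_le (Nat.le_succ _))
          rwa [PMF.pure_map] at this
      · rw [if_neg hd]
        refine Coupled.matched (Coupled.idle (g := ⟨W, _, _, _⟩) hS ⟨hsame,
          hp.congr rfl rfl rfl rfl fun q _ _ _ hq => hreq q g.count hq, hL.z, hy,
          congrArg (· ++ _) hL.entries, rfl, hL.alive⟩
          ((hP.congr (by simp [hW]) hac).count_le (Nat.le_succ _)))
  | delete =>
    simp only [Ghost.act, Mind.yAct, hL.entries, hL.y]
    cases hq : g.entries[g.sys.y.controlHead]? with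
    | none => exact (Coupled.idle hS hL hidle).matched
    | some e =>
      obtain ⟨b, q⟩ := e
      cases b with
      | true => exact (Coupled.idle hS hL hidle).matched
      | false =>
        have hmem := List.mem_of_getElem? hq
        have key := fun yr => matched_treat (T := T) (enc := enc) (rule := rule) (sec := sec)
          (B := B) (q := q) (c := .delete) (msg := []) (P := s.Requested)
          (g := { g with
            sys := { g.sys with
              y := { g.sys.y with control := g.sys.y.control ++ [.deletion] }, yRefs := yr }
            entries := g.entries ++ [(true, q)] })
          (s := { s with
            y := { g.sys.y with control := g.sys.y.control ++ [.deletion] }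
            entries := g.entries ++ [(true, q)] }) hS
          (hL.same.congr rfl rfl rfl rfl rfl rfl)
          (hL.pointers.congr rfl rfl rfl rfl fun _ _ _ _ h => h) hL.z rfl rfl hL.count hL.alive
          hm hl hlim (fun _ _ => hadv rfl rfl rfl)
          (fun q' h => by
            rcases h with h | h
            · rw [List.mem_append, List.mem_singleton] at h
              rcases h with h | h
              · exact .inl (.inl (hL.entries ▸ h))
              grind
            · exact .inl (.inr h)) (fun h => by cases h) (he _ hmem)
        cases hj : g.indices[q]? with
        | some j =>
          have := key (g.sys.yRefs ++ [.deletionOf j])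
          simpa only [Ghost.poke, hj] using this
        | none =>
          have := key g.sys.yRefs
          simpa only [Ghost.poke, hj, PMF.pure_map] using this

theorem requester_step (hI : g.Inv lim sec) (hlim : lim = if live then d + 1 else d)
    (hS : S.active = .environment) (hL : Linked d g S s)
    (hP : Paid g.indices g.sys g.count s.counts) (hm : s.mode = .requester)
    (ha : g.sys.active = .requester) :
    MatchedPos rule live B d T enc sec (g.step lim rule sec) S s none := by
  have hac : ∀ i, g.sys.active ≠ .client i := by simp [ha]
  cases hh : g.sys.y.halted with
  | true =>
    rw [Ghost.step, if_pos ha, if_pos hh]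
    refine .det (payoff_conf_environment hS) (step_conf_pure hS (r := (s.idle, none)) fun b => ?_)
      (Coupled.idle hS hL (hP.congr (by simp) hac)).matched
    simp [Mind.next, hm, hL.y, hh]
  | false =>
    rw [Ghost.step, if_pos ha, if_neg (by simp [hh])]
    refine .flip (payoff_conf_environment hS) (step_conf hS) fun b => ?_
    simp [Mind.next, hm, hL.y, hh]
    have h1 := hL.setY (g.sys.y.step none b).1 .requester
    have h2 : Paid g.indices (g.withY (g.sys.y.step none b).1).sys g.count s.counts :=
      hP.congr rfl hac
    rcases (g.sys.y.step none b).2 with _ | _ | ⟨a, msg⟩ <;> dsimp only [Ghost.next]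
    · exact Coupled.matched (.ready hS h1 h2 (.inr (.inl ⟨rfl, ha⟩)))
    · exact (Coupled.idle hS h1 (h2.congr (by simp) hac)).matched
    · exact matched_yAct (g := g.withY (g.sys.y.step none b).1) hI.consistent hI.mainSessions hI.length hI.entries hlim hS h1 h2 ha msg a

end

open Sys (firstMain pendingDeletion firstMain_eq_none)

/-! ## The steps of the terminate phase -/

section

variable {g : Ghost D E R}
  {S : Sys D (E.extend D) idler} {s : Mind E R} {d T L lim sec : ℕ} {rule : SidRule} {live : Bool}
  {enc : View → ℕ} {B : Payoff}

/-- How much the procedure of the terminate phase may still do. -/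
def Mind.todo (s : Mind E R) (d T : ℕ) : ℕ :=
  ∑ q ∈ Finset.range (min s.count (d + 1)), ((T - s.counts .run q) + (1 - s.counts .delete q) +
    (T - s.counts .runDeletion q))

theorem Mind.todo_tick {p : Chore} {q : ℕ} (hq : q < min s.count (d + 1))
    (h : s.counts p q < p.limit T) : (s.tick p q).todo d T < s.todo d T := by
  refine Finset.sum_lt_sum (fun i _ => ?_) ⟨q, Finset.mem_range.2 hq, ?_⟩
  · have : ∀ p', s.counts p' i ≤ (s.tick p q).counts p' i := fun p' => by
      simp only [tick]
      grind
    grind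
  · cases p <;> simp [tick, Chore.limit]
      at h ⊢ <;> omega

/-- The requester's sessions in the second execution are among those in the first, and they are in
the same state there. -/
theorem Same.finished (h : Same g.sys S) (hf : Finished D g.sys.sessions) :
    Finished D S.sessions := by
  have key : ∀ (i : ℕ) (t' : Session), S.sessions[i]? = some t' → t'.isMain = true →
      ∃ t o, g.sys.sessions[i]? = some t ∧ t.isMain = true ∧ t' = { t with owner := o } := by
    intro i t' h1 h2
    simp [Session.isMain] at h2
    obtain ⟨t, h3, h4⟩ := h.owner i t' h1 h2.2
    obtain ⟨w, hw⟩ := h.agree.get_some h3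
    rw [h1] at hw
    obtain rfl := Option.some.inj hw
    exact ⟨t, w, h3, by simpa [Session.isMain, h4] using h2.1, rfl⟩
  have hpend : ∀ (t : Session) (o : Owner), pendingDeletion S.sessions { t with owner := o } =
      pendingDeletion g.sys.sessions t := by
    intro t o
    unfold pendingDeletion
    congr 1
    funext j
    cases hj : g.sys.sessions[j]? with
    | none => rw [h.agree.get_none hj]
    | some u =>
      obtain ⟨w, hw⟩ := h.agree.get_some hj
      rw [hw]
      rfl
  obtain ⟨h1, h2, h3⟩ := hf
  refine ⟨firstMain_eq_none.2 fun i t' ht hm => ?_, firstMain_eq_none.2 fun i t' ht hm => ?_,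
    firstMain_eq_none.2 fun i t' ht hm => ?_⟩ <;>
    obtain ⟨t, o, h4, h5, rfl⟩ := key i t' ht hm
  · exact firstMain_eq_none.1 h1 i t h4 h5
  · exact firstMain_eq_none.1 h2 i t h4 h5
  · rw [hpend]
    exact firstMain_eq_none.1 h3 i t h4 h5

/-- All that is left to the second execution is to write down the encoded view and to end the alive
phase: its procedure of the terminate phase has nothing to do, because the emulated one has done
everything. -/
theorem matched_finished (hS : S.active = .environment) (hL : Linked d g S s)
    (hf : Finished D g.sys.sessions) :
    Matched rule live B d T enc sec
      (PMF.pure { g with sys := { g.sys with active := .done } }) S { s with mode := .ending }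
      (some (.own 0 (List.replicate (enc s.view + 1) true) .output)) := by
  have hview : s.view = g.sys.outcome.2 := by
    have : s.view = ({ s with z := s.z.calledAs g.sys.z } : Mind E R).view := rfl
    rw [this, hL.z]
    rfl
  rw [hview]
  set msg := List.replicate (enc g.sys.outcome.2 + 1) true
  have h1 : S.perform live rule sec (.own 0 msg .output) = PMF.pure
      { S with
        z := { S.z with controlHead := 0, output := S.z.output ++ written msg, caller := none }
        active := .environment } := by
    exact congrArg PMF.pure (if_pos hL.same.alive)
  refine .det (payoff_conf_environment hS) (by rw [step_conf_pend hS, h1, PMF.pure_map]) ?_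
  refine .det (payoff_conf_environment rfl)
    (step_conf_pure rfl (r := ({ s with mode := .ending }, some (.own 0 [] .endAlive)))
      fun b => rfl) ?_
  refine .det (payoff_conf_environment rfl) (by
    rw [step_conf_pend rfl]
    exact PMF.pure_map _ _) ?_
  refine .det (payoff_conf (by grind)) (by
    rw [step_conf_ne (by grind), Sys.step_scheduler rule sec rfl,
      Finished.schedule, PMF.pure_map]
    exact hL.same.finished hf) ?_
  refine .here ⟨rfl, .done rfl rfl hL.same.agree.x ?_⟩
  change S.z.output ++ written msg = _
  rw [hL.same.output]
  rfl

/-- Chores may be void: the client may have halted, the deletion may be impossible, the session may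
not exist. Then the second execution makes a detour and comes back to its scheduling mode, while the
first one stands still. Each detour consumes a part of `todo`, so after finitely many of them
something really happens; the induction is on `todo`. -/
theorem scheduler_step (hI : g.Inv lim sec) (hlim : lim = if live then d + 1 else d)
    (hR : R.reactive = false) (hB : Bounded D L T) (hLong : ¬g.Long L)
    (ha : g.sys.active = .scheduler) (hal : g.sys.alive = false) (hS : S.active = .environment)
    (hL : Linked d g S s) (hP : Paid g.indices g.sys g.count s.counts) (hm : s.mode = .scheduler) :
    MatchedPos rule live B d T enc sec (g.step lim rule sec) S s none := by
  have hle : lim ≤ d + 1 := by grind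
  induction hn : s.todo d T using Nat.strong_induction_on generalizing S s with
  | _ n ih =>
  have hch := schedule_chore (rule := rule) hI hle ha hal hB hLong hL.count hP
  cases hpq : s.chore d T with
  | none =>
    rw [hpq] at hch
    rw [Ghost.step_of_ne (by simp [ha]), Sys.step_scheduler rule sec ha, hch.schedule, PMF.pure_map]
    refine .det (payoff_conf_environment hS) (step_conf_pure hS (r := (_, some _)) fun b => ?_)
      (matched_finished hS hL hch)
    simp only [Mind.next, hm, hpq]
  | some e =>
    obtain ⟨p, q⟩ := e
    rw [hpq] at hch
    obtain ⟨hq, hqd, hlt, hord, hcases⟩ := hch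
    have hreq : ∀ q', (s.tick p q).Requested q' → s.Requested q' ∨ p = .delete ∧ q' = q := by
      intro q' h
      rcases h with h | h
      · exact .inl (.inl h)
      · simp only [Mind.tick] at h
        split_ifs at h with h1
        · grind
        · exact .inl (.inr h)
    have hptr : Pointers d s.Requested g.indices g.sys.sessions g.sys.zRefs S.zRefs S.yRefs
        (s.tick p q) := hL.pointers.congr rfl rfl rfl rfl fun _ _ _ _ h => h
    refine .det (payoff_conf_environment hS)
      (step_conf_pure hS (r := (s.tick p q).treat D d p q []) fun b => by
        simp only [Mind.next, hm, hpq]) ?_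
    rcases hcases with ⟨h1, h2⟩ | ⟨h1, h2⟩
    · rw [Ghost.step_of_ne (by simp [ha]), Sys.step_scheduler rule sec ha, h1]
      exact matched_treat hS hL.same hptr hL.z hL.y hL.entries hL.count hL.alive hI.mainSessions
        hI.length hlim h2 hreq (fun h => .inr (hord h)) (hL.count ▸ hq)
    · obtain ⟨o, h3, h4⟩ := Landed.treat (rule := rule) (sec := sec) (live := live) hL.same hptr
        hI.mainSessions (fun h => by rw [hI.length, hlim, h]; simp) p [] (fun h => by
          rw [hI.length, ← hL.count, hlim]; split <;> omega) hqd fun h => .inr (hord h)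
      obtain ⟨del, len, h5⟩ := Mind.treat_fst (s := s.tick p q) (D := D) (d := d) (p := p) hqd []
      rw [h3]
      rw [h5] at h4 ⊢
      set s' : Mind E R := { s.tick p q with deletion := del, len := len, mode := .wake 0 } with hs'
      have hlink : ∀ {W W' : Sys D E R} {S' : Sys D (E.extend D) idler}, W.z = g.sys.z →
          W.y = g.sys.y → W.alive = g.sys.alive →
          Landed d (fun q' => s.Requested q' ∨ p = .delete ∧ q' = q) g.indices W W' S' s' →
          Linked d { g with sys := W' } S' s' := fun {W W' S'} e1 e2 e3 h =>
        Landed.linked (g := { g with sys := W' }) h hreq (by rw [e1]; exact hL.z)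
          (by rw [e2]; exact hL.y) (by rw [e3]; exact hL.alive) hL.entries hL.count
      have after : ∀ S' : Sys D (E.extend D) idler, Linked d g S' s' →
          Met g.sys S' s'.clients →
          Matched rule live B d T enc sec (g.step lim rule sec) S' s' none := by
        intro S' h6 h7
        have hS' : S'.active = .environment := by
          rcases h7 with h | h | h
          · rw [ha] at h
            exact h.1.elim
          · exact h.2.1
          · exact h.1
        obtain ⟨s'', e1, e2, h8, h9, h10⟩ := exists_ready
          (T := T) (enc := enc) (sec := sec) hS' rfl h6 h7
        refine (h10 _ (ih _ ?_ hS' h8 (e1 ▸ h1) ?_ rfl).matches).matches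
        · rw [← hn]
          refine lt_of_eq_of_lt ?_ (Mind.todo_tick (lt_min hq (by omega)) hlt)
          unfold Mind.todo
          rw [e1, e2]
        · rcases h9 with h | h | h
          · grind
          · grind
          · exact h.1
      refine .wait (payoff_conf_environment hS) fun c hc => ?_
      rw [step_conf_pend hS, PMF.mem_support_map_iff] at hc
      obtain ⟨S', hS', rfl⟩ := hc
      rcases h2 with h2 | ⟨i, t, h2, h6, h7⟩ <;> rw [h2] at h4
      · have h8 := h4.of_pure_left hS'
        exact after S' (hlink rfl rfl rfl h8) h8.met
      · have h8 := h4.of_pure_left hS'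
        have h9 : S'.active = .client i := by
          rcases h8.met with h | h | h
          · exact h.2
          · cases h.1
          grind
        have h10 : S'.active.IsCore := by rw [h9]; trivial
        refine .wait (payoff_conf (by simp [h9])) fun c hc => ?_
        rw [step_conf_ne (by simp [h9]), Sys.step_core rule sec S' h10, PMF.mem_support_map_iff] at hc
        obtain ⟨S'', hS'', rfl⟩ := hc
        rw [PMF.mem_support_map_iff] at hS''
        obtain ⟨b, -, rfl⟩ := hS''
        set W : Sys D E R := { g.sys with active := .client i } with hW
        have h11 := Landed.core h8.same h8.pointers hI.consistent hR h9 b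
        -- Activating the halted client in an imagined copy of the first execution leads straight
        -- back to its present configuration. So `Landed.core` describes the detour of the second
        -- execution.
        have h12 : W.applyUpd (W.upd b) = g.sys := by
          have : W.upd b = .pass W.x := by
            simp [Sys.upd, hW, h6, h7]
          rw [this]
          change (W.core W.x (W.sessions.modify _ id) _).finish .idle = _
          rw [List.modify_id]
          change Sys.idle _ = _
          rw [Sys.idle_core_self, Sys.idle, if_neg (by grind), hW, ← ha]
        rw [h12] at h11
        exact after _ (hlink (W := W) rfl rfl rfl h11) h11.met

end

/-! ## The hybrid argument -/

section

variable {g : Ghost D E R}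
  {S : Sys D (E.extend D) idler} {s : Mind E R} {d T L lim sec : ℕ} {rule : SidRule} {live : Bool}
  {enc : View → ℕ} {B : Payoff}

theorem Sys.applyUpd_sessions (W : Sys D E R) (u : Update D) :
    (W.applyUpd u).sessions = W.sessions.modify u.idx u.f := by
  unfold applyUpd finish
  split
  · rfl
  · rw [idle_sessions]
    rfl
  · split
    · rfl
    · unfold notifyOwner
      aesop

theorem ready_step (hI : g.Inv lim sec) (hlim : lim = if live then d + 1 else d)
    (hR : R.reactive = false) (hB : Bounded D L T) (hLong : ¬g.Long L)
    (hS : S.active = .environment) (hL : Linked d g S s)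
    (hP : Paid g.indices g.sys g.count s.counts) (h : Ready g s) :
    MatchedPos rule live B d T enc sec (g.step lim rule sec) S s none := by
  rcases h with ⟨h1, h2, h3⟩ | ⟨h1, h2⟩ | ⟨h1, h2, h3⟩
  · exact environment_step hI hS hL hP h1 h2 h3
  · exact requester_step hI hlim hS hL hP h1 h2
  · exact scheduler_step hI hlim hR hB hLong h2 h3 hS hL hP h1

theorem core_step (hI : g.Inv lim sec) (hR : R.reactive = false) (hm : s.mode = .wake 0)
    (hL : Linked d g S s) (hP : Paid g.indices g.sys g.count s.counts) (ha : g.sys.active.IsCore)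
    (hS : S.active = g.sys.active) :
    MatchedPos rule live B d T enc sec (g.step lim rule sec) S s none := by
  have hne : ∀ a, ¬a.IsCore → g.sys.active ≠ a := fun a h1 h2 => h1 (h2 ▸ ha)
  have hne' : ∀ a, ¬a.IsCore → S.active ≠ a := fun a h1 => hS ▸ hne a h1
  refine .sync (payoff_conf (hne' _ id)) ?_
  rw [Ghost.step_of_ne (hne _ id), Sys.step_core rule sec _ ha, step_conf_ne (hne' _ id),
    Sys.step_core rule sec S (hS ▸ ha), PMF.map_comp, PMF.map_comp]
  refine Lift.map _ fun b _ => ⟨rfl, ?_⟩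
  have h := Landed.core hL.same hL.pointers hI.consistent hR hS b
  refine .meeting hm (Landed.linked (g := { g with sys := _ }) h (fun _ h => h) hL.z hL.y hL.alive
    hL.entries hL.count) ?_ h.met
  -- An active client that has not halted makes the step with which it has been credited
  -- (`upd_client`).
  refine hP.advance h.advance hI.mainSessions hI.consistent fun i t t' h1 h2 h3 h4 => ?_
  obtain ⟨h5, h6⟩ := g.sys.upd_client b h1 h2 h4
  replace h3 : (g.sys.applyUpd (g.sys.upd b)).sessions[i]? = some t' := h3
  rw [Sys.applyUpd_sessions, h5, List.getElem?_modify_eq, h2] at h3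
  grind

/-- One statement for two hybrids: limit `d + 1` if requests are met, limit `d` otherwise, with the
same strategy in both cases. Long inputs are the bad event, since only in their absence `T`
activations suffice to exhaust a client. -/
theorem simulates_coupling (hlim : lim = if live then d + 1 else d) (hR : R.reactive = false)
    (hT : Bounded D L T) {A : Distinguisher} (hB1 : ∀ w o, B w o ≤ 1)
    (hB : ∀ w v, B w (written (List.replicate (enc v + 1) true)) = A (w, v) true) :
    Simulates (Ghost.step lim rule sec) (Ghost.pay A)
      (Macro.step live rule sec) (Macro.payoff B) (fun g : Ghost D E R => g.Inv lim sec ∧ g.Long L)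
      (fun g c => g.Inv lim sec ∧ Coupling D E R d T enc sec g c) where
  payW_le := Ghost.pay_le_step _ _ _ _
  payS_le := Macro.payoff_le_step _
  payW_le_one g := Sys.pay_le_one A g.sys
  payS_le_one c := Sys.payoff_le_one hB1 c.sys
  bad_step g h g' hg := by
    obtain ⟨h1, h2⟩ := Ghost.step_inv h.1 hg
    exact ⟨h1, h2.long h.2⟩
  step g c := by
    rintro ⟨hI, hc, h⟩
    obtain ⟨S, s, o⟩ := c
    obtain rfl : o = none := hc
    by_cases hLong : g.Long L
    · grind
    have hpos : g.sys.active ≠ .done → MatchedPos rule live B d T enc sec (g.step lim rule sec) S s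
        none → g.pay A = 0 ∧ MatchesPos (Macro.step live rule sec) (Macro.payoff B)
          (fun g c => g.Inv lim sec ∧ Coupling D E R d T enc sec g c) (g.step lim rule sec)
          (conf d T enc sec S s none) := fun h1 h2 =>
      ⟨Sys.pay_of_active h1, h2.mono fun g' c hg hc => ⟨(Ghost.step_inv hI hg).1, hc⟩⟩
    rcases h with ⟨hm, hL, hP, hmet⟩ | ⟨hS, hL, hP, hr⟩ | ⟨h1, h2, h3, h4⟩
    · have hS : ¬g.sys.active.IsCore → S.active = .environment := fun h => by
        rcases hmet with h1 | h1 | h1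
        · grind
        · exact h1.2.1
        · exact h1.1
      have hdone : g.sys.active ≠ .done := fun h => by
        rcases hmet with h1 | h1 | h1
        · rw [h] at h1
          exact h1.1
        · grind
        grind
      refine .inr (.inl (hpos hdone ?_))
      by_cases hcore : g.sys.active.IsCore ∧ S.active = g.sys.active
      · exact core_step hI hR hm hL hP hcore.1 hcore.2
      · have hS : S.active = .environment := by
          rcases hmet with h1 | h1 | h1
          · grind
          · exact h1.2.1
          · exact h1.1
        obtain ⟨s', h1, -, h2, h3, h4⟩ := exists_ready
          hS hm hL hmet
        exact h4 _ (ready_step hI hlim hR hT hLong hS h2 (h1 ▸ hP) h3).matches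
    · refine .inr (.inl (hpos (fun h => ?_) (ready_step hI hlim hR hT hLong hS hL hP hr)))
      rcases hr with h1 | h1 | h1
      · grind
      · grind
      grind
    · refine .inr (.inr ⟨fun n => ?_, fun n => Ghost.val_of_done h1 n⟩)
      rw [Macro.val_of_done h2]
      change S.payoff B = g.sys.pay A
      rw [Sys.payoff, if_pos h2, Sys.pay, if_pos h1, h3, h4, hB]
      rfl

theorem coupling_initial :
    Coupling D E R d T enc sec (Ghost.initial D E R sec)
      (Macro.initial D (E.extend D) (Mind.plan D E R d T enc sec) sec) := by
  refine ⟨rfl, .ready rfl ⟨⟨⟨rfl, rfl⟩, rfl, rfl, ?_⟩, ⟨rfl, ⟨?_, rfl, ?_, ?_⟩, ?_, ?_, fun _ => rfl, ?_⟩,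
    rfl, rfl, rfl, rfl, rfl⟩ ⟨?_, ?_, ?_, ?_, fun _ _ _ => rfl⟩ (.inl ⟨rfl, rfl, rfl⟩)⟩ <;>
    simp [Ghost.initial, Macro.initial, Sys.initial, Mind.plan, Mind.start]

end

/-- A view consists of finitely many finite words over finite alphabets, so there are countably
many. Only the view has to be encoded; the collector's work tape reaches the distinguisher anyway.
-/
theorem View.exists_encoding : ∃ enc : View → ℕ, enc.Injective := by
  have : Function.Injective fun v : View =>
      (v.input, v.output, v.incoming, v.outgoing, v.randomness,
        v.control.map fun p => decide (p = .main)) := by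
    intro v w h
    obtain ⟨v1, v2, v3, v4, v5, v6⟩ := v
    obtain ⟨w1, w2, w3, w4, w5, w6⟩ := w
    simp at h
    obtain ⟨rfl, rfl, rfl, rfl, rfl, h⟩ := h
    have : Function.Injective fun p : Protocol => decide (p = .main) := by
      intro p q h
      cases p <;> cases q <;> simp at h ⊢
    rw [List.map_injective_iff.2 this h]
  exact ⟨_, (Encodable.encode_injective).comp this⟩

/-- Given `δ`, the length `L` is chosen such that long inputs have probability at most `δ` in either
hybrid, then `T`, then the strategy. Each hybrid is within `δ` of the strategy's execution with or
without a working requester, and these differ by at most the 1-representative error. The strategy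
depends on `δ`, but this bound does not, so `δ` may tend to zero. -/
theorem Ghost.value_le_add (hE : E.PPT)
    (hY : R.Y.PPT) (hR : R.reactive = false) (rule : SidRule) (sec : ℕ) (A : Distinguisher)
    (d : ℕ) :
    value (Ghost.step (d + 1) rule sec) (pay A) (Ghost.initial D E R sec) ≤
      value (Ghost.step d rule sec) (pay A) (Ghost.initial D E R sec) +
        representativeError rule D 1 sec ∧
    value (Ghost.step d rule sec) (pay A) (Ghost.initial D E R sec) ≤
      value (Ghost.step (d + 1) rule sec) (pay A) (Ghost.initial D E R sec) +
        representativeError rule D 1 sec := by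
  obtain ⟨enc, henc⟩ := View.exists_encoding
  have : Nonempty View := ⟨⟨[], [], [], [], [], []⟩⟩
  set C : (ℤ → Option Bool) → List Sym → PMF Bool := fun w o =>
    A (w, Function.invFun enc (o.length - 2))
  have hB : ∀ w v, C w (written (List.replicate (enc v + 1) true)) true = A (w, v) true := by
    intro w v
    -- One letter is added so that the message is never empty, and writing it adds a separator; the
    -- decoder subtracts both.
    have : (written (List.replicate (enc v + 1) true)).length - 2 = enc v := by
      simp [written, List.replicate_succ]
    simp only [C, this, Function.leftInverse_invFun henc v]
  have key : ∀ δ : ℝ≥0∞, δ ≠ 0 → ∃ a b : ℝ≥0∞,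
      (value (Ghost.step (d + 1) rule sec) (pay A) (Ghost.initial D E R sec) ≤ a + δ ∧
        a ≤ value (Ghost.step (d + 1) rule sec) (pay A) (Ghost.initial D E R sec) + δ) ∧
      (value (Ghost.step d rule sec) (pay A) (Ghost.initial D E R sec) ≤ b + δ ∧
        b ≤ value (Ghost.step d rule sec) (pay A) (Ghost.initial D E R sec) + δ) ∧
      a ≤ b + representativeError rule D 1 sec ∧ b ≤ a + representativeError rule D 1 sec := by
    intro δ hδ
    obtain ⟨L, hL⟩ := Ghost.exists_long_le rule D E hY (d + 1) sec hδ
    obtain ⟨L', hL'⟩ := Ghost.exists_long_le rule D E hY d sec hδ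
    obtain ⟨T, hT⟩ := exists_bounded D (max L L')
    have hT1 : Bounded D L T := ⟨hT.1, fun p c h1 h2 => hT.2 p c h1 (h2.trans (le_max_left _ _))⟩
    have hT2 : Bounded D L' T := ⟨hT.1, fun p c h1 h2 => hT.2 p c h1 (h2.trans (le_max_right _ _))⟩
    have h1 := simulates_coupling (E := E) (R := R) (d := d) (enc := enc) (rule := rule) (sec := sec)
      (live := true) (lim := d + 1) rfl hR hT1 (B := fun w o => C w o true) (fun w o => PMF.coe_le_one _ _) hB
    have h2 := simulates_coupling (E := E) (R := R) (d := d) (enc := enc) (rule := rule) (sec := sec)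
      (live := false) (lim := d) rfl hR hT2 (B := fun w o => C w o true) (fun w o => PMF.coe_le_one _ _) hB
    obtain ⟨h3, h4⟩ := Macro.value_le_add (Environment.extend_ppt hE D) (Mind.plan D E R d T enc sec)
      rule sec C
    exact ⟨_, _, ⟨(h1.le_value ⟨inv_initial _ _, coupling_initial⟩).trans (add_le_add le_rfl hL),
      (h1.value_le ⟨inv_initial _ _, coupling_initial⟩).trans (add_le_add le_rfl hL)⟩,
      ⟨(h2.le_value ⟨inv_initial _ _, coupling_initial⟩).trans (add_le_add le_rfl hL'),
      (h2.value_le ⟨inv_initial _ _, coupling_initial⟩).trans (add_le_add le_rfl hL')⟩, h3, h4⟩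
  have half : ∀ ε : ℝ≥0∞, ε ≠ 0 → ε / 2 ≠ 0 := fun ε h => (ENNReal.half_pos h).ne'
  constructor <;> refine ENNReal.le_of_forall_pos_le_add fun ε hε _ => ?_
  all_goals
    obtain ⟨a, b, ⟨h1, h2⟩, ⟨h3, h4⟩, h5, h6⟩ := key _ (half ε (by simpa using hε.ne'))
    have h7 : (ε : ℝ≥0∞) = ε / 2 + ε / 2 := (ENNReal.add_halves _).symm
    rw [h7]
  · calc _ ≤ a + ε / 2 := h1
      _ ≤ b + representativeError rule D 1 sec + ε / 2 := by gcongr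
      _ ≤ _ + ε / 2 + representativeError rule D 1 sec + ε / 2 := by gcongr
      _ = _ := by ring
  · calc _ ≤ b + ε / 2 := h3
      _ ≤ a + representativeError rule D 1 sec + ε / 2 := by gcongr
      _ ≤ _ + ε / 2 + representativeError rule D 1 sec + ε / 2 := by gcongr
      _ = _ := by ring

theorem ofReal_abs_sub_le {a b ε : ℝ≥0∞} (ha : a ≤ 1) (hb : b ≤ 1) (h1 : a ≤ b + ε)
    (h2 : b ≤ a + ε) : ENNReal.ofReal |a.toReal - b.toReal| ≤ ε := by
  by_cases hε : ε = ⊤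
  · simp_all
  have ha' := ne_top_of_le_ne_top ENNReal.one_ne_top ha
  have hb' := ne_top_of_le_ne_top ENNReal.one_ne_top hb
  refine ENNReal.ofReal_le_of_le_toReal (abs_sub_le_iff.2 ⟨?_, ?_⟩)
  · rw [sub_le_iff_le_add', ← ENNReal.toReal_add hb' hε]
    simp_all
  · rw [sub_le_iff_le_add', ← ENNReal.toReal_add ha' hε]
    simp_all

/-- Real and ideal execution are the hybrids with limits `k` and `0`, linked by `k` comparisons of
neighbours. -/
theorem obliviousRepresentativeError_le (rule : SidRule) (D : DataCollector) (k sec : ℕ) :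
    obliviousRepresentativeError rule D k sec ≤ k * representativeError rule D 1 sec := by
  refine iSup_le fun E => iSup_le fun hE => iSup_le fun R => iSup_le fun hY => iSup_le fun hR =>
    iSup_le fun A => ?_
  obtain ⟨hk, hR⟩ := hR
  unfold advantage
  rw [Ghost.prob_eq hE hk hR sec A, Ghost.prob_silent_eq hY rule sec A]
  -- Telescoping. Both one-sided estimates are carried along, and the absolute value of the
  -- difference is taken only at the end, where probabilities are known to be finite.
  have key : ∀ k : ℕ,
      value (Ghost.step k rule sec) (Ghost.pay A) (Ghost.initial D E R sec) ≤
        value (Ghost.step 0 rule sec) (Ghost.pay A) (Ghost.initial D E R sec) +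
          k * representativeError rule D 1 sec ∧
      value (Ghost.step 0 rule sec) (Ghost.pay A) (Ghost.initial D E R sec) ≤
        value (Ghost.step k rule sec) (Ghost.pay A) (Ghost.initial D E R sec) +
          k * representativeError rule D 1 sec := by
    intro k
    induction k with
    | zero => simp
    | succ k ih =>
      obtain ⟨h1, h2⟩ := Ghost.value_le_add (D := D) hE hY hR.1 rule sec A k
      rw [Nat.cast_succ, add_mul, one_mul]
      constructor
      · refine h1.trans ?_
        rw [← add_assoc]
        gcongr
        exact ih.1
      · refine ih.2.trans ?_
        rw [add_comm (_ * _), ← add_assoc]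
        gcongr
  exact ofReal_abs_sub_le (value_le_one (fun g : Ghost D E R => Sys.pay_le_one A g.sys) _)
    (value_le_one (fun g : Ghost D E R => Sys.pay_le_one A g.sys) _) (key k).1 (key k).2

end DeletionCompliance

end

theorem theorem2p1 (rule : DeletionCompliance.SidRule) (D : DeletionCompliance.DataCollector)
    (k : ℕ) (sec : ℕ) :
    DeletionCompliance.obliviousRepresentativeError rule D k sec ≤
      (k : ENNReal) * DeletionCompliance.representativeError rule D 1 sec :=
  DeletionCompliance.obliviousRepresentativeError_le rule D k sec
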